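/- Let $K$ be a non-archimedean local field with ring of integers $\mathfrak o$, maximal ideal $\mathfrak p$, residue field of cardinality $q$, Weil group $\mathbf W_K$, inertia group $\mathbf I_K$ and a Frobenius element $\mathrm{Fr}$, normalized by $\|\mathrm{Fr}\|=q^{-1}$. Let $\psi:K\to\mathbb C^\times$ be an additive character that is trivial on $\mathfrak p$ but not on $\mathfrak o$. Let $G^\vee$ be the complex dual group of an unramified connected reductive $K$-group: a connected complex reductive group with a pinning (maximal torus $T^\vee$, basis $\Delta$ of the root system $\Phi$ of $(G^\vee,T^\vee)$, root vectors for the simple roots) and an automorphism $\theta$ of finite order preserving the pinning. Let $\mathbf W_K$ act on $G^\vee$ through $\mathbf W_K/\mathbf I_K\cong\mathbb Z$, with $\mathrm{Fr}$ acting by $\theta$. Let $M^\vee\supseteq T^\vee$ be a $\theta$-stable standard Levi subgroup with root system $\Phi_M$, and let $\mathrm{Lie}(G^\vee)/\mathrm{Lie}(M^\vee)=\hat{\mathfrak g}/\hat{\mathfrak m}$ carry the adjoint action of ${}^LM=M^\vee\rtimes\mathbf W_K$. Let $\phi_M:\mathbf W_K\times SL_2(\mathbb C)\to M^\vee\rtimes\mathbf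 W_K$ be an unramified L-parameter, i.e. an L-parameter with $\phi_M(w)=(1,w)$ for $w\in\mathbf I_K$. Write $r_M\theta=\phi_M\big(\mathrm{Fr},\left(\begin{smallmatrix}q^{-1/2}&0\\0&q^{1/2}\end{smallmatrix}\right)\big)$ and assume that $r_M\in T^{\vee,\theta,\circ}$, the identity component of the group of $\theta$-fixed elements of $T^\vee$ (this can always be achieved by replacing $\phi_M$ with an equivalent L-parameter). For $z\in Z(M^\vee)^{\theta,\circ}$ let $z\phi_M$ be the L-parameter which equals $\phi_M$ on $\mathbf I_K\times SL_2(\mathbb C)$ and satisfies $(z\phi_M)(\mathrm{Fr})=z\,\phi_M(\mathrm{Fr})$. The Weil–Deligne representation $(\rho,N)$ on $V=\hat{\mathfrak g}/\hat{\mathfrak m}$ attached to $\tilde\rho=\mathrm{Ad}_{G^\vee}|_{\hat{\mathfrak g}/\hat{\mathfrak m}}\circ z\phi_M$ is trivial on $\mathbf I_K$, with $\rho(\mathrm{Fr})=\tilde\rho\big(\mathrm{Fr},\left(\begin{smallmatrix}q^{-1/2}&0\\0&q^{1/2}\end{smallmatrix}\right)\big)$ and $N=d\tilde\rho|_{SL_2(\mathbb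 C)}\left(\begin{smallmatrix}0&1\\0&0\end{smallmatrix}\right)$. Put $V_N=\ker N$. Its $\gamma$-factor is $\gamma(s,\rho,\psi)=\epsilon(s,\rho,\psi)\,L(1-s,\rho^\vee)\,L(s,\rho)^{-1}$, where $L(s,\rho)=\det(1-q^{-s}\rho(\mathrm{Fr})|V_N)^{-1}$, $\epsilon(s,\rho,\psi)=\epsilon(s,\rho_0,\psi)\det(-q^{-s}\rho(\mathrm{Fr})|V/V_N)$, $\rho_0$ is $\rho$ with nilpotent operator $0$, and $\epsilon(s,\rho_0,\psi)$ is Tate's $\epsilon$-factor with respect to the $\psi$-self-dual Haar measure on $K$. Call two roots equivalent if their restrictions to $\mathrm{Lie}(T^\vee)^\theta$ are positive multiples of each other, and let $(\Phi\setminus\Phi_M)/\theta$ be the set of equivalence classes in $\Phi\setminus\Phi_M$. A class $a$ is of type II if it contains roots $\alpha_1,\alpha_2,\alpha_1+\alpha_2$ with $\alpha_2\in\langle\theta\rangle\alpha_1$, and of type I otherwise. Put $\gamma_a=\sum_{\alpha\in a}\alpha$, $m_+(a)=|a|$, $m_-(a)=0$ for $a$ of type I, and $\gamma_a=\tfrac12\sum_{\alpha\in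 a}\alpha$, $m_+(a)=2|a|/3$, $m_-(a)=|a|/3$ for $a$ of type II; here $\gamma_a$ is a character of $T^\vee$. The relative $\mu$-function of the Iwahori–Hecke algebra is $$m^M(t)=q^{(\dim\hat{\mathfrak m}-\dim\hat{\mathfrak g})/2}\prod_{a\in(\Phi\setminus\Phi_M)/\theta}\frac{1-\gamma_a(t)^{-2}}{\big(1+q^{-m_-(a)}\gamma_a(t)^{-1}\big)\big(1-q^{-m_+(a)}\gamma_a(t)^{-1}\big)}\qquad(t\in T^\vee).$$ Then $$\gamma\big(0,\mathrm{Ad}_{G^\vee}|_{\hat{\mathfrak g}/\hat{\mathfrak m}}\circ z\phi_M,\psi\big)=\pm\,m^M(z\,r_M)$$ as rational functions of $z\in Z(M^\vee)^{\theta,\circ}$. That is, there are a sign $\varepsilon\in\{1,-1\}$ independent of $z$ and a regular function $f$, not identically zero on $Z(M^\vee)^{\theta,\circ}$, such that for every $z\in Z(M^\vee)^{\theta,\circ}$ with $f(z)\neq0$ the denominators of $m^M(z r_M)$ do not vanish and $\lim_{s\to0}\gamma(s,\mathrm{Ad}_{G^\vee}|_{\hat{\mathfrak g}/\hat{\mathfrak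 m}}\circ z\phi_M,\psi)=\varepsilon\, m^M(z\,r_M)$. -/

import Mathlib

open scoped Matrix Topology ValuativeRel

noncomputable section

namespace UnramGamma

/-! ### Linear algebraic groups over `ℂ`, regular functions and Lie algebras -/

section AlgebraicGroups

variable {n : ℕ}

/-- The algebra `ℂ[G]` of regular functions on a (closed) subgroup `G` of `GL_n(ℂ)`: it is
generated by the matrix entries of `g` and of `g⁻¹`. -/
def regularFunctions (G : Subgroup (GL (Fin n) ℂ)) : Subalgebra ℂ (G → ℂ) :=
  Algebra.adjoin ℂ
    (Set.range (fun (p : Fin n × Fin n) (g : G) => (g : GL (Fin n) ℂ).val p.1 p.2) ∪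
      Set.range (fun (p : Fin n × Fin n) (g : G) => (g⁻¹ : GL (Fin n) ℂ).val p.1 p.2))

/-- `G ⊆ GL_n(ℂ)` is Zariski closed: the zero locus of polynomials in the matrix entries. -/
def IsZariskiClosed (G : Subgroup (GL (Fin n) ℂ)) : Prop :=
  ∃ S : Set (MvPolynomial (Fin n × Fin n) ℂ), ∀ g : GL (Fin n) ℂ,
    g ∈ G ↔ ∀ p ∈ S, MvPolynomial.eval (fun ij => g.val ij.1 ij.2) p = 0

/-- A subgroup of `G` which is Zariski closed in `G`. -/
def IsClosedIn {G : Subgroup (GL (Fin n) ℂ)} (H : Subgroup G) : Prop :=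
  ∃ S ⊆ (regularFunctions G : Set (G → ℂ)), ∀ g : G, g ∈ H ↔ ∀ f ∈ S, f g = 0

/-- Connected reductive linear algebraic group over `ℂ`: closed in `GL_n(ℂ)`, connected (for
complex algebraic groups the Zariski and the classical topology give the same notion), and
with trivial unipotent radical.  (Closed unipotent groups in characteristic zero are
automatically connected.) -/
structure IsConnectedReductive (G : Subgroup (GL (Fin n) ℂ)) : Prop where
  closed : IsZariskiClosed G
  connected : IsConnected (G : Set (GL (Fin n) ℂ))
  unipotentRadical : ∀ U : Subgroup G, U.Normal → IsClosedIn U →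
    (∀ u ∈ U, IsNilpotent ((u : GL (Fin n) ℂ).val - 1)) → U = ⊥

/-- An algebraic torus in `G`: closed, connected and simultaneously diagonalizable. -/
structure IsTorus {G : Subgroup (GL (Fin n) ℂ)} (T : Subgroup G) : Prop where
  closed : IsClosedIn T
  connected : IsConnected (T : Set G)
  diagonalizable : ∃ P : GL (Fin n) ℂ, ∀ t ∈ T, (P * (t : GL (Fin n) ℂ) * P⁻¹).val.IsDiag

/-- A maximal torus of a connected reductive group `G`, i.e. a torus that is its own centralizer
in `G` (in a connected reductive group a torus is maximal among the tori if and only if it equals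
its centralizer). -/
structure IsMaximalTorus {G : Subgroup (GL (Fin n) ℂ)} (T : Subgroup G) : Prop where
  torus : IsTorus T
  centralizer : Subgroup.centralizer (T : Set G) = T

/-- The identity component `H°`. -/
def identityComponent {G : Subgroup (GL (Fin n) ℂ)} (H : Subgroup G) : Subgroup G :=
  (Subgroup.connectedComponentOfOne H).map H.subtype

variable (G : Subgroup (GL (Fin n) ℂ))

/-- The Lie algebra `Lie(G)`, as tangent space at the identity: the point derivations of `ℂ[G]`
at `1`. -/
def LieAlg : Submodule ℂ (Module.Dual ℂ (regularFunctions G)) where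
  carrier := {D | ∀ f h : regularFunctions G, D (f * h) = f.1 1 * D h + D f * h.1 1}
  add_mem' {D E} hD hE f h := by
    simp only [LinearMap.add_apply, hD f h, hE f h]; ring
  zero_mem' f h := by simp
  smul_mem' c D hD f h := by
    simp only [LinearMap.smul_apply, hD f h, smul_eq_mul]; ring

/-- The group of automorphisms of the algebraic group `G`. -/
def AlgAut : Subgroup (MulAut G) where
  carrier := {σ | ∀ f : G → ℂ, (fun g => f (σ g)) ∈ regularFunctions G ↔ f ∈ regularFunctions G}
  mul_mem' {σ τ} hσ hτ f := (hτ (fun g => f (σ g))).trans (hσ f)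
  one_mem' _ := Iff.rfl
  inv_mem' {σ} hσ f := by
    have := hσ (fun g => f (σ⁻¹ g))
    simpa using this.symm

variable {G}

/-- The comorphism `f ↦ f ∘ σ` of an algebraic automorphism. -/
def pullback {σ : MulAut G} (hσ : σ ∈ AlgAut G) : regularFunctions G →ₗ[ℂ] regularFunctions G where
  toFun f := ⟨fun g => f.1 (σ g), (hσ f.1).2 f.2⟩
  map_add' _ _ := rfl
  map_smul' _ _ := rfl

/-- The differential `dσ : Lie(G) → Lie(G)` of an algebraic automorphism: `(dσ D)(f) = D (f ∘ σ)`. -/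
def differential {σ : MulAut G} (hσ : σ ∈ AlgAut G) : LieAlg G →ₗ[ℂ] LieAlg G where
  toFun D := ⟨D.1 ∘ₗ pullback hσ, fun f h => by
    have := D.2 (pullback hσ f) (pullback hσ h)
    have e : pullback hσ (f * h) = pullback hσ f * pullback hσ h := rfl
    have e1 : ∀ k : regularFunctions G, (pullback hσ k).1 1 = k.1 1 := fun k =>
      congrArg k.1 (map_one σ)
    rw [← e, e1, e1] at this
    exact this⟩
  map_add' _ _ := rfl
  map_smul' _ _ := rfl

theorem differential_apply {σ : MulAut G} (hσ : σ ∈ AlgAut G) (D : LieAlg G)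
    (f : regularFunctions G) : (differential hσ D).1 f = D.1 (pullback hσ f) := rfl

theorem differential_comp {σ τ : MulAut G} (hσ : σ ∈ AlgAut G) (hτ : τ ∈ AlgAut G) (h1 : σ * τ = 1)
    (D : LieAlg G) : differential hσ (differential hτ D) = D := by
  apply Subtype.ext; apply LinearMap.ext; intro f
  simp only [differential_apply]
  congr 1
  apply Subtype.ext; funext g
  exact congrArg f.1 (DFunLike.congr_fun h1 g)

/-- The differential of an algebraic automorphism, as a linear automorphism of `Lie(G)`. -/
def differentialEquiv {σ : MulAut G} (hσ : σ ∈ AlgAut G) : LieAlg G ≃ₗ[ℂ] LieAlg G :=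
  LinearEquiv.ofLinearMap (differential hσ) (differential (inv_mem hσ))
    (LinearMap.ext fun D => differential_comp _ _ (mul_inv_cancel σ) D)
    (LinearMap.ext fun D => differential_comp _ _ (inv_mul_cancel σ) D)

/-- `Lie(M) ⊆ Lie(G)` for a closed subgroup `M`: the derivations that kill the ideal of `M`. -/
def lieSub (M : Subgroup G) : Submodule ℂ (LieAlg G) where
  carrier := {D | ∀ f : regularFunctions G, (∀ m ∈ M, f.1 m = 0) → D.1 f = 0}
  add_mem' {D E} hD hE f hf := by
    have h1 := hD f hf
    have h2 := hE f hf
    simp [h1, h2]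
  zero_mem' f _ := by simp
  smul_mem' c D hD f hf := by
    have h1 := hD f hf
    simp [h1]

theorem differential_mem_lieSub {σ : MulAut G} (hσ : σ ∈ AlgAut G) {M : Subgroup G}
    (hM : ∀ m ∈ M, σ m ∈ M) {D : LieAlg G} (hD : D ∈ lieSub M) :
    differential hσ D ∈ lieSub M := fun f hf =>
  hD (pullback hσ f) fun m hm => hf _ (hM m hm)

theorem map_lieSub {σ : MulAut G} (hσ : σ ∈ AlgAut G) {M : Subgroup G}
    (hM : ∀ m, σ m ∈ M ↔ m ∈ M) :
    (lieSub M).map (differentialEquiv hσ : LieAlg G →ₗ[ℂ] LieAlg G) = lieSub M := by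
  apply le_antisymm
  · rintro _ ⟨D, hD, rfl⟩
    exact differential_mem_lieSub hσ (fun m hm => (hM m).2 hm) hD
  · intro D hD
    refine ⟨differential (inv_mem hσ) D,
      differential_mem_lieSub (inv_mem hσ) (fun m hm => ?_) hD, ?_⟩
    · rw [← hM]; simpa using hm
    · exact differential_comp hσ (inv_mem hσ) (mul_inv_cancel σ) D

/-- The automorphism of `Lie(G)/Lie(M)` induced by an algebraic automorphism that preserves `M`. -/
def differentialQuot {σ : MulAut G} (hσ : σ ∈ AlgAut G) {M : Subgroup G}
    (hM : ∀ m, σ m ∈ M ↔ m ∈ M) : (LieAlg G ⧸ lieSub M) ≃ₗ[ℂ] (LieAlg G ⧸ lieSub M) :=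
  Submodule.Quotient.equiv _ _ (differentialEquiv hσ) (map_lieSub hσ hM)

/-- A polynomial curve in `G`. -/
def IsPolynomialCurve (u : ℂ → G) : Prop :=
  ∀ i j, (∃ p : Polynomial ℂ, ∀ t, (u t : GL (Fin n) ℂ).val i j = p.eval t) ∧
    ∃ p : Polynomial ℂ, ∀ t, ((u t)⁻¹ : GL (Fin n) ℂ).val i j = p.eval t

theorem entry_mem (i j : Fin n) :
    (fun g : G => (g : GL (Fin n) ℂ).val i j) ∈ regularFunctions G :=
  Algebra.subset_adjoin (Or.inl ⟨(i, j), rfl⟩)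

theorem inv_entry_mem (i j : Fin n) :
    (fun g : G => (g⁻¹ : GL (Fin n) ℂ).val i j) ∈ regularFunctions G :=
  Algebra.subset_adjoin (Or.inr ⟨(i, j), rfl⟩)

theorem conj_regular {f : G → ℂ} (hf : f ∈ regularFunctions G) (x : G) :
    (fun g => f (MulAut.conj x g)) ∈ regularFunctions G := by
  induction hf using Algebra.adjoin_induction with
  | mem f hf =>
    rcases hf with ⟨⟨i, j⟩, rfl⟩ | ⟨⟨i, j⟩, rfl⟩
    · have : (fun g : G => ((MulAut.conj x g : G) : GL (Fin n) ℂ).val i j) =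
          ∑ l, ∑ k, ((x : GL (Fin n) ℂ).val i k * (x⁻¹ : GL (Fin n) ℂ).val l j) •
            (fun g : G => (g : GL (Fin n) ℂ).val k l) := by
        funext g
        simp [MulAut.conj_apply, Matrix.mul_apply, Finset.sum_mul]
        exact Finset.sum_congr rfl fun _ _ => Finset.sum_congr rfl fun _ _ => by ring
      simp only [this]
      exact sum_mem fun _ _ => sum_mem fun _ _ => Subalgebra.smul_mem _ (entry_mem _ _) _
    · have : (fun g : G => (((MulAut.conj x g : G) : GL (Fin n) ℂ)⁻¹).val i j) =
          ∑ l, ∑ k, ((x : GL (Fin n) ℂ).val i k * (x⁻¹ : GL (Fin n) ℂ).val l j) •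
            (fun g : G => (g⁻¹ : GL (Fin n) ℂ).val k l) := by
        funext g
        have : ((MulAut.conj x g : G) : GL (Fin n) ℂ)⁻¹ =
          (x : GL (Fin n) ℂ) * (g : GL (Fin n) ℂ)⁻¹ * (x : GL (Fin n) ℂ)⁻¹ := by
          simp [MulAut.conj_apply, mul_assoc]
        rw [this]
        simp only [Units.val_mul, Matrix.mul_apply, Finset.sum_mul, Finset.sum_apply,
          Pi.smul_apply, smul_eq_mul]
        exact Finset.sum_congr rfl fun _ _ => Finset.sum_congr rfl fun _ _ => by ring
      simp only [this]
      exact sum_mem fun _ _ => sum_mem fun _ _ => Subalgebra.smul_mem _ (inv_entry_mem _ _) _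
  | algebraMap r => exact Subalgebra.algebraMap_mem _ r
  | add f h _ _ hf hh => exact add_mem hf hh
  | mul f h _ _ hf hh => exact mul_mem hf hh

theorem conj_mem_algAut (x : G) : MulAut.conj x ∈ AlgAut G := fun f =>
  ⟨fun h => by simpa [MulAut.conj_apply, mul_assoc] using conj_regular h x⁻¹,
    fun h => conj_regular h x⟩

/-- The adjoint action of `x ∈ G` on `Lie(G)`. -/
def Ad (x : G) : LieAlg G →ₗ[ℂ] LieAlg G := differential (conj_mem_algAut x)

theorem polynomial_conj {u : ℂ → G} (hu : IsPolynomialCurve u) {f : G → ℂ}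
    (hf : f ∈ regularFunctions G) : ∃ p : Polynomial (regularFunctions G), ∀ t g,
      f (MulAut.conj (u t) g) = (p.eval (algebraMap ℂ _ t)).1 g := by
  unfold IsPolynomialCurve at hu
  have hu1 := fun i j => (hu i j).1
  have hu2 := fun i j => (hu i j).2
  choose p hp using hu1
  choose p' hp' using hu2
  have key : ∀ (F : Fin n → Fin n → G → ℂ), (∀ k l, F k l ∈ regularFunctions G) → ∀ i j,
      ∃ P : Polynomial (regularFunctions G), ∀ t g,
        ∑ l, ∑ k, (u t : GL (Fin n) ℂ).val i k * F k l g * ((u t)⁻¹ : GL (Fin n) ℂ).val l j =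
          (P.eval (algebraMap ℂ _ t)).1 g := by
    intro F hF i j
    refine ⟨∑ l, ∑ k, (p i k).map (algebraMap ℂ _) * Polynomial.C ⟨F k l, hF k l⟩ *
      (p' l j).map (algebraMap ℂ _), fun t g => ?_⟩
    have ev : ∀ r : Polynomial ℂ, (((r.map (algebraMap ℂ (regularFunctions G))).eval
        (algebraMap ℂ (regularFunctions G) t)).1 g) = r.eval t := fun r => by
      rw [Polynomial.eval_map, Polynomial.eval₂_at_apply]
      rfl
    simp only [Polynomial.eval_finsetSum, Polynomial.eval_mul, Polynomial.eval_C,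
      AddSubmonoidClass.coe_finsetSum, MulMemClass.coe_mul, Finset.sum_apply, Pi.mul_apply, ev,
      hp, hp']
  induction hf using Algebra.adjoin_induction with
  | mem f hf =>
    rcases hf with ⟨⟨i, j⟩, rfl⟩ | ⟨⟨i, j⟩, rfl⟩
    · obtain ⟨P, hP⟩ := key (fun k l g => (g : GL (Fin n) ℂ).val k l) entry_mem i j
      refine ⟨P, fun t g => ?_⟩
      rw [← hP]
      simp [MulAut.conj_apply, Matrix.mul_apply, Finset.sum_mul]
    · obtain ⟨P, hP⟩ := key (fun k l g => (g⁻¹ : GL (Fin n) ℂ).val k l) inv_entry_mem i j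
      refine ⟨P, fun t g => ?_⟩
      rw [← hP]
      have : ((MulAut.conj (u t) g : G) : GL (Fin n) ℂ)⁻¹ =
          (u t : GL (Fin n) ℂ) * (g : GL (Fin n) ℂ)⁻¹ * (u t : GL (Fin n) ℂ)⁻¹ := by
        simp [MulAut.conj_apply, mul_assoc]
      simp only [this, Units.val_mul, Matrix.mul_apply, Finset.sum_mul]
  | algebraMap r =>
    exact ⟨Polynomial.C (algebraMap ℂ _ r), fun t g => by simp⟩
  | add f h _ _ hf hh =>
    obtain ⟨P, hP⟩ := hf
    obtain ⟨Q, hQ⟩ := hh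
    exact ⟨P + Q, fun t g => by
      rw [Polynomial.eval_add]; exact congrArg₂ (· + ·) (hP t g) (hQ t g)⟩
  | mul f h _ _ hf hh =>
    obtain ⟨P, hP⟩ := hf
    obtain ⟨Q, hQ⟩ := hh
    exact ⟨P * Q, fun t g => by
      rw [Polynomial.eval_mul]; exact congrArg₂ (· * ·) (hP t g) (hQ t g)⟩

theorem differentiable_Ad {u : ℂ → G} (hu : IsPolynomialCurve u) (D : LieAlg G)
    (f : regularFunctions G) : Differentiable ℂ (fun t => (Ad (u t) D).1 f) := by
  obtain ⟨p, hp⟩ := polynomial_conj hu f.2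
  have : ∀ t, (Ad (u t) D).1 f = ∑ k ∈ Finset.range (p.natDegree + 1), t ^ k * D.1 (p.coeff k) := by
    intro t
    have e : pullback (conj_mem_algAut (u t)) f = p.eval (algebraMap ℂ _ t) :=
      Subtype.ext (funext fun g => hp t g)
    rw [Ad, differential_apply, e, Polynomial.eval_eq_sum_range, map_sum]
    refine Finset.sum_congr rfl fun k _ => ?_
    rw [← map_pow, mul_comm, ← Algebra.smul_def, map_smul, smul_eq_mul]
  simp only [this]
  fun_prop

/-- The derivative at `t = 0` of `Ad (u t)`, for a polynomial curve `u`. -/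
def adDeriv {u : ℂ → G} (hu : IsPolynomialCurve u) : LieAlg G →ₗ[ℂ] LieAlg G where
  toFun D := ⟨{ toFun := fun f => deriv (fun t => (Ad (u t) D).1 f) 0
                map_add' := fun f h => by
                  simp only [map_add]
                  exact deriv_add (differentiable_Ad hu D f 0) (differentiable_Ad hu D h 0)
                map_smul' := fun c f => by
                  simp only [map_smul, smul_eq_mul, RingHom.id_apply]
                  exact deriv_const_mul c (differentiable_Ad hu D f 0) }, fun f h => by
      have e : ∀ t, (Ad (u t) D).1 (f * h) =
          f.1 1 * (Ad (u t) D).1 h + (Ad (u t) D).1 f * h.1 1 := fun t => (Ad (u t) D).2 f h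
      simp only [LinearMap.coe_mk, AddHom.coe_mk, e]
      rw [deriv_fun_add ((differentiable_Ad hu D h 0).const_mul _)
        ((differentiable_Ad hu D f 0).mul_const _),
        deriv_const_mul _ (differentiable_Ad hu D h 0),
        deriv_mul_const (differentiable_Ad hu D f 0)]⟩
  map_add' D E := by
    apply Subtype.ext; apply LinearMap.ext; intro f
    simp only [map_add]
    exact deriv_add (differentiable_Ad hu D f 0) (differentiable_Ad hu E f 0)
  map_smul' c D := by
    apply Subtype.ext; apply LinearMap.ext; intro f
    simp only [map_smul]
    exact deriv_const_mul c (differentiable_Ad hu D f 0)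

theorem adDeriv_apply {u : ℂ → G} (hu : IsPolynomialCurve u) (D : LieAlg G)
    (f : regularFunctions G) : (adDeriv hu D).1 f = deriv (fun t => (Ad (u t) D).1 f) 0 := rfl

theorem adDeriv_mem_lieSub {u : ℂ → G} (hu : IsPolynomialCurve u) {M : Subgroup G}
    (hM : ∀ t, u t ∈ M) : lieSub M ≤ (lieSub M).comap (adDeriv hu) := by
  intro D hD f hf
  rw [adDeriv_apply]
  have : ∀ t, (Ad (u t) D).1 f = 0 := fun t =>
    differential_mem_lieSub (conj_mem_algAut (u t))
      (fun m hm => mul_mem (mul_mem (hM t) hm) (inv_mem (hM t))) hD f hf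
  simp [this]

/-- If `σ` is an algebraic automorphism with `u (c t) = σ (u t)`, then `dσ` scales the
derivative of `Ad (u t)` by `c`. -/
theorem adDeriv_differential {u : ℂ → G} (hu : IsPolynomialCurve u) {σ : MulAut G}
    (hσ : σ ∈ AlgAut G) (c : ℂ) (h : ∀ t, u (c * t) = σ (u t)) (D : LieAlg G) :
    c • adDeriv hu (differential hσ D) = differential hσ (adDeriv hu D) := by
  apply Subtype.ext; apply LinearMap.ext; intro f
  have e : ∀ t, (Ad (u t) D).1 (pullback hσ f) = (Ad (u (c * t)) (differential hσ D)).1 f := by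
    intro t
    simp only [Ad, differential_apply]
    congr 1
    apply Subtype.ext; funext g
    simp [pullback, h, MulAut.conj_apply]
  have e2 : (differential hσ (adDeriv hu D)).1 f =
      deriv (fun t => (Ad (u (c * t)) (differential hσ D)).1 f) 0 := by
    rw [differential_apply, adDeriv_apply]
    simp only [e]
  rw [e2, deriv_comp_mul_left c (fun t => (Ad (u t) (differential hσ D)).1 f) 0, mul_zero]
  rfl

end AlgebraicGroups

/-! ### Pinned groups, Frobenius action, Levi subgroups and restricted roots -/

section Roots

variable {n : ℕ} {G : Subgroup (GL (Fin n) ℂ)}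

/-- The roots of `(G, T)`: the nontrivial characters of `T` that occur in `Lie(G)`. -/
def roots (T : Subgroup G) : Set (T →* ℂˣ) :=
  {α | α ≠ 1 ∧ ∃ D : LieAlg G, D ≠ 0 ∧ ∀ t : T, Ad (t : G) D = (α t : ℂ) • D}

/-- `Δ` is a basis of the root system of `(G, T)`; characters are written multiplicatively. -/
structure IsRootBasis (T : Subgroup G) (Δ : Set (T →* ℂˣ)) : Prop where
  subset : Δ ⊆ roots T
  independent : ∀ c : Δ →₀ ℤ, (c.prod fun α k => (α : T →* ℂˣ) ^ k) = 1 → c = 0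
  pos_or_neg : ∀ α ∈ roots T, α ∈ Submonoid.closure Δ ∨ α⁻¹ ∈ Submonoid.closure Δ

/-- The character `α ∘ θ` of `T`, for an automorphism `θ` of `G` that stabilizes `T`. -/
def charComp {T : Subgroup G} {θ : MulAut G} (hT : ∀ g, θ g ∈ T ↔ g ∈ T) (α : T →* ℂˣ) :
    T →* ℂˣ :=
  α.comp ((θ.toMonoidHom.comp T.subtype).codRestrict T fun t => (hT t).2 t.2)

/-- The complex dual group `G = G^∨` of an unramified reductive group over a local field: a
connected complex reductive group with a pinning `(T, Δ, (X_α)_{α ∈ Δ})` and an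
automorphism `θ` (the action of Frobenius) of finite order which preserves the pinning. -/
structure PinnedDualGroup (n : ℕ) where
  G : Subgroup (GL (Fin n) ℂ)
  reductive : IsConnectedReductive G
  T : Subgroup G
  maximalTorus : IsMaximalTorus T
  Δ : Set (T →* ℂˣ)
  basis : IsRootBasis T Δ
  X : (T →* ℂˣ) → LieAlg G
  X_ne_zero : ∀ α ∈ Δ, X α ≠ 0
  X_mem : ∀ α ∈ Δ, ∀ t : T, Ad (t : G) (X α) = (α t : ℂ) • X α
  θ : MulAut G
  θ_algebraic : θ ∈ AlgAut G
  θ_finite : IsOfFinOrder θ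
  θ_torus : ∀ g, θ g ∈ T ↔ g ∈ T
  θ_basis : ∀ α ∈ Δ, charComp θ_torus α ∈ Δ
  θ_pinning : ∀ α ∈ Δ, differential θ_algebraic (X (charComp θ_torus α)) = X α

namespace PinnedDualGroup

variable (P : PinnedDualGroup n)

/-- The subgroup `G^θ` of elements fixed by `θ`. -/
def fixed : Subgroup P.G := MonoidHom.eqLocus P.θ.toMonoidHom (MonoidHom.id P.G)

/-- `T^{θ,∘}`. -/
def torusFixed : Subgroup P.G := identityComponent (P.T ⊓ P.fixed)

/-- The standard Levi subgroup attached to `J ⊆ Δ`: the centralizer of `(⋂_{α ∈ J} ker α)°`. -/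
def standardLevi (J : Set (P.T →* ℂˣ)) : Subgroup P.G :=
  Subgroup.centralizer
    (identityComponent ((⨅ α ∈ J, α.ker).map P.T.subtype) : Set P.G)

/-- A `θ`-stable standard Levi subgroup `M = M^∨` of `G^∨`, i.e. the dual group of a standard Levi
subgroup over the local field. -/
structure Levi where
  J : Set (P.T →* ℂˣ)
  subset : J ⊆ P.Δ
  stable : ∀ m, P.θ m ∈ P.standardLevi J ↔ m ∈ P.standardLevi J

variable {P}

/-- The subgroup `M ⊆ G`. -/
def Levi.M (L : P.Levi) : Subgroup P.G := P.standardLevi L.J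

/-- The parabolic root subsystem `Φ_M`. -/
def Levi.rootsM (L : P.Levi) : Set (P.T →* ℂˣ) := {α ∈ roots P.T | α ∈ Subgroup.closure L.J}

/-- `Z(M)^{θ,∘}`. -/
def Levi.centerFixed (L : P.Levi) : Subgroup P.G :=
  identityComponent ((L.M ⊓ Subgroup.centralizer (L.M : Set P.G)) ⊓ P.fixed)

variable (P)

/-- Two roots are equivalent when their restrictions to `Lie(T)^θ` (equivalently, to `T^{θ,∘}`) are
positive multiples of each other. -/
def RootEquiv (α β : P.T →* ℂˣ) : Prop :=
  ∃ k l : ℕ, 0 < k ∧ 0 < l ∧ ∀ t : P.T, (t : P.G) ∈ P.torusFixed → α t ^ k = β t ^ l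

/-- The equivalence class in `Φ/θ` of a root. -/
def rootClass (α : P.T →* ℂˣ) : Set (P.T →* ℂˣ) := {β ∈ roots P.T | P.RootEquiv α β}

variable {P} in
/-- The set of equivalence classes `(Φ \ Φ_M)/θ`. -/
def Levi.classes (L : P.Levi) : Set (Set (P.T →* ℂˣ)) :=
  {a | ∃ α ∈ roots P.T \ L.rootsM, a = P.rootClass α}

/-- A class is of type II when it contains a triple `α₁, α₂, α₁ + α₂` with `α₂ ∈ ⟨θ⟩ α₁`.
Otherwise it is of type I. -/
def IsTypeII (a : Set (P.T →* ℂˣ)) : Prop :=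
  ∃ α₁ ∈ a, ∃ α₂ ∈ a, α₁ * α₂ ∈ a ∧ ∃ k : ℕ, α₂ = (charComp P.θ_torus)^[k] α₁

open Classical in
/-- The parameter `m_+`: `|a|` in type I and `2|a|/3` in type II. -/
def mPlus (a : Set (P.T →* ℂˣ)) : ℕ := if P.IsTypeII a then 2 * a.ncard / 3 else a.ncard

open Classical in
/-- The parameter `m_-`: `0` in type I and `|a|/3` in type II. -/
def mMinus (a : Set (P.T →* ℂˣ)) : ℕ := if P.IsTypeII a then a.ncard / 3 else 0

/-- The root `γ_a ∈ R_0` of the Iwahori--Hecke algebra attached to the class `a`: the sum (written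
multiplicatively) of those `α ∈ a` that are not a sum of two elements of `a`.  For `a` of type I
this is the sum of all the roots in `a`.  For `a` of type II (where `a` consists of `2k` roots `α_i`
and of `k` roots each of which is a sum of two of the `α_i`) this is half the sum of all the
roots in `a`. -/
def gammaRoot (a : Set (P.T →* ℂˣ)) : P.T →* ℂˣ :=
  ∏ᶠ α ∈ {α ∈ a | ¬ ∃ β ∈ a, ∃ β' ∈ a, α = β * β'}, α

/-- The denominator `(1 + q^{-m_-} γ_a(t)^{-1}) (1 - q^{-m_+} γ_a(t)^{-1})`. -/
def muDenominator (q : ℕ) (a : Set (P.T →* ℂˣ)) (t : P.T) : ℂ :=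
  (1 + ((q : ℂ) ^ P.mMinus a)⁻¹ * (P.gammaRoot a t : ℂ)⁻¹) *
    (1 - ((q : ℂ) ^ P.mPlus a)⁻¹ * (P.gammaRoot a t : ℂ)⁻¹)

variable {P}

/-- The relative `μ`-function
`m^M(t) = q^{(dim m - dim g)/2} ∏_{a ∈ (Φ \ Φ_M)/θ}`
`(1 - γ_a(t)^{-2}) / ((1 + q^{-m_-(a)} γ_a(t)^{-1}) (1 - q^{-m_+(a)} γ_a(t)^{-1}))`. -/
def Levi.relativeMu (L : P.Levi) (q : ℕ) (t : P.T) : ℂ :=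
  (((q : ℝ) ^ (-(Module.finrank ℂ (LieAlg P.G ⧸ lieSub L.M) : ℝ) / 2) : ℝ) : ℂ) *
    ∏ᶠ a ∈ L.classes, (1 - ((P.gammaRoot a t : ℂ) ^ 2)⁻¹) / P.muDenominator q a t

theorem identityComponent_le {H : Subgroup G} : identityComponent H ≤ H := by
  rintro _ ⟨h, -, rfl⟩
  exact h.2

theorem Levi.torus_le (L : P.Levi) : P.T ≤ L.M := by
  intro t ht
  have hc := P.maximalTorus.centralizer
  rw [Levi.M, standardLevi, Subgroup.mem_centralizer_iff]
  intro s hs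
  have hsT : s ∈ P.T := by
    obtain ⟨s', -, rfl⟩ := identityComponent_le hs
    exact s'.2
  rw [← hc, Subgroup.mem_centralizer_iff] at ht
  exact ht s hsT

theorem Levi.centerFixed_le_torus (L : P.Levi) : L.centerFixed ≤ P.T := by
  intro z hz
  have hz' : z ∈ Subgroup.centralizer (L.M : Set P.G) := (identityComponent_le hz).1.2
  rw [← P.maximalTorus.centralizer, Subgroup.mem_centralizer_iff]
  rw [Subgroup.mem_centralizer_iff] at hz'
  exact fun t ht => hz' t (L.torus_le ht)

theorem torusFixed_le_torus : P.torusFixed ≤ P.T := fun _ ht => (identityComponent_le ht).1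

theorem Levi.centerFixed_comm (L : P.Levi) {z : P.G} (hz : z ∈ L.centerFixed) {m : P.G}
    (hm : m ∈ L.M) : m * z = z * m :=
  Subgroup.mem_centralizer_iff.1 (identityComponent_le hz).1.2 m hm

theorem Levi.centerFixed_le (L : P.Levi) {z : P.G} (hz : z ∈ L.centerFixed) : z ∈ L.M :=
  (identityComponent_le hz).1.1

theorem Levi.centerFixed_fixed (L : P.Levi) {z : P.G} (hz : z ∈ L.centerFixed) : P.θ z = z :=
  (identityComponent_le hz).2

end PinnedDualGroup

end Roots

/-! ### Local fields, the Weil group and additive characters -/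

section LocalField

variable (K : Type*) [Field K] [ValuativeRel K] [TopologicalSpace K] [IsNonarchimedeanLocalField K]

/-- The cardinality `q` of the residue field. -/
def residueCard : ℕ := Nat.card 𝓀[K]

theorem residueCard_pos : 0 < residueCard K := Nat.card_pos

/-- The maximal ideal of the ring of integers of the separable closure `K_s`: the non-units among
the elements that are integral over the ring of integers of `K`. -/
def sepMaximalIdeal : Set (SeparableClosure K) :=
  {y | IsIntegral 𝒪[K] y ∧ (y = 0 ∨ ¬ IsIntegral 𝒪[K] y⁻¹)}

/-- `σ` is an arithmetic Frobenius element: it acts on the residue field of `K_s` as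
`x ↦ x ^ q`. -/
def IsFrobenius (σ : SeparableClosure K ≃ₐ[K] SeparableClosure K) : Prop :=
  ∀ x, IsIntegral 𝒪[K] x → σ x - x ^ residueCard K ∈ sepMaximalIdeal K

/-- `σ` lies in the inertia group: it acts trivially on the residue field of `K_s`. -/
def IsInertia (σ : SeparableClosure K ≃ₐ[K] SeparableClosure K) : Prop :=
  ∀ x, IsIntegral 𝒪[K] x → σ x - x ∈ sepMaximalIdeal K

/-- The Weil group `W_K`, as the fibre product of `Gal(K_s/K)` and `ℤ` over `Gal(k_s/k)`.  It is
generated by the pairs `(σ, 1)` with `σ` a Frobenius element and the pairs `(σ, 0)` with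
`σ` in the inertia group. -/
def WeilGroup : Subgroup ((SeparableClosure K ≃ₐ[K] SeparableClosure K) × Multiplicative ℤ) :=
  Subgroup.closure {x | (IsFrobenius K x.1 ∧ x.2 = Multiplicative.ofAdd 1) ∨
    (IsInertia K x.1 ∧ x.2 = 1)}

/-- The degree map `W_K → ℤ`, which sends Frobenius elements to `1`. -/
def WeilGroup.deg : WeilGroup K →* Multiplicative ℤ :=
  (MonoidHom.snd _ _).comp (WeilGroup K).subtype

/-- The inertia group `I_K ⊆ W_K`. -/
def WeilGroup.inertia : Subgroup (WeilGroup K) := (WeilGroup.deg K).ker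

/-- The Frobenius elements of `W_K`. -/
def FrobeniusElement : Type _ := {w : WeilGroup K // WeilGroup.deg K w = Multiplicative.ofAdd 1}

variable {K}

/-- The order `n(ψ)` of an additive character: the largest `n` such that `ψ` is trivial
on `ϖ^{-n} 𝒪`. -/
def charOrder (ψ : AddChar K ℂ) : ℤ :=
  sSup {n : ℤ | ∀ ϖ : 𝒪[K], Irreducible ϖ → ∀ y : 𝒪[K], ψ ((ϖ : K) ^ (-n) * (y : K)) = 1}

/-- The measure `μ` on `K` is self-dual with respect to `ψ`: Fourier inversion
`f^^(x) = f(-x)` holds for Schwartz--Bruhat functions. -/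
def IsSelfDual [MeasurableSpace K] (ψ : AddChar K ℂ) (μ : MeasureTheory.Measure K) : Prop :=
  ∀ f : K → ℂ, IsLocallyConstant f → HasCompactSupport f →
    ∀ x, ∫ y, (∫ z, f z * ψ (z * y) ∂μ) * ψ (y * x) ∂μ = f (-x)

end LocalField

/-! ### Weil--Deligne representations trivial on inertia, and their local factors -/

section WeilDeligne

/-- A Weil--Deligne representation on which the inertia group acts trivially, given by
`frob = ρ(Fr)` and the operator `N`, with `ρ(Fr) N ρ(Fr)⁻¹ = q⁻¹ N`, in the form
`N ρ(Fr) = q ρ(Fr) N`.  (For finite dimensional `V` and `q > 1` this relation forces `N` to be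
nilpotent.) -/
structure UnramifiedWD (q : ℕ) (V : Type*) [AddCommGroup V] [Module ℂ V] where
  frob : V ≃ₗ[ℂ] V
  N : V →ₗ[ℂ] V
  comm : ∀ v, N (frob v) = (q : ℂ) • frob (N v)

namespace UnramifiedWD

variable {q : ℕ} {V : Type*} [AddCommGroup V] [Module ℂ V] (ρ : UnramifiedWD q V)

theorem ker_le : LinearMap.ker ρ.N ≤ (LinearMap.ker ρ.N).comap (ρ.frob : V →ₗ[ℂ] V) := by
  intro v hv
  have hv' : ρ.N v = 0 := hv
  simp [ρ.comm, hv']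

/-- The action of `ρ(Fr)` on `V_N = ker N`. -/
def frobKer : LinearMap.ker ρ.N →ₗ[ℂ] LinearMap.ker ρ.N :=
  (ρ.frob : V →ₗ[ℂ] V).restrict ρ.ker_le

/-- The action of `ρ(Fr)` on `V / V_N`. -/
def frobQuot : (V ⧸ LinearMap.ker ρ.N) →ₗ[ℂ] (V ⧸ LinearMap.ker ρ.N) :=
  Submodule.mapQ _ _ (ρ.frob : V →ₗ[ℂ] V) ρ.ker_le

/-- The contragredient Weil--Deligne representation, with `N^∨ λ = - λ ∘ N`. -/
def dual : UnramifiedWD q (Module.Dual ℂ V) where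
  frob := ρ.frob.symm.dualMap
  N := -ρ.N.dualMap
  comm l := by
    apply LinearMap.ext; intro v
    have h := ρ.comm (ρ.frob.symm v)
    rw [LinearEquiv.apply_symm_apply] at h
    simp [h]

/-- `L(s, ρ) = det(1 - q^{-s} ρ(Fr) | V_N)⁻¹`. -/
def LFactor (s : ℂ) : ℂ := (LinearMap.det (1 - ((q : ℂ) ^ (-s)) • ρ.frobKer))⁻¹

variable {K : Type*} [Field K] [ValuativeRel K] [TopologicalSpace K] [IsNonarchimedeanLocalField K]
  [MeasurableSpace K]

/-- `ε(s, ρ_0, ψ)` for the unramified representation `ρ_0` of `W_K` underlying `ρ`.  On an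
unramified quasi-character `χ` of `K^×` it is
`ε(χ ‖ ‖^s, ψ, dx) = χ(c) ‖c‖^s ‖c‖⁻¹ ∫_𝒪 dx` with `c` of valuation `n(ψ)`, and it is extended
additively. The measure `dx = μ` has to be taken self-dual with respect to `ψ`. -/
def epsilonZero (ψ : AddChar K ℂ) (μ : MeasureTheory.Measure K) (s : ℂ) : ℂ :=
  LinearMap.det ((ρ.frob ^ charOrder ψ : V ≃ₗ[ℂ] V) : V →ₗ[ℂ] V) *
    ((q : ℂ) ^ ((charOrder ψ : ℂ) * (1 - s)) * (μ.real (𝒪[K] : Set K) : ℂ)) ^ Module.finrank ℂ V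

/-- `ε(s, ρ, ψ) = ε(s, ρ_0, ψ) det(- q^{-s} ρ(Fr) | V / V_N)`. -/
def epsilonFactor (ψ : AddChar K ℂ) (μ : MeasureTheory.Measure K) (s : ℂ) : ℂ :=
  ρ.epsilonZero ψ μ s * LinearMap.det (-((q : ℂ) ^ (-s)) • ρ.frobQuot)

/-- `γ(s, ρ, ψ) = ε(s, ρ, ψ) L(1-s, ρ^∨) L(s, ρ)⁻¹`. -/
def gammaFactor (ψ : AddChar K ℂ) (μ : MeasureTheory.Measure K) (s : ℂ) : ℂ :=
  ρ.epsilonFactor ψ μ s * ρ.dual.LFactor (1 - s) * (ρ.LFactor s)⁻¹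

end UnramifiedWD

end WeilDeligne

/-! ### Unramified L-parameters -/

section LParameters

variable {n : ℕ} (P : PinnedDualGroup n)
variable (K : Type*) [Field K] [ValuativeRel K] [TopologicalSpace K] [IsNonarchimedeanLocalField K]

/-- The action of `W_K` on `G^∨`, through `W_K / I_K ≅ ℤ`, with Frobenius acting by `θ`. -/
def weilAction : WeilGroup K →* MulAut P.G := (zpowersHom (MulAut P.G) P.θ).comp (WeilGroup.deg K)

theorem weilAction_apply (w : WeilGroup K) :
    weilAction P K w = P.θ ^ (WeilGroup.deg K w).toAdd := rfl

/-- The L-group `G^∨ ⋊ W_K`. -/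
abbrev LGroup : Type _ := P.G ⋊[weilAction P K] WeilGroup K

variable {P K}

theorem theta_zpow_stable (L : P.Levi) (k : ℤ) (m : P.G) : (P.θ ^ k) m ∈ L.M ↔ m ∈ L.M := by
  have h1 : ∀ m, P.θ m ∈ L.M ↔ m ∈ L.M := L.stable
  have h2 : ∀ m, P.θ⁻¹ m ∈ L.M ↔ m ∈ L.M := fun m => by
    rw [← h1 (P.θ⁻¹ m)]; simp
  induction k generalizing m with
  | zero => simp
  | succ k ih => rw [zpow_add_one, MulAut.mul_apply]; exact (ih _).trans (h1 m)
  | pred k ih => rw [zpow_sub_one, MulAut.mul_apply]; exact (ih _).trans (h2 m)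

theorem theta_zpow_fixed (L : P.Levi) {z : P.G} (hz : z ∈ L.centerFixed) (k : ℤ) :
    (P.θ ^ k) z = z := by
  have h1 : P.θ z = z := L.centerFixed_fixed hz
  have h2 : P.θ⁻¹ z = z := by
    conv_lhs => rw [← h1]
    simp
  induction k with
  | zero => simp
  | succ k ih => rw [zpow_add_one, MulAut.mul_apply, h1, ih]
  | pred k ih => rw [zpow_sub_one, MulAut.mul_apply, h2, ih]

/-- The automorphism of `G^∨` given by conjugation with an element of the L-group. -/
def innerAut (h : LGroup P K) : MulAut P.G := MulAut.conj h.left * weilAction P K h.right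

theorem innerAut_mem (h : LGroup P K) : innerAut h ∈ AlgAut P.G :=
  mul_mem (conj_mem_algAut _) (zpow_mem P.θ_algebraic _)

theorem innerAut_stable (L : P.Levi) {h : LGroup P K} (hh : h.left ∈ L.M) (m : P.G) :
    innerAut h m ∈ L.M ↔ m ∈ L.M := by
  have : innerAut h m = h.left * (P.θ ^ (WeilGroup.deg K h.right).toAdd) m * h.left⁻¹ := rfl
  rw [this, Subgroup.mul_mem_cancel_right _ (inv_mem hh), Subgroup.mul_mem_cancel_left _ hh,
    theta_zpow_stable]

variable (K) in
/-- An unramified L-parameter for (the `K`-group with dual group) `M`: a homomorphism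
`φ : W_K × SL_2(ℂ) → M^∨ ⋊ W_K ⊆ G^∨ ⋊ W_K` over `W_K`, algebraic on `SL_2(ℂ)` and with
`φ(w) = (1, w)` for `w ∈ I_K` (so `φ` is automatically continuous).  The requirement that `φ(W_K)` consists of semisimple elements is
formulated separately, as `IsFrobeniusSemisimple`. -/
structure UnramifiedLParameter (L : P.Levi) where
  hom : WeilGroup K × Matrix.SpecialLinearGroup (Fin 2) ℂ →* LGroup P K
  right : ∀ x, (hom x).right = x.1
  left_mem : ∀ x, (hom x).left ∈ L.M
  unramified : ∀ w ∈ WeilGroup.inertia K, hom (w, 1) = SemidirectProduct.inr w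
  algebraic : ∀ i j, ∃ p : MvPolynomial (Fin 2 × Fin 2) ℂ,
    ∀ g : Matrix.SpecialLinearGroup (Fin 2) ℂ,
      ((hom (1, g)).left : GL (Fin n) ℂ).val i j = MvPolynomial.eval (fun k => g.1 k.1 k.2) p

namespace UnramifiedLParameter

variable {L : P.Levi} (φ : UnramifiedLParameter K L)

/-- `φ(W_K)` consists of semisimple elements: for every `w ∈ W_K` some positive power of `w` acts
trivially on `G^∨`, and the corresponding power of `φ(w)` has a semisimple component
in `G^∨`. -/
def IsFrobeniusSemisimple : Prop :=
  ∀ w : WeilGroup K, ∃ k : ℕ, 0 < k ∧ weilAction P K (w ^ k) = 1 ∧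
    Module.End.IsSemisimple (Matrix.toLin' ((φ.hom (w, 1) ^ k).left : GL (Fin n) ℂ).val)

theorem twist_map_mul {z : P.G} (hz : z ∈ L.centerFixed)
    (x y : WeilGroup K × Matrix.SpecialLinearGroup (Fin 2) ℂ) :
    z ^ (WeilGroup.deg K (x * y).1).toAdd * (φ.hom (x * y)).left =
      z ^ (WeilGroup.deg K x.1).toAdd * (φ.hom x).left *
        weilAction P K x.1 (z ^ (WeilGroup.deg K y.1).toAdd * (φ.hom y).left) := by
  have hc : ∀ k : ℤ, (φ.hom x).left * z ^ k = z ^ k * (φ.hom x).left := fun k =>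
    ((show Commute (φ.hom x).left z from
      L.centerFixed_comm hz (φ.left_mem x)).zpow_right k).eq
  simp only [SemidirectProduct.mul_left, map_mul, φ.right, Prod.fst_mul, toAdd_mul,
    map_zpow]
  rw [weilAction_apply, theta_zpow_fixed L hz, zpow_add]
  simp only [mul_assoc]
  rw [← mul_assoc (φ.hom x).left, hc, mul_assoc]

/-- The homomorphism underlying the twist `z φ`: `(w, g) ↦ z^{deg w} φ(w, g)`. -/
def twistHom {z : P.G} (hz : z ∈ L.centerFixed) :
    WeilGroup K × Matrix.SpecialLinearGroup (Fin 2) ℂ →* LGroup P K :=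
  MonoidHom.mk' (fun x => ⟨z ^ (WeilGroup.deg K x.1).toAdd * (φ.hom x).left, x.1⟩)
    fun x y => SemidirectProduct.ext (φ.twist_map_mul hz x y) rfl

theorem twistHom_left {z : P.G} (hz : z ∈ L.centerFixed)
    (x : WeilGroup K × Matrix.SpecialLinearGroup (Fin 2) ℂ) :
    (φ.twistHom hz x).left = z ^ (WeilGroup.deg K x.1).toAdd * (φ.hom x).left := rfl

theorem twistHom_left_of_deg {z : P.G} (hz : z ∈ L.centerFixed)
    (x : WeilGroup K × Matrix.SpecialLinearGroup (Fin 2) ℂ) (hx : WeilGroup.deg K x.1 = 1) :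
    (φ.twistHom hz x).left = (φ.hom x).left := by
  rw [twistHom_left, hx, toAdd_one, zpow_zero, one_mul]

/-- The twist `z φ` by `z ∈ Z(M^∨)^{θ,∘}`: it agrees with `φ` on `I_K × SL_2(ℂ)` and
`(zφ)(Fr) = z φ(Fr)` for every Frobenius element. -/
def twist {z : P.G} (hz : z ∈ L.centerFixed) : UnramifiedLParameter K L where
  hom := φ.twistHom hz
  right _ := rfl
  left_mem x := mul_mem (zpow_mem (L.centerFixed_le hz) _) (φ.left_mem x)
  unramified w hw := by
    apply SemidirectProduct.ext
    · rw [twistHom_left_of_deg φ hz (w, 1) hw, φ.unramified w hw]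
    · rfl
  algebraic i j := by
    obtain ⟨p, hp⟩ := φ.algebraic i j
    refine ⟨p, fun g => ?_⟩
    rw [twistHom_left_of_deg φ hz (1, g) (map_one _), hp g]

/-- The unipotent element `(1 t; 0 1)` of `SL_2(ℂ)`. -/
def unip (t : ℂ) : Matrix.SpecialLinearGroup (Fin 2) ℂ := ⟨!![1, t; 0, 1], by simp⟩

theorem unip_neg (t : ℂ) : unip (-t) = (unip t)⁻¹ := by
  rw [eq_inv_iff_mul_eq_one]
  apply Subtype.ext
  rw [Matrix.SpecialLinearGroup.coe_mul]
  simp [unip, Matrix.one_fin_two]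

variable (K) in
/-- The element `diag(q^{-1/2}, q^{1/2})` of `SL_2(ℂ)`. -/
def diagQ : Matrix.SpecialLinearGroup (Fin 2) ℂ :=
  ⟨!![((√(residueCard K : ℝ) : ℝ) : ℂ)⁻¹, 0; 0, ((√(residueCard K : ℝ) : ℝ) : ℂ)], by
    have : 0 < √(residueCard K : ℝ) := Real.sqrt_pos.2 (by exact_mod_cast residueCard_pos K)
    have h : ((√(residueCard K : ℝ) : ℝ) : ℂ) ≠ 0 := by exact_mod_cast this.ne'
    simp [Matrix.det_fin_two_of, h]⟩

variable (K) in
theorem diagQ_mul_unip (t : ℂ) :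
    diagQ K * unip t = unip ((residueCard K : ℂ)⁻¹ * t) * diagQ K := by
  have h0 : 0 < √(residueCard K : ℝ) := Real.sqrt_pos.2 (by exact_mod_cast residueCard_pos K)
  have h : ((√(residueCard K : ℝ) : ℝ) : ℂ) ≠ 0 := by exact_mod_cast h0.ne'
  have h2 : (residueCard K : ℂ) =
      ((√(residueCard K : ℝ) : ℝ) : ℂ) * ((√(residueCard K : ℝ) : ℝ) : ℂ) := by
    rw [← Complex.ofReal_mul, Real.mul_self_sqrt (Nat.cast_nonneg _)]
    simp
  apply Subtype.ext
  rw [Matrix.SpecialLinearGroup.coe_mul, Matrix.SpecialLinearGroup.coe_mul]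
  simp only [unip, diagQ, h2, Matrix.mul_fin_two]
  simp [h, mul_comm, mul_left_comm]

/-- The element `φ(Fr, diag(q^{-1/2}, q^{1/2})) = r_M θ` of the L-group. -/
def infChar (Fr : FrobeniusElement K) : LGroup P K := φ.hom (Fr.1, diagQ K)

/-- The element `r_M ∈ M^∨` with `r_M θ = φ(Fr, diag(q^{-1/2}, q^{1/2}))`. -/
def r (Fr : FrobeniusElement K) : P.G := (φ.infChar Fr).left

/-- The curve `t ↦ φ(1, (1 t; 0 1))` in `M^∨`. -/
def unipCurve (t : ℂ) : P.G := (φ.hom (1, unip t)).left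

theorem unipCurve_eq (t : ℂ) : φ.hom (1, unip t) = SemidirectProduct.inl (φ.unipCurve t) := by
  apply SemidirectProduct.ext
  · rfl
  · simp [φ.right]

theorem unipCurve_polynomial : IsPolynomialCurve φ.unipCurve := by
  have key : ∀ i j, ∃ p : Polynomial ℂ, ∀ t,
      (φ.unipCurve t : GL (Fin n) ℂ).val i j = p.eval t := by
    intro i j
    obtain ⟨p, hp⟩ := φ.algebraic i j
    refine ⟨MvPolynomial.aeval
      (fun k : Fin 2 × Fin 2 => (!![1, Polynomial.X; 0, 1] : Matrix _ _ (Polynomial ℂ)) k.1 k.2) p,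
      fun t => ?_⟩
    rw [unipCurve, hp, ← Polynomial.coe_evalRingHom, MvPolynomial.aeval_def,
      MvPolynomial.hom_eval₂, MvPolynomial.eval, MvPolynomial.coe_eval₂Hom]
    congr 1
    · ext; simp
    · funext ⟨a, b⟩
      fin_cases a <;> fin_cases b <;> simp [unip]
  intro i j
  refine ⟨key i j, ?_⟩
  obtain ⟨p, hp⟩ := key i j
  refine ⟨p.comp (-Polynomial.X), fun t => ?_⟩
  have h : φ.unipCurve (-t) = (φ.unipCurve t)⁻¹ := by
    apply SemidirectProduct.inl_injective (φ := weilAction P K)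
    rw [map_inv, ← unipCurve_eq, ← unipCurve_eq, ← map_inv, unip_neg]
    simp
  have := hp (-t)
  rw [h] at this
  simpa using this

theorem unipCurve_conj (Fr : FrobeniusElement K) (t : ℂ) :
    φ.unipCurve ((residueCard K : ℂ)⁻¹ * t) = innerAut (φ.infChar Fr) (φ.unipCurve t) := by
  have h1 : φ.infChar Fr * SemidirectProduct.inl (φ.unipCurve t) =
      SemidirectProduct.inl (φ.unipCurve ((residueCard K : ℂ)⁻¹ * t)) * φ.infChar Fr := by
    rw [← unipCurve_eq, ← unipCurve_eq, infChar, ← map_mul, ← map_mul]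
    congr 1
    apply Prod.ext
    · simp
    · simpa using diagQ_mul_unip K t
  have h2 := congrArg SemidirectProduct.left h1
  simp only [SemidirectProduct.mul_left, SemidirectProduct.left_inl, SemidirectProduct.right_inl,
    map_one, MulAut.one_apply] at h2
  simp [innerAut, MulAut.conj_apply, h2]

/-- The Weil--Deligne representation attached to `Ad ∘ φ` on `Lie(G^∨)/Lie(M^∨)`.  Here `Fr` acts by
the adjoint action of `φ(Fr, diag(q^{-1/2}, q^{1/2}))`, and `N` is the differential of
`Ad ∘ φ|_{SL_2(ℂ)}` at the nilpotent matrix `(0 1; 0 0)`. -/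
def adWD (Fr : FrobeniusElement K) :
    UnramifiedWD (residueCard K) (LieAlg P.G ⧸ lieSub L.M) where
  frob := differentialQuot (innerAut_mem (φ.infChar Fr))
    (innerAut_stable L (φ.left_mem (Fr.1, diagQ K)))
  N := Submodule.mapQ _ _ (adDeriv φ.unipCurve_polynomial)
    (adDeriv_mem_lieSub φ.unipCurve_polynomial fun t => φ.left_mem (1, unip t))
  comm v := by
    induction v using Submodule.Quotient.induction_on with | _ D => ?_
    have hq : (residueCard K : ℂ) ≠ 0 := by exact_mod_cast (residueCard_pos K).ne'
    have h := adDeriv_differential φ.unipCurve_polynomial (innerAut_mem (φ.infChar Fr))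
      (residueCard K : ℂ)⁻¹ (φ.unipCurve_conj Fr) D
    rw [inv_smul_eq_iff₀ hq] at h
    exact congrArg (Submodule.Quotient.mk (p := lieSub L.M)) h

end UnramifiedLParameter

end LParameters

end UnramGamma

end

open UnramGamma

/-!
Let `F` be the operator by which Frobenius acts on `V = Lie(G) / Lie(M)`. Up to the sign
`(-1) ^ dim V`, the γ-factor at `s = 0` is the power `q ^ (-dim V / 2)` times
`det(1 - F⁻¹) / det(1 - q⁻¹ F⁻¹)`, and the μ-function is that same power times a product over
classes of roots; the theorem says that the determinants factor accordingly.

* *The γ-factor does not depend on `N`.* Since `N` identifies `V / V_N` with its image, up to a twist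
  by `q`, the factors by which `L(1 - s, ρ^∨)` and `L(s, ρ)` differ from the full determinants are
  exactly compensated by the determinant on `V / V_N` in the ε-factor
  (`UnramifiedWD.gammaFactor_eq`). Fourier inversion for the indicator function of `𝒪` gives
  `μ(𝒪)² = q` (`measure_integers_sq`), and the value at `s = 0` follows
  (`UnramifiedWD.tendsto_gammaFactor`).

* *Lie algebras.* A Zariski closed subgroup `G` of `GL_n(ℂ)` contains the one-parameter groups of its
  tangent vectors (`LieAlg.expGL_mem`), so `Lie(G)` is a Lie algebra of matrices, on which
  algebraic automorphisms of `G` act. The radical of the trace form consists of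
  nilpotent matrices, hence generates a unipotent normal subgroup (`eq_bot_of_pow_eq_bot`). It is
  therefore zero when `G` is reductive, and `Lie(G)` is split over the Lie algebra of the torus with
  a nondegenerate invariant form (`isSplitReductive`). This yields the `sl₂`-triples and the
  one-dimensional root spaces.

* *The classes of roots.* The orbit under `θ` of a simple root is either discrete in the Dynkin
  diagram or a disjoint union of edges (`IsPinned.orbit_cases`). In the first case the roots that
  restrict to multiples of the simple root `β` form one orbit, of some length `k`, and `θᵏ` acts as
  `1` on the root space of `β`. In the second case they form two orbits, that of `β` of length `2 k`
  and that of `β + θᵏ β` of length `k`; here `θᵏ` exchanges the two factors of the root vector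
  `⁅e (θᵏ β), e β⁆`, hence acts on it as `-1`. The reflection attached to an orbit of simple roots
  comes from an automorphism of `Lie(G)` that commutes with `θ`, and such reflections move every root
  to a multiple of a simple root on the `θ`-fixed part of the torus. Hence all classes look like
  those of simple roots (`IsPinned.exists_isType`, `PinnedDualGroup.exists_isClass`).

* *The determinant.* `F⁻¹` permutes the root spaces outside `Lie(M)` along the orbits of `θ`, so that
  `det(1 - y F⁻¹)` is the product over the orbits of `1 - yᵏ ε γ⁻¹`, where `k` is the length, `γ` is
  the product over the orbit and `ε` is the sign above (`det_one_sub_smul_eq_prod`,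
  `PinnedDualGroup.Levi.det_eq_prod`). A class of type I contributes `1 - yᵏ γ_a⁻¹`, and one of type II
  contributes `(1 + yᵏ γ_a⁻¹) (1 - y²ᵏ γ_a⁻¹)`; the quotient of the values at `y = 1` and `y = q⁻¹` is
  the factor of the μ-function in either case (`PinnedDualGroup.nonempty_classData`).

* *Nonvanishing.* Some `θ`-fixed element `x` of the center of `Lie(M)` is not annihilated by any root
  outside `M`. Along the one-parameter group `exp(s x)` the characters `γ_a` are nontrivial
  exponentials, so the denominators of the μ-function vanish for few values of `s`
  (`PinnedDualGroup.Levi.exists_muDenominator_ne_zero`).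
-/

open scoped Matrix Topology ValuativeRel

open UnramGamma

namespace UnramGamma

open Module MeasureTheory NormedSpace

attribute [local instance] LieRing.ofAssociativeRing

/-! ### Lie algebras with an invariant form that split over an abelian subalgebra -/

section SplitReductive

variable {L : Type*} [LieRing L] [LieAlgebra ℂ L] {H : Submodule ℂ L}

/-- The simultaneous eigenspace in `L` of the elements of `A ≤ H`, for the restriction to `A` of the
functional `χ` on `H`. Functionals with the same restriction to `A` give the same space. -/
def weightSpace (A : Submodule ℂ H) (χ : Dual ℂ H) : Submodule ℂ L where
  carrier := {x | ∀ h ∈ A, ⁅(h : L), x⁆ = χ h • x}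
  add_mem' hx hy h hh := by rw [lie_add, hx h hh, hy h hh, smul_add]
  zero_mem' h _ := by simp
  smul_mem' c x hx h hh := by rw [lie_smul, hx h hh, smul_comm]

theorem weightSpace_congr {A : Submodule ℂ H} {χ χ' : Dual ℂ H} (h : ∀ a ∈ A, χ a = χ' a) :
    weightSpace (L := L) A χ = weightSpace A χ' := by
  ext x
  exact forall₂_congr fun a ha => by rw [h a ha]

theorem weightSpace_top_le (A : Submodule ℂ H) (χ : Dual ℂ H) :
    weightSpace (L := L) ⊤ χ ≤ weightSpace A χ := fun _ hx h _ => hx h trivial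

theorem lie_mem_weightSpace {A : Submodule ℂ H} {χ χ' : Dual ℂ H} {x y : L}
    (hx : x ∈ weightSpace A χ) (hy : y ∈ weightSpace A χ') : ⁅x, y⁆ ∈ weightSpace A (χ + χ') := by
  intro h hh
  rw [leibniz_lie, hx h hh, hy h hh, smul_lie, lie_smul, ← add_smul]
  rfl

theorem eq_of_mem_weightSpace {A : Submodule ℂ H} {χ χ' : Dual ℂ H} {x : L} (hx0 : x ≠ 0)
    (hx : x ∈ weightSpace A χ) (hx' : x ∈ weightSpace A χ') {h : H} (hh : h ∈ A) :
    χ h = χ' h :=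
  smul_left_injective ℂ hx0 ((hx h hh).symm.trans (hx' h hh))

theorem eq_zero_of_lie_e [FiniteDimensional ℂ L] {h e f x : L} (t : IsSl2Triple h e f) {c : ℂ} (hx : ⁅h, x⁆ = c • x)
    (hex : ⁅e, x⁆ = 0) (hc : ∀ m : ℕ, c ≠ m) : x = 0 := by
  by_contra hx0
  obtain ⟨m, hm⟩ := (⟨hx0, hx, hex⟩ : t.HasPrimitiveVectorWith x c).exists_nat
  exact hc m hm

theorem exists_pow_toEnd_eq_zero [FiniteDimensional ℂ L] {h e f x : L} (t : IsSl2Triple h e f)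
    {c : ℂ} (hx : ⁅h, x⁆ = c • x) : ∃ k : ℕ, (LieModule.toEnd ℂ L L e ^ k) x = 0 := by
  by_contra! hne
  have hs : (Set.range fun k : ℕ => c + 2 * k).Infinite := by
    rw [Set.infinite_range_iff (fun n m ↦ by simp)]; infer_instance
  exact hs ((LieModule.toEnd ℂ L L (h : L)).eigenvectors_linearIndependent
    {c + 2 * k | k : ℕ}
    (fun s => (LieModule.toEnd ℂ L L e ^ (Classical.choose s.2)) x)
    (fun ⟨r, hr⟩ ↦ by
      simp [t.lie_h_pow_toEnd_e hx, Classical.choose_spec hr, hne,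
        Module.End.hasEigenvector_iff])).finite

theorem exists_int_of_sl2Triple [FiniteDimensional ℂ L] {h e f x : L} (t : IsSl2Triple h e f)
    {c : ℂ} (hx0 : x ≠ 0) (hx : ⁅h, x⁆ = c • x) : ∃ m : ℤ, c = m := by
  obtain ⟨k, hk, hk'⟩ := Nat.exists_not_and_succ_of_not_zero_of_exists
    (p := fun k => (LieModule.toEnd ℂ L L e ^ k) x = 0) (by simpa using hx0)
    (exists_pow_toEnd_eq_zero t hx)
  have P : t.HasPrimitiveVectorWith ((LieModule.toEnd ℂ L L e ^ k) x) (c + 2 * k) :=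
    ⟨hk, t.lie_h_pow_toEnd_e hx k, by rw [IsSl2Triple.lie_e_pow_toEnd_e]; exact hk'⟩
  obtain ⟨m, hm⟩ := P.exists_nat
  exact ⟨m - 2 * k, by push_cast; linear_combination hm⟩

variable (H) in
/-- `L` is the direct sum of `H` and of weight spaces for nonzero functionals on `H`, and it carries
a nondegenerate invariant symmetric bilinear form `B` for which `χ ⁅x, y⁆ ≠ 0` whenever `x` and
`y` have opposite nonzero weights `χ`, `-χ` and pair nontrivially. -/
structure IsSplitReductive (B : LinearMap.BilinForm ℂ L) : Prop where
  iSup_weightSpace : ⨆ χ : Dual ℂ H, weightSpace (L := L) ⊤ χ = ⊤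
  weightSpace_zero : weightSpace (L := L) (⊤ : Submodule ℂ H) 0 = H
  symm : ∀ x y, B x y = B y x
  invariant : ∀ x y z, B ⁅x, y⁆ z = B x ⁅y, z⁆
  nondegenerate : ∀ x, (∀ y, B x y = 0) → x = 0
  coroot : ∀ χ : Dual ℂ H, χ ≠ 0 → ∀ x ∈ weightSpace (L := L) ⊤ χ,
    ∀ y ∈ weightSpace (L := L) ⊤ (-χ), B x y ≠ 0 → ∃ h : H, (h : L) = ⁅x, y⁆ ∧ χ h ≠ 0

variable (H) in
/-- The nonzero functionals on `H` with a nonzero weight space. -/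
def rootSet : Set (Dual ℂ H) := {χ | χ ≠ 0 ∧ weightSpace (L := L) ⊤ χ ≠ ⊥}

namespace IsSplitReductive

variable {B : LinearMap.BilinForm ℂ L} (S : IsSplitReductive H B)
include S

theorem lie_eq_zero {x y : L} (hx : x ∈ H) (hy : y ∈ H) : ⁅x, y⁆ = 0 := by
  have : y ∈ weightSpace (L := L) (⊤ : Submodule ℂ H) 0 := by rwa [S.weightSpace_zero]
  simpa using this ⟨x, hx⟩ trivial

theorem mem_weightSpace_zero {x : L} (hx : x ∈ H) (A : Submodule ℂ H) :
    x ∈ weightSpace A 0 := by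
  intro h _
  simp [S.lie_eq_zero h.2 hx]

theorem form_eq_zero {A : Submodule ℂ H} {χ χ' : Dual ℂ H} {x y : L}
    (hx : x ∈ weightSpace A χ) (hy : y ∈ weightSpace A χ') {h : H} (hh : h ∈ A)
    (hne : χ h + χ' h ≠ 0) : B x y = 0 := by
  have h1 : B ⁅x, (h : L)⁆ y = B x ⁅(h : L), y⁆ := S.invariant _ _ _
  rw [← lie_skew, hx h hh, hy h hh] at h1
  simp only [map_neg, map_smul, LinearMap.neg_apply, LinearMap.smul_apply, smul_eq_mul] at h1
  have : (χ h + χ' h) * B x y = 0 := by linear_combination -h1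
  exact (mul_eq_zero.1 this).resolve_left hne

/-- A weight vector that is orthogonal to the opposite weight space vanishes. -/
theorem eq_zero_of_form {A : Submodule ℂ H} {χ : Dual ℂ H} {x : L} (hx : x ∈ weightSpace A χ)
    (h0 : ∀ z ∈ weightSpace (L := L) A (-χ), B x z = 0) : x = 0 := by
  refine S.nondegenerate x fun y => ?_
  have hy : y ∈ ⨆ χ : Dual ℂ H, weightSpace (L := L) ⊤ χ := by rw [S.iSup_weightSpace]; trivial
  induction hy using Submodule.iSup_induction' with
  | zero => simp
  | add y z _ _ hy hz => simp [hy, hz]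
  | mem χ' y hy =>
    by_cases h : ∃ a ∈ A, χ a + χ' a ≠ 0
    · obtain ⟨a, ha, hne⟩ := h
      exact S.form_eq_zero hx (weightSpace_top_le A χ' hy) ha hne
    · push Not at h
      refine h0 y ?_
      rw [weightSpace_congr (χ' := χ') fun a ha => by
        simpa using (eq_neg_of_add_eq_zero_right (h a ha)).symm]
      exact weightSpace_top_le A χ' hy

theorem disjoint_iSup {A : Submodule ℂ H} {χ : Dual ℂ H} {p : Dual ℂ H → Prop}
    (hp : ∀ χ', p χ' → ∃ a ∈ A, χ' a ≠ χ a) {x : L} (hx : x ∈ weightSpace A χ)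
    (hx' : x ∈ ⨆ χ', ⨆ _ : p χ', weightSpace (L := L) ⊤ χ') : x = 0 := by
  refine S.eq_zero_of_form hx fun z hz => ?_
  have hle : ⨆ χ', ⨆ _ : p χ', weightSpace (L := L) ⊤ χ' ≤ LinearMap.ker (B.flip z) := by
    refine iSup₂_le fun χ' h y hy => ?_
    obtain ⟨a, ha, hne⟩ := hp χ' h
    exact S.form_eq_zero (weightSpace_top_le A χ' hy) hz ha (by simpa [sub_eq_zero, ← sub_eq_add_neg] using hne)
  exact hle hx'

/-- Decomposition of a weight space of `A ≤ H` under `H`. -/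
theorem weightSpace_le_iSup (A : Submodule ℂ H) (χ : Dual ℂ H) :
    weightSpace (L := L) A χ ≤
      ⨆ χ', ⨆ _ : ∀ a ∈ A, χ' a = χ a, weightSpace (L := L) ⊤ χ' := by
  intro x hx
  have h1 : x ∈ (⨆ χ', ⨆ _ : ∀ a ∈ A, χ' a = χ a, weightSpace (L := L) ⊤ χ') ⊔
      ⨆ χ', ⨆ _ : ¬ ∀ a ∈ A, χ' a = χ a, weightSpace (L := L) ⊤ χ' := by
    rw [← iSup_split, S.iSup_weightSpace]
    trivial
  obtain ⟨y, hy, z, hz, rfl⟩ := Submodule.mem_sup.1 h1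
  have hy' : y ∈ weightSpace (L := L) A χ := by
    refine (iSup₂_le fun χ' h => ?_ : _ ≤ weightSpace (L := L) A χ) hy
    rw [← weightSpace_congr h]
    exact weightSpace_top_le A χ'
  have hz' : z ∈ weightSpace (L := L) A χ := by simpa using sub_mem hx hy'
  have : z = 0 := S.disjoint_iSup (fun χ' h => by push Not at h; exact h) hz' hz
  rwa [this, add_zero]

theorem mem_of_mem_iSup {χ : Dual ℂ H} {s : Set (Dual ℂ H)} {x : L} (hx0 : x ≠ 0)
    (hx : x ∈ weightSpace (L := L) ⊤ χ) (hx' : x ∈ ⨆ χ' ∈ s, weightSpace (L := L) ⊤ χ') :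
    χ ∈ s := by
  by_contra h
  refine hx0 (S.disjoint_iSup (p := (· ∈ s)) (fun χ' h' => ?_) hx hx')
  by_contra! hh
  exact h ((LinearMap.ext fun a => hh a trivial : χ' = χ) ▸ h')

theorem iSupIndep_weightSpace :
    iSupIndep fun χ : Dual ℂ H => weightSpace (L := L) (⊤ : Submodule ℂ H) χ := by
  intro χ
  rw [Submodule.disjoint_def]
  intro x hx hx'
  by_contra h0
  exact S.mem_of_mem_iSup (s := {χ' | χ' ≠ χ}) h0 hx hx' rfl

theorem finite_rootSet [FiniteDimensional ℂ L] : (rootSet (L := L) H).Finite :=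
  (WellFoundedGT.finite_ne_bot_of_iSupIndep S.iSupIndep_weightSpace).subset fun _ h => h.2

theorem neg_mem_rootSet {χ : Dual ℂ H} (h : χ ∈ rootSet (L := L) H) :
    -χ ∈ rootSet (L := L) H := by
  refine ⟨neg_ne_zero.2 h.1, fun hb => h.2 ((Submodule.eq_bot_iff _).2 fun x hx => ?_)⟩
  refine S.eq_zero_of_form hx fun z hz => ?_
  rw [hb, Submodule.mem_bot] at hz
  simp [hz]

/-- Every root vector is part of an `sl₂`-triple of weight vectors. -/
theorem exists_sl2Triple {χ : Dual ℂ H} (hχ : χ ≠ 0) {e : L} (he0 : e ≠ 0)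
    (he : e ∈ weightSpace (L := L) ⊤ χ) :
    ∃ (h : H) (f : L), f ∈ weightSpace (L := L) ⊤ (-χ) ∧ χ h = 2 ∧ IsSl2Triple (h : L) e f := by
  obtain ⟨f, hf, hB⟩ : ∃ f ∈ weightSpace (L := L) ⊤ (-χ), B e f ≠ 0 := by
    by_contra! h
    exact he0 (S.eq_zero_of_form he h)
  obtain ⟨h, hh, hne⟩ := S.coroot χ hχ e he f hf hB
  have h2 : χ ((2 / χ h) • h) = 2 := by simp [hne]
  have hf' : (2 / χ h) • f ∈ weightSpace (L := L) ⊤ (-χ) := Submodule.smul_mem _ _ hf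
  refine ⟨(2 / χ h) • h, (2 / χ h) • f, hf', h2, ⟨fun h0 => ?_, ?_, ?_, ?_⟩⟩
  · have h0' : (2 / χ h) • h = 0 := Subtype.ext h0
    simp [h0'] at h2
  · rw [lie_smul, ← hh]; rfl
  · rw [he _ trivial, h2, two_smul, two_smul]
  · rw [hf' _ trivial, LinearMap.neg_apply, h2, neg_smul, two_smul, two_smul]

variable [FiniteDimensional ℂ L]

/-- If `e` is part of an `sl₂`-triple, then `ad e` is onto a weight space as soon as no primitive
vector can have the opposite weight. -/
theorem exists_lie_eq {A : Submodule ℂ H} {h : H} (hA : h ∈ A) {e f : L}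
    (t : IsSl2Triple (h : L) e f) {ε χ : Dual ℂ H} (he : e ∈ weightSpace (L := L) A ε)
    (hχ : ∀ m : ℕ, -(χ h + 2) ≠ m) {x : L} (hx : x ∈ weightSpace (L := L) A (χ + ε)) :
    ∃ y ∈ weightSpace (L := L) A χ, ⁅e, y⁆ = x := by
  have hε : ε h = 2 := by
    have h1 := he h hA
    rw [t.lie_h_e_smul ℂ] at h1
    exact (smul_left_injective ℂ t.e_ne_zero h1).symm
  set N : Submodule ℂ L := (weightSpace (L := L) A χ).map (LieAlgebra.ad ℂ L e) with hN
  set V := weightSpace (L := L) A (χ + ε)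
  set V' := weightSpace (L := L) A (-(χ + ε))
  have hsub : N ≤ V := by
    rintro _ ⟨y, hy, rfl⟩
    have := lie_mem_weightSpace he hy
    rwa [add_comm] at this
  -- The form pairs the weight spaces of `χ + ε` and of `-(χ + ε)` perfectly.
  let p : V' →ₗ[ℂ] V →ₗ[ℂ] ℂ := B.compl₁₂ V'.subtype V.subtype
  have hp : ∀ a b, p a b = B a b := fun _ _ => rfl
  have i1 : Function.Injective p := by
    rw [injective_iff_map_eq_zero]
    intro a ha
    refine Subtype.ext (S.eq_zero_of_form a.2 fun z hz => ?_)
    rw [neg_neg] at hz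
    exact DFunLike.congr_fun ha ⟨z, hz⟩
  have i2 : Function.Injective p.flip := by
    rw [injective_iff_map_eq_zero]
    intro a ha
    refine Subtype.ext (S.eq_zero_of_form a.2 fun z hz => ?_)
    rw [S.symm]
    exact DFunLike.congr_fun ha ⟨z, hz⟩
  have pp : p.IsPerfPair := .of_injective i1 i2
  by_contra hcon
  have hxN : (⟨x, hx⟩ : V) ∉ N.comap V.subtype := by
    rintro ⟨y, hy, hyx⟩
    exact hcon ⟨y, hy, hyx⟩
  -- If `x` is not in the image, some `z` of weight `-(χ + ε)` is orthogonal to the image but not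
  -- to `x`. By invariance `e` annihilates `z`, and a nonzero such `z` has its eigenvalue for `h`
  -- in `ℕ`.
  obtain ⟨φ, hφx, hφN⟩ := Submodule.exists_le_ker_of_notMem hxN
  obtain ⟨z, rfl⟩ := pp.bijective_left.2 φ
  have hz : ⁅e, (z : L)⁆ = 0 := by
    have hez : ⁅e, (z : L)⁆ ∈ weightSpace (L := L) A (-χ) := by
      have h2 := lie_mem_weightSpace he z.2
      rwa [show ε + -(χ + ε) = -χ by abel] at h2
    refine S.eq_zero_of_form hez fun y hy => ?_
    rw [neg_neg] at hy
    rw [← lie_skew, map_neg, LinearMap.neg_apply, S.invariant, neg_eq_zero]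
    exact hφN (show (⟨⁅e, y⁆, hsub ⟨y, hy, rfl⟩⟩ : V) ∈ _ from ⟨y, hy, rfl⟩)
  have hz0 : (z : L) = 0 := eq_zero_of_lie_e t (z.2 h hA) hz fun m => by
    simpa [hε] using hχ m
  apply hφx
  rw [hp, hz0]
  simp

/-- Root spaces are one-dimensional. -/
theorem exists_smul_eq {χ : Dual ℂ H} (hχ : χ ≠ 0) {e x : L} (he0 : e ≠ 0)
    (he : e ∈ weightSpace (L := L) ⊤ χ) (hx : x ∈ weightSpace (L := L) ⊤ χ) :
    ∃ c : ℂ, x = c • e := by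
  obtain ⟨h, f, -, -, t⟩ := S.exists_sl2Triple hχ he0 he
  obtain ⟨y, hy, hyx⟩ := S.exists_lie_eq (A := ⊤) trivial t he (χ := 0)
    (fun m hm => by
      have h1 : ((m : ℂ) + 2) = 0 := by rw [← hm]; simp
      exact absurd h1 (by exact_mod_cast (by omega : m + 2 ≠ 0)))
    (x := x) (by rwa [zero_add])
  -- Thus `x = ⁅e, y⁆` with `y` of weight zero, that is `y ∈ H`.
  rw [S.weightSpace_zero] at hy
  refine ⟨-χ ⟨y, hy⟩, ?_⟩
  rw [← hyx, ← lie_skew, neg_smul, ← he ⟨y, hy⟩ trivial]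

end IsSplitReductive

end SplitReductive

/-! ### Reflections -/

section Reflection

variable {L : Type*} [LieRing L] [LieAlgebra ℂ L] {H : Submodule ℂ L}

/-- The exponential of a nilpotent inner derivation. -/
theorem exists_exp_ad {e : L} (he : IsNilpotent (LieAlgebra.ad ℂ L e)) :
    ∃ τ : L ≃ₗ⁅ℂ⁆ L,
      (∀ x, ⁅e, ⁅e, ⁅e, x⁆⁆⁆ = 0 → τ x = x + ⁅e, x⁆ + (2⁻¹ : ℂ) • ⁅e, ⁅e, x⁆⁆) ∧
      ∀ θ : L ≃ₗ⁅ℂ⁆ L, θ e = e → ∀ x, θ (τ x) = τ (θ x) := by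
  let _i : LieAlgebra ℚ L :=
    { Module.compHom L (algebraMap ℚ ℂ) with
      lie_smul := fun q x y => lie_smul (algebraMap ℚ ℂ q) x y }
  have hq : ∀ (q : ℚ) (x : L), q • x = (q : ℂ) • x := fun _ _ => rfl
  have hd : IsNilpotent (LieDerivation.ad ℂ L e).toLinearMap := by
    have : (LieDerivation.ad ℂ L e).toLinearMap = LieAlgebra.ad ℂ L e := by ext; simp
    rwa [this]
  have hD : ∀ x, (LieDerivation.ad ℂ L e).toLinearMap x = ⁅e, x⁆ := fun x => by simp
  refine ⟨LieDerivation.exp (LieDerivation.ad ℂ L e) hd, fun x hx => ?_, fun θ hθ x => ?_⟩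
  · have := IsNilpotent.exp_smul_eq_sum (M := L) (a := (LieDerivation.ad ℂ L e).toLinearMap)
      (m := x) (k := 3) (by simp [pow_succ, hx]) hd
    rw [LieDerivation.exp_map_apply]
    refine (this.trans ?_)
    simp [Finset.sum_range_succ, pow_succ, hq]
  · have hd' := hd
    obtain ⟨k, hk⟩ := hd'
    have key : ∀ x, LieDerivation.exp (LieDerivation.ad ℂ L e) hd x =
        ∑ i ∈ Finset.range k, (((i.factorial : ℚ)⁻¹ : ℚ) : ℂ) •
          ((LieDerivation.ad ℂ L e).toLinearMap ^ i) x := by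
      intro x
      rw [LieDerivation.exp_map_apply, IsNilpotent.exp_eq_sum hk, LinearMap.sum_apply]
      rfl
    have hp : ∀ i x, θ (((LieDerivation.ad ℂ L e).toLinearMap ^ i) x) =
        ((LieDerivation.ad ℂ L e).toLinearMap ^ i) (θ x) := by
      intro i
      induction i with
      | zero => intro x; simp
      | succ i ih =>
        intro x
        rw [pow_succ, Module.End.mul_apply, ih, Module.End.mul_apply, hD, hD]
        rw [LieEquiv.map_lie, hθ]
    rw [key, key, map_sum]
    exact Finset.sum_congr rfl fun i _ => by rw [map_smul, hp]

/-- The automorphism `exp(ad e) exp(- ad f) exp(ad e)` attached to an `sl₂`-triple `(h, e, f)` with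
nilpotent `ad e` and `ad f`: it acts as a reflection on the elements `x` for which
`e` and `f` have opposite weights. -/
theorem exists_reflection {h e f : L} (t : IsSl2Triple h e f)
    (he : IsNilpotent (LieAlgebra.ad ℂ L e)) (hf : IsNilpotent (LieAlgebra.ad ℂ L f)) :
    ∃ τ : L ≃ₗ⁅ℂ⁆ L,
      (∀ (x : L) (c : ℂ), ⁅x, e⁆ = c • e → ⁅x, f⁆ = -(c • f) → τ x = x - c • h) ∧
      ∀ θ : L ≃ₗ⁅ℂ⁆ L, θ e = e → θ f = f → ∀ x, θ (τ x) = τ (θ x) := by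
  have hf' : IsNilpotent (LieAlgebra.ad ℂ L (-f)) := by rw [map_neg]; exact hf.neg
  obtain ⟨τ₁, h1, h1'⟩ := exists_exp_ad he
  obtain ⟨τ₂, h2, h2'⟩ := exists_exp_ad hf'
  refine ⟨(τ₁.trans τ₂).trans τ₁, fun x c hxe hxf => ?_, fun θ hθe hθf x => ?_⟩
  · have ex : ⁅e, x⁆ = -(c • e) := by rw [← lie_skew, hxe]
    have fx : ⁅f, x⁆ = c • f := by rw [← lie_skew, hxf, neg_neg]
    have eh : ⁅e, h⁆ = -((2 : ℂ) • e) := by rw [← lie_skew, t.lie_h_e_smul ℂ]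
    have fh : ⁅f, h⁆ = (2 : ℂ) • f := by rw [← lie_skew, t.lie_lie_smul_f ℂ, neg_neg]
    have fe : ⁅f, e⁆ = -h := by rw [← lie_skew, t.lie_e_f]
    have a1 : τ₁ x = x - c • e := by
      rw [h1 x (by simp [ex])]
      simp [ex, sub_eq_add_neg]
    have a2 : τ₂ x = x - c • f := by
      rw [h2 x (by simp [fx])]
      simp [fx, sub_eq_add_neg]
    have a3 : τ₂ e = e + h - f := by
      rw [h2 e (by simp [fe, fh])]
      simp [fe, fh, sub_eq_add_neg]
    have a4 : τ₁ e = e := by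
      rw [h1 e (by simp)]
      simp
    have a5 : τ₁ h = h - (2 : ℂ) • e := by
      rw [h1 h (by simp [eh])]
      simp [eh, sub_eq_add_neg]
    change τ₁ (τ₂ (τ₁ x)) = _
    rw [a1, map_sub, map_smul, a2, a3]
    have : x - c • f - c • (e + h - f) = x - c • e - c • h := by module
    rw [this, map_sub, map_sub, map_smul, map_smul, a1, a4, a5]
    module
  · change θ (τ₁ (τ₂ (τ₁ x))) = τ₁ (τ₂ (τ₁ (θ x)))
    rw [h1' θ hθe, h2' θ (by rw [map_neg, hθf]), h1' θ hθe]

variable [FiniteDimensional ℂ L] {B : LinearMap.BilinForm ℂ L}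

theorem IsSplitReductive.isNilpotent_ad (S : IsSplitReductive H B) {h : H} {e f : L}
    (t : IsSl2Triple (h : L) e f) : IsNilpotent (LieAlgebra.ad ℂ L e) := by
  rw [Module.End.isNilpotent_iff_of_finite]
  intro x
  have hx : x ∈ ⨆ χ : Dual ℂ H, weightSpace (L := L) ⊤ χ := by rw [S.iSup_weightSpace]; trivial
  induction hx using Submodule.iSup_induction' with
  | zero => exact ⟨0, by simp⟩
  | add y z _ _ hy hz =>
    obtain ⟨k, hk⟩ := hy
    obtain ⟨l, hl⟩ := hz
    refine ⟨k + l, ?_⟩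
    rw [map_add, pow_add, Module.End.mul_apply _ _ z, hl, map_zero, add_zero, ← pow_add, add_comm,
      pow_add, Module.End.mul_apply, hk, map_zero]
  | mem χ y hy => exact exists_pow_toEnd_eq_zero t (hy h trivial)

/-- An `sl₂`-triple of weight vectors for `A ≤ H` gives an automorphism of `L` that acts on
`A` as a reflection. -/
theorem IsSplitReductive.exists_reflection (S : IsSplitReductive H B) {A : Submodule ℂ H} {h : H}
    {e f : L} (t : IsSl2Triple (h : L) e f) {ε : Dual ℂ H}
    (he : e ∈ weightSpace (L := L) A ε) (hf : f ∈ weightSpace (L := L) A (-ε)) :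
    ∃ τ : L ≃ₗ⁅ℂ⁆ L, (∀ x ∈ A, τ x = ((x - ε x • h : H) : L)) ∧
      ∀ θ : L ≃ₗ⁅ℂ⁆ L, θ e = e → θ f = f → ∀ x, θ (τ x) = τ (θ x) := by
  obtain ⟨τ, h1, h2⟩ := UnramGamma.exists_reflection t (S.isNilpotent_ad t)
    (S.isNilpotent_ad (h := -h) t.symm)
  refine ⟨τ, fun x hx => ?_, h2⟩
  rw [h1 x (ε x) (he x hx) (by rw [hf x hx, LinearMap.neg_apply, neg_smul])]
  rfl

end Reflection

/-! ### Automorphisms, and the action of a pinned automorphism on the roots -/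

section Automorphisms

variable {L : Type*} [LieRing L] [LieAlgebra ℂ L] {H : Submodule ℂ L}

/-- The restriction to `H` of an automorphism of `L` that stabilizes `H`. -/
def restrictAut (τ : L ≃ₗ⁅ℂ⁆ L) (hτ : ∀ x, τ x ∈ H ↔ x ∈ H) : H ≃ₗ[ℂ] H where
  toFun x := ⟨τ x, (hτ x).2 x.2⟩
  invFun x := ⟨τ.symm x, (hτ _).1 (by simp)⟩
  map_add' x y := Subtype.ext (map_add τ (x : L) y)
  map_smul' c x := Subtype.ext (map_smul τ c (x : L))
  left_inv x := Subtype.ext (by simp)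
  right_inv x := Subtype.ext (by simp)

@[simp]
theorem coe_restrictAut (τ : L ≃ₗ⁅ℂ⁆ L) (hτ : ∀ x, τ x ∈ H ↔ x ∈ H) (x : H) :
    (restrictAut τ hτ x : L) = τ x := rfl

/-- The action `χ ↦ χ ∘ τ` of an automorphism on functionals on `H`. -/
def pullWeight (τ : L ≃ₗ⁅ℂ⁆ L) (hτ : ∀ x, τ x ∈ H ↔ x ∈ H) : Dual ℂ H ≃ₗ[ℂ] Dual ℂ H :=
  (restrictAut τ hτ).dualMap

theorem pullWeight_apply (τ : L ≃ₗ⁅ℂ⁆ L) (hτ : ∀ x, τ x ∈ H ↔ x ∈ H) (χ : Dual ℂ H) (x : H) :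
    pullWeight τ hτ χ x = χ (restrictAut τ hτ x) := rfl

theorem map_mem_weightSpace_top (τ : L ≃ₗ⁅ℂ⁆ L) (hτ : ∀ x, τ x ∈ H ↔ x ∈ H) {χ : Dual ℂ H}
    {x : L} : τ x ∈ weightSpace (L := L) ⊤ χ ↔ x ∈ weightSpace (L := L) ⊤ (pullWeight τ hτ χ) := by
  constructor
  · intro h a _
    apply τ.injective
    have := h (restrictAut τ hτ a) trivial
    change τ ⁅(a : L), x⁆ = τ _
    rw [LieEquiv.map_lie, map_smul]
    exact this
  · intro h a _
    obtain ⟨b, rfl⟩ := (restrictAut τ hτ).surjective a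
    have := congrArg τ (h b trivial)
    rw [LieEquiv.map_lie, map_smul] at this
    exact this

theorem pullWeight_mem_rootSet (τ : L ≃ₗ⁅ℂ⁆ L) (hτ : ∀ x, τ x ∈ H ↔ x ∈ H) {χ : Dual ℂ H} :
    pullWeight τ hτ χ ∈ rootSet (L := L) H ↔ χ ∈ rootSet (L := L) H := by
  refine and_congr (by simp) (not_congr ?_)
  rw [Submodule.eq_bot_iff, Submodule.eq_bot_iff]
  constructor
  · intro h x hx
    have := h (τ.symm x) ((map_mem_weightSpace_top τ hτ).1 (by simpa using hx))
    simpa using this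
  · intro h x hx
    simpa using h _ ((map_mem_weightSpace_top τ hτ).2 hx)

theorem mem_iff_of_forall_mem [FiniteDimensional ℂ L] (τ : L ≃ₗ⁅ℂ⁆ L) (h : ∀ x ∈ H, τ x ∈ H)
    (x : L) : τ x ∈ H ↔ x ∈ H := by
  have h1 : H.map (τ.toLinearEquiv : L →ₗ[ℂ] L) = H := by
    refine Submodule.eq_of_le_of_finrank_eq ?_ ?_
    · rintro _ ⟨y, hy, rfl⟩
      exact h y hy
    · exact τ.toLinearEquiv.finrank_map_eq H
  refine ⟨fun hx => ?_, h x⟩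
  rw [← h1] at hx
  obtain ⟨y, hy, hyx⟩ := hx
  rwa [← τ.injective hyx]

/-- The elements of `H` fixed by `θ`. -/
def fixedPart (θ : L ≃ₗ⁅ℂ⁆ L) (H : Submodule ℂ L) : Submodule ℂ H where
  carrier := {x | θ x = x}
  add_mem' {x y} hx hy := by
    change θ ((x : L) + y) = x + y
    rw [map_add, hx, hy]
  zero_mem' := map_zero θ
  smul_mem' c x hx := by
    change θ (c • (x : L)) = c • (x : L)
    rw [map_smul, hx]

theorem mem_fixedPart {θ : L ≃ₗ⁅ℂ⁆ L} {x : H} : x ∈ fixedPart θ H ↔ θ x = x := Iff.rfl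

variable {θ : L ≃ₗ⁅ℂ⁆ L} {hθ : ∀ x, θ x ∈ H ↔ x ∈ H}

theorem iterate_pullWeight (j : ℕ) (χ : Dual ℂ H) (x : H) :
    ((pullWeight θ hθ)^[j] χ) x = χ ((restrictAut θ hθ)^[j] x) := by
  induction j generalizing χ with
  | zero => rfl
  | succ j ih => rw [Function.iterate_succ_apply, ih, pullWeight_apply, Function.iterate_succ_apply']

theorem coe_iterate_restrictAut (j : ℕ) (x : H) :
    ((restrictAut θ hθ)^[j] x : L) = θ^[j] x := by
  induction j with
  | zero => rfl
  | succ j ih => rw [Function.iterate_succ_apply', coe_restrictAut, ih, Function.iterate_succ_apply']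

theorem sum_iterate_mem {N : ℕ} (h2 : ∀ x, (restrictAut θ hθ)^[N] x = x) (x : H) :
    ∑ j ∈ Finset.range N, (restrictAut θ hθ)^[j] x ∈ fixedPart θ H := by
  have : restrictAut θ hθ (∑ j ∈ Finset.range N, (restrictAut θ hθ)^[j] x) =
      ∑ j ∈ Finset.range N, (restrictAut θ hθ)^[j] x := by
    rw [map_sum]
    have h3 := Finset.sum_range_succ (fun j => (restrictAut θ hθ)^[j] x) N
    rw [Finset.sum_range_succ', h2] at h3
    simpa [← Function.iterate_succ_apply'] using h3
  exact congrArg Subtype.val this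

theorem apply_of_fixed {χ : Dual ℂ H} {x : H} (hx : x ∈ fixedPart θ H) :
    pullWeight θ hθ χ x = χ x := by
  rw [pullWeight_apply]
  exact congrArg χ (Subtype.ext hx)

theorem iterate_apply_of_fixed {χ : Dual ℂ H} {x : H} (hx : x ∈ fixedPart θ H) (j : ℕ) :
    ((pullWeight θ hθ)^[j] χ) x = χ x := by
  induction j with
  | zero => rfl
  | succ j ih => rw [Function.iterate_succ_apply', apply_of_fixed hx, ih]

end Automorphisms

section Pinned

variable {L : Type*} [LieRing L] [LieAlgebra ℂ L] {H : Submodule ℂ L}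

/-- An automorphism `θ` of `L` of finite order that stabilizes `H`, a basis `Δ` of the root system,
and, for the simple roots `β`, an `sl₂`-triple `(h β, e β, f β)` of weight vectors, all permuted
by `θ`. -/
structure IsPinned (θ : L ≃ₗ⁅ℂ⁆ L) (hθ : ∀ x, θ x ∈ H ↔ x ∈ H) (Δ : Set (Dual ℂ H))
    (h : Dual ℂ H → H) (e f : Dual ℂ H → L) : Prop where
  finite_order : ∃ N : ℕ, 0 < N ∧ ∀ x, θ^[N] x = x
  indep : LinearIndepOn ℂ id Δ
  subset : Δ ⊆ rootSet (L := L) H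
  pos_or_neg : ∀ α ∈ rootSet (L := L) H, α ∈ AddSubmonoid.closure Δ ∨ -α ∈ AddSubmonoid.closure Δ
  pull_mem : ∀ β ∈ Δ, pullWeight θ hθ β ∈ Δ
  triple : ∀ β ∈ Δ, IsSl2Triple (h β : L) (e β) (f β)
  e_mem : ∀ β ∈ Δ, e β ∈ weightSpace (L := L) ⊤ β
  f_mem : ∀ β ∈ Δ, f β ∈ weightSpace (L := L) ⊤ (-β)
  map_h : ∀ β ∈ Δ, θ (h (pullWeight θ hθ β)) = h β
  map_e : ∀ β ∈ Δ, θ (e (pullWeight θ hθ β)) = e β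
  map_f : ∀ β ∈ Δ, θ (f (pullWeight θ hθ β)) = f β

namespace IsPinned

variable {θ : L ≃ₗ⁅ℂ⁆ L} {hθ : ∀ x, θ x ∈ H ↔ x ∈ H} {Δ : Set (Dual ℂ H)}
    {h : Dual ℂ H → H} {e f : Dual ℂ H → L} (Q : IsPinned θ hθ Δ h e f)
include Q

theorem root_coroot {β : Dual ℂ H} (hβ : β ∈ Δ) : β (h β) = 2 := by
  have h1 := Q.e_mem β hβ (h β) trivial
  rw [(Q.triple β hβ).lie_h_e_smul ℂ] at h1
  exact (smul_left_injective ℂ (Q.triple β hβ).e_ne_zero h1).symm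

/-- The opposite basis `-Δ`, with the triples `(-h, f, e)`. -/
theorem neg {B : LinearMap.BilinForm ℂ L} (S : IsSplitReductive H B) :
    IsPinned θ hθ (-Δ) (fun χ => -h (-χ)) (fun χ => f (-χ)) (fun χ => e (-χ)) where
  finite_order := Q.finite_order
  indep := by
    rw [← Set.image_neg_eq_neg]
    refine LinearIndepOn.id_image ?_
    have := Q.indep.map_injOn (LinearEquiv.neg ℂ (M := Dual ℂ H)).toLinearMap
      (LinearEquiv.neg ℂ (M := Dual ℂ H)).injective.injOn
    exact this
  subset β hβ := by simpa using S.neg_mem_rootSet (Q.subset hβ)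
  pos_or_neg α hα := by
    have key : ∀ γ : Dual ℂ H, γ ∈ AddSubmonoid.closure (-Δ) ↔ -γ ∈ AddSubmonoid.closure Δ := by
      intro γ
      rw [AddSubmonoid.closure_neg, AddSubmonoid.mem_neg]
    rw [key, key, neg_neg]
    exact (Q.pos_or_neg α hα).symm
  pull_mem β hβ := by simpa using Q.pull_mem _ hβ
  triple β hβ := (Q.triple _ hβ).symm
  e_mem β hβ := by simpa using Q.f_mem _ hβ
  f_mem β hβ := Q.e_mem _ hβ
  map_h β hβ := by
    have := Q.map_h _ hβ
    rw [map_neg] at this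
    simp [this]
  map_e β hβ := by simpa using Q.map_f _ hβ
  map_f β hβ := by simpa using Q.map_e _ hβ

theorem exists_eq [FiniteDimensional ℂ L] (w : Dual ℂ H → ℂ) : ∃ x : H, ∀ β ∈ Δ, β x = w β := by
  let b := Basis.extend Q.indep
  let φ : Dual ℂ (Dual ℂ H) := b.constr ℂ fun i => w i
  refine ⟨(evalEquiv ℂ H).symm φ, fun β hβ => ?_⟩
  have h1 : φ β = w β := by
    have hmem : β ∈ Q.indep.extend (Set.subset_univ _) :=
      Q.indep.subset_extend (Set.subset_univ _) hβ
    have := b.constr_basis ℂ (fun i => w i) ⟨β, hmem⟩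
    rw [Basis.extend_apply_self] at this
    exact this
  rw [← h1]
  exact Module.apply_evalEquiv_symm_apply (R := ℂ) (M := H) β φ

theorem iterate_mem (j : ℕ) {β : Dual ℂ H} (hβ : β ∈ Δ) : (pullWeight θ hθ)^[j] β ∈ Δ := by
  induction j with
  | zero => exact hβ
  | succ j ih => rw [Function.iterate_succ_apply']; exact Q.pull_mem _ ih

theorem exists_iterate_eq :
    ∃ N : ℕ, 0 < N ∧ (∀ x, θ^[N] x = x) ∧ (∀ x, (restrictAut θ hθ)^[N] x = x) ∧
      ∀ χ, (pullWeight θ hθ)^[N] χ = χ := by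
  obtain ⟨N, hN, h1⟩ := Q.finite_order
  have h2 : ∀ x, (restrictAut θ hθ)^[N] x = x := fun x =>
    Subtype.ext (by rw [coe_iterate_restrictAut, h1])
  exact ⟨N, hN, h1, h2, fun χ => LinearMap.ext fun x => by rw [iterate_pullWeight, h2]⟩

/-- Simple roots take arbitrary `θ`-invariant values on the `θ`-fixed elements of `H`. -/
theorem exists_fixed_eq [FiniteDimensional ℂ L] {w : Dual ℂ H → ℂ}
    (hw : ∀ β ∈ Δ, w (pullWeight θ hθ β) = w β) :
    ∃ x ∈ fixedPart θ H, ∀ β ∈ Δ, β x = w β := by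
  obtain ⟨N, hN, -, h2, h3⟩ := Q.exists_iterate_eq
  obtain ⟨x, hx⟩ := Q.exists_eq w
  refine ⟨(N : ℂ)⁻¹ • ∑ j ∈ Finset.range N, (restrictAut θ hθ)^[j] x,
    Submodule.smul_mem _ _ (sum_iterate_mem h2 x), fun β hβ => ?_⟩
  have hw' : ∀ j, w ((pullWeight θ hθ)^[j] β) = w β := by
    intro j
    induction j with
    | zero => rfl
    | succ j ih => rw [Function.iterate_succ_apply', hw _ (Q.iterate_mem j hβ), ih]
  rw [map_smul, map_sum]
  simp only [← iterate_pullWeight]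
  rw [Finset.sum_congr rfl fun j _ => (hx _ (Q.iterate_mem j hβ)).trans (hw' j)]
  have : (N : ℂ) ≠ 0 := by exact_mod_cast hN.ne'
  simp [this]

omit Q in
theorem exists_nat_of_mem_closure {α : Dual ℂ H} (hα : α ∈ AddSubmonoid.closure Δ) {x : H}
    (hx : ∀ β ∈ Δ, ∃ m : ℕ, β x = m) : ∃ m : ℕ, α x = m := by
  induction hα using AddSubmonoid.closure_induction with
  | mem β hβ => exact hx β hβ
  | zero => exact ⟨0, by simp⟩
  | add a b _ _ ha hb =>
    obtain ⟨m, hm⟩ := ha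
    obtain ⟨m', hm'⟩ := hb
    exact ⟨m + m', by simp [hm, hm']⟩

/-- There is a `θ`-fixed element on which all simple roots are `1`; it computes the height. -/
theorem exists_height [FiniteDimensional ℂ L] :
    ∃ ρ ∈ fixedPart θ H, (∀ β ∈ Δ, β ρ = 1) ∧
      ∀ α ∈ AddSubmonoid.closure Δ, α ≠ 0 → ∃ m : ℕ, 0 < m ∧ α ρ = m := by
  obtain ⟨ρ, hρ, h1⟩ := Q.exists_fixed_eq (w := fun _ => 1) fun _ _ => rfl
  refine ⟨ρ, hρ, h1, fun α hα => ?_⟩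
  induction hα using AddSubmonoid.closure_induction with
  | mem β hβ => exact fun _ => ⟨1, one_pos, by simp [h1 β hβ]⟩
  | zero => exact fun hh => absurd rfl hh
  | add a b _ _ ha hb =>
    intro hab
    by_cases ha0 : a = 0
    · subst ha0
      rw [zero_add] at hab ⊢
      exact hb hab
    obtain ⟨m, hm, hm'⟩ := ha ha0
    by_cases hb0 : b = 0
    · subst hb0
      exact ⟨m, hm, by simp [hm']⟩
    obtain ⟨l, hl, hl'⟩ := hb hb0
    exact ⟨m + l, by omega, by simp [hm', hl']⟩

end IsPinned

end Pinned

/-! ### The form `∑ γ(x) γ(y)` on `H` and descent of heights -/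

section RootForm

variable {L : Type*} [LieRing L] [LieAlgebra ℂ L] {H : Submodule ℂ L}

/-- The symmetric bilinear form `(x, y) ↦ ∑ γ(x) γ(y)` on `H`, with the sum over all roots. It is
invariant under all automorphisms and positive where the roots take real values. -/
noncomputable def rootForm (hfin : (rootSet (L := L) H).Finite) : LinearMap.BilinForm ℂ H :=
  ∑ γ ∈ hfin.toFinset, γ.smulRight γ

variable (hfin : (rootSet (L := L) H).Finite)

theorem rootForm_apply (x y : H) : rootForm hfin x y = ∑ γ ∈ hfin.toFinset, γ x * γ y := by
  simp [rootForm]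

theorem rootForm_comm (x y : H) : rootForm hfin x y = rootForm hfin y x := by
  simp only [rootForm_apply, mul_comm]

theorem rootForm_restrictAut (τ : L ≃ₗ⁅ℂ⁆ L) (hτ : ∀ x, τ x ∈ H ↔ x ∈ H) (x y : H) :
    rootForm hfin (restrictAut τ hτ x) (restrictAut τ hτ y) = rootForm hfin x y := by
  rw [rootForm_apply, rootForm_apply]
  refine Finset.sum_equiv (pullWeight τ hτ).toEquiv (fun γ => ?_) fun γ _ => rfl
  simp [pullWeight_mem_rootSet]

/-- The root form is positive semidefinite on elements at which the roots are real. -/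
theorem rootForm_self {x : H} (hx : ∀ γ ∈ rootSet (L := L) H, (γ x).im = 0) :
    0 ≤ (rootForm hfin x x).re ∧ (rootForm hfin x x).im = 0 ∧
      ((rootForm hfin x x).re ≤ 0 → ∀ γ ∈ rootSet (L := L) H, γ x = 0) := by
  have h1 : ∀ γ ∈ hfin.toFinset, (γ x * γ x).re = (γ x).re ^ 2 ∧ (γ x * γ x).im = 0 := by
    intro γ hγ
    have := hx γ (hfin.mem_toFinset.1 hγ)
    simp [Complex.mul_re, Complex.mul_im, this, sq]
  rw [rootForm_apply, Complex.re_sum, Complex.im_sum, Finset.sum_congr rfl fun γ hγ => (h1 γ hγ).1,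
    Finset.sum_congr rfl fun γ hγ => (h1 γ hγ).2]
  refine ⟨Finset.sum_nonneg fun γ _ => sq_nonneg _, by simp, fun h0 γ hγ => ?_⟩
  have h2 := (Finset.sum_eq_zero_iff_of_nonneg fun γ _ => sq_nonneg _).1
    (le_antisymm h0 (Finset.sum_nonneg fun γ _ => sq_nonneg (γ x).re)) γ (hfin.mem_toFinset.2 hγ)
  exact Complex.ext (pow_eq_zero_iff two_ne_zero |>.1 h2) (hx γ hγ)

variable {θ : L ≃ₗ⁅ℂ⁆ L} {hθ : ∀ x, θ x ∈ H ↔ x ∈ H}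

theorem rootForm_iterate (j : ℕ) (x y : H) :
    rootForm hfin ((restrictAut θ hθ)^[j] x) ((restrictAut θ hθ)^[j] y) = rootForm hfin x y := by
  induction j with
  | zero => rfl
  | succ j ih => rw [Function.iterate_succ_apply', Function.iterate_succ_apply',
      rootForm_restrictAut, ih]

theorem iterate_eq_of_fixed {x : H} (hx : x ∈ fixedPart θ H) (j : ℕ) :
    (restrictAut θ hθ)^[j] x = x :=
  Function.iterate_fixed (f := restrictAut θ hθ) (Subtype.ext hx) j

end RootForm

section Descent

variable {L : Type*} [LieRing L] [LieAlgebra ℂ L] [FiniteDimensional ℂ L] {H : Submodule ℂ L}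
  {B : LinearMap.BilinForm ℂ L}
  {θ : L ≃ₗ⁅ℂ⁆ L} {hθ : ∀ x, θ x ∈ H ↔ x ∈ H} {Δ : Set (Dual ℂ H)}
  {h : Dual ℂ H → H} {e f : Dual ℂ H → L}

namespace IsPinned

variable (Q : IsPinned θ hθ Δ h e f) (S : IsSplitReductive H B)
include Q S

omit S in
theorem root_coroot_int {γ β : Dual ℂ H} (hγ : γ ∈ rootSet (L := L) H) (hβ : β ∈ Δ) :
    ∃ m : ℤ, γ (h β) = m := by
  obtain ⟨x, hx, hx0⟩ := (Submodule.ne_bot_iff _).1 hγ.2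
  exact exists_int_of_sl2Triple (Q.triple β hβ) hx0 (hx _ trivial)

omit S in
theorem root_coroot_im {γ β : Dual ℂ H} (hγ : γ ∈ rootSet (L := L) H) (hβ : β ∈ Δ) :
    (γ (h β)).im = 0 := by
  obtain ⟨m, hm⟩ := Q.root_coroot_int hγ hβ
  simp [hm]

/-- Coroots are dual to roots, up to a positive multiple, with respect to the root form. -/
theorem rootForm_coroot {β : Dual ℂ H} (hβ : β ∈ Δ) :
    ∃ r : ℝ, 0 < r ∧ ∀ x, rootForm S.finite_rootSet (h β) x = r * β x := by
  obtain ⟨τ, h1, -⟩ := S.exists_reflection (A := ⊤) (Q.triple β hβ) (Q.e_mem β hβ) (Q.f_mem β hβ)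
  have hτ := mem_iff_of_forall_mem (H := H) τ fun x hx => by
    have := h1 ⟨x, hx⟩ trivial
    rw [this]
    exact Subtype.mem _
  have h2 : ∀ x, restrictAut τ hτ x = x - β x • h β := fun x => Subtype.ext (h1 x trivial)
  have h3 : restrictAut τ hτ (h β) = -h β := by
    rw [h2, Q.root_coroot hβ, two_smul]
    abel
  obtain ⟨p1, p2, p3⟩ := rootForm_self S.finite_rootSet (x := h β)
    fun γ hγ => Q.root_coroot_im hγ hβ
  refine ⟨(rootForm S.finite_rootSet (h β) (h β)).re / 2, ?_, fun x => ?_⟩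
  · by_contra hcon
    have := p3 (by linarith) β (Q.subset hβ)
    rw [Q.root_coroot hβ] at this
    exact two_ne_zero this
  · have h4 := rootForm_restrictAut S.finite_rootSet τ hτ (h β) x
    rw [h3, h2] at h4
    have h5 : (((rootForm S.finite_rootSet (h β) (h β)).re : ℝ) : ℂ) =
        rootForm S.finite_rootSet (h β) (h β) := Complex.ext rfl (by simp [p2])
    push_cast
    rw [h5]
    simp only [map_neg, map_sub, map_smul, LinearMap.neg_apply, smul_eq_mul] at h4
    linear_combination -h4 / 2

/-- A nonnegative combination `α` of simple roots is represented, with respect to the root form, by a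
nonnegative real combination of coroots. -/
theorem exists_rootForm_eq {α : Dual ℂ H} (hα : α ∈ AddSubmonoid.closure Δ) :
    ∃ y : H, (∀ x, rootForm S.finite_rootSet y x = α x) ∧
      (∀ γ ∈ rootSet (L := L) H, (γ y).im = 0) ∧
      ∀ φ : Dual ℂ H, (∀ β ∈ Δ, (φ (h β)).re ≤ 0) → (φ y).re ≤ 0 := by
  induction hα using AddSubmonoid.closure_induction with
  | mem β hβ =>
    obtain ⟨r, hr, hr'⟩ := Q.rootForm_coroot S hβ
    have hr0 : (r : ℂ) ≠ 0 := by exact_mod_cast hr.ne'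
    refine ⟨((r⁻¹ : ℝ) : ℂ) • h β, fun x => ?_, fun γ hγ => ?_, fun φ hφ => ?_⟩
    · rw [map_smul, LinearMap.smul_apply, hr', smul_eq_mul]
      push_cast
      field_simp
    · rw [map_smul, smul_eq_mul, Complex.mul_im, Q.root_coroot_im hγ hβ]
      simp
    · rw [map_smul, smul_eq_mul, Complex.mul_re, Complex.ofReal_im, zero_mul, sub_zero,
        Complex.ofReal_re]
      exact mul_nonpos_of_nonneg_of_nonpos (inv_nonneg.2 hr.le) (hφ β hβ)
  | zero => exact ⟨0, by simp, by simp, by simp⟩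
  | add a b _ _ ha hb =>
    obtain ⟨y, h1, h2, h3⟩ := ha
    obtain ⟨z, g1, g2, g3⟩ := hb
    refine ⟨y + z, fun x => by simp [h1, g1], fun γ hγ => by simp [h2 γ hγ, g2 γ hγ],
      fun φ hφ => ?_⟩
    have e1 := h3 φ hφ
    have e2 := g3 φ hφ
    simp only [map_add, Complex.add_re]
    linarith

/-- The average under `θ` of some simple coroot pairs positively with a given positive `α`: otherwise
the average `y` of the element that represents `α` satisfies `rootForm y y ≤ 0`, so that all roots
vanish at `y`, although the form pairs `y` with a `θ`-fixed element that computes heights to a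
nonzero value. -/
theorem exists_pos_average {N : ℕ} (hN : 0 < N) (h2 : ∀ x, (restrictAut θ hθ)^[N] x = x)
    {α : Dual ℂ H} (hα : α ∈ AddSubmonoid.closure Δ) (hα0 : α ≠ 0) :
    ∃ β ∈ Δ, 0 < (α (∑ j ∈ Finset.range N, (restrictAut θ hθ)^[j] (h β))).re := by
  by_contra! hcon
  obtain ⟨y, h3, h4, h5⟩ := Q.exists_rootForm_eq S hα
  obtain ⟨ρ, hρ, -, hρ2⟩ := Q.exists_height
  obtain ⟨m, hm, hm'⟩ := hρ2 α hα hα0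
  set yb := ∑ j ∈ Finset.range N, (restrictAut θ hθ)^[j] y with hyb
  have hybf : yb ∈ fixedPart θ H := sum_iterate_mem h2 y
  -- The value of the form on `yb` and a fixed vector is `N` times its value on `y`.
  have key : ∀ z ∈ fixedPart θ H, rootForm S.finite_rootSet yb z = N * α z := by
    intro z hz
    rw [hyb, map_sum, LinearMap.sum_apply]
    have : ∀ j ∈ Finset.range N, rootForm S.finite_rootSet ((restrictAut θ hθ)^[j] y) z = α z := by
      intro j _
      rw [← h3]
      conv_lhs => rw [← iterate_eq_of_fixed (hθ := hθ) hz j]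
      exact rootForm_iterate _ _ _ _
    rw [Finset.sum_congr rfl this]
    simp
  let φ : Dual ℂ H := α ∘ₗ ∑ j ∈ Finset.range N, ((restrictAut θ hθ : H →ₗ[ℂ] H) ^ j)
  have hφ : ∀ x, φ x = α (∑ j ∈ Finset.range N, (restrictAut θ hθ)^[j] x) := by
    intro x
    simp only [φ, LinearMap.comp_apply, LinearMap.sum_apply]
    congr 1
    refine Finset.sum_congr rfl fun j _ => ?_
    rw [Module.End.pow_apply]
    rfl
  have hy0 : (α yb).re ≤ 0 := by
    rw [hyb, ← hφ]
    exact h5 φ fun β hβ => by rw [hφ]; exact hcon β hβ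
  have him : ∀ γ ∈ rootSet (L := L) H, (γ yb).im = 0 := by
    intro γ hγ
    rw [hyb, map_sum, Complex.im_sum]
    refine Finset.sum_eq_zero fun j _ => ?_
    rw [← iterate_pullWeight]
    refine h4 _ ?_
    clear * - hγ
    induction j with
    | zero => exact hγ
    | succ j ih => rw [Function.iterate_succ_apply', pullWeight_mem_rootSet]; exact ih
  obtain ⟨-, -, p3⟩ := rootForm_self S.finite_rootSet him
  have hall := p3 (by
    rw [key yb hybf, ← Complex.ofReal_natCast, Complex.re_ofReal_mul]
    exact mul_nonpos_of_nonneg_of_nonpos (Nat.cast_nonneg _) hy0)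
  have h6 := key ρ hρ
  rw [rootForm_apply, Finset.sum_eq_zero fun γ hγ => by
    rw [hall γ (S.finite_rootSet.mem_toFinset.1 hγ), zero_mul], hm'] at h6
  have : (N : ℂ) * m ≠ 0 := by exact_mod_cast (Nat.mul_pos hN hm).ne'
  exact this h6.symm

omit S in
/-- The difference of two simple roots is not a root. -/
theorem lie_f_e_eq_zero {β γ : Dual ℂ H} (hβ : β ∈ Δ) (hγ : γ ∈ Δ) (hne : β ≠ γ) :
    ⁅f γ, e β⁆ = 0 := by
  classical
  by_contra h0
  have hmem : ⁅f γ, e β⁆ ∈ weightSpace (L := L) ⊤ (-γ + β) :=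
    lie_mem_weightSpace (Q.f_mem γ hγ) (Q.e_mem β hβ)
  have hroot : -γ + β ∈ rootSet (L := L) H := by
    refine ⟨fun hh => hne ?_, fun hb => h0 (by rw [hb] at hmem; simpa using hmem)⟩
    exact (neg_add_eq_zero.1 hh).symm
  have key : ∀ δ δ' : Dual ℂ H, δ ∈ Δ → δ' ∈ Δ → δ ≠ δ' → -δ + δ' ∉ AddSubmonoid.closure Δ := by
    intro δ δ' hδ hδ' hd hcl
    obtain ⟨x, hx⟩ := Q.exists_eq fun χ => if χ = δ then 1 else 0
    obtain ⟨m, hm⟩ := exists_nat_of_mem_closure hcl (x := x) fun ε hε => by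
      rw [hx ε hε]
      split_ifs
      · exact ⟨1, by simp⟩
      · exact ⟨0, by simp⟩
    rw [LinearMap.add_apply, LinearMap.neg_apply, hx δ hδ, hx δ' hδ', if_pos rfl,
      if_neg hd.symm, add_zero] at hm
    have h1 : ((m : ℤ) : ℂ) = ((-1 : ℤ) : ℂ) := by rw [Int.cast_natCast, ← hm]; simp
    have h2 : (m : ℤ) = -1 := by exact_mod_cast h1
    omega
  rcases Q.pos_or_neg _ hroot with hp | hp
  · exact key γ β hγ hβ hne.symm hp
  · rw [neg_add, neg_neg, add_comm] at hp
    exact key β γ hβ hγ hne hp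

omit S in
theorem hasPrimitiveVector {β γ : Dual ℂ H} (hβ : β ∈ Δ) (hγ : γ ∈ Δ) (hne : β ≠ γ) :
    (Q.triple γ hγ).symm.HasPrimitiveVectorWith (e β) (-β (h γ)) where
  ne_zero := (Q.triple β hβ).e_ne_zero
  lie_h := by rw [neg_lie, Q.e_mem β hβ _ trivial, neg_smul]
  lie_e := Q.lie_f_e_eq_zero hβ hγ hne

omit S in
theorem exists_nat_cartan {β γ : Dual ℂ H} (hβ : β ∈ Δ) (hγ : γ ∈ Δ) (hne : β ≠ γ) :
    ∃ m : ℕ, β (h γ) = -m := by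
  obtain ⟨m, hm⟩ := (Q.hasPrimitiveVector hβ hγ hne).exists_nat
  exact ⟨m, by rw [← hm, neg_neg]⟩

end IsPinned

end Descent

/-! ### Orbits of simple roots -/

section Orbit

variable {L : Type*} [LieRing L] [LieAlgebra ℂ L] [FiniteDimensional ℂ L] {H : Submodule ℂ L}
  {B : LinearMap.BilinForm ℂ L}
  {θ : L ≃ₗ⁅ℂ⁆ L} {hθ : ∀ x, θ x ∈ H ↔ x ∈ H} {Δ : Set (Dual ℂ H)}
  {h : Dual ℂ H → H} {e f : Dual ℂ H → L}

namespace IsPinned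

variable (Q : IsPinned θ hθ Δ h e f) (S : IsSplitReductive H B)
  {β : Dual ℂ H} (hβ : β ∈ Δ) {O : Finset (Dual ℂ H)}
  (hO : ∀ γ, γ ∈ O ↔ ∃ j, (pullWeight θ hθ)^[j] β = γ)
include Q hO

omit [FiniteDimensional ℂ L] in
theorem pull_mem_orbit {γ : Dual ℂ H} : pullWeight θ hθ γ ∈ O ↔ γ ∈ O := by
  obtain ⟨N, hN, -, -, h3⟩ := Q.exists_iterate_eq
  rw [hO, hO]
  constructor
  · rintro ⟨j, hj⟩
    refine ⟨N - 1 + j, ?_⟩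
    rw [Function.iterate_add_apply, hj, ← Function.iterate_succ_apply]
    have : (N - 1).succ = N := by omega
    rw [this, h3]
  · rintro ⟨j, rfl⟩
    exact ⟨j + 1, Function.iterate_succ_apply' _ _ _⟩

omit [FiniteDimensional ℂ L] in
theorem sum_pull {M : Type*} [AddCommMonoid M] (g : Dual ℂ H → M) :
    ∑ γ ∈ O, g (pullWeight θ hθ γ) = ∑ γ ∈ O, g γ :=
  Finset.sum_equiv (pullWeight θ hθ).toEquiv (fun _ => (Q.pull_mem_orbit hO).symm) fun _ _ => rfl

include hβ

omit [FiniteDimensional ℂ L] in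
theorem orbit_subset {γ : Dual ℂ H} (hγ : γ ∈ O) : γ ∈ Δ := by
  obtain ⟨j, rfl⟩ := (hO γ).1 hγ
  exact Q.iterate_mem j hβ

omit Q hβ [FiniteDimensional ℂ L] in
theorem orbit_apply {γ : Dual ℂ H} (hγ : γ ∈ O) {x : H} (hx : x ∈ fixedPart θ H) :
    γ x = β x := by
  obtain ⟨j, rfl⟩ := (hO γ).1 hγ
  exact iterate_apply_of_fixed hx j

omit [FiniteDimensional ℂ L] in
theorem sum_h_mem : ∑ γ ∈ O, h γ ∈ fixedPart θ H := by
  have h1 : restrictAut θ hθ (∑ γ ∈ O, h γ) = ∑ γ ∈ O, h γ := by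
    conv_lhs => rw [← Q.sum_pull hO]
    rw [map_sum]
    exact Finset.sum_congr rfl fun γ hγ => Subtype.ext (Q.map_h γ (Q.orbit_subset hβ hO hγ))
  exact congrArg Subtype.val h1

omit [FiniteDimensional ℂ L] in
theorem map_sum_e : θ (∑ γ ∈ O, e γ) = ∑ γ ∈ O, e γ := by
  conv_lhs => rw [← Q.sum_pull hO]
  rw [map_sum]
  exact Finset.sum_congr rfl fun γ hγ => Q.map_e γ (Q.orbit_subset hβ hO hγ)

omit [FiniteDimensional ℂ L] in
theorem map_sum_f : θ (∑ γ ∈ O, f γ) = ∑ γ ∈ O, f γ := by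
  conv_lhs => rw [← Q.sum_pull hO]
  rw [map_sum]
  exact Finset.sum_congr rfl fun γ hγ => Q.map_f γ (Q.orbit_subset hβ hO hγ)

include S in
/-- The form of the orbit sum of coroots with itself is a positive multiple of its value under `β`. -/
theorem orbit_sum_pos : 0 < (β (∑ γ ∈ O, h γ)).re := by
  by_contra! hcon
  set hs := ∑ γ ∈ O, h γ with hhs
  have hsf := Q.sum_h_mem hβ hO
  obtain ⟨ρ, hρ, hρ1, -⟩ := Q.exists_height
  obtain ⟨r, hr, hr'⟩ := Q.rootForm_coroot S hβ
  have hβO : β ∈ O := (hO β).2 ⟨0, rfl⟩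
  have hform : ∀ x ∈ fixedPart θ H, rootForm S.finite_rootSet hs x = O.card * (r * β x) := by
    intro x hx
    rw [hhs, map_sum, LinearMap.sum_apply, Finset.sum_congr rfl fun γ hγ => ?_,
      Finset.sum_const, nsmul_eq_mul]
    obtain ⟨j, rfl⟩ := (hO γ).1 hγ
    rw [← hr', ← rootForm_iterate (hθ := hθ) S.finite_rootSet j, iterate_eq_of_fixed hx]
    congr 2
    clear hγ
    induction j with
    | zero => rfl
    | succ j ih =>
      rw [← ih, Function.iterate_succ_apply, Function.iterate_succ_apply']
      congr 1
      exact Subtype.ext (Q.map_h _ (Q.iterate_mem j hβ))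
  have him : ∀ γ ∈ rootSet (L := L) H, (γ hs).im = 0 := by
    intro γ hγ
    rw [hhs, map_sum, Complex.im_sum]
    exact Finset.sum_eq_zero fun δ hδ => Q.root_coroot_im hγ (Q.orbit_subset hβ hO hδ)
  have hall := (rootForm_self S.finite_rootSet him).2.2 (by
    rw [hform hs hsf, ← mul_assoc, ← Complex.ofReal_natCast, ← Complex.ofReal_mul,
      Complex.re_ofReal_mul]
    exact mul_nonpos_of_nonneg_of_nonpos (mul_nonneg (Nat.cast_nonneg _) hr.le) hcon)
  have h0 := hform ρ hρ
  rw [rootForm_apply, Finset.sum_eq_zero fun γ hγ => by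
    rw [hall γ (S.finite_rootSet.mem_toFinset.1 hγ), zero_mul], hρ1 β hβ] at h0
  have hc : (O.card : ℂ) ≠ 0 := by exact_mod_cast (Finset.card_pos.2 ⟨β, hβO⟩).ne'
  have hr0 : (r : ℂ) ≠ 0 := by exact_mod_cast hr.ne'
  exact mul_ne_zero hc (mul_ne_zero hr0 one_ne_zero) h0.symm

include S in
/-- In the Dynkin diagram, the subgraph on a `θ`-orbit of simple roots is either discrete or a
disjoint union of edges: it is vertex transitive, and by positivity every vertex has degree at
most one. -/
theorem orbit_cases :
    (β (∑ γ ∈ O, h γ) = 2 ∧ ∀ γ ∈ O, ∀ γ' ∈ O, γ ≠ γ' → γ (h γ') = 0) ∨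
    (β (∑ γ ∈ O, h γ) = 1 ∧ ∀ γ ∈ O, ∃ γ' ∈ O, γ ≠ γ' ∧ γ (h γ') = -1 ∧
      ∀ γ'' ∈ O, γ ≠ γ'' → γ'' ≠ γ' → γ (h γ'') = 0) := by
  classical
  have hsf := Q.sum_h_mem hβ hO
  have hpos := Q.orbit_sum_pos S hβ hO
  set a := β (∑ γ ∈ O, h γ) with ha
  -- The row sum of the Cartan matrix of the orbit is the same for every row, and positive.
  have key : ∀ γ ∈ O, ∃ m : Dual ℂ H → ℕ, (∀ δ ∈ O, γ ≠ δ → γ (h δ) = -m δ) ∧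
      a = 2 - (∑ δ ∈ O.erase γ, m δ : ℕ) := by
    intro γ hγ
    have hγΔ := Q.orbit_subset hβ hO hγ
    have : ∀ δ, ∃ m : ℕ, δ ∈ O → γ ≠ δ → γ (h δ) = -m := by
      intro δ
      by_cases hδ : δ ∈ O ∧ γ ≠ δ
      · obtain ⟨m, hm⟩ := Q.exists_nat_cartan hγΔ (Q.orbit_subset hβ hO hδ.1) hδ.2
        exact ⟨m, fun _ _ => hm⟩
      · exact ⟨0, fun h1 h2 => absurd ⟨h1, h2⟩ hδ⟩
    choose m hm using this
    refine ⟨m, hm, ?_⟩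
    rw [ha, ← orbit_apply hO hγ hsf, map_sum, ← Finset.add_sum_erase _ _ hγ, Q.root_coroot hγΔ,
      Finset.sum_congr rfl fun δ hδ =>
        hm δ (Finset.mem_of_mem_erase hδ) (Finset.ne_of_mem_erase hδ).symm]
    simp [sub_eq_add_neg]
  have hβO : β ∈ O := (hO β).2 ⟨0, rfl⟩
  obtain ⟨m₀, -, hm₀⟩ := key β hβO
  have hle : ∑ δ ∈ O.erase β, m₀ δ < 2 := by
    rw [hm₀] at hpos
    have h2 : (0 : ℝ) < 2 - (∑ δ ∈ O.erase β, m₀ δ : ℕ) := by simpa using hpos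
    have : ((∑ δ ∈ O.erase β, m₀ δ : ℕ) : ℝ) < (2 : ℕ) := by push_cast at h2 ⊢; linarith
    exact_mod_cast this
  have hsum : ∀ γ ∈ O, ∀ m : Dual ℂ H → ℕ, a = 2 - (∑ δ ∈ O.erase γ, m δ : ℕ) →
      ∑ δ ∈ O.erase γ, m δ = ∑ δ ∈ O.erase β, m₀ δ := by
    intro γ _ m hm
    have : ((∑ δ ∈ O.erase γ, m δ : ℕ) : ℂ) = (∑ δ ∈ O.erase β, m₀ δ : ℕ) := by
      linear_combination hm - hm₀
    exact_mod_cast this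
  have hcase : ∑ δ ∈ O.erase β, m₀ δ = 0 ∨ ∑ δ ∈ O.erase β, m₀ δ = 1 := by omega
  rcases hcase with h0 | h1
  · refine Or.inl ⟨by rw [hm₀, h0]; simp, fun γ hγ γ' hγ' hne => ?_⟩
    obtain ⟨m, hm, hma⟩ := key γ hγ
    have h2 := hsum γ hγ m hma
    rw [h0, Finset.sum_eq_zero_iff] at h2
    rw [hm γ' hγ' hne, h2 γ' (Finset.mem_erase.2 ⟨hne.symm, hγ'⟩)]
    simp
  · refine Or.inr ⟨by rw [hm₀, h1]; norm_num, fun γ hγ => ?_⟩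
    obtain ⟨m, hm, hma⟩ := key γ hγ
    have h2 := hsum γ hγ m hma
    rw [h1] at h2
    obtain ⟨γ', hγ', h3'⟩ := Finset.exists_ne_zero_of_sum_ne_zero (h2 ▸ one_ne_zero)
    have h4' := Finset.add_sum_erase _ m hγ'
    have h3 : m γ' = 1 := by omega
    have h4 : ∀ δ ∈ O.erase γ, δ ≠ γ' → m δ = 0 := fun δ hδ hδ' =>
      (Finset.sum_eq_zero_iff.1 (by omega : ∑ x ∈ (O.erase γ).erase γ', m x = 0)) δ
        (Finset.mem_erase.2 ⟨hδ', hδ⟩)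
    obtain ⟨hne, hγ'O⟩ := Finset.mem_erase.1 hγ'
    refine ⟨γ', hγ'O, hne.symm, by rw [hm γ' hγ'O hne.symm, h3]; simp, fun γ'' hγ'' hn1 hn2 => ?_⟩
    rw [hm γ'' hγ'' hn1, h4 γ'' (Finset.mem_erase.2 ⟨hn1.symm, hγ''⟩) hn2]
    simp

omit hO hβ in
theorem lie_e_f_eq_zero {γ δ : Dual ℂ H} (hγ : γ ∈ Δ) (hδ : δ ∈ Δ) (hne : γ ≠ δ) :
    ⁅e γ, f δ⁆ = 0 := by
  rw [← lie_skew, Q.lie_f_e_eq_zero hγ hδ hne, neg_zero]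

/-- The sums over an orbit of simple roots form an `sl₂`-triple, up to normalization. -/
theorem orbit_triple {c : ℂ} (hc : c * β (∑ γ ∈ O, h γ) = 2) :
    IsSl2Triple ((c • ∑ γ ∈ O, h γ : H) : L) (∑ γ ∈ O, e γ) (c • ∑ γ ∈ O, f γ) := by
  classical
  have hsf := Q.sum_h_mem hβ hO
  have hval : ∀ γ ∈ O, γ (c • ∑ γ ∈ O, h γ) = 2 := fun γ hγ => by
    rw [map_smul, orbit_apply hO hγ hsf, smul_eq_mul, hc]
  refine ⟨fun h0 => ?_, ?_, ?_, ?_⟩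
  · have h1 : c • ∑ γ ∈ O, h γ = 0 := Subtype.ext h0
    have := hval β ((hO β).2 ⟨0, rfl⟩)
    rw [h1, map_zero] at this
    exact two_ne_zero this.symm
  · rw [lie_smul, _root_.sum_lie]
    simp only [_root_.lie_sum]
    rw [Submodule.coe_smul, AddSubmonoidClass.coe_finsetSum]
    congr 1
    refine Finset.sum_congr rfl fun γ hγ => ?_
    rw [Finset.sum_eq_single_of_mem γ hγ fun δ hδ hne =>
      Q.lie_e_f_eq_zero (Q.orbit_subset hβ hO hγ) (Q.orbit_subset hβ hO hδ) hne.symm]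
    exact (Q.triple γ (Q.orbit_subset hβ hO hγ)).lie_e_f
  · have h2 : 2 • ∑ γ ∈ O, e γ = ∑ γ ∈ O, 2 • e γ := Finset.smul_sum
    rw [_root_.lie_sum, h2]
    refine Finset.sum_congr rfl fun γ hγ => ?_
    rw [Q.e_mem γ (Q.orbit_subset hβ hO hγ) _ trivial, hval γ hγ, two_smul, two_smul]
  · have h2 : -(2 • c • ∑ γ ∈ O, f γ) = c • ∑ γ ∈ O, -(2 • f γ) := by
      rw [Finset.sum_neg_distrib, ← Finset.smul_sum, smul_neg, smul_comm c 2]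
    rw [lie_smul, _root_.lie_sum, h2]
    congr 1
    refine Finset.sum_congr rfl fun γ hγ => ?_
    rw [Q.f_mem γ (Q.orbit_subset hβ hO hγ) _ trivial, LinearMap.neg_apply, hval γ hγ, neg_smul,
      two_smul, two_smul]

omit [FiniteDimensional ℂ L] in
theorem sum_e_mem : ∑ γ ∈ O, e γ ∈ weightSpace (L := L) (fixedPart θ H) β := by
  refine Submodule.sum_mem _ fun γ hγ => ?_
  rw [← weightSpace_congr fun a ha => orbit_apply hO hγ ha]
  exact weightSpace_top_le _ _ (Q.e_mem γ (Q.orbit_subset hβ hO hγ))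

omit [FiniteDimensional ℂ L] in
theorem sum_f_mem : ∑ γ ∈ O, f γ ∈ weightSpace (L := L) (fixedPart θ H) (-β) := by
  refine Submodule.sum_mem _ fun γ hγ => ?_
  rw [← weightSpace_congr (χ := -γ) fun a ha => by
    rw [LinearMap.neg_apply, LinearMap.neg_apply, orbit_apply hO hγ ha]]
  exact weightSpace_top_le _ _ (Q.f_mem γ (Q.orbit_subset hβ hO hγ))

omit hO hβ [FiniteDimensional ℂ L] in
theorem root_height_ne_zero {ρ : H} (hρ : ∀ α ∈ AddSubmonoid.closure Δ, α ≠ 0 →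
    ∃ m : ℕ, 0 < m ∧ α ρ = m) {χ : Dual ℂ H} (hχ : χ ∈ rootSet (L := L) H) : χ ρ ≠ 0 := by
  rcases Q.pos_or_neg χ hχ with hp | hp
  · obtain ⟨m, hm, hm'⟩ := hρ χ hp hχ.1
    rw [hm']
    exact_mod_cast hm.ne'
  · obtain ⟨m, hm, hm'⟩ := hρ _ hp (neg_ne_zero.2 hχ.1)
    intro h0
    rw [LinearMap.neg_apply, h0, neg_zero] at hm'
    exact hm.ne (by exact_mod_cast hm')

omit hO hβ in
include S in
/-- The centralizer of the `θ`-fixed part of `H` is `H`. -/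
theorem weightSpace_fixedPart_zero : weightSpace (L := L) (fixedPart θ H) 0 = H := by
  refine le_antisymm ?_ fun x hx => S.mem_weightSpace_zero hx _
  refine (S.weightSpace_le_iSup _ _).trans (iSup₂_le fun χ hχ => ?_)
  by_cases h0 : χ = 0
  · rw [h0, S.weightSpace_zero]
  · obtain ⟨ρ, hρ, -, hρ2⟩ := Q.exists_height
    have : weightSpace (L := L) ⊤ χ = ⊥ := by
      by_contra hb
      exact Q.root_height_ne_zero hρ2 ⟨h0, hb⟩ (hχ ρ hρ)
    rw [this]
    exact bot_le

include S in
/-- The sum of the simple root vectors of the orbit maps the space of weight `n β` onto that of weight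
`(n + 1) β`. -/
theorem exists_lie_sum_e_eq (n : ℕ) {x : L}
    (hx : x ∈ weightSpace (L := L) (fixedPart θ H) ((n + 1) • β)) :
    ∃ y ∈ weightSpace (L := L) (fixedPart θ H) (n • β), ⁅∑ γ ∈ O, e γ, y⁆ = x := by
  have hpos := Q.orbit_sum_pos S hβ hO
  have h0 : β (∑ γ ∈ O, h γ) ≠ 0 := fun h0 => by simp [h0] at hpos
  have hc : (2 / β (∑ γ ∈ O, h γ)) * β (∑ γ ∈ O, h γ) = 2 := div_mul_cancel₀ _ h0
  refine S.exists_lie_eq (Submodule.smul_mem _ _ (Q.sum_h_mem hβ hO)) (Q.orbit_triple hβ hO hc)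
    (Q.sum_e_mem hβ hO) (fun m hm => ?_) (by rwa [← succ_nsmul])
  rw [LinearMap.smul_apply, map_smul, smul_eq_mul, hc] at hm
  have h1 : ((n * 2 + 2 + m : ℕ) : ℂ) = 0 := by
    push_cast
    rw [← hm, nsmul_eq_mul]
    ring
  exact absurd h1 (by exact_mod_cast (by omega : n * 2 + 2 + m ≠ 0))

include S in
/-- The space of weight `β` for the `θ`-fixed part of `H` is spanned by the root vectors of the orbit:
it is the image of the space of weight zero, which is `H`. -/
theorem exists_sum_smul_e {x : L} (hx : x ∈ weightSpace (L := L) (fixedPart θ H) β) :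
    ∃ c : Dual ℂ H → ℂ, x = ∑ γ ∈ O, c γ • e γ := by
  obtain ⟨y, hy, rfl⟩ := Q.exists_lie_sum_e_eq S hβ hO 0 (x := x) (by simpa using hx)
  rw [zero_nsmul, Q.weightSpace_fixedPart_zero S] at hy
  refine ⟨fun γ => -γ ⟨y, hy⟩, ?_⟩
  rw [_root_.sum_lie]
  refine Finset.sum_congr rfl fun γ hγ => ?_
  rw [← lie_skew, neg_smul, ← Q.e_mem γ (Q.orbit_subset hβ hO hγ) ⟨y, hy⟩ trivial]

include S in
/-- The roots with the same restriction as `β` to the `θ`-fixed part of `H` form the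
orbit of `β`. -/
theorem mem_orbit_of_restrict_eq {χ : Dual ℂ H} (hχ : χ ∈ rootSet (L := L) H)
    (h1 : ∀ a ∈ fixedPart θ H, χ a = β a) : χ ∈ O := by
  obtain ⟨x, hx, hx0⟩ := (Submodule.ne_bot_iff _).1 hχ.2
  have hx' := weightSpace_top_le (fixedPart θ H) χ hx
  rw [weightSpace_congr h1] at hx'
  obtain ⟨c, hc⟩ := Q.exists_sum_smul_e S hβ hO hx'
  refine S.mem_of_mem_iSup (s := O) hx0 hx ?_
  rw [hc]
  refine Submodule.sum_mem _ fun γ hγ => Submodule.smul_mem _ _ ?_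
  exact Submodule.mem_iSup_of_mem γ (Submodule.mem_iSup_of_mem hγ
    (Q.e_mem γ (Q.orbit_subset hβ hO hγ)))

omit hO hβ in
theorem lie_e_e_eq_zero {γ δ : Dual ℂ H} (hγ : γ ∈ Δ) (hδ : δ ∈ Δ) (h0 : γ ≠ δ → γ (h δ) = 0) :
    ⁅e δ, e γ⁆ = 0 := by
  by_cases hne : γ = δ
  · rw [hne, lie_self]
  have := (Q.hasPrimitiveVector hγ hδ hne).pow_toEnd_f_eq_zero_of_eq_nat (n := 0)
    (by simp [h0 hne])
  simpa using this

include S in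
theorem weightSpace_eq_bot_of_succ {n : ℕ}
    (hn : weightSpace (L := L) (fixedPart θ H) (n • β) = ⊥) {m : ℕ} (hm : n ≤ m) :
    weightSpace (L := L) (fixedPart θ H) (m • β) = ⊥ := by
  induction m, hm using Nat.le_induction with
  | base => exact hn
  | succ m _ ih =>
    rw [Submodule.eq_bot_iff]
    intro x hx
    obtain ⟨y, hy, rfl⟩ := Q.exists_lie_sum_e_eq S hβ hO m hx
    rw [ih, Submodule.mem_bot] at hy
    rw [hy, lie_zero]

include S in
/-- When the orbit is discrete in the Dynkin diagram, twice the restriction of `β` is not a restricted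
root, since the root vectors of the orbit commute. -/
theorem weightSpace_two_eq_bot
    (hd : ∀ γ ∈ O, ∀ γ' ∈ O, γ ≠ γ' → γ (h γ') = 0) :
    weightSpace (L := L) (fixedPart θ H) (2 • β) = ⊥ := by
  rw [Submodule.eq_bot_iff]
  intro x hx
  obtain ⟨y, hy, rfl⟩ := Q.exists_lie_sum_e_eq S hβ hO 1 hx
  rw [one_nsmul] at hy
  obtain ⟨c, rfl⟩ := Q.exists_sum_smul_e S hβ hO hy
  rw [_root_.sum_lie]
  refine Finset.sum_eq_zero fun γ hγ => ?_
  rw [_root_.lie_sum]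
  refine Finset.sum_eq_zero fun δ hδ => ?_
  rw [lie_smul, Q.lie_e_e_eq_zero (Q.orbit_subset hβ hO hδ) (Q.orbit_subset hβ hO hγ)
    (hd δ hδ γ hγ), smul_zero]

end IsPinned

end Orbit

/-! ### Restricted roots -/

section RestrictedRoots

variable {L : Type*} [LieRing L] [LieAlgebra ℂ L] {H : Submodule ℂ L}

/-- The restrictions of `α` and `χ` to the `θ`-fixed part of `H` are positive rational multiples of
each other. -/
def RestrictEquiv (θ : L ≃ₗ⁅ℂ⁆ L) (α χ : Dual ℂ H) : Prop :=
  ∃ k l : ℕ, 0 < k ∧ 0 < l ∧ ∀ x ∈ fixedPart θ H, k * α x = l * χ x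

variable {θ : L ≃ₗ⁅ℂ⁆ L} {hθ : ∀ x, θ x ∈ H ↔ x ∈ H}

theorem RestrictEquiv.symm {α χ : Dual ℂ H} (h : RestrictEquiv θ α χ) : RestrictEquiv θ χ α := by
  obtain ⟨k, l, hk, hl, h⟩ := h
  exact ⟨l, k, hl, hk, fun x hx => (h x hx).symm⟩

theorem RestrictEquiv.trans {α β χ : Dual ℂ H} (h : RestrictEquiv θ α β)
    (h' : RestrictEquiv θ β χ) : RestrictEquiv θ α χ := by
  obtain ⟨k, l, hk, hl, h⟩ := h
  obtain ⟨k', l', hk', hl', h'⟩ := h'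
  refine ⟨k * k', l * l', by positivity, by positivity, fun x hx => ?_⟩
  push_cast
  linear_combination (k' : ℂ) * h x hx + (l : ℂ) * h' x hx

variable (hθ) in
/-- The root `α` and the roots whose restriction to the fixed part of `H` is a positive multiple of
that of `α` form a single `θ`-orbit, and the first power of `θ` that fixes `α` fixes the
root space of `α` pointwise. -/
def IsTypeOneRoot (α : Dual ℂ H) : Prop :=
  (∀ χ ∈ rootSet (L := L) H, RestrictEquiv θ α χ → ∃ j, (pullWeight θ hθ)^[j] α = χ) ∧
    ∀ x ∈ weightSpace (L := L) ⊤ α, θ^[Function.minimalPeriod (pullWeight θ hθ) α] x = x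

variable (hθ) in
/-- The `θ`-orbit of `α` has `2 k` elements, `α + θᵏ α` is a root with an orbit of `k` elements,
the two orbits together are the roots whose restriction is a positive multiple of that of `α`, and
`θ²ᵏ`, respectively `θᵏ`, acts on the root space of `α`, respectively of `α + θᵏ α`, as `1`,
respectively as `-1`. -/
def IsTypeTwoRoot (α : Dual ℂ H) : Prop :=
  ∃ k, 0 < k ∧ Function.minimalPeriod (pullWeight θ hθ) α = 2 * k ∧
    Function.minimalPeriod (pullWeight θ hθ) (α + (pullWeight θ hθ)^[k] α) = k ∧
    α + (pullWeight θ hθ)^[k] α ∈ rootSet (L := L) H ∧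
    (∀ χ ∈ rootSet (L := L) H, RestrictEquiv θ α χ →
      (∃ j, (pullWeight θ hθ)^[j] α = χ) ∨
        ∃ j, (pullWeight θ hθ)^[j] (α + (pullWeight θ hθ)^[k] α) = χ) ∧
    (∀ x ∈ weightSpace (L := L) ⊤ α, θ^[2 * k] x = x) ∧
    ∀ x ∈ weightSpace (L := L) ⊤ (α + (pullWeight θ hθ)^[k] α), θ^[k] x = -x

variable {τ : L ≃ₗ⁅ℂ⁆ L} {hτ : ∀ x, τ x ∈ H ↔ x ∈ H} (hc : ∀ x, θ (τ x) = τ (θ x))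
include hc

theorem pullWeight_comm (χ : Dual ℂ H) :
    pullWeight τ hτ (pullWeight θ hθ χ) = pullWeight θ hθ (pullWeight τ hτ χ) := by
  ext x
  simp only [pullWeight_apply]
  exact congrArg χ (Subtype.ext (hc x))

theorem iterate_pullWeight_comm (j : ℕ) (χ : Dual ℂ H) :
    (pullWeight θ hθ)^[j] (pullWeight τ hτ χ) = pullWeight τ hτ ((pullWeight θ hθ)^[j] χ) := by
  induction j generalizing χ with
  | zero => rfl
  | succ j ih => rw [Function.iterate_succ_apply, ← pullWeight_comm hc, ih,
      ← Function.iterate_succ_apply (pullWeight θ hθ)]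

theorem restrictEquiv_pull {α χ : Dual ℂ H} :
    RestrictEquiv θ (pullWeight τ hτ α) (pullWeight τ hτ χ) ↔ RestrictEquiv θ α χ := by
  refine exists₂_congr fun k l => and_congr_right fun _ => and_congr_right fun _ => ?_
  constructor
  · intro hh x hx
    obtain ⟨y, rfl⟩ := (restrictAut τ hτ).surjective x
    refine hh y (τ.injective ?_)
    exact (hc y).symm.trans hx
  · intro hh x hx
    refine hh (restrictAut τ hτ x) ?_
    rw [mem_fixedPart] at hx ⊢
    rw [coe_restrictAut, hc, hx]

theorem minimalPeriod_pull (α : Dual ℂ H) :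
    Function.minimalPeriod (pullWeight θ hθ) (pullWeight τ hτ α) =
      Function.minimalPeriod (pullWeight θ hθ) α := by
  rw [Function.minimalPeriod_eq_minimalPeriod_iff]
  intro m
  rw [Function.IsPeriodicPt, Function.IsFixedPt, iterate_pullWeight_comm hc,
    (pullWeight τ hτ).injective.eq_iff]
  rfl

omit hc in
theorem iterate_comm_apply (hc : ∀ x, θ (τ x) = τ (θ x)) (j : ℕ) (x : L) :
    θ^[j] (τ x) = τ (θ^[j] x) := by
  induction j generalizing x with
  | zero => rfl
  | succ j ih => rw [Function.iterate_succ_apply, hc, ih, ← Function.iterate_succ_apply θ]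

theorem isTypeOneRoot_of_pull {α : Dual ℂ H} (h : IsTypeOneRoot hθ (pullWeight τ hτ α)) :
    IsTypeOneRoot hθ α := by
  refine ⟨fun χ hχ hα => ?_, fun x hx => ?_⟩
  · obtain ⟨j, hj⟩ := h.1 (pullWeight τ hτ χ) ((pullWeight_mem_rootSet τ hτ).2 hχ)
      ((restrictEquiv_pull hc).2 hα)
    rw [iterate_pullWeight_comm hc] at hj
    exact ⟨j, (pullWeight τ hτ).injective hj⟩
  · have := h.2 (τ.symm x) ((map_mem_weightSpace_top τ hτ).1 (by simpa using hx))
    rw [minimalPeriod_pull hc] at this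
    have h2 := congrArg τ this
    rw [← iterate_comm_apply hc] at h2
    simpa using h2

theorem isTypeTwoRoot_of_pull {α : Dual ℂ H} (h : IsTypeTwoRoot hθ (pullWeight τ hτ α)) :
    IsTypeTwoRoot hθ α := by
  obtain ⟨k, hk, h1, h2, h3, h4, h5, h6⟩ := h
  rw [iterate_pullWeight_comm hc, ← map_add] at h2 h3 h4 h6
  rw [minimalPeriod_pull hc] at h1 h2
  refine ⟨k, hk, h1, h2, (pullWeight_mem_rootSet τ hτ).1 h3, fun χ hχ hα => ?_,
    fun x hx => ?_, fun x hx => ?_⟩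
  · rcases h4 (pullWeight τ hτ χ) ((pullWeight_mem_rootSet τ hτ).2 hχ)
      ((restrictEquiv_pull hc).2 hα) with ⟨j, hj⟩ | ⟨j, hj⟩
    · rw [iterate_pullWeight_comm hc] at hj
      exact Or.inl ⟨j, (pullWeight τ hτ).injective hj⟩
    · rw [iterate_pullWeight_comm hc] at hj
      exact Or.inr ⟨j, (pullWeight τ hτ).injective hj⟩
  · have h7 := congrArg τ (h5 (τ.symm x) ((map_mem_weightSpace_top τ hτ).1 (by simpa using hx)))
    rw [← iterate_comm_apply hc] at h7
    simpa using h7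
  · have h7 := congrArg τ (h6 (τ.symm x) ((map_mem_weightSpace_top τ hτ).1 (by simpa using hx)))
    rw [← iterate_comm_apply hc] at h7
    simpa using h7

end RestrictedRoots

section SimpleClasses

variable {L : Type*} [LieRing L] [LieAlgebra ℂ L] [FiniteDimensional ℂ L] {H : Submodule ℂ L}
  {B : LinearMap.BilinForm ℂ L}
  {θ : L ≃ₗ⁅ℂ⁆ L} {hθ : ∀ x, θ x ∈ H ↔ x ∈ H} {Δ : Set (Dual ℂ H)}
  {h : Dual ℂ H → H} {e f : Dual ℂ H → L}

namespace IsPinned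

variable (Q : IsPinned θ hθ Δ h e f) (S : IsSplitReductive H B)
include Q

omit [FiniteDimensional ℂ L] in
theorem cartan_iterate {γ δ : Dual ℂ H} (hδ : δ ∈ Δ) (j : ℕ) :
    ((pullWeight θ hθ)^[j] γ) (h ((pullWeight θ hθ)^[j] δ)) = γ (h δ) := by
  induction j with
  | zero => rfl
  | succ j ih =>
    rw [← ih, Function.iterate_succ_apply', Function.iterate_succ_apply', pullWeight_apply]
    exact congrArg _ (Subtype.ext (Q.map_h _ (Q.iterate_mem j hδ)))

omit [FiniteDimensional ℂ L] in
theorem iterate_map_e {β : Dual ℂ H} (hβ : β ∈ Δ) (j : ℕ) :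
    θ^[j] (e ((pullWeight θ hθ)^[j] β)) = e β := by
  induction j with
  | zero => rfl
  | succ j ih =>
    rw [Function.iterate_succ_apply, Function.iterate_succ_apply', Q.map_e _ (Q.iterate_mem j hβ),
      ih]

omit [FiniteDimensional ℂ L] in
theorem iterate_map_h {β : Dual ℂ H} (hβ : β ∈ Δ) (j : ℕ) :
    θ^[j] (h ((pullWeight θ hθ)^[j] β)) = h β := by
  induction j with
  | zero => rfl
  | succ j ih =>
    rw [Function.iterate_succ_apply, Function.iterate_succ_apply', Q.map_h _ (Q.iterate_mem j hβ),
      ih]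

omit [FiniteDimensional ℂ L] in
theorem minimalPeriod_pos (χ : Dual ℂ H) : 0 < Function.minimalPeriod (pullWeight θ hθ) χ := by
  obtain ⟨N, hN, -, -, h3⟩ := Q.exists_iterate_eq
  exact Function.IsPeriodicPt.minimalPeriod_pos hN (h3 χ)

include S in
/-- Within an orbit of simple roots, the Cartan integers are symmetric. -/
theorem cartan_symm {β : Dual ℂ H} (hβ : β ∈ Δ) (j : ℕ) :
    ((pullWeight θ hθ)^[j] β) (h β) = β (h ((pullWeight θ hθ)^[j] β)) := by
  obtain ⟨r, hr, hr'⟩ := Q.rootForm_coroot S hβ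
  have hr0 : (r : ℂ) ≠ 0 := by exact_mod_cast hr.ne'
  apply mul_left_cancel₀ hr0
  have h1 : (restrictAut θ hθ)^[j] (h ((pullWeight θ hθ)^[j] β)) = h β :=
    Subtype.ext ((coe_iterate_restrictAut _ _).trans (Q.iterate_map_h hβ j))
  rw [← hr', iterate_pullWeight, ← hr', ← rootForm_iterate (hθ := hθ) _ j (h β) (h _), h1,
    rootForm_comm]

variable {β : Dual ℂ H} (hβ : β ∈ Δ) {O : Finset (Dual ℂ H)}
  (hO : ∀ γ, γ ∈ O ↔ ∃ j, (pullWeight θ hθ)^[j] β = γ)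
include hβ hO

include S in
/-- If the Dynkin diagram on the orbit `O` of `β` has edges, then `O` has `2 k` elements and
the neighbour of `γ ∈ O` is `θᵏ γ`. -/
theorem exists_partner (hE : ∀ γ ∈ O, ∃ γ' ∈ O, γ ≠ γ' ∧ γ (h γ') = -1 ∧
      ∀ γ'' ∈ O, γ ≠ γ'' → γ'' ≠ γ' → γ (h γ'') = 0) :
    ∃ k, 0 < k ∧ Function.minimalPeriod (pullWeight θ hθ) β = 2 * k ∧
      ∀ γ ∈ O, (pullWeight θ hθ)^[k] ((pullWeight θ hθ)^[k] γ) = γ ∧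
        (pullWeight θ hθ)^[k] γ ∈ O ∧ γ ≠ (pullWeight θ hθ)^[k] γ ∧
        γ (h ((pullWeight θ hθ)^[k] γ)) = -1 ∧
        ∀ γ'' ∈ O, γ ≠ γ'' → γ'' ≠ (pullWeight θ hθ)^[k] γ → γ (h γ'') = 0 := by
  set σ := pullWeight θ hθ with hσ
  have hmem : ∀ j, σ^[j] β ∈ O := fun j => (hO _).2 ⟨j, rfl⟩
  obtain ⟨γ', hγ', hne, hv, hz⟩ := hE β (hmem 0)
  obtain ⟨j, rfl⟩ := (hO γ').1 hγ'
  -- Both `β` and `θ²ʲ β` are neighbours of `θʲ β`.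
  have e1 : (σ^[j] β) (h (σ^[j] (σ^[j] β))) = -1 := by
    rw [Q.cartan_iterate (Q.iterate_mem j hβ), hv]
  have e2 : (σ^[j] β) (h β) = -1 := by rw [Q.cartan_symm S hβ, hv]
  have hself : ∀ i, (σ^[i] β) (h (σ^[i] β)) = 2 := fun i => Q.root_coroot (Q.iterate_mem i hβ)
  have h2ne : (2 : ℂ) ≠ -1 := by norm_num
  obtain ⟨δ, -, -, -, hδ⟩ := hE _ (hmem j)
  have f1 : σ^[j] (σ^[j] β) = δ := by
    by_contra hcon
    have := hδ _ (by rw [← Function.iterate_add_apply]; exact hmem _)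
      (fun hh => h2ne (by rw [← hself j, ← e1, ← hh])) hcon
    rw [e1] at this
    norm_num at this
  have f2 : β = δ := by
    by_contra hcon
    have := hδ β (hmem 0) (fun hh => hne hh.symm) hcon
    rw [e2] at this
    norm_num at this
  have f3 : σ^[2 * j] β = β := by rw [two_mul, Function.iterate_add_apply, f1, f2]
  -- The minimal period divides `2 j` and not `j`, hence is even, with an odd quotient.
  have d1 : Function.minimalPeriod σ β ∣ 2 * j := Function.IsPeriodicPt.minimalPeriod_dvd f3
  have d2 : ¬ Function.minimalPeriod σ β ∣ j := fun hd =>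
    hne ((Function.isPeriodicPt_iff_minimalPeriod_dvd.2 hd).symm)
  have hpos := Q.minimalPeriod_pos β
  rw [← hσ] at hpos
  obtain ⟨c, hc⟩ := d1
  obtain ⟨k, hk⟩ : ∃ k, Function.minimalPeriod σ β = 2 * k := by
    rcases Nat.even_or_odd' c with ⟨d, hd | hd⟩
    · exact absurd ⟨d, by subst hd; nlinarith⟩ d2
    · rcases Nat.even_or_odd' (Function.minimalPeriod σ β) with ⟨k, hk | hk⟩
      · exact ⟨k, hk⟩
      · exfalso
        rw [hd, hk] at hc
        have : (2 * k + 1) * (2 * d + 1) = 2 * (2 * k * d + k + d) + 1 := by ring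
        omega
  have hjk : σ^[j] β = σ^[k] β := by
    rcases Nat.even_or_odd' c with ⟨d, hd | hd⟩
    · exact absurd ⟨d, by subst hd; nlinarith⟩ d2
    · have : j = k + 2 * k * d := by
        rw [hd, hk] at hc
        nlinarith
      rw [this, Function.iterate_add_apply, ← hk, (Function.isPeriodicPt_minimalPeriod σ β).mul_const d]
  have hper : σ^[k] (σ^[k] β) = β := by
    rw [← Function.iterate_add_apply, ← two_mul, ← hk]
    exact Function.isPeriodicPt_minimalPeriod σ β
  refine ⟨k, by omega, hk, fun γ hγ => ?_⟩
  obtain ⟨i, rfl⟩ := (hO γ).1 hγ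
  have hcomm : σ^[k] (σ^[i] β) = σ^[i] (σ^[k] β) := by
    rw [← Function.iterate_add_apply, add_comm, Function.iterate_add_apply]
  have hcomm' : ∀ χ, σ^[k] (σ^[i] χ) = σ^[i] (σ^[k] χ) := fun χ => by
    rw [← Function.iterate_add_apply, add_comm, Function.iterate_add_apply]
  have hv' : (σ^[i] β) (h (σ^[k] (σ^[i] β))) = -1 := by
    rw [hcomm, Q.cartan_iterate (Q.iterate_mem k hβ), ← hjk, hv]
  have hmem' : σ^[k] (σ^[i] β) ∈ O := by rw [← Function.iterate_add_apply]; exact hmem _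
  have hne' : σ^[i] β ≠ σ^[k] (σ^[i] β) := fun hh => h2ne (by rw [← hself i, ← hv', ← hh])
  refine ⟨by rw [hcomm', hcomm', hper], hmem', hne', hv', fun γ'' hγ'' hn1 hn2 => ?_⟩
  obtain ⟨ε, -, -, -, hε⟩ := hE _ hγ
  have : σ^[k] (σ^[i] β) = ε := by
    by_contra hcon
    have := hε _ hmem' hne' hcon
    rw [hv'] at this
    norm_num at this
  exact hε γ'' hγ'' hn1 (this ▸ hn2)

end IsPinned

end SimpleClasses

/-! ### The types of simple roots, and reduction to simple roots -/

section SimpleTypes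

variable {L : Type*} [LieRing L] [LieAlgebra ℂ L] [FiniteDimensional ℂ L] {H : Submodule ℂ L}
  {B : LinearMap.BilinForm ℂ L}
  {θ : L ≃ₗ⁅ℂ⁆ L} {hθ : ∀ x, θ x ∈ H ↔ x ∈ H} {Δ : Set (Dual ℂ H)}
  {h : Dual ℂ H → H} {e f : Dual ℂ H → L}

namespace IsPinned

variable (Q : IsPinned θ hθ Δ h e f) (S : IsSplitReductive H B)
include Q

theorem lie_e_e_of_cartan {γ δ : Dual ℂ H} (hγ : γ ∈ Δ) (hδ : δ ∈ Δ) (hne : γ ≠ δ)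
    (hv : γ (h δ) = -1) : ⁅e δ, e γ⁆ ≠ 0 ∧ ⁅e δ, ⁅e δ, e γ⁆⁆ = 0 := by
  have P := Q.hasPrimitiveVector hγ hδ hne
  have h1 : -γ (h δ) = (1 : ℕ) := by rw [hv]; simp
  constructor
  · simpa using P.pow_toEnd_f_ne_zero_of_eq_nat h1 (i := 1) le_rfl
  · simpa [pow_succ] using P.pow_toEnd_f_eq_zero_of_eq_nat h1

theorem exists_smul_of_mem_weightSpace (S : IsSplitReductive H B) {β : Dual ℂ H} (hβ : β ∈ Δ)
    {x : L} (hx : x ∈ weightSpace (L := L) ⊤ β) : ∃ c : ℂ, x = c • e β :=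
  S.exists_smul_eq (Q.subset hβ).1 (Q.triple β hβ).e_ne_zero (Q.e_mem β hβ) hx

variable {β : Dual ℂ H} (hβ : β ∈ Δ)
include hβ S

/-- `θⁿ` fixes the root space of a simple root `β` pointwise when it fixes `β`. -/
theorem iterate_apply_eq {m : ℕ} (hm : (pullWeight θ hθ)^[m] β = β) {x : L}
    (hx : x ∈ weightSpace (L := L) ⊤ β) : θ^[m] x = x := by
  obtain ⟨c, rfl⟩ := Q.exists_smul_of_mem_weightSpace S hβ hx
  have h1 := Q.iterate_map_e hβ m
  rw [hm] at h1
  have h2 : ∀ (j : ℕ) (y : L), θ^[j] (c • y) = c • θ^[j] y := by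
    intro j
    induction j with
    | zero => intro y; rfl
    | succ j ih => intro y; rw [Function.iterate_succ_apply, map_smul, ih]; rfl
  rw [h2, h1]

variable {O : Finset (Dual ℂ H)} (hO : ∀ γ, γ ∈ O ↔ ∃ j, (pullWeight θ hθ)^[j] β = γ)
include hO

omit S in
/-- A root equivalent to `β` restricts to a multiple `n β`, with `n` a positive integer. -/
theorem exists_nat_restrict {χ : Dual ℂ H} (hχ : χ ∈ rootSet (L := L) H)
    (hr : RestrictEquiv θ β χ) :
    ∃ n : ℕ, 0 < n ∧ ∀ x ∈ fixedPart θ H, χ x = (n • β) x := by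
  classical
  obtain ⟨k, l, hk, hl, hkl⟩ := hr
  have hl0 : (l : ℂ) ≠ 0 := by exact_mod_cast hl.ne'
  have hk0 : (k : ℂ) ≠ 0 := by exact_mod_cast hk.ne'
  have hβO : β ∈ O := (hO β).2 ⟨0, rfl⟩
  obtain ⟨ρ, hρ, hρ1, hρ2⟩ := Q.exists_height
  have hpos : χ ∈ AddSubmonoid.closure Δ := by
    refine (Q.pos_or_neg χ hχ).resolve_right fun hn => ?_
    obtain ⟨m, hm, hm'⟩ := hρ2 _ hn (neg_ne_zero.2 hχ.1)
    have h1 := hkl ρ hρ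
    rw [hρ1 β hβ, mul_one] at h1
    rw [LinearMap.neg_apply] at hm'
    have h2 : ((k + l * m : ℕ) : ℂ) = 0 := by push_cast; rw [← hm', h1]; ring
    have h3 : k + l * m = 0 := by exact_mod_cast h2
    omega
  -- The multiple is the sum of the coefficients of `χ` at the simple roots in the orbit.
  obtain ⟨x, hx, hx1⟩ := Q.exists_fixed_eq (w := fun γ => if γ ∈ O then 1 else 0) fun γ _ => by
    simp only [Q.pull_mem_orbit hO]
  obtain ⟨n, hn⟩ := exists_nat_of_mem_closure hpos (x := x) fun γ hγ => by
    rw [hx1 γ hγ]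
    split_ifs
    · exact ⟨1, by simp⟩
    · exact ⟨0, by simp⟩
  have h1 := hkl x hx
  rw [hx1 β hβ, if_pos hβO, mul_one, hn] at h1
  refine ⟨n, Nat.pos_of_ne_zero fun h0 => hk0 (by rw [h1, h0]; simp), fun y hy => ?_⟩
  have h2 := hkl y hy
  rw [h1] at h2
  rw [LinearMap.smul_apply, nsmul_eq_mul]
  apply mul_left_cancel₀ hl0
  rw [← h2]
  ring

/-- A simple root whose orbit is discrete in the Dynkin diagram is of type one. -/
theorem isTypeOneRoot_of_mem (hd : ∀ γ ∈ O, ∀ γ' ∈ O, γ ≠ γ' → γ (h γ') = 0) :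
    IsTypeOneRoot hθ β := by
  refine ⟨fun χ hχ hr => ?_, fun x hx =>
    Q.iterate_apply_eq S hβ (Function.isPeriodicPt_minimalPeriod _ β) hx⟩
  obtain ⟨n, hn, hn'⟩ := Q.exists_nat_restrict hβ hO hχ hr
  have h2 : ∀ m, 2 ≤ m → weightSpace (L := L) (fixedPart θ H) (m • β) = ⊥ := fun m hm =>
    Q.weightSpace_eq_bot_of_succ S hβ hO (Q.weightSpace_two_eq_bot S hβ hO hd) hm
  have h1 : n = 1 := by
    by_contra hne
    refine hχ.2 (eq_bot_iff.2 ((weightSpace_top_le (fixedPart θ H) χ).trans ?_))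
    rw [weightSpace_congr hn', h2 n (by omega)]
  rw [h1, one_nsmul] at hn'
  exact (hO χ).1 (Q.mem_orbit_of_restrict_eq S hβ hO hχ hn')

variable {k : ℕ} (hk : ∀ γ ∈ O, (pullWeight θ hθ)^[k] ((pullWeight θ hθ)^[k] γ) = γ ∧
        (pullWeight θ hθ)^[k] γ ∈ O ∧ γ ≠ (pullWeight θ hθ)^[k] γ ∧
        γ (h ((pullWeight θ hθ)^[k] γ)) = -1 ∧
        ∀ γ'' ∈ O, γ ≠ γ'' → γ'' ≠ (pullWeight θ hθ)^[k] γ → γ (h γ'') = 0)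
include hk

/-- The space of weight `2 β` is spanned by the brackets of adjacent root vectors of the orbit. -/
theorem exists_sum_smul_lie {x : L} (hx : x ∈ weightSpace (L := L) (fixedPart θ H) (2 • β)) :
    ∃ c : Dual ℂ H → ℂ, x = ∑ γ ∈ O, c γ • ⁅e ((pullWeight θ hθ)^[k] γ), e γ⁆ := by
  obtain ⟨y, hy, rfl⟩ := Q.exists_lie_sum_e_eq S hβ hO 1 hx
  rw [one_nsmul] at hy
  obtain ⟨c, rfl⟩ := Q.exists_sum_smul_e S hβ hO hy
  refine ⟨c, ?_⟩
  rw [_root_.lie_sum]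
  refine Finset.sum_congr rfl fun γ hγ => ?_
  obtain ⟨-, h1, -, -, h2⟩ := hk γ hγ
  rw [lie_smul, _root_.sum_lie, Finset.sum_eq_single_of_mem _ h1 fun δ hδ hne => ?_]
  refine Q.lie_e_e_eq_zero (Q.orbit_subset hβ hO hγ) (Q.orbit_subset hβ hO hδ) fun hn => ?_
  exact h2 δ hδ hn hne

/-- When the Dynkin diagram on the orbit is a union of edges, `3 β` is not a restricted root: the
components of type `A₂` have no root of height three. -/
theorem weightSpace_three_eq_bot : weightSpace (L := L) (fixedPart θ H) (3 • β) = ⊥ := by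
  rw [Submodule.eq_bot_iff]
  intro x hx
  obtain ⟨y, hy, rfl⟩ := Q.exists_lie_sum_e_eq S hβ hO 2 hx
  obtain ⟨c, rfl⟩ := Q.exists_sum_smul_lie S hβ hO hk hy
  rw [_root_.lie_sum]
  refine Finset.sum_eq_zero fun γ hγ => ?_
  rw [lie_smul, _root_.sum_lie, Finset.sum_eq_zero, smul_zero]
  intro δ hδ
  obtain ⟨h0, h1, h2, h3, h4⟩ := hk γ hγ
  obtain ⟨g0, g1, g2, g3, g4⟩ := hk _ h1
  rw [h0] at g1 g2 g3 g4
  have hγΔ := Q.orbit_subset hβ hO hγ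
  have hδΔ := Q.orbit_subset hβ hO hδ
  have hpΔ := Q.orbit_subset hβ hO h1
  by_cases hd1 : δ = (pullWeight θ hθ)^[k] γ
  · rw [hd1]
    exact (Q.lie_e_e_of_cartan hγΔ hpΔ h2 h3).2
  by_cases hd2 : δ = γ
  · rw [hd2, ← lie_skew (e ((pullWeight θ hθ)^[k] γ)) (e γ), lie_neg, (Q.lie_e_e_of_cartan hpΔ hγΔ g2 g3).2, neg_zero]
  · rw [leibniz_lie, Q.lie_e_e_eq_zero hpΔ hδΔ fun hn => g4 δ hδ hn hd2,
      Q.lie_e_e_eq_zero hγΔ hδΔ fun hn => h4 δ hδ hn hd1, zero_lie, lie_zero, add_zero]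

omit S in
omit [FiniteDimensional ℂ L] in
theorem lie_e_mem {γ : Dual ℂ H} (hγ : γ ∈ O) :
    ⁅e ((pullWeight θ hθ)^[k] γ), e γ⁆ ∈ weightSpace (L := L) ⊤ (γ + (pullWeight θ hθ)^[k] γ) := by
  rw [add_comm]
  exact lie_mem_weightSpace (Q.e_mem _ (Q.orbit_subset hβ hO (hk γ hγ).2.1))
    (Q.e_mem _ (Q.orbit_subset hβ hO hγ))

/-- A simple root whose orbit is a union of edges of the Dynkin diagram is of type two. -/
theorem isTypeTwoRoot_of_mem (hk0 : 0 < k)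
    (hper : Function.minimalPeriod (pullWeight θ hθ) β = 2 * k) : IsTypeTwoRoot hθ β := by
  classical
  have hβO : β ∈ O := (hO β).2 ⟨0, rfl⟩
  obtain ⟨h0, h1, h2, h3, h4⟩ := hk β hβO
  have hpΔ := Q.orbit_subset hβ hO h1
  have hlie := (Q.lie_e_e_of_cartan hβ hpΔ h2 h3).1
  have hmem := Q.lie_e_mem hβ hO hk hβO
  have hroot : β + (pullWeight θ hθ)^[k] β ∈ rootSet (L := L) H := by
    refine ⟨fun hz => ?_, fun hb => hlie (by rw [hb] at hmem; simpa using hmem)⟩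
    obtain ⟨ρ, -, hρ, -⟩ := Q.exists_height
    have := DFunLike.congr_fun hz ρ
    rw [LinearMap.add_apply, hρ β hβ, hρ _ hpΔ, LinearMap.zero_apply] at this
    norm_num at this
  have hadd : ∀ (j : ℕ) (χ χ' : Dual ℂ H), (pullWeight θ hθ)^[j] (χ + χ') =
      (pullWeight θ hθ)^[j] χ + (pullWeight θ hθ)^[j] χ' := by
    intro j χ χ'
    ext x
    simp only [LinearMap.add_apply, iterate_pullWeight]
  refine ⟨k, hk0, hper, ?_, hroot, fun χ hχ hr => ?_, fun x hx => ?_, fun x hx => ?_⟩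
  · refine Nat.dvd_antisymm (Function.IsPeriodicPt.minimalPeriod_dvd ?_) ?_
    · rw [Function.IsPeriodicPt, Function.IsFixedPt, hadd, h0, add_comm]
    · -- A power of `θ` that fixes `β + θᵏ β` either fixes or exchanges the two summands.
      set m := Function.minimalPeriod (pullWeight θ hθ) (β + (pullWeight θ hθ)^[k] β)
      have hm : (pullWeight θ hθ)^[m] (β + (pullWeight θ hθ)^[k] β) =
        β + (pullWeight θ hθ)^[k] β := Function.isPeriodicPt_minimalPeriod _ _
      obtain ⟨x, hx⟩ := Q.exists_eq fun χ => if χ = β then 1 else 0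
      have hmx := DFunLike.congr_fun hm x
      rw [hadd, LinearMap.add_apply, LinearMap.add_apply, hx _ (Q.iterate_mem m hβ),
        hx _ (Q.iterate_mem m hpΔ), hx β hβ, hx _ hpΔ, if_pos rfl, if_neg h2.symm, add_zero,
        ← Function.iterate_add_apply] at hmx
      by_cases c1 : (pullWeight θ hθ)^[m] β = β
      · have := Function.IsPeriodicPt.minimalPeriod_dvd c1
        rw [hper] at this
        exact (Dvd.intro_left 2 rfl).trans this
      · rw [if_neg c1, zero_add] at hmx
        have c2 : (pullWeight θ hθ)^[m + k] β = β := by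
          by_contra hcon
          simp [hcon] at hmx
        have := Function.IsPeriodicPt.minimalPeriod_dvd c2
        rw [hper] at this
        exact (Nat.dvd_add_left (dvd_refl k)).1 ((Dvd.intro_left 2 rfl).trans this)
  · obtain ⟨n, hn, hn'⟩ := Q.exists_nat_restrict hβ hO hχ hr
    have h3b : ∀ m, 3 ≤ m → weightSpace (L := L) (fixedPart θ H) (m • β) = ⊥ := fun m hm =>
      Q.weightSpace_eq_bot_of_succ S hβ hO (Q.weightSpace_three_eq_bot S hβ hO hk) hm
    have hle : n < 3 := by
      by_contra hge
      refine hχ.2 (eq_bot_iff.2 ((weightSpace_top_le (fixedPart θ H) χ).trans ?_))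
      rw [weightSpace_congr hn', h3b n (by omega)]
    have hcase : n = 1 ∨ n = 2 := by omega
    rcases hcase with rfl | rfl
    · rw [one_nsmul] at hn'
      exact Or.inl ((hO χ).1 (Q.mem_orbit_of_restrict_eq S hβ hO hχ hn'))
    · obtain ⟨x, hx, hx0⟩ := (Submodule.ne_bot_iff _).1 hχ.2
      have hx' := weightSpace_top_le (fixedPart θ H) χ hx
      rw [weightSpace_congr hn'] at hx'
      obtain ⟨c, hc⟩ := Q.exists_sum_smul_lie S hβ hO hk hx'
      have hχ' : χ ∈ {χ | ∃ γ ∈ O, χ = γ + (pullWeight θ hθ)^[k] γ} := by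
        refine S.mem_of_mem_iSup hx0 hx ?_
        rw [hc]
        refine Submodule.sum_mem _ fun γ hγ => Submodule.smul_mem _ _ ?_
        exact Submodule.mem_iSup_of_mem (γ + (pullWeight θ hθ)^[k] γ) (Submodule.mem_iSup_of_mem
          ⟨γ, hγ, rfl⟩ (Q.lie_e_mem hβ hO hk hγ))
      obtain ⟨γ, hγ, rfl⟩ := hχ'
      obtain ⟨j, rfl⟩ := (hO γ).1 hγ
      refine Or.inr ⟨j, ?_⟩
      rw [hadd, ← Function.iterate_add_apply, ← Function.iterate_add_apply, add_comm j k]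
  · exact Q.iterate_apply_eq S hβ (hper ▸ Function.isPeriodicPt_minimalPeriod _ β) hx
  · obtain ⟨c, rfl⟩ := S.exists_smul_eq hroot.1 hlie hmem hx
    have hs : ∀ (j : ℕ) (y : L), θ^[j] (c • y) = c • θ^[j] y := by
      intro j
      induction j with
      | zero => intro y; rfl
      | succ j ih => intro y; rw [Function.iterate_succ_apply, map_smul, ih]; rfl
    have hl : ∀ (j : ℕ) (y z : L), θ^[j] ⁅y, z⁆ = ⁅θ^[j] y, θ^[j] z⁆ := by
      intro j
      induction j with
      | zero => intro y z; rfl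
      | succ j ih => intro y z; rw [Function.iterate_succ_apply, LieEquiv.map_lie, ih]; rfl
    have e1 := Q.iterate_map_e hβ k
    have e2 := Q.iterate_map_e hpΔ k
    rw [h0] at e2
    -- `θᵏ` exchanges the two factors of the bracket `⁅e (θᵏ β), e β⁆`: hence the sign.
    rw [hs, hl, e1, e2, ← smul_neg, lie_skew]

end IsPinned

end SimpleTypes

section Dichotomy

variable {L : Type*} [LieRing L] [LieAlgebra ℂ L] [FiniteDimensional ℂ L] {H : Submodule ℂ L}
  {B : LinearMap.BilinForm ℂ L}
  {θ : L ≃ₗ⁅ℂ⁆ L} {hθ : ∀ x, θ x ∈ H ↔ x ∈ H} {Δ : Set (Dual ℂ H)}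
  {h : Dual ℂ H → H} {e f : Dual ℂ H → L}

namespace IsPinned

variable (Q : IsPinned θ hθ Δ h e f) (S : IsSplitReductive H B)
include Q S

theorem exists_orbit (β : Dual ℂ H) (hβ : β ∈ Δ) :
    ∃ O : Finset (Dual ℂ H), ∀ γ, γ ∈ O ↔ ∃ j, (pullWeight θ hθ)^[j] β = γ := by
  have hfin : {γ | ∃ j, (pullWeight θ hθ)^[j] β = γ}.Finite := by
    refine S.finite_rootSet.subset ?_
    rintro _ ⟨j, rfl⟩
    exact Q.subset (Q.iterate_mem j hβ)
  exact ⟨hfin.toFinset, fun γ => by simp⟩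

theorem isTypeOneRoot_or_isTypeTwoRoot {β : Dual ℂ H} (hβ : β ∈ Δ) :
    IsTypeOneRoot hθ β ∨ IsTypeTwoRoot hθ β := by
  obtain ⟨O, hO⟩ := Q.exists_orbit S β hβ
  rcases Q.orbit_cases S hβ hO with ⟨-, hd⟩ | ⟨-, hE⟩
  · exact Or.inl (Q.isTypeOneRoot_of_mem S hβ hO hd)
  · obtain ⟨k, hk0, hper, hk⟩ := Q.exists_partner S hβ hO hE
    exact Or.inr (Q.isTypeTwoRoot_of_mem S hβ hO hk hk0 hper)

/-- The reflection attached to a `θ`-orbit of simple roots, as an automorphism of `L` that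
commutes with `θ`. -/
theorem exists_orbit_reflection {β : Dual ℂ H} (hβ : β ∈ Δ) {O : Finset (Dual ℂ H)}
    (hO : ∀ γ, γ ∈ O ↔ ∃ j, (pullWeight θ hθ)^[j] β = γ) :
    ∃ (τ : L ≃ₗ⁅ℂ⁆ L) (hτ : ∀ x, τ x ∈ H ↔ x ∈ H) (r : ℝ), 0 < r ∧ (∀ x, θ (τ x) = τ (θ x)) ∧
      ∀ χ : Dual ℂ H, ∀ x ∈ fixedPart θ H,
        pullWeight τ hτ χ x = χ x - β x * (r * χ (∑ γ ∈ O, h γ)) := by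
  have hpos := Q.orbit_sum_pos S hβ hO
  set hs := ∑ γ ∈ O, h γ with hhs
  obtain ⟨r, hr, hr2⟩ : ∃ r : ℝ, 0 < r ∧ (r : ℂ) * β hs = 2 := by
    rcases Q.orbit_cases S hβ hO with ⟨h1, -⟩ | ⟨h1, -⟩
    · exact ⟨1, one_pos, by rw [h1]; norm_num⟩
    · exact ⟨2, two_pos, by rw [h1]; norm_num⟩
  have hsf := Q.sum_h_mem hβ hO
  obtain ⟨τ, h1, h2⟩ := S.exists_reflection (Q.orbit_triple hβ hO hr2) (Q.sum_e_mem hβ hO)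
    (Submodule.smul_mem _ (r : ℂ) (Q.sum_f_mem hβ hO))
  have hc : ∀ x, θ (τ x) = τ (θ x) :=
    h2 θ (Q.map_sum_e hβ hO) (by rw [map_smul, Q.map_sum_f hβ hO])
  have hτ := mem_iff_of_forall_mem (H := H) τ fun x hx => by
    rw [← Q.weightSpace_fixedPart_zero S]
    intro a ha
    have ha' : a - β a • (r : ℂ) • hs ∈ fixedPart θ H :=
      sub_mem ha (Submodule.smul_mem _ _ (Submodule.smul_mem _ _ hsf))
    have h3 : τ ((a - β a • (r : ℂ) • hs : H) : L) = a := by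
      rw [h1 _ ha']
      congr 1
      rw [map_sub, map_smul, map_smul, smul_eq_mul, smul_eq_mul, hr2]
      module
    rw [← h3, ← LieEquiv.map_lie, S.lie_eq_zero (Subtype.mem _) hx]
    simp
  refine ⟨τ, hτ, r, hr, hc, fun χ x hx => ?_⟩
  have h4 : restrictAut τ hτ x = x - β x • (r : ℂ) • hs := Subtype.ext (h1 x hx)
  rw [pullWeight_apply, h4, map_sub, map_smul, map_smul, smul_eq_mul, smul_eq_mul]

/-- Every positive root is carried, by an automorphism that commutes with `θ`, to a root with the
same restriction as a multiple of a simple root. -/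
theorem exists_pull_restrictEquiv {m : ℕ} {α : Dual ℂ H} (hα : α ∈ AddSubmonoid.closure Δ)
    (hαr : α ∈ rootSet (L := L) H) {ρ : H} (hρ : ρ ∈ fixedPart θ H) (hρ1 : ∀ β ∈ Δ, β ρ = 1)
    (hρ2 : ∀ α ∈ AddSubmonoid.closure Δ, α ≠ 0 → ∃ m : ℕ, 0 < m ∧ α ρ = m) (hm : α ρ = m) :
    ∃ (τ : L ≃ₗ⁅ℂ⁆ L) (hτ : ∀ x, τ x ∈ H ↔ x ∈ H), (∀ x, θ (τ x) = τ (θ x)) ∧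
      ∃ β ∈ Δ, RestrictEquiv θ (pullWeight τ hτ α) β := by
  classical
  induction m using Nat.strong_induction_on generalizing α with
  | _ m ih =>
  obtain ⟨N, hN, -, h2, h3⟩ := Q.exists_iterate_eq
  obtain ⟨β, hβ, hpos⟩ := Q.exists_pos_average S hN h2 hα hαr.1
  obtain ⟨O, hO⟩ := Q.exists_orbit S β hβ
  have hsf := Q.sum_h_mem hβ hO
  have hβO : β ∈ O := (hO β).2 ⟨0, rfl⟩
  -- The sum of the coroots over the orbit is a positive multiple of their average under `θ`.
  have hpos' : 0 < (α (∑ γ ∈ O, h γ)).re := by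
    have e1 : ∀ γ ∈ O, ∑ j ∈ Finset.range N, (restrictAut θ hθ)^[j] (h γ) =
        ∑ j ∈ Finset.range N, (restrictAut θ hθ)^[j] (h β) := by
      intro γ hγ
      obtain ⟨i, rfl⟩ := (hO γ).1 hγ
      have e2 : (restrictAut θ hθ)^[i] (h ((pullWeight θ hθ)^[i] β)) = h β :=
        Subtype.ext ((coe_iterate_restrictAut _ _).trans (Q.iterate_map_h hβ i))
      have e3 := iterate_eq_of_fixed (hθ := hθ)
        (sum_iterate_mem h2 (h ((pullWeight θ hθ)^[i] β))) i
      rw [← e3, ← e2]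
      have e4 : ∀ x : H, (restrictAut θ hθ)^[i] x = ((restrictAut θ hθ : H →ₗ[ℂ] H) ^ i) x :=
        fun x => by rw [Module.End.pow_apply]; rfl
      rw [e4, map_sum]
      refine Finset.sum_congr rfl fun j _ => ?_
      rw [← e4, ← Function.iterate_add_apply, add_comm, Function.iterate_add_apply]
    have e5 : (N : ℂ) • ∑ γ ∈ O, h γ =
        (O.card : ℂ) • ∑ j ∈ Finset.range N, (restrictAut θ hθ)^[j] (h β) := by
      have e6 : ∑ j ∈ Finset.range N, (restrictAut θ hθ)^[j] (∑ γ ∈ O, h γ) =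
          (N : ℂ) • ∑ γ ∈ O, h γ := by
        rw [Finset.sum_congr rfl fun j _ => iterate_eq_of_fixed (hθ := hθ) hsf j]
        rw [Finset.sum_const, Finset.card_range, Nat.cast_smul_eq_nsmul]
      rw [← e6]
      have e7 : ∀ (j : ℕ), (restrictAut θ hθ)^[j] (∑ γ ∈ O, h γ) =
          ∑ γ ∈ O, (restrictAut θ hθ)^[j] (h γ) := by
        intro j
        have e4 : ∀ x : H, (restrictAut θ hθ)^[j] x = ((restrictAut θ hθ : H →ₗ[ℂ] H) ^ j) x :=
          fun x => by rw [Module.End.pow_apply]; rfl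
        simp only [e4, map_sum]
      rw [Finset.sum_congr rfl fun j _ => e7 j, Finset.sum_comm, Finset.sum_congr rfl e1,
        Finset.sum_const, Nat.cast_smul_eq_nsmul]
    have e8 := congrArg (fun z => (α z).re) e5
    simp only [map_smul, smul_eq_mul] at e8
    rw [← Complex.ofReal_natCast, ← Complex.ofReal_natCast, Complex.re_ofReal_mul,
      Complex.re_ofReal_mul] at e8
    have e9 : (0 : ℝ) < O.card := by exact_mod_cast Finset.card_pos.2 ⟨β, hβO⟩
    have e10 : (0 : ℝ) < N := by exact_mod_cast hN
    exact pos_of_mul_pos_right (e8 ▸ mul_pos e9 hpos) e10.le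
  -- The value `α y` is the sum of the coefficients of `α` at the simple roots outside the orbit. If
  -- it vanishes, `α` restricts to a multiple of `β`. Otherwise the reflection attached to the orbit
  -- does not change it, hence maps `α` to a positive root, whose height is smaller.
  obtain ⟨y, hy, hy1⟩ := Q.exists_fixed_eq (w := fun γ => if γ ∈ O then 0 else 1) fun γ _ => by
    simp only [Q.pull_mem_orbit hO]
  have hynat : ∀ γ ∈ Δ, ∃ m : ℕ, γ y = m := fun γ hγ => by
    rw [hy1 γ hγ]
    split_ifs
    · exact ⟨0, by simp⟩
    · exact ⟨1, by simp⟩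
  have hβy : β y = 0 := by rw [hy1 β hβ, if_pos hβO]
  by_cases h0 : α y = 0
  · have key : ∀ χ ∈ AddSubmonoid.closure Δ, χ y = 0 →
        ∃ n : ℕ, ∀ x ∈ fixedPart θ H, χ x = n * β x := by
      intro χ hχ
      induction hχ using AddSubmonoid.closure_induction with
      | mem γ hγ =>
        intro h0
        rw [hy1 γ hγ] at h0
        have : γ ∈ O := by
          by_contra hcon
          simp [hcon] at h0
        exact ⟨1, fun x hx => by rw [orbit_apply hO this hx]; simp⟩
      | zero => exact fun _ => ⟨0, fun x _ => by simp⟩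
      | add a b ha hb iha ihb =>
        intro h0
        obtain ⟨p, hp⟩ := exists_nat_of_mem_closure ha hynat
        obtain ⟨q, hq⟩ := exists_nat_of_mem_closure hb hynat
        rw [LinearMap.add_apply, hp, hq] at h0
        have h0' : p + q = 0 := by exact_mod_cast h0
        obtain ⟨n, hn⟩ := iha (by rw [hp, (by omega : p = 0)]; simp)
        obtain ⟨n', hn'⟩ := ihb (by rw [hq, (by omega : q = 0)]; simp)
        refine ⟨n + n', fun x hx => ?_⟩
        rw [LinearMap.add_apply, hn x hx, hn' x hx]
        push_cast
        ring
    obtain ⟨n, hn⟩ := key α hα h0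
    refine ⟨LieEquiv.refl, fun x => Iff.rfl, fun x => rfl, β, hβ, 1, n, one_pos, ?_, fun x hx => ?_⟩
    · refine Nat.pos_of_ne_zero fun hn0 => ?_
      have := hn ρ hρ
      rw [hn0, Nat.cast_zero, zero_mul] at this
      exact Q.root_height_ne_zero hρ2 hαr this
    · rw [← hn x hx]
      simp
      rfl
  · obtain ⟨τ, hτ, r, hr, hc, hpull⟩ := Q.exists_orbit_reflection S hβ hO
    have hαr' : pullWeight τ hτ α ∈ rootSet (L := L) H := (pullWeight_mem_rootSet τ hτ).2 hαr
    have hα' : pullWeight τ hτ α ∈ AddSubmonoid.closure Δ := by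
      refine (Q.pos_or_neg _ hαr').resolve_right fun hn => h0 ?_
      obtain ⟨p, hp⟩ := exists_nat_of_mem_closure hn hynat
      obtain ⟨q, hq⟩ := exists_nat_of_mem_closure hα hynat
      rw [LinearMap.neg_apply, hpull α y hy, hβy, zero_mul, sub_zero, hq] at hp
      have hpq : ((p + q : ℕ) : ℂ) = 0 := by push_cast; rw [← hp]; ring
      have hpq' : p + q = 0 := by exact_mod_cast hpq
      rw [hq, (by omega : q = 0)]
      simp
    obtain ⟨m', hm', hm''⟩ := hρ2 _ hα' hαr'.1
    have hlt : m' < m := by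
      have h4 := hpull α ρ hρ
      rw [hm'', hρ1 β hβ, one_mul, hm] at h4
      have h5 := congrArg Complex.re h4
      rw [Complex.sub_re, Complex.re_ofReal_mul, Complex.natCast_re, Complex.natCast_re] at h5
      have h6 : (m' : ℝ) < m := by
        rw [h5]
        linarith [mul_pos hr hpos']
      exact_mod_cast h6
    obtain ⟨τ', hτ', hc', β', hβ', hr'⟩ := ih m' hlt hα' hαr' hm''
    refine ⟨τ'.trans τ, fun x => (hτ _).trans (hτ' x), fun x => ?_, β', hβ', ?_⟩
    · change θ (τ (τ' x)) = τ (τ' (θ x))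
      rw [hc, hc']
    · exact hr'

theorem exists_isType_of_mem_closure {α : Dual ℂ H} (hα : α ∈ AddSubmonoid.closure Δ)
    (hαr : α ∈ rootSet (L := L) H) :
    ∃ α₁ ∈ rootSet (L := L) H, RestrictEquiv θ α α₁ ∧
      (IsTypeOneRoot hθ α₁ ∨ IsTypeTwoRoot hθ α₁) := by
  obtain ⟨ρ, hρ, hρ1, hρ2⟩ := Q.exists_height
  obtain ⟨m, -, hm⟩ := hρ2 α hα hαr.1
  obtain ⟨τ, hτ, hc, β, hβ, hr⟩ := Q.exists_pull_restrictEquiv S hα hαr hρ hρ1 hρ2 hm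
  obtain ⟨α₁, rfl⟩ := (pullWeight τ hτ).surjective β
  refine ⟨α₁, (pullWeight_mem_rootSet τ hτ).1 (Q.subset hβ), (restrictEquiv_pull hc).1 hr, ?_⟩
  exact (Q.isTypeOneRoot_or_isTypeTwoRoot S hβ).imp (isTypeOneRoot_of_pull hc)
    (isTypeTwoRoot_of_pull hc)

/-- Every root is equivalent to one of type one or of type two. -/
theorem exists_isType {α : Dual ℂ H} (hαr : α ∈ rootSet (L := L) H) :
    ∃ α₁ ∈ rootSet (L := L) H, RestrictEquiv θ α α₁ ∧
      (IsTypeOneRoot hθ α₁ ∨ IsTypeTwoRoot hθ α₁) := by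
  rcases Q.pos_or_neg α hαr with hp | hn
  · exact Q.exists_isType_of_mem_closure S hp hαr
  · refine (Q.neg S).exists_isType_of_mem_closure S ?_ hαr
    rw [AddSubmonoid.closure_neg, AddSubmonoid.mem_neg]
    exact hn

end IsPinned

end Dichotomy

/-! ### The γ-factor of a Weil–Deligne representation -/

namespace UnramifiedWD

variable {q : ℕ} {V : Type*} [AddCommGroup V] [Module ℂ V] (ρ : UnramifiedWD q V)

theorem N_symm (v : V) : ρ.frob.symm (ρ.N v) = (q : ℂ) • ρ.N (ρ.frob.symm v) := by
  have h := ρ.comm (ρ.frob.symm v)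
  rw [LinearEquiv.apply_symm_apply] at h
  rw [h, map_smul, LinearEquiv.symm_apply_apply]

theorem ker_le_symm (hq : q ≠ 0) :
    LinearMap.ker ρ.N ≤ (LinearMap.ker ρ.N).comap (ρ.frob.symm : V →ₗ[ℂ] V) := by
  intro v hv
  have hv' : ρ.N v = 0 := hv
  have h := ρ.N_symm v
  rw [hv', map_zero] at h
  exact (smul_eq_zero.1 h.symm).resolve_left (by exact_mod_cast hq)

/-- Precomposition with `N`, as a map from the dual of `V` to the dual of `V / V_N`. -/
noncomputable def dualToQuot : Dual ℂ V →ₗ[ℂ] Dual ℂ (V ⧸ LinearMap.ker ρ.N) where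
  toFun l := (LinearMap.ker ρ.N).liftQ (l ∘ₗ ρ.N) (by
    rw [LinearMap.ker_comp]
    exact Submodule.comap_mono bot_le)
  map_add' _ _ := by
    apply LinearMap.ext; intro v
    induction v using Submodule.Quotient.induction_on with | _ v => rfl
  map_smul' _ _ := by
    apply LinearMap.ext; intro v
    induction v using Submodule.Quotient.induction_on with | _ v => rfl

theorem dualToQuot_mk (l : Dual ℂ V) (v : V) :
    ρ.dualToQuot l (Submodule.Quotient.mk v) = l (ρ.N v) := rfl

theorem ker_dualToQuot : LinearMap.ker ρ.dualToQuot = LinearMap.ker ρ.dual.N := by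
  ext l
  rw [LinearMap.mem_ker, LinearMap.mem_ker]
  change _ ↔ -(ρ.N.dualMap l) = 0
  rw [neg_eq_zero]
  constructor
  · intro h
    apply LinearMap.ext; intro v
    exact DFunLike.congr_fun h (Submodule.Quotient.mk v)
  · intro h
    apply LinearMap.ext; intro v
    induction v using Submodule.Quotient.induction_on with | _ v => ?_
    exact DFunLike.congr_fun h v

theorem dualToQuot_surjective : Function.Surjective ρ.dualToQuot := by
  intro η
  obtain ⟨g, hg⟩ := LinearMap.exists_leftInverse_of_injective
    ((LinearMap.ker ρ.N).liftQ ρ.N le_rfl) (by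
      rw [Submodule.ker_liftQ, Submodule.mkQ_map_self])
  refine ⟨η ∘ₗ g, ?_⟩
  apply LinearMap.ext; intro v
  induction v using Submodule.Quotient.induction_on with | _ v => ?_
  rw [dualToQuot_mk]
  exact congrArg η (DFunLike.congr_fun hg (Submodule.Quotient.mk v))

variable [FiniteDimensional ℂ V]

/-- The determinants of the contragredient representation, in terms of `V`: the quotient of `V^∨`
by the kernel of `N^∨` is dual to `V / V_N`, twisted by `q`. -/
theorem det_one_sub_symm (hq : q ≠ 0) (y : ℂ) :
    LinearMap.det (1 - y • (ρ.frob.symm : V →ₗ[ℂ] V)) =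
      LinearMap.det (1 - y • ρ.dual.frobKer) * LinearMap.det (1 - (y * q) •
        (LinearMap.ker ρ.N).mapQ (LinearMap.ker ρ.N) (ρ.frob.symm : V →ₗ[ℂ] V)
          (ρ.ker_le_symm hq)) := by
  set Fd : Dual ℂ V →ₗ[ℂ] Dual ℂ V := (ρ.dual.frob : Dual ℂ V →ₗ[ℂ] Dual ℂ V)
  have h1 : (1 - y • (ρ.frob.symm : V →ₗ[ℂ] V)).dualMap = 1 - y • Fd := by
    apply LinearMap.ext; intro l
    apply LinearMap.ext; intro v
    simp [Fd, dual]
  have hinv : LinearMap.ker ρ.dual.N ≤ (LinearMap.ker ρ.dual.N).comap (1 - y • Fd) := by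
    intro l hl
    have := ρ.dual.ker_le hl
    exact sub_mem hl (Submodule.smul_mem _ _ this)
  rw [← LinearMap.det_dualMap, h1, LinearMap.det_eq_det_mul_det _ _ hinv]
  congr 1
  · refine Eq.trans ?_ (LinearMap.det_dualMap _)
    rw [← LinearMap.det_conj _ ((Submodule.quotEquivOfEq _ _ ρ.ker_dualToQuot.symm).trans
      (ρ.dualToQuot.quotKerEquivOfSurjective ρ.dualToQuot_surjective))]
    congr 1
    apply LinearMap.ext; intro η
    obtain ⟨l, rfl⟩ := ρ.dualToQuot_surjective η
    have h2 : ((Submodule.quotEquivOfEq _ _ ρ.ker_dualToQuot.symm).trans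
      (ρ.dualToQuot.quotKerEquivOfSurjective ρ.dualToQuot_surjective)).symm (ρ.dualToQuot l) =
        Submodule.Quotient.mk l := by
      rw [LinearEquiv.symm_apply_eq]
      rfl
    rw [LinearMap.comp_apply, LinearMap.comp_apply, LinearEquiv.coe_coe, LinearEquiv.coe_coe, h2]
    apply LinearMap.ext; intro v
    induction v using Submodule.Quotient.induction_on with | _ v => ?_
    change (l - y • Fd l) (ρ.N v) = ρ.dualToQuot l (Submodule.Quotient.mk v - (y * q) •
      Submodule.Quotient.mk (ρ.frob.symm v))
    rw [map_sub, map_smul, dualToQuot_mk, dualToQuot_mk]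
    have h3 : Fd l (ρ.N v) = l (ρ.frob.symm (ρ.N v)) := rfl
    rw [LinearMap.sub_apply, LinearMap.smul_apply, h3, N_symm, map_smul, smul_smul]

theorem det_one_sub_frob (c : ℂ) :
    LinearMap.det (1 - c • (ρ.frob : V →ₗ[ℂ] V)) =
      LinearMap.det (1 - c • ρ.frobKer) * LinearMap.det (1 - c • ρ.frobQuot) := by
  have hinv : LinearMap.ker ρ.N ≤ (LinearMap.ker ρ.N).comap (1 - c • (ρ.frob : V →ₗ[ℂ] V)) :=
    fun l hl => sub_mem hl (Submodule.smul_mem _ _ (ρ.ker_le hl))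
  rw [LinearMap.det_eq_det_mul_det _ _ hinv]
  congr 2
  apply LinearMap.ext; intro v
  induction v using Submodule.Quotient.induction_on with | _ v => rfl

omit [FiniteDimensional ℂ V] in
/-- `-c F (1 - c⁻¹ F⁻¹) = 1 - c F` on `V / V_N`. -/
theorem det_neg_frobQuot_mul (hq : q ≠ 0) {c d : ℂ} (hcd : c * d = 1) :
    LinearMap.det (-c • ρ.frobQuot) * LinearMap.det (1 - d •
        (LinearMap.ker ρ.N).mapQ (LinearMap.ker ρ.N) (ρ.frob.symm : V →ₗ[ℂ] V)
          (ρ.ker_le_symm hq)) = LinearMap.det (1 - c • ρ.frobQuot) := by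
  rw [← LinearMap.det_comp]
  congr 1
  apply LinearMap.ext; intro v
  induction v using Submodule.Quotient.induction_on with | _ v => ?_
  change (Submodule.Quotient.mk ((-c) • ρ.frob (v - d • ρ.frob.symm v)) : V ⧸ LinearMap.ker ρ.N) =
    Submodule.Quotient.mk (v - c • ρ.frob v)
  congr 1
  rw [map_sub, map_smul, LinearEquiv.apply_symm_apply, smul_sub, smul_smul]
  have : -c * d = -1 := by rw [← hcd]; ring
  rw [this]
  module

variable {K : Type*} [Field K] [ValuativeRel K] [MeasurableSpace K]

/-- The `γ`-factor does not depend on the monodromy operator `N`. -/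
theorem gammaFactor_eq (hq : q ≠ 0) (ψ : AddChar K ℂ) (μ : MeasureTheory.Measure K) {s : ℂ}
    (hs : LinearMap.det (1 - (q : ℂ) ^ (s - 1) • (ρ.frob.symm : V →ₗ[ℂ] V)) ≠ 0) :
    ρ.gammaFactor ψ μ s = ρ.epsilonZero ψ μ s *
      LinearMap.det (1 - (q : ℂ) ^ (-s) • (ρ.frob : V →ₗ[ℂ] V)) /
        LinearMap.det (1 - (q : ℂ) ^ (s - 1) • (ρ.frob.symm : V →ₗ[ℂ] V)) := by
  have hq' : (q : ℂ) ≠ 0 := by exact_mod_cast hq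
  have hcd : (q : ℂ) ^ (-s) * ((q : ℂ) ^ (s - 1) * q) = 1 := by
    nth_rewrite 3 [← Complex.cpow_one (q : ℂ)]
    rw [← Complex.cpow_add _ _ hq', ← Complex.cpow_add _ _ hq']
    simp
  have h1 := ρ.det_one_sub_symm hq ((q : ℂ) ^ (s - 1))
  have h2 := ρ.det_neg_frobQuot_mul hq hcd
  have h3 := ρ.det_one_sub_frob ((q : ℂ) ^ (-s))
  rw [h1] at hs
  rw [h1, h3, ← h2, gammaFactor, epsilonFactor, LFactor, LFactor, inv_inv, neg_sub]
  have h4 := left_ne_zero_of_mul hs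
  have h5 := right_ne_zero_of_mul hs
  field_simp

/-- The value at `s = 0` of the `γ`-factor, for a character of order `-1`. -/
theorem tendsto_gammaFactor (hq : q ≠ 0) {ψ : AddChar K ℂ} (hψ : charOrder ψ = -1)
    {μ : MeasureTheory.Measure K} (hμ : μ.real (𝒪[K] : Set K) ^ 2 = q)
    (hs : LinearMap.det (1 - (q : ℂ)⁻¹ • (ρ.frob.symm : V →ₗ[ℂ] V)) ≠ 0) :
    Filter.Tendsto (fun s : ℂ => ρ.gammaFactor ψ μ s) (𝓝[≠] 0)
      (𝓝 ((-1) ^ finrank ℂ V * ((((q : ℝ) ^ (-(finrank ℂ V : ℝ) / 2) : ℝ) : ℂ) *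
        (LinearMap.det (1 - (ρ.frob.symm : V →ₗ[ℂ] V)) /
          LinearMap.det (1 - (q : ℂ)⁻¹ • (ρ.frob.symm : V →ₗ[ℂ] V)))))) := by
  have hq' : (q : ℂ) ≠ 0 := by exact_mod_cast hq
  have hdet : ∀ (A : V →ₗ[ℂ] V) {g : ℂ → ℂ}, Continuous g →
      Continuous fun s => LinearMap.det (1 - g s • A) := by
    intro A g hg
    have b := Module.finBasis ℂ V
    simp only [← LinearMap.det_toMatrix b, map_sub, map_smul]
    fun_prop
  have hc1 : Continuous fun s : ℂ => (q : ℂ) ^ (s - 1) := by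
    apply Continuous.const_cpow (by fun_prop) (Or.inl hq')
  have hc2 : Continuous fun s : ℂ => (q : ℂ) ^ (-s) := by
    apply Continuous.const_cpow (by fun_prop) (Or.inl hq')
  have hc3 : Continuous fun s : ℂ => (q : ℂ) ^ ((charOrder ψ : ℂ) * (1 - s)) := by
    apply Continuous.const_cpow (by fun_prop) (Or.inl hq')
  have hd := hdet (ρ.frob.symm : V →ₗ[ℂ] V) hc1
  have hn := hdet (ρ.frob : V →ₗ[ℂ] V) hc2
  have he1 : (q : ℂ) ^ ((0 : ℂ) - 1) = (q : ℂ)⁻¹ := by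
    rw [zero_sub, Complex.cpow_neg_one]
  have hne : ∀ᶠ s in 𝓝 (0 : ℂ),
      LinearMap.det (1 - (q : ℂ) ^ (s - 1) • (ρ.frob.symm : V →ₗ[ℂ] V)) ≠ 0 :=
    hd.continuousAt.eventually_ne (by rw [he1]; exact hs)
  have hev : ∀ᶠ s in 𝓝[≠] (0 : ℂ), ρ.epsilonZero ψ μ s *
      LinearMap.det (1 - (q : ℂ) ^ (-s) • (ρ.frob : V →ₗ[ℂ] V)) /
        LinearMap.det (1 - (q : ℂ) ^ (s - 1) • (ρ.frob.symm : V →ₗ[ℂ] V)) =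
      ρ.gammaFactor ψ μ s :=
    (hne.filter_mono nhdsWithin_le_nhds).mono fun s h => (ρ.gammaFactor_eq hq ψ μ h).symm
  refine Filter.Tendsto.congr' hev (Filter.Tendsto.mono_left ?_ nhdsWithin_le_nhds)
  have hc4 : Continuous fun s : ℂ => ρ.epsilonZero ψ μ s := by
    unfold epsilonZero
    fun_prop
  have hlim := ((hc4.mul hn).continuousAt (x := (0 : ℂ))).div hd.continuousAt
    (by rw [he1]; exact hs)
  -- At `s = 0` the constant is `q⁻¹ μ(𝒪) = q ^ (-1/2)`.
  have hmu : (q : ℂ) ^ ((charOrder ψ : ℂ) * (1 - 0)) * (μ.real (𝒪[K] : Set K) : ℂ) =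
      (((q : ℝ) ^ (-1 / 2 : ℝ) : ℝ) : ℂ) := by
    have hq0 : (0 : ℝ) < q := by exact_mod_cast Nat.pos_of_ne_zero hq
    have h1 : μ.real (𝒪[K] : Set K) = (q : ℝ) ^ (1 / 2 : ℝ) := by
      rw [← hμ, ← Real.sqrt_eq_rpow, Real.sqrt_sq MeasureTheory.measureReal_nonneg]
    have h2 : (q : ℂ) ^ ((charOrder ψ : ℂ) * (1 - 0)) = (((q : ℝ) ^ (-1 : ℝ) : ℝ) : ℂ) := by
      rw [hψ, Complex.ofReal_cpow hq0.le]
      simp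
    rw [h1, h2, ← Complex.ofReal_mul, ← Real.rpow_add hq0]
    norm_num
  have hdim : ((((q : ℝ) ^ (-1 / 2 : ℝ) : ℝ) : ℂ)) ^ finrank ℂ V =
      (((q : ℝ) ^ (-(finrank ℂ V : ℝ) / 2) : ℝ) : ℂ) := by
    rw [← Complex.ofReal_pow, ← Real.rpow_natCast, ← Real.rpow_mul (Nat.cast_nonneg q)]
    congr 2
    ring
  -- `F⁻¹ (1 - F) = -(1 - F⁻¹)`.
  have hsign : LinearMap.det (ρ.frob.symm : V →ₗ[ℂ] V) *
      LinearMap.det (1 - (ρ.frob : V →ₗ[ℂ] V)) =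
        (-1) ^ finrank ℂ V * LinearMap.det (1 - (ρ.frob.symm : V →ₗ[ℂ] V)) := by
    rw [← LinearMap.det_smul, ← LinearMap.det_comp]
    congr 1
    apply LinearMap.ext; intro v
    simp
  have hval : ρ.epsilonZero ψ μ 0 * LinearMap.det (1 - (q : ℂ) ^ (-(0 : ℂ)) •
      (ρ.frob : V →ₗ[ℂ] V)) / LinearMap.det (1 - (q : ℂ) ^ ((0 : ℂ) - 1) •
        (ρ.frob.symm : V →ₗ[ℂ] V)) = (-1) ^ finrank ℂ V *
        ((((q : ℝ) ^ (-(finrank ℂ V : ℝ) / 2) : ℝ) : ℂ) *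
        (LinearMap.det (1 - (ρ.frob.symm : V →ₗ[ℂ] V)) /
          LinearMap.det (1 - (q : ℂ)⁻¹ • (ρ.frob.symm : V →ₗ[ℂ] V)))) := by
    rw [epsilonZero, hmu, hdim, he1, neg_zero, Complex.cpow_zero, one_smul, hψ, zpow_neg_one]
    have : ((ρ.frob⁻¹ : V ≃ₗ[ℂ] V) : V →ₗ[ℂ] V) = (ρ.frob.symm : V →ₗ[ℂ] V) := rfl
    rw [this, mul_right_comm, hsign]
    ring
  rw [← hval]
  exact hlim

end UnramifiedWD

/-! ### The self-dual measure -/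

section SelfDual

variable {K : Type*} [Field K] [ValuativeRel K] [TopologicalSpace K] [IsNonarchimedeanLocalField K]

theorem charOrder_eq_neg_one {ψ : AddChar K ℂ} (hψ : ∀ x : 𝒪[K], x ∈ 𝓂[K] → ψ (x : K) = 1)
    (hψ' : ∃ x : 𝒪[K], ψ (x : K) ≠ 1) : charOrder ψ = -1 := by
  refine IsGreatest.csSup_eq ⟨fun ϖ hϖ y => ?_, fun n hn => ?_⟩
  · have h : ϖ * y ∈ 𝓂[K] := Ideal.mul_mem_right _ _ hϖ.not_isUnit
    simpa using hψ _ h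
  · obtain ⟨x, hx⟩ := hψ'
    obtain ⟨ϖ, hϖ⟩ := IsDiscreteValuationRing.exists_irreducible 𝒪[K]
    by_contra hlt
    obtain ⟨m, rfl⟩ := Int.eq_ofNat_of_zero_le (by omega : 0 ≤ n)
    apply hx
    have h0 : (ϖ : K) ≠ 0 := by simpa using hϖ.ne_zero
    have h1 := hn ϖ hϖ (ϖ ^ m * x)
    rw [← h1]
    congr 1
    push_cast
    rw [zpow_neg, zpow_natCast, inv_mul_cancel_left₀ (pow_ne_zero _ h0)]

theorem lt_one_mem_nhds : {x : K | ValuativeRel.valuation K x < 1} ∈ 𝓝 (0 : K) := by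
  have := (IsValuativeTopology.hasBasis_nhds_zero' K).mem_of_mem (i := 1) one_ne_zero
  simpa using this

theorem isOpen_integers : IsOpen (𝒪[K] : Set K) :=
  AddSubgroup.isOpen_of_mem_nhds (𝒪[K] : Subring K).toAddSubgroup (g := 0)
    (Filter.mem_of_superset lt_one_mem_nhds fun _ hx =>
      (Valuation.mem_integer_iff _ _).2 (le_of_lt hx))

theorem isClopen_integers : IsClopen (𝒪[K] : Set K) :=
  ⟨AddSubgroup.isClosed_of_isOpen (𝒪[K] : Subring K).toAddSubgroup isOpen_integers,
    isOpen_integers⟩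

theorem isOpen_lt_one : IsOpen {x : K | ValuativeRel.valuation K x < 1} :=
  AddSubgroup.isOpen_of_mem_nhds ((ValuativeRel.valuation K).ltAddSubgroup 1) (g := 0)
    lt_one_mem_nhds

theorem isCompact_integers : IsCompact (𝒪[K] : Set K) :=
  IsNonarchimedeanLocalField.isCompact_closedBall K 1

theorem mem_maximalIdeal_iff (x : 𝒪[K]) :
    x ∈ 𝓂[K] ↔ ValuativeRel.valuation K (x : K) < 1 := by
  rw [IsLocalRing.mem_maximalIdeal, mem_nonunits_iff,
    (Valuation.integer.integers _).isUnit_iff_valuation_eq_one]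
  exact (lt_iff_le_and_ne.trans (and_iff_right x.2)).symm

variable [MeasurableSpace K] [BorelSpace K] (μ : Measure K) [μ.IsAddHaarMeasure]

/-- `𝒪` is the disjoint union of the cosets of `𝔭`, of which there are as many as residues. -/
theorem measure_integers :
    μ (𝒪[K] : Set K) = residueCard K * μ {x : K | ValuativeRel.valuation K x < 1} := by
  have : Fintype 𝓀[K] := Fintype.ofFinite _
  set F : 𝓀[K] → Set K := fun r => {x | ∃ h : x ∈ 𝒪[K], IsLocalRing.residue 𝒪[K] ⟨x, h⟩ = r}
  have h1 : (𝒪[K] : Set K) = ⋃ r, F r := by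
    ext x
    simp [F]
  have h2 : ∀ r, ∃ l : K, F r = (fun x => l + x) ⁻¹' {x : K | ValuativeRel.valuation K x < 1} := by
    intro r
    obtain ⟨l, rfl⟩ := IsLocalRing.residue_surjective r
    refine ⟨-l, ?_⟩
    have hmem : ∀ (x : K) (h : x ∈ 𝒪[K]), IsLocalRing.residue 𝒪[K] ⟨x, h⟩ =
        IsLocalRing.residue 𝒪[K] l ↔ ValuativeRel.valuation K (-(l : K) + x) < 1 := by
      intro x h
      rw [← sub_eq_zero, ← map_sub, IsLocalRing.residue_eq_zero_iff, mem_maximalIdeal_iff]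
      rw [neg_add_eq_sub]
      rfl
    ext x
    constructor
    · rintro ⟨h, hx⟩
      exact (hmem x h).1 hx
    · intro hx
      have hxm : x ∈ 𝒪[K] := by
        have : -(l : K) + x ∈ 𝒪[K] := (Valuation.mem_integer_iff _ _).2 (le_of_lt hx)
        simpa using add_mem l.2 this
      exact ⟨hxm, (hmem x hxm).2 hx⟩
  have hmeas : ∀ r, MeasurableSet (F r) := by
    intro r
    obtain ⟨l, hl⟩ := h2 r
    rw [hl]
    exact (isOpen_lt_one.preimage (continuous_const_add l)).measurableSet
  rw [h1, measure_iUnion ?_ hmeas]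
  · rw [tsum_fintype]
    have : ∀ r, μ (F r) = μ {x : K | ValuativeRel.valuation K x < 1} := by
      intro r
      obtain ⟨l, hl⟩ := h2 r
      rw [hl, measure_preimage_add]
    simp [this, residueCard]
  · intro r r' hne
    rw [Function.onFun, Set.disjoint_left]
    rintro x ⟨h, hx⟩ ⟨h', hx'⟩
    exact hne (hx.symm.trans hx')

/-- A self-dual measure gives `𝒪` the volume `√q`, when `ψ` is trivial on `𝔭` but not on `𝒪`:
the Fourier transform of the indicator function of `𝒪` is `μ(𝒪)` times that of `𝔭`. -/
theorem measure_integers_sq {ψ : AddChar K ℂ} (hψ : ∀ x : 𝒪[K], x ∈ 𝓂[K] → ψ (x : K) = 1)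
    (hψ' : ∃ x : 𝒪[K], ψ (x : K) ≠ 1) (hμ : IsSelfDual ψ μ) :
    μ.real (𝒪[K] : Set K) ^ 2 = residueCard K := by
  classical
  set f : K → ℂ := (𝒪[K] : Set K).indicator 1 with hf
  have hfl : IsLocallyConstant f := by
    rw [hf, ← LocallyConstant.coe_charFn ℂ isClopen_integers]
    exact LocallyConstant.isLocallyConstant _
  have hfc : HasCompactSupport f := HasCompactSupport.intro isCompact_integers fun x hx => by
    simp [hf, hx]
  have h1 : ∀ y, ∫ z, f z * ψ (z * y) ∂μ =
      {x : K | ValuativeRel.valuation K x < 1}.indicator (fun _ => (μ.real (𝒪[K] : Set K) : ℂ)) y := by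
    intro y
    by_cases hy : ValuativeRel.valuation K y < 1
    · have h2 : (fun z => f z * ψ (z * y)) = f := by
        funext z
        by_cases hz : z ∈ 𝒪[K]
        · have hm : (⟨z, hz⟩ : 𝒪[K]) * ⟨y, hy.le⟩ ∈ 𝓂[K] :=
            Ideal.mul_mem_left _ _ ((mem_maximalIdeal_iff _).2 hy)
          have := hψ _ hm
          simp only [Subring.coe_mul] at this
          rw [this, mul_one]
        · simp [hf, hz]
      rw [h2, hf, integral_indicator isOpen_integers.measurableSet]
      simp [hy]
    -- For `y ∉ 𝔭` translation by `x / y ∈ 𝒪` multiplies the integrand by `ψ x ≠ 1`.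
    · obtain ⟨x, hx⟩ := hψ'
      have hy0 : y ≠ 0 := by
        rintro rfl
        simp at hy
      have hz : (x : K) / y ∈ 𝒪[K] := by
        rw [Valuation.mem_integer_iff, map_div₀]
        refine (div_le_one₀ ?_).2 (le_trans x.2 (not_lt.1 hy))
        exact zero_lt_iff.2 ((Valuation.ne_zero_iff _).2 hy0)
      have h2 := integral_add_right_eq_self (μ := μ) (fun z => f z * ψ (z * y)) ((x : K) / y)
      have h3 : ∀ z, f (z + x / y) * ψ ((z + x / y) * y) = ψ (x : K) * (f z * ψ (z * y)) := by
        intro z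
        have h4 : f (z + x / y) = f z := by
          simp only [hf, Set.indicator, SetLike.mem_coe]
          rw [add_mem_cancel_right hz]
          rfl
        rw [h4, add_mul, div_mul_cancel₀ _ hy0, AddChar.map_add_eq_mul]
        ring
      simp only [h3] at h2
      rw [integral_const_mul] at h2
      have h5 : (ψ (x : K) - 1) * ∫ z, f z * ψ (z * y) ∂μ = 0 := by rw [sub_mul, h2]; ring
      rw [(mul_eq_zero.1 h5).resolve_left (sub_ne_zero.2 hx)]
      simp [hy]
  have h6 := hμ f hfl hfc 0
  simp only [h1, mul_zero, AddChar.map_zero_eq_one, mul_one, neg_zero] at h6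
  rw [integral_indicator isOpen_lt_one.measurableSet, setIntegral_const] at h6
  have h7 := congrArg ENNReal.toReal (measure_integers μ)
  rw [ENNReal.toReal_mul, ENNReal.toReal_natCast] at h7
  have h8 : f 0 = 1 := by simp [hf, zero_mem]
  rw [h8, Complex.real_smul] at h6
  have h9 : μ.real {x : K | ValuativeRel.valuation K x < 1} * μ.real (𝒪[K] : Set K) = 1 := by
    exact_mod_cast h6
  rw [Measure.real, Measure.real] at h9
  rw [Measure.real, sq]
  nth_rewrite 1 [h7]
  rw [mul_assoc, h9, mul_one]

end SelfDual

/-! ### The exponential of a matrix -/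

section MatrixExponential

variable {n : ℕ}

open scoped Matrix.Norms.Operator in
theorem hasDerivAt_exp_entry (X : Matrix (Fin n) (Fin n) ℂ) (i j : Fin n) (s : ℂ) :
    HasDerivAt (fun s : ℂ => exp (s • X) i j) ((exp (s • X) * X) i j) s := by
  have h := hasDerivAt_exp_smul_const (𝕂 := ℂ) X s
  exact (hasDerivAt_pi.1 ((hasDerivAt_pi.1 h) i)) j

/-- The exponential of a matrix, as an element of `GL_n(ℂ)`. -/
noncomputable def expGL (X : Matrix (Fin n) (Fin n) ℂ) : GL (Fin n) ℂ where
  val := exp X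
  inv := exp (-X)
  val_inv := by
    rw [← Matrix.exp_add_of_commute _ _ (Commute.neg_right (Commute.refl X)), add_neg_cancel,
      exp_zero]
  inv_val := by
    rw [← Matrix.exp_add_of_commute _ _ (Commute.neg_left (Commute.refl X)), neg_add_cancel,
      exp_zero]

theorem val_expGL (X : Matrix (Fin n) (Fin n) ℂ) : (expGL X).val = exp X := rfl

theorem expGL_zero : expGL (0 : Matrix (Fin n) (Fin n) ℂ) = 1 := Units.ext exp_zero

theorem expGL_add {X Y : Matrix (Fin n) (Fin n) ℂ} (h : Commute X Y) :
    expGL (X + Y) = expGL X * expGL Y := Units.ext (Matrix.exp_add_of_commute _ _ h)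

theorem expGL_neg (X : Matrix (Fin n) (Fin n) ℂ) : expGL (-X) = (expGL X)⁻¹ := Units.ext rfl

theorem expGL_add_smul (X : Matrix (Fin n) (Fin n) ℂ) (s t : ℂ) :
    expGL ((s + t) • X) = expGL (s • X) * expGL (t • X) := by
  rw [add_smul, expGL_add (((Commute.refl X).smul_left s).smul_right t)]

theorem conj_expGL (g : GL (Fin n) ℂ) (X : Matrix (Fin n) (Fin n) ℂ) :
    g * expGL X * g⁻¹ = expGL (g.val * X * g⁻¹.val) :=
  Units.ext (Matrix.exp_units_conj g X).symm

theorem exp_diagonal_apply (v : Fin n → ℂ) :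
    exp (Matrix.diagonal v) = Matrix.diagonal fun i => Complex.exp (v i) := by
  rw [Matrix.exp_diagonal]
  congr 1
  funext i
  rw [Complex.exp_eq_exp_ℂ, Pi.coe_exp]

theorem hasDerivAt_of_linear {c : ℂ → Matrix (Fin n) (Fin n) ℂ} {c' : Matrix (Fin n) (Fin n) ℂ}
    {s : ℂ} (h : ∀ i j, HasDerivAt (fun s => c s i j) (c' i j) s)
    (l : Matrix (Fin n) (Fin n) ℂ →ₗ[ℂ] ℂ) : HasDerivAt (fun s => l (c s)) (l c') s := by
  have key : ∀ M : Matrix (Fin n) (Fin n) ℂ, l M = ∑ i, ∑ j, M i j * l (Matrix.single i j 1) := by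
    intro M
    conv_lhs => rw [Matrix.matrix_eq_sum_single M]
    simp only [map_sum]
    refine Finset.sum_congr rfl fun i _ => Finset.sum_congr rfl fun j _ => ?_
    rw [← smul_eq_mul, ← map_smul, Matrix.smul_single, smul_eq_mul, mul_one]
  rw [key c', funext fun s => key (c s)]
  exact HasDerivAt.fun_sum fun i _ => HasDerivAt.fun_sum fun j _ => (h i j).mul_const _

/-- The derivative of a curve in a linear subspace lies in the subspace. -/
theorem mem_of_hasDerivAt {W : Submodule ℂ (Matrix (Fin n) (Fin n) ℂ)}
    {c : ℂ → Matrix (Fin n) (Fin n) ℂ} {c' : Matrix (Fin n) (Fin n) ℂ} {s : ℂ}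
    (h : ∀ i j, HasDerivAt (fun s => c s i j) (c' i j) s) (hc : ∀ s, c s ∈ W) : c' ∈ W := by
  by_contra hn
  obtain ⟨l, hl, hW⟩ := Submodule.exists_le_ker_of_notMem hn
  have h1 := hasDerivAt_of_linear h l
  have h2 : (fun s => l (c s)) = fun _ => 0 := funext fun s => hW (hc s)
  rw [h2] at h1
  exact hl (h1.unique (hasDerivAt_const s 0))

theorem hasDerivAt_conj_exp (X Y : Matrix (Fin n) (Fin n) ℂ) (i j : Fin n) :
    HasDerivAt (fun s : ℂ => (exp (s • X) * Y * exp (s • (-X))) i j) ((X * Y - Y * X) i j) 0 := by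
  have h : ∀ i j, HasDerivAt (fun s : ℂ => (exp (s • X) * Y * exp (s • (-X))) i j)
      (((exp ((0 : ℂ) • X) * X) * Y * exp ((0 : ℂ) • (-X)) +
        exp ((0 : ℂ) • X) * Y * (exp ((0 : ℂ) • (-X)) * (-X))) i j) 0 := by
    intro i j
    simp only [Matrix.mul_apply (M := _ * Y), Matrix.mul_apply (N := Y), Matrix.add_apply]
    rw [← Finset.sum_add_distrib]
    refine HasDerivAt.fun_sum fun k _ => ?_
    refine HasDerivAt.mul ?_ (hasDerivAt_exp_entry (-X) k j 0)
    exact HasDerivAt.fun_sum fun l _ => (hasDerivAt_exp_entry X i l 0).mul_const _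
  have h0 := h i j
  simp only [zero_smul, exp_zero, one_mul, mul_one, Matrix.mul_neg] at h0
  rwa [← sub_eq_add_neg] at h0

/-- A differentiable one-parameter group of matrices is given by the exponential map. -/
theorem eq_exp_of_oneParameter {M : ℂ → Matrix (Fin n) (Fin n) ℂ} {Y : Matrix (Fin n) (Fin n) ℂ}
    (h0 : M 0 = 1) (hadd : ∀ s t, M (s + t) = M s * M t)
    (h : ∀ i j, HasDerivAt (fun s => M s i j) (Y i j) 0) (s : ℂ) : M s = exp (s • Y) := by
  have h1 : ∀ s i j, HasDerivAt (fun s => M s i j) ((M s * Y) i j) s := by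
    intro s i j
    have e : (fun t => M t i j) = fun t => ∑ k, M s i k * M (t - s) k j := by
      funext t
      rw [← Matrix.mul_apply, ← hadd, add_sub_cancel]
    rw [e, Matrix.mul_apply]
    refine HasDerivAt.fun_sum fun k _ => HasDerivAt.const_mul _ ?_
    have := (h k j)
    rw [← sub_self s] at this
    exact this.comp_sub_const s s
  have h2 : ∀ s i j, HasDerivAt (fun s => (M s * exp (s • (-Y))) i j) 0 s := by
    intro s i j
    have h3 : HasDerivAt (fun s => (M s * exp (s • (-Y))) i j)
        ((M s * Y * exp (s • (-Y)) + M s * (exp (s • (-Y)) * (-Y))) i j) s := by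
      simp only [Matrix.mul_apply (M := M _), Matrix.mul_apply (M := M s * Y), Matrix.add_apply]
      rw [← Finset.sum_add_distrib]
      refine HasDerivAt.fun_sum fun k _ => ?_
      have := (h1 s i k).mul (hasDerivAt_exp_entry (-Y) k j s)
      rwa [Matrix.mul_apply] at this
    have hc : Commute Y (exp (s • (-Y))) := by
      have : Commute Y (s • (-Y)) := ((Commute.refl Y).neg_right).smul_right s
      exact this.exp_right
    rw [mul_assoc, hc.eq, Matrix.mul_neg, Matrix.mul_neg, add_neg_cancel] at h3
    exact h3
  have h4 : M s * exp (s • (-Y)) = 1 := by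
    ext i j
    have := is_const_of_deriv_eq_zero (𝕜 := ℂ) (fun s => (h2 s i j).differentiableAt)
      (fun s => (h2 s i j).deriv) s 0
    rw [this, h0, zero_smul, exp_zero, one_mul]
  have h5 := congrArg (· * exp (s • Y)) h4
  simp only [mul_assoc, one_mul] at h5
  rwa [smul_neg, ← val_expGL, ← val_expGL, expGL_neg, ← Units.val_mul, inv_mul_cancel,
    Units.val_one, mul_one] at h5

end MatrixExponential

/-! ### Tangent vectors and one-parameter groups -/

section TangentSpace

variable {n : ℕ} {G : Subgroup (GL (Fin n) ℂ)}

theorem val_inv_expGL_smul (X : Matrix (Fin n) (Fin n) ℂ) (s : ℂ) :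
    ((expGL (s • X))⁻¹).val = exp (s • (-X)) := by
  rw [← expGL_neg, val_expGL, smul_neg]

theorem mk_expGL_zero {X : Matrix (Fin n) (Fin n) ℂ} (h : expGL ((0 : ℂ) • X) ∈ G) :
    (⟨expGL ((0 : ℂ) • X), h⟩ : G) = 1 := by
  apply Subtype.ext
  simp only [zero_smul, expGL_zero]
  rfl

/-- The matrix entries, as regular functions. -/
def entry (G : Subgroup (GL (Fin n) ℂ)) (i j : Fin n) : regularFunctions G :=
  ⟨fun g => (g : GL (Fin n) ℂ).val i j, entry_mem i j⟩

/-- The matrix of a tangent vector at the identity. -/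
def toMat : LieAlg G →ₗ[ℂ] Matrix (Fin n) (Fin n) ℂ where
  toFun D := Matrix.of fun i j => D.1 (entry G i j)
  map_add' _ _ := rfl
  map_smul' _ _ := rfl

theorem toMat_apply (D : LieAlg G) (i j : Fin n) : toMat D i j = D.1 (entry G i j) := rfl

theorem LieAlg.map_one (D : LieAlg G) : D.1 1 = 0 := by
  have h := D.2 1 1
  rw [mul_one] at h
  simpa using h

theorem LieAlg.map_inv_entry (D : LieAlg G) (i j : Fin n) :
    D.1 ⟨_, inv_entry_mem i j⟩ = -toMat D i j := by
  have h : ∑ k, entry G i k * (⟨_, inv_entry_mem k j⟩ : regularFunctions G) =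
      ((1 : Matrix (Fin n) (Fin n) ℂ) i j) • (1 : regularFunctions G) := by
    apply Subtype.ext; funext g
    simp only [AddSubmonoidClass.coe_finsetSum, MulMemClass.coe_mul, Finset.sum_apply,
      Pi.mul_apply]
    have := congrFun (congrFun (Units.mul_inv (g : GL (Fin n) ℂ)) i) j
    rw [Matrix.mul_apply] at this
    refine Eq.trans this ?_
    change _ = (1 : Matrix (Fin n) (Fin n) ℂ) i j * 1
    rw [mul_one]
  have h2 := congrArg D.1 h
  rw [map_smul, LieAlg.map_one D, smul_zero, map_sum] at h2
  have h3 : ∀ k, D.1 (entry G i k * (⟨_, inv_entry_mem k j⟩ : regularFunctions G)) =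
      (1 : Matrix (Fin n) (Fin n) ℂ) i k * D.1 ⟨_, inv_entry_mem k j⟩ +
        toMat D i k * (1 : Matrix (Fin n) (Fin n) ℂ) k j := fun k => by
    rw [D.2]
    simp [entry, toMat_apply]
  simp only [h3, Finset.sum_add_distrib] at h2
  have h4 : ∑ k, toMat D i k * (1 : Matrix (Fin n) (Fin n) ℂ) k j = toMat D i j := by
    rw [← Matrix.mul_apply, mul_one]
  have h5 : ∑ k, (1 : Matrix (Fin n) (Fin n) ℂ) i k *
      D.1 (⟨_, inv_entry_mem k j⟩ : regularFunctions G) =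
        D.1 (⟨_, inv_entry_mem i j⟩ : regularFunctions G) := by
    simp [Matrix.one_apply]
  rw [h4, h5] at h2
  exact eq_neg_of_add_eq_zero_left h2

/-- Along the one-parameter group of a tangent vector, regular functions are differentiable with
the expected derivative. -/
theorem hasDerivAt_regular (D : LieAlg G) (hG : ∀ s : ℂ, expGL (s • toMat D) ∈ G)
    (f : regularFunctions G) :
    HasDerivAt (fun s : ℂ => f.1 ⟨expGL (s • toMat D), hG s⟩) (D.1 f) 0 := by
  have h1 : ∀ f : regularFunctions G, f.1 ⟨expGL ((0 : ℂ) • toMat D), hG 0⟩ = f.1 1 := fun f => congrArg f.1 (mk_expGL_zero _)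
  obtain ⟨f, hf⟩ := f
  induction hf using Algebra.adjoin_induction with
  | mem f hf =>
    rcases hf with ⟨⟨i, j⟩, rfl⟩ | ⟨⟨i, j⟩, rfl⟩
    · have := hasDerivAt_exp_entry (toMat D) i j 0
      rw [zero_smul, exp_zero, one_mul] at this
      exact this
    · have := hasDerivAt_exp_entry (-toMat D) i j 0
      rw [zero_smul, exp_zero, one_mul, Matrix.neg_apply, ← LieAlg.map_inv_entry] at this
      refine this.congr_of_eventuallyEq (Filter.Eventually.of_forall fun s => ?_)
      exact congrFun (congrFun (val_inv_expGL_smul (toMat D) s) i) j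
  | algebraMap r =>
    have h : D.1 ⟨algebraMap ℂ _ r, Subalgebra.algebraMap_mem _ r⟩ = 0 := by
      have : (⟨algebraMap ℂ _ r, Subalgebra.algebraMap_mem _ r⟩ : regularFunctions G) =
          r • 1 := by
        apply Subtype.ext; funext g
        change r = r * 1
        rw [mul_one]
      rw [this, map_smul, LieAlg.map_one D, smul_zero]
    rw [h]
    exact hasDerivAt_const _ _
  | add f h hf hh ihf ihh =>
    have := ihf.add ihh
    rw [← map_add] at this
    exact this
  | mul f h hf hh ihf ihh =>
    have := ihf.mul ihh
    have e := D.2 (⟨f, hf⟩ : regularFunctions G) (⟨h, hh⟩ : regularFunctions G)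
    rw [add_comm] at e
    rw [h1 ⟨f, hf⟩, h1 ⟨h, hh⟩] at this
    exact this.congr_deriv e.symm

/-- The derivation of the polynomial ring attached to the left invariant vector field of `X`. -/
noncomputable def leftInvariant (X : Matrix (Fin n) (Fin n) ℂ) :
    Derivation ℂ (MvPolynomial (Fin n × Fin n) ℂ) (MvPolynomial (Fin n × Fin n) ℂ) :=
  MvPolynomial.mkDerivation ℂ fun p => ∑ k, X k p.2 • MvPolynomial.X (p.1, k)

theorem leftInvariant_X (X : Matrix (Fin n) (Fin n) ℂ) (p : Fin n × Fin n) :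
    leftInvariant X (MvPolynomial.X p) = ∑ k, X k p.2 • MvPolynomial.X (p.1, k) :=
  MvPolynomial.mkDerivation_X _ _ _

theorem hasDerivAt_eval_exp (X : Matrix (Fin n) (Fin n) ℂ) (p : MvPolynomial (Fin n × Fin n) ℂ)
    (s : ℂ) :
    HasDerivAt (fun s : ℂ => MvPolynomial.eval (fun ij => exp (s • X) ij.1 ij.2) p)
      (MvPolynomial.eval (fun ij => exp (s • X) ij.1 ij.2) (leftInvariant X p)) s := by
  induction p using MvPolynomial.induction_on with
  | C a => simpa using hasDerivAt_const s a
  | add p q hp hq =>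
    simp only [map_add]
    exact hp.add hq
  | mul_X p i hp =>
    have h1 := hp.mul (hasDerivAt_exp_entry X i.1 i.2 s)
    simp only [map_mul, MvPolynomial.eval_X]
    refine h1.congr_deriv ?_
    rw [Derivation.leibniz, leftInvariant_X, map_add, smul_eq_mul, smul_eq_mul, map_mul, map_mul,
      MvPolynomial.eval_X, map_sum, Matrix.mul_apply, add_comm, mul_comm (exp (s • X) i.1 i.2)]
    congr 2
    refine Finset.sum_congr rfl fun k _ => ?_
    rw [MvPolynomial.smul_eval, MvPolynomial.eval_X, mul_comm]

/-- Evaluation of a polynomial in the matrix entries at `g h`, as a regular function of `h`. -/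
noncomputable def evalTranslate (g : G) :
    MvPolynomial (Fin n × Fin n) ℂ →ₐ[ℂ] regularFunctions G :=
  MvPolynomial.aeval fun p => ∑ k, (g : GL (Fin n) ℂ).val p.1 k • entry G k p.2

theorem evalTranslate_apply (g h : G) (p : MvPolynomial (Fin n × Fin n) ℂ) :
    (evalTranslate g p).1 h =
      MvPolynomial.eval (fun ij => (g * h : G).1.val ij.1 ij.2) p := by
  induction p using MvPolynomial.induction_on with
  | C a => 
    rw [evalTranslate, MvPolynomial.algHom_C, MvPolynomial.eval_C]
    rfl
  | add p q hp hq => 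
    rw [map_add, map_add, ← hp, ← hq]
    rfl
  | mul_X p i hp =>
    rw [map_mul, map_mul, ← hp, MvPolynomial.eval_X]
    refine congrArg ((evalTranslate g p).1 h * ·) ?_
    rw [evalTranslate, MvPolynomial.aeval_X, Subgroup.coe_mul, Units.val_mul, Matrix.mul_apply,
      AddSubmonoidClass.coe_finsetSum, Finset.sum_apply]
    rfl

theorem LieAlg.apply_evalTranslate (D : LieAlg G) (g : G) (p : MvPolynomial (Fin n × Fin n) ℂ) :
    D.1 (evalTranslate g p) =
      MvPolynomial.eval (fun ij => (g : GL (Fin n) ℂ).val ij.1 ij.2)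
        (leftInvariant (toMat D) p) := by
  induction p using MvPolynomial.induction_on with
  | C a =>
    have : evalTranslate g (MvPolynomial.C a) = a • 1 := by
      rw [evalTranslate, MvPolynomial.algHom_C, Algebra.algebraMap_eq_smul_one]
    rw [this, map_smul, LieAlg.map_one D]
    simp
  | add p q hp hq => simp only [map_add, hp, hq]
  | mul_X p i hp =>
    rw [map_mul, D.2, evalTranslate_apply, hp, evalTranslate_apply, mul_one,
      Derivation.leibniz, leftInvariant_X, map_add, smul_eq_mul, smul_eq_mul, map_mul, map_mul,
      MvPolynomial.eval_X, map_sum, evalTranslate, MvPolynomial.aeval_X, map_sum,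
      mul_comm (MvPolynomial.eval _ (leftInvariant (toMat D) p))]
    congr 2
    refine Finset.sum_congr rfl fun k _ => ?_
    rw [MvPolynomial.smul_eval, MvPolynomial.eval_X, map_smul, smul_eq_mul, mul_comm, toMat_apply]

/-- Tangent vectors exponentiate into a Zariski closed group: the functions vanishing on the
group are stable under the left invariant derivation, so that all the derivatives at `s = 0` of
their values at `exp (s X)` vanish. -/
theorem LieAlg.expGL_mem (hG : IsZariskiClosed G) (D : LieAlg G) (s : ℂ) :
    expGL (s • toMat D) ∈ G := by
  obtain ⟨S, hS⟩ := hG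
  rw [hS]
  intro p hp
  set δ := leftInvariant (toMat D)
  have hI : ∀ p : MvPolynomial (Fin n × Fin n) ℂ,
      (∀ g : G, MvPolynomial.eval (fun ij => (g : GL (Fin n) ℂ).val ij.1 ij.2) p = 0) →
      ∀ g : G, MvPolynomial.eval (fun ij => (g : GL (Fin n) ℂ).val ij.1 ij.2) (δ p) = 0 := by
    intro p hp g
    rw [← LieAlg.apply_evalTranslate]
    have : evalTranslate g p = 0 := by
      apply Subtype.ext; funext h
      rw [evalTranslate_apply, hp]
      rfl
    rw [this, map_zero]
  have hk : ∀ k : ℕ, ∀ g : G,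
      MvPolynomial.eval (fun ij => (g : GL (Fin n) ℂ).val ij.1 ij.2) (δ^[k] p) = 0 := by
    intro k
    induction k with
    | zero => exact fun g => (hS g).1 g.2 p hp
    | succ k ih =>
      rw [Function.iterate_succ_apply']
      exact hI _ ih
  set F : MvPolynomial (Fin n × Fin n) ℂ → ℂ → ℂ := fun p s =>
    MvPolynomial.eval (fun ij => exp (s • toMat D) ij.1 ij.2) p with hF
  have hd : ∀ p, deriv (F p) = F (δ p) := fun p =>
    funext fun s => (hasDerivAt_eval_exp (toMat D) p s).deriv
  have hit : ∀ k, iteratedDeriv k (F p) = F (δ^[k] p) := by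
    intro k
    induction k with
    | zero => rw [iteratedDeriv_zero]; rfl
    | succ k ih => rw [iteratedDeriv_succ, ih, hd, Function.iterate_succ_apply']
  have hdiff : Differentiable ℂ (F p) := fun s =>
    (hasDerivAt_eval_exp (toMat D) p s).differentiableAt
  have h := Complex.taylorSeries_eq_of_entire hdiff 0 s
  have h0 : ∀ k, iteratedDeriv k (F p) 0 = 0 := by
    intro k
    rw [hit, hF]
    simpa using hk k 1
  simp only [h0, smul_zero, tsum_zero] at h
  exact h.symm

theorem toMat_injective : Function.Injective (toMat : LieAlg G →ₗ[ℂ] Matrix (Fin n) (Fin n) ℂ) := by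
  rw [injective_iff_map_eq_zero]
  intro D hD
  have hG : ∀ s : ℂ, expGL (s • toMat D) ∈ G := fun s => by
    rw [hD, smul_zero, expGL_zero]
    exact one_mem G
  apply Subtype.ext; apply LinearMap.ext; intro f
  have h1 := hasDerivAt_regular D hG f
  have h2 : (fun s : ℂ => f.1 ⟨expGL (s • toMat D), hG s⟩) = fun _ => f.1 1 := by
    funext s
    refine congrArg f.1 (Subtype.ext ?_)
    simp only [hD, smul_zero, expGL_zero]
    rfl
  rw [h2] at h1
  exact h1.unique (hasDerivAt_const _ _)

/-- The velocity vector of a one-parameter group in `G` is a tangent vector. -/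
theorem exists_toMat_eq {X : Matrix (Fin n) (Fin n) ℂ} (hG : ∀ s : ℂ, expGL (s • X) ∈ G) :
    ∃ D : LieAlg G, toMat D = X := by
  have hd : ∀ f : regularFunctions G,
      DifferentiableAt ℂ (fun s : ℂ => f.1 ⟨expGL (s • X), hG s⟩) 0 := by
    rintro ⟨f, hf⟩
    induction hf using Algebra.adjoin_induction with
    | mem f hf =>
      rcases hf with ⟨⟨i, j⟩, rfl⟩ | ⟨⟨i, j⟩, rfl⟩
      · exact (hasDerivAt_exp_entry X i j 0).differentiableAt
      · refine (hasDerivAt_exp_entry (-X) i j 0).differentiableAt.congr_of_eventuallyEq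
          (Filter.Eventually.of_forall fun s => ?_)
        exact congrFun (congrFun (val_inv_expGL_smul X s) i) j
    | algebraMap r => exact differentiableAt_const r
    | add f h hf hh ihf ihh => exact ihf.add ihh
    | mul f h hf hh ihf ihh => exact ihf.mul ihh
  have h1 : ∀ f : regularFunctions G, f.1 ⟨expGL ((0 : ℂ) • X), hG 0⟩ = f.1 1 := fun f => congrArg f.1 (mk_expGL_zero _)
  refine ⟨⟨{ toFun := fun f => deriv (fun s : ℂ => f.1 ⟨expGL (s • X), hG s⟩) 0
             map_add' := fun f h => deriv_add (hd f) (hd h)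
             map_smul' := fun c f => deriv_const_mul c (hd f) }, fun f h => ?_⟩, ?_⟩
  · have := deriv_mul (hd f) (hd h)
    rw [h1, h1, add_comm] at this
    exact this
  · ext i j
    have := hasDerivAt_exp_entry X i j 0
    rw [zero_smul, exp_zero, one_mul] at this
    exact this.deriv

theorem hasDerivAt_eq {D : LieAlg G} (hG : IsZariskiClosed G) (f : regularFunctions G) :
    HasDerivAt (fun s : ℂ => f.1 ⟨expGL (s • toMat D), LieAlg.expGL_mem hG D s⟩) (D.1 f) 0 :=
  hasDerivAt_regular D _ f

theorem mem_range_toMat (hG : IsZariskiClosed G) {X : Matrix (Fin n) (Fin n) ℂ} :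
    X ∈ LinearMap.range (toMat (G := G)) ↔ ∀ s : ℂ, expGL (s • X) ∈ G := by
  constructor
  · rintro ⟨D, rfl⟩
    exact LieAlg.expGL_mem hG D
  · exact fun h => exists_toMat_eq h

/-- An algebraic automorphism carries the one-parameter group of `D` to that of its
differential. -/
theorem apply_expGL (hG : IsZariskiClosed G) {σ : MulAut G} (hσ : σ ∈ AlgAut G) (D : LieAlg G)
    (s : ℂ) : σ ⟨expGL (s • toMat D), LieAlg.expGL_mem hG D s⟩ =
      ⟨expGL (s • toMat (differential hσ D)), LieAlg.expGL_mem hG (differential hσ D) s⟩ := by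
  apply Subtype.ext
  apply Units.ext
  refine eq_exp_of_oneParameter
    (M := fun s => (σ ⟨expGL (s • toMat D), LieAlg.expGL_mem hG D s⟩).1.val) ?_ (fun s t => ?_)
    (fun i j => ?_) s
  · simp only [mk_expGL_zero, map_one]
    rfl
  · have : (⟨expGL ((s + t) • toMat D), LieAlg.expGL_mem hG D (s + t)⟩ : G) =
        ⟨expGL (s • toMat D), LieAlg.expGL_mem hG D s⟩ * ⟨expGL (t • toMat D), LieAlg.expGL_mem hG D t⟩ :=
      Subtype.ext (expGL_add_smul _ s t)
    simp only [this, map_mul]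
    rfl
  · exact hasDerivAt_eq hG (pullback hσ (entry G i j))

theorem toMat_Ad (x : G) (D : LieAlg G) :
    toMat (Ad x D) = (x : GL (Fin n) ℂ).val * toMat D * (x⁻¹ : GL (Fin n) ℂ).val := by
  ext i j
  have h : pullback (conj_mem_algAut x) (entry G i j) =
      ∑ l, ∑ k, ((x : GL (Fin n) ℂ).val i k * (x⁻¹ : GL (Fin n) ℂ).val l j) • entry G k l := by
    apply Subtype.ext; funext g
    simp only [AddSubmonoidClass.coe_finsetSum, Finset.sum_apply]
    change (x.1.val * g.1.val * (x.1⁻¹).val) i j = ∑ l, ∑ k, _ * g.1.val k l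
    simp only [Matrix.mul_apply, Finset.sum_mul]
    exact Finset.sum_congr rfl fun _ _ => Finset.sum_congr rfl fun _ _ => by ring
  rw [toMat_apply, Ad, differential_apply, h]
  simp only [map_sum, map_smul, smul_eq_mul, Matrix.mul_apply, Finset.sum_mul, toMat_apply]
  exact Finset.sum_congr rfl fun _ _ => Finset.sum_congr rfl fun _ _ => by ring

end TangentSpace

/-! ### The Lie algebra of a linear group and the adjoint action -/

section LieAlgebra

variable {n : ℕ} {G : Subgroup (GL (Fin n) ℂ)} (hG : IsZariskiClosed G)

theorem conj_mem_range {X : Matrix (Fin n) (Fin n) ℂ} (x : G)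
    (hX : X ∈ LinearMap.range (toMat (G := G))) :
    (x : GL (Fin n) ℂ).val * X * (x⁻¹ : GL (Fin n) ℂ).val ∈ LinearMap.range (toMat (G := G)) := by
  obtain ⟨D, rfl⟩ := hX
  exact ⟨Ad x D, toMat_Ad x D⟩

/-- The Lie algebra of a closed linear group `G`, as an algebra of matrices. -/
noncomputable def matLie : LieSubalgebra ℂ (Matrix (Fin n) (Fin n) ℂ) where
  toSubmodule := LinearMap.range (toMat (G := G))
  lie_mem' {X Y} hX hY := by
    rw [LieRing.of_associative_ring_bracket]
    refine mem_of_hasDerivAt (hasDerivAt_conj_exp X Y) fun s => ?_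
    rw [← val_inv_expGL_smul]
    exact conj_mem_range ⟨expGL (s • X), (mem_range_toMat hG).1 hX s⟩ hY

/-- The identification of `Lie(G)` with the algebra of its matrices. -/
noncomputable def toLie : LieAlg G ≃ₗ[ℂ] matLie hG :=
  LinearEquiv.ofInjective toMat toMat_injective

theorem coe_toLie (D : LieAlg G) :
    (toLie hG D : Matrix (Fin n) (Fin n) ℂ) = toMat D := rfl

theorem expGL_smul_mem (X : matLie hG) (s : ℂ) :
    expGL (s • (X : Matrix (Fin n) (Fin n) ℂ)) ∈ G := (mem_range_toMat hG).1 X.2 s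

theorem expGL_mem (X : matLie hG) : expGL (X : Matrix (Fin n) (Fin n) ℂ) ∈ G := by
  simpa using expGL_smul_mem hG X 1

variable {hG}

/-- The exponential map `Lie(G) → G`. -/
noncomputable def expG (X : matLie hG) : G := ⟨expGL X, expGL_mem hG X⟩

theorem val_expG (X : matLie hG) :
    (expG X : GL (Fin n) ℂ).val = exp (X : Matrix (Fin n) (Fin n) ℂ) := rfl

theorem val_inv_expG (X : matLie hG) :
    ((expG X)⁻¹ : GL (Fin n) ℂ).val = exp (-(X : Matrix (Fin n) (Fin n) ℂ)) := rfl

theorem hasDerivAt_expG (X : matLie hG) (f : regularFunctions G) :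
    HasDerivAt (fun s : ℂ => f.1 (expG (s • X))) (((toLie hG).symm X).1 f) 0 := by
  obtain ⟨D, rfl⟩ := (toLie hG).surjective X
  rw [LinearEquiv.symm_apply_apply]
  exact hasDerivAt_eq hG f

theorem eq_zero_of_expG_eq_one {X : matLie hG} (h : ∀ s : ℂ, expG (s • X) = 1) : X = 0 := by
  apply Subtype.ext
  ext i j
  have h1 := hasDerivAt_exp_entry (X : Matrix (Fin n) (Fin n) ℂ) i j 0
  have h2 : (fun s : ℂ => exp (s • (X : Matrix (Fin n) (Fin n) ℂ)) i j) =
      fun _ => (1 : Matrix (Fin n) (Fin n) ℂ) i j := by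
    funext s
    have := congrArg (fun g : G => (g : GL (Fin n) ℂ).val i j) (h s)
    exact this
  rw [h2, zero_smul, exp_zero, one_mul] at h1
  exact h1.unique (hasDerivAt_const _ _)

variable (hG)

/-- The adjoint action of `x ∈ G` on matrices. -/
noncomputable def adj (x : G) : matLie hG →ₗ[ℂ] matLie hG where
  toFun X := ⟨(x : GL (Fin n) ℂ).val * X * (x⁻¹ : GL (Fin n) ℂ).val, conj_mem_range x X.2⟩
  map_add' X Y := Subtype.ext (by simp [mul_add, add_mul])
  map_smul' c X := Subtype.ext (by simp)

theorem coe_adj (x : G) (X : matLie hG) : (adj hG x X : Matrix (Fin n) (Fin n) ℂ) =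
    (x : GL (Fin n) ℂ).val * X * (x⁻¹ : GL (Fin n) ℂ).val := rfl

theorem toLie_Ad (x : G) (D : LieAlg G) : toLie hG (Ad x D) = adj hG x (toLie hG D) :=
  Subtype.ext (toMat_Ad x D)

theorem adj_mul (x y : G) (X : matLie hG) : adj hG (x * y) X = adj hG x (adj hG y X) := by
  apply Subtype.ext
  simp only [coe_adj, Subgroup.coe_mul, Units.val_mul, mul_inv_rev, mul_assoc]

theorem adj_one (X : matLie hG) : adj hG 1 X = X := by
  apply Subtype.ext
  simp [coe_adj]

theorem conj_expG (x : G) (X : matLie hG) : x * expG X * x⁻¹ = expG (adj hG x X) :=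
  Subtype.ext (conj_expGL _ _)

/-- The differential of an algebraic automorphism, on matrices. -/
noncomputable def matDiff {σ : MulAut G} (hσ : σ ∈ AlgAut G) : matLie hG ≃ₗ[ℂ] matLie hG :=
  ((toLie hG).symm.trans (differentialEquiv hσ)).trans (toLie hG)

theorem matDiff_toLie {σ : MulAut G} (hσ : σ ∈ AlgAut G) (D : LieAlg G) :
    matDiff hG hσ (toLie hG D) = toLie hG (differential hσ D) := by
  change toLie hG (differential hσ ((toLie hG).symm (toLie hG D))) = _
  rw [LinearEquiv.symm_apply_apply]

theorem apply_expG {σ : MulAut G} (hσ : σ ∈ AlgAut G) (X : matLie hG) :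
    σ (expG X) = expG (matDiff hG hσ X) := by
  obtain ⟨D, rfl⟩ := (toLie hG).surjective X
  rw [matDiff_toLie]
  have := apply_expGL hG hσ D 1
  have e : ∀ D : LieAlg G, (⟨expGL ((1 : ℂ) • toMat D), LieAlg.expGL_mem hG D 1⟩ : G) =
      expG (toLie hG D) := by
    intro D
    apply Subtype.ext
    change expGL ((1 : ℂ) • toMat D) = expGL (toMat D)
    rw [one_smul]
  rw [e, e] at this
  exact this

theorem matDiff_conj {σ : MulAut G} (hσ : σ ∈ AlgAut G) (x : G) (X : matLie hG) :
    matDiff hG hσ (adj hG x X) = adj hG (σ x) (matDiff hG hσ X) := by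
  obtain ⟨D, rfl⟩ := (toLie hG).surjective X
  rw [← toLie_Ad, matDiff_toLie, matDiff_toLie, ← toLie_Ad]
  congr 1
  apply Subtype.ext; apply LinearMap.ext; intro f
  simp only [Ad, differential_apply]
  congr 1
  apply Subtype.ext; funext g
  simp [pullback, MulAut.conj_apply]

/-- The differential of an algebraic automorphism, as an automorphism of Lie algebras. -/
noncomputable def lieDiff {σ : MulAut G} (hσ : σ ∈ AlgAut G) : matLie hG ≃ₗ⁅ℂ⁆ matLie hG :=
  { matDiff hG hσ with
    map_lie' := by
      intro X Y
      change matDiff hG hσ ⁅X, Y⁆ = ⁅matDiff hG hσ X, matDiff hG hσ Y⁆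
      -- Compare the derivatives at `s = 0` of the images of `exp(s X) Y exp(-s X)`, computed with a
      -- linear extension `S` of the differential to all matrices.
      obtain ⟨S, hS⟩ := LinearMap.exists_extend (p := (matLie hG).toSubmodule)
        ((matLie hG).toSubmodule.subtype ∘ₗ (matDiff hG hσ : matLie hG →ₗ[ℂ] matLie hG))
      have hS' : ∀ X : matLie hG, S (X : Matrix (Fin n) (Fin n) ℂ) = (matDiff hG hσ X : _) :=
        fun X => DFunLike.congr_fun hS X
      apply Subtype.ext
      ext i j
      have h1 := hasDerivAt_of_linear
        (hasDerivAt_conj_exp (X : Matrix (Fin n) (Fin n) ℂ) (Y : Matrix (Fin n) (Fin n) ℂ))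
        (Matrix.entryLinearMap ℂ ℂ i j ∘ₗ S)
      have h2 := hasDerivAt_conj_exp (matDiff hG hσ X : Matrix (Fin n) (Fin n) ℂ)
        (matDiff hG hσ Y : Matrix (Fin n) (Fin n) ℂ) i j
      have h3 : ∀ s : ℂ, S (exp (s • (X : Matrix (Fin n) (Fin n) ℂ)) * Y *
          exp (s • (-(X : Matrix (Fin n) (Fin n) ℂ)))) =
          exp (s • (matDiff hG hσ X : Matrix (Fin n) (Fin n) ℂ)) * (matDiff hG hσ Y : _) *
            exp (s • (-(matDiff hG hσ X : Matrix (Fin n) (Fin n) ℂ))) := by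
        intro s
        have e : ∀ X Y : matLie hG, exp (s • (X : Matrix (Fin n) (Fin n) ℂ)) * Y *
            exp (s • (-(X : Matrix (Fin n) (Fin n) ℂ))) = (adj hG (expG (s • X)) Y : _) := by
          intro X Y
          rw [coe_adj, val_inv_expG, val_expG, smul_neg]
          rfl
        rw [e, e, hS', matDiff_conj, apply_expG, map_smul]
      have h4 : (fun s : ℂ => (Matrix.entryLinearMap ℂ ℂ i j ∘ₗ S)
          (exp (s • (X : Matrix (Fin n) (Fin n) ℂ)) * Y *
          exp (s • (-(X : Matrix (Fin n) (Fin n) ℂ))))) = fun s : ℂ =>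
          (exp (s • (matDiff hG hσ X : Matrix (Fin n) (Fin n) ℂ)) * (matDiff hG hσ Y : _) *
            exp (s • (-(matDiff hG hσ X : Matrix (Fin n) (Fin n) ℂ)))) i j := by
        funext s
        rw [LinearMap.comp_apply, h3]
        rfl
      rw [h4] at h1
      have h5 := h1.unique h2
      rw [LinearMap.comp_apply, ← LieRing.of_associative_ring_bracket, ← LieSubalgebra.coe_bracket,
        hS'] at h5
      rw [LieSubalgebra.coe_bracket, LieRing.of_associative_ring_bracket]
      exact h5 }

end LieAlgebra

/-! ### Characters of groups of diagonal matrices -/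

section Characters

variable {n : ℕ}

/-- An invertible diagonal matrix. -/
noncomputable def diagUnit (d : Fin n → ℂˣ) : GL (Fin n) ℂ where
  val := Matrix.diagonal fun i => (d i : ℂ)
  inv := Matrix.diagonal fun i => ((d i)⁻¹ : ℂˣ)
  val_inv := by simp [Matrix.diagonal_mul_diagonal]
  inv_val := by simp [Matrix.diagonal_mul_diagonal]

/-- The diagonal matrices with entries `d`, conjugated by `P⁻¹`. -/
noncomputable def diagGL (P : GL (Fin n) ℂ) : (Fin n → ℂˣ) →* GL (Fin n) ℂ where
  toFun d := P⁻¹ * diagUnit d * P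
  map_one' := by
    have : diagUnit (1 : Fin n → ℂˣ) = 1 := Units.ext (by simp [diagUnit])
    rw [this]
    group
  map_mul' d d' := by
    have : diagUnit (d * d') = diagUnit d * diagUnit d' :=
      Units.ext (by simp [diagUnit, Matrix.diagonal_mul_diagonal])
    rw [this]
    group

theorem val_diagGL (P : GL (Fin n) ℂ) (d : Fin n → ℂˣ) :
    (diagGL P d).val = P⁻¹.val * (Matrix.diagonal fun i => (d i : ℂ)) * P.val := rfl

theorem val_conj_diagGL (P : GL (Fin n) ℂ) (d : Fin n → ℂˣ) :
    (P * diagGL P d * P⁻¹).val = Matrix.diagonal fun i => (d i : ℂ) := by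
  have : P * diagGL P d * P⁻¹ = diagUnit d := by
    change P * (P⁻¹ * diagUnit d * P) * P⁻¹ = _
    group
  rw [this]
  rfl

theorem exists_diagGL_eq {P g : GL (Fin n) ℂ} (h : (P * g * P⁻¹).val.IsDiag) :
    ∃ d, g = diagGL P d := by
  set D := P * g * P⁻¹ with hD
  have h1 : ∀ i, D.val i i ≠ 0 := by
    intro i hi
    have h2 := congrFun (congrFun (Units.mul_inv D) i) i
    rw [Matrix.mul_apply, Finset.sum_eq_zero] at h2
    · simp at h2
    · intro k _
      by_cases hk : i = k
      · rw [← hk, hi, zero_mul]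
      · rw [h hk, zero_mul]
  refine ⟨fun i => Units.mk0 _ (h1 i), ?_⟩
  have h3 : g = P⁻¹ * D * P := by rw [hD]; group
  rw [h3]
  apply Units.ext
  rw [val_diagGL, Units.val_mul, Units.val_mul]
  congr 2
  exact h.diagonal_diag.symm

/-- The character `d ↦ ∏ dᵢ ^ mᵢ` of the group of diagonal matrices. -/
noncomputable def monomialChar (m : Fin n → ℤ) : (Fin n → ℂˣ) →* ℂˣ where
  toFun d := ∏ i, d i ^ m i
  map_one' := by simp
  map_mul' d d' := by simp [mul_zpow, Finset.prod_mul_distrib]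

theorem monomialChar_apply (m : Fin n → ℤ) (d : Fin n → ℂˣ) :
    monomialChar m d = ∏ i, d i ^ m i := rfl

theorem monomialChar_add (m m' : Fin n → ℤ) (d : Fin n → ℂˣ) :
    monomialChar (m + m') d = monomialChar m d * monomialChar m' d := by
  simp [monomialChar_apply, zpow_add, Finset.prod_mul_distrib]

theorem monomialChar_zero (d : Fin n → ℂˣ) : monomialChar 0 d = 1 := by
  simp [monomialChar_apply]

theorem monomialChar_neg (m : Fin n → ℤ) (d : Fin n → ℂˣ) :
    monomialChar (-m) d = (monomialChar m d)⁻¹ := by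
  simp [monomialChar_apply]

/-- Evaluation of Laurent polynomials. -/
noncomputable def evalLaurent (d : Fin n → ℂˣ) : AddMonoidAlgebra ℂ (Fin n → ℤ) →ₐ[ℂ] ℂ :=
  AddMonoidAlgebra.lift ℂ ℂ (Fin n → ℤ)
    { toFun := fun m => (monomialChar m.toAdd d : ℂ)
      map_one' := by rw [toAdd_one, monomialChar_zero, Units.val_one]
      map_mul' := fun m m' => by rw [toAdd_mul, monomialChar_add, Units.val_mul] }

theorem evalLaurent_apply (d : Fin n → ℂˣ) (c : AddMonoidAlgebra ℂ (Fin n → ℤ)) :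
    evalLaurent d c = c.coeff.sum fun m a => a * (monomialChar m d : ℂ) :=
  AddMonoidAlgebra.lift_apply _ _

theorem evalLaurent_single (d : Fin n → ℂˣ) (m : Fin n → ℤ) :
    evalLaurent d (AddMonoidAlgebra.single m 1) = monomialChar m d := by
  simp [evalLaurent_apply]

/-- The characters that are trivial on a group of diagonal matrices. -/
def trivialChars (A : Subgroup (Fin n → ℂˣ)) : AddSubgroup (Fin n → ℤ) where
  carrier := {m | ∀ d ∈ A, monomialChar m d = 1}
  zero_mem' d _ := monomialChar_zero d
  add_mem' {m m'} h h' d hd := by rw [monomialChar_add, h d hd, h' d hd, one_mul]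
  neg_mem' {m} h d hd := by rw [monomialChar_neg, h d hd, inv_one]

/-- Laurent polynomials that vanish on a group of diagonal matrices also vanish at the points where
all the characters trivial on the group are trivial, by the linear independence of characters. -/
theorem evalLaurent_eq_zero {A : Subgroup (Fin n → ℂˣ)} {c : AddMonoidAlgebra ℂ (Fin n → ℤ)}
    (hc : ∀ d ∈ A, evalLaurent d c = 0) {d : Fin n → ℂˣ}
    (hd : ∀ m ∈ trivialChars A, monomialChar m d = 1) : evalLaurent d c = 0 := by
  classical
  -- Group the monomials by their restriction to `A`; their values at `d` only depend on it.
  set res : (Fin n → ℤ) → (A →* ℂ) := fun m =>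
    (Units.coeHom ℂ).comp ((monomialChar m).comp A.subtype) with hres
  have hres' : ∀ m (a : A), res m a = (monomialChar m a : ℂ) := fun m a => rfl
  have hinj : ∀ m m', res m = res m' → monomialChar m d = monomialChar m' d := by
    intro m m' h
    have h1 : m - m' ∈ trivialChars A := by
      intro a ha
      have h2 := DFunLike.congr_fun h ⟨a, ha⟩
      rw [hres', hres'] at h2
      rw [sub_eq_add_neg, monomialChar_add, monomialChar_neg, Units.ext h2, mul_inv_cancel]
    have h3 := hd _ h1
    rwa [sub_eq_add_neg, monomialChar_add, monomialChar_neg, mul_inv_eq_one] at h3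
  set g : (A →* ℂ) → ℂ := fun χ =>
    if h : ∃ m, res m = χ then (monomialChar h.choose d : ℂ) else 0
  have hg : ∀ m, g (res m) = monomialChar m d := by
    intro m
    have h : ∃ m', res m' = res m := ⟨m, rfl⟩
    simp only [g, dif_pos h]
    rw [hinj _ _ h.choose_spec]
  have h0 : Finsupp.mapDomain res c.coeff = 0 := by
    refine (linearIndependent_iff.1 (linearIndependent_monoidHom A ℂ)) _ ?_
    funext a
    rw [Finsupp.linearCombination_apply, Finsupp.sum_mapDomain_index (by simp)
      (by intros; rw [add_smul]), Finsupp.sum, Finset.sum_apply, Pi.zero_apply, ← hc a a.2,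
      evalLaurent_apply, Finsupp.sum]
    rfl
  rw [evalLaurent_apply]
  have h1 := Finsupp.sum_mapDomain_index (f := res) (s := c.coeff) (h := fun χ a => a * g χ)
    (by simp) (by intros; rw [add_mul])
  rw [h0, Finsupp.sum_zero_index] at h1
  simp only [hg] at h1
  exact h1.symm

variable {G : Subgroup (GL (Fin n) ℂ)}

theorem exists_laurent_entry (P : GL (Fin n) ℂ) (i j : Fin n) :
    ∃ c, ∀ d, (diagGL P d).val i j = evalLaurent d c := by
  refine ⟨∑ k, (P⁻¹.val i k * P.val k j) • AddMonoidAlgebra.single (Pi.single k 1) 1, fun d => ?_⟩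
  rw [val_diagGL, Matrix.mul_assoc, Matrix.mul_apply, map_sum]
  refine Finset.sum_congr rfl fun k _ => ?_
  rw [map_smul, evalLaurent_single, Matrix.diagonal_mul, smul_eq_mul, monomialChar_apply,
    Finset.prod_eq_single k]
  · simp; ring
  · intro l _ hl
    simp [Pi.single_eq_of_ne hl]
  · simp

theorem exists_laurent_inv_entry (P : GL (Fin n) ℂ) (i j : Fin n) :
    ∃ c, ∀ d, ((diagGL P d)⁻¹).val i j = evalLaurent d c := by
  refine ⟨∑ k, (P⁻¹.val i k * P.val k j) • AddMonoidAlgebra.single (Pi.single k (-1)) 1,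
    fun d => ?_⟩
  rw [← map_inv, val_diagGL, Matrix.mul_assoc, Matrix.mul_apply, map_sum]
  refine Finset.sum_congr rfl fun k _ => ?_
  rw [map_smul, evalLaurent_single, Matrix.diagonal_mul, smul_eq_mul, monomialChar_apply,
    Finset.prod_eq_single k]
  · simp; ring
  · intro l _ hl
    simp [Pi.single_eq_of_ne hl]
  · simp

/-- A regular function restricts to a Laurent polynomial on diagonal matrices. -/
theorem exists_laurent (P : GL (Fin n) ℂ) {f : G → ℂ} (hf : f ∈ regularFunctions G) :
    ∃ c, ∀ d (h : diagGL P d ∈ G), f ⟨diagGL P d, h⟩ = evalLaurent d c := by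
  induction hf using Algebra.adjoin_induction with
  | mem f hf =>
    rcases hf with ⟨⟨i, j⟩, rfl⟩ | ⟨⟨i, j⟩, rfl⟩
    · obtain ⟨c, hc⟩ := exists_laurent_entry P i j
      exact ⟨c, fun d h => hc d⟩
    · obtain ⟨c, hc⟩ := exists_laurent_inv_entry P i j
      exact ⟨c, fun d h => hc d⟩
  | algebraMap r => exact ⟨algebraMap ℂ _ r, fun d h => by rw [AlgHom.commutes]; rfl⟩
  | add f h _ _ hf hh =>
    obtain ⟨c, hc⟩ := hf
    obtain ⟨c', hc'⟩ := hh
    exact ⟨c + c', fun d h => by rw [map_add, ← hc d h, ← hc' d h]; rfl⟩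
  | mul f h _ _ hf hh =>
    obtain ⟨c, hc⟩ := hf
    obtain ⟨c', hc'⟩ := hh
    exact ⟨c * c', fun d h => by rw [map_mul, ← hc d h, ← hc' d h]; rfl⟩

theorem exists_laurent_eval (P : GL (Fin n) ℂ) (p : MvPolynomial (Fin n × Fin n) ℂ) :
    ∃ c, ∀ d, MvPolynomial.eval (fun ij => (diagGL P d).val ij.1 ij.2) p = evalLaurent d c := by
  induction p using MvPolynomial.induction_on with
  | C a => exact ⟨algebraMap ℂ _ a, fun d => by rw [AlgHom.commutes, MvPolynomial.eval_C]; rfl⟩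
  | add p q hp hq =>
    obtain ⟨c, hc⟩ := hp
    obtain ⟨c', hc'⟩ := hq
    exact ⟨c + c', fun d => by rw [map_add, map_add, hc, hc']⟩
  | mul_X p i hp =>
    obtain ⟨c, hc⟩ := hp
    obtain ⟨c', hc'⟩ := exists_laurent_entry P i.1 i.2
    exact ⟨c * c', fun d => by rw [map_mul, map_mul, hc, MvPolynomial.eval_X, hc']⟩

/-- The diagonal matrices in a subgroup of `G`. -/
noncomputable def diagPart (P : GL (Fin n) ℂ) (A : Subgroup G) : Subgroup (Fin n → ℂˣ) :=
  (A.map G.subtype).comap (diagGL P)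

theorem mem_diagPart {P : GL (Fin n) ℂ} {A : Subgroup G} {d : Fin n → ℂˣ} :
    d ∈ diagPart P A ↔ ∃ h : diagGL P d ∈ G, (⟨diagGL P d, h⟩ : G) ∈ A := by
  constructor
  · rintro ⟨a, ha, he⟩
    have h : diagGL P d ∈ G := by rw [← he]; exact a.2
    have e : a = ⟨diagGL P d, h⟩ := Subtype.ext he
    exact ⟨h, e ▸ ha⟩
  · rintro ⟨h, ha⟩
    exact ⟨_, ha, rfl⟩

/-- The diagonal part of a closed group is cut out by characters. -/
theorem mem_diagPart_iff (hG : IsZariskiClosed G) (P : GL (Fin n) ℂ) {A : Subgroup G}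
    (hA : IsClosedIn A) (d : Fin n → ℂˣ) :
    d ∈ diagPart P A ↔ ∀ m ∈ trivialChars (diagPart P A), monomialChar m d = 1 := by
  refine ⟨fun hd m hm => hm d hd, fun hd => ?_⟩
  obtain ⟨S, hS⟩ := hG
  obtain ⟨F, hF, hAF⟩ := hA
  have h1 : diagGL P d ∈ G := by
    rw [hS]
    intro p hp
    obtain ⟨c, hc⟩ := exists_laurent_eval P p
    rw [hc]
    refine evalLaurent_eq_zero (fun a ha => ?_) hd
    obtain ⟨h, -⟩ := mem_diagPart.1 ha
    rw [← hc]
    exact (hS _).1 h p hp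
  refine mem_diagPart.2 ⟨h1, ?_⟩
  rw [hAF]
  intro f hf
  obtain ⟨c, hc⟩ := exists_laurent P (hF hf)
  rw [hc]
  refine evalLaurent_eq_zero (fun a ha => ?_) hd
  obtain ⟨h, ha'⟩ := mem_diagPart.1 ha
  rw [← hc a h]
  exact (hAF _).1 ha' f hf

end Characters

/-! ### The identity component of a diagonalizable group -/

section IdentityComponent

variable {n : ℕ} {G : Subgroup (GL (Fin n) ℂ)}

/-- The Lie algebra of the group of diagonal matrices cut out by the characters in `Λ`. -/
def diagLie (Λ : AddSubgroup (Fin n → ℤ)) : Submodule ℂ (Fin n → ℂ) where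
  carrier := {v | ∀ m ∈ Λ, ∑ i, (m i : ℂ) * v i = 0}
  zero_mem' m _ := by simp
  add_mem' {v w} hv hw m hm := by
    simp only [Pi.add_apply, mul_add, Finset.sum_add_distrib, hv m hm, hw m hm, add_zero]
  smul_mem' c v hv m hm := by
    simp only [Pi.smul_apply, smul_eq_mul, mul_left_comm _ c, ← Finset.mul_sum, hv m hm, mul_zero]

/-- The linear version of `diagGL`. -/
noncomputable def diagMat (P : GL (Fin n) ℂ) : (Fin n → ℂ) →ₗ[ℂ] Matrix (Fin n) (Fin n) ℂ where
  toFun v := P⁻¹.val * Matrix.diagonal v * P.val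
  map_add' v w := by
    have h : Matrix.diagonal (v + w) = Matrix.diagonal v + Matrix.diagonal w :=
      (Matrix.diagonal_add v w).symm
    rw [h, mul_add, add_mul]
  map_smul' c v := by rw [Matrix.diagonal_smul]; simp

theorem diagMat_apply (P : GL (Fin n) ℂ) (v : Fin n → ℂ) :
    diagMat P v = P⁻¹.val * Matrix.diagonal v * P.val := rfl

theorem conj_diagMat (P : GL (Fin n) ℂ) (v : Fin n → ℂ) :
    P.val * diagMat P v * P⁻¹.val = Matrix.diagonal v := by
  rw [diagMat_apply]
  simp only [Matrix.mul_assoc, Units.mul_inv, mul_one]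
  rw [← Matrix.mul_assoc, Units.mul_inv, one_mul]

/-- Entrywise exponentials. -/
noncomputable def expDiag (v : Fin n → ℂ) : Fin n → ℂˣ := fun i =>
  Units.mk0 (Complex.exp (v i)) (Complex.exp_ne_zero _)

theorem expGL_diagMat (P : GL (Fin n) ℂ) (v : Fin n → ℂ) :
    expGL (diagMat P v) = diagGL P (expDiag v) := by
  have h := conj_expGL P⁻¹ (Matrix.diagonal v)
  rw [inv_inv] at h
  change expGL (P⁻¹.val * Matrix.diagonal v * P.val) = _
  rw [← h]
  apply Units.ext
  rw [Units.val_mul, Units.val_mul, val_expGL, exp_diagonal_apply]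
  rfl

theorem monomialChar_expDiag (m : Fin n → ℤ) (v : Fin n → ℂ) :
    (monomialChar m (expDiag v) : ℂ) = Complex.exp (∑ i, (m i : ℂ) * v i) := by
  rw [monomialChar_apply, Complex.exp_sum, Units.coe_prod]
  refine Finset.prod_congr rfl fun i _ => ?_
  rw [Complex.exp_int_mul]
  simp [expDiag]

theorem expDiag_add (v w : Fin n → ℂ) : expDiag (v + w) = expDiag v * expDiag w := by
  funext i
  exact Units.ext (Complex.exp_add _ _)

theorem expDiag_neg (v : Fin n → ℂ) : expDiag (-v) = (expDiag v)⁻¹ := by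
  funext i
  exact Units.ext (by simp [expDiag, Complex.exp_neg])

theorem expDiag_zero : expDiag (0 : Fin n → ℂ) = 1 := by
  funext i
  exact Units.ext (by simp [expDiag])

/-- A linear function with values in `2πiℤ` on a line vanishes on it. -/
theorem eq_zero_of_exp_eq_one {a : ℂ} (h : ∀ s : ℂ, Complex.exp (s * a) = 1) : a = 0 := by
  have h1 : HasDerivAt (fun s : ℂ => Complex.exp (s * a)) (Complex.exp (0 * a) * (1 * a)) 0 :=
    ((hasDerivAt_id (0 : ℂ)).mul_const a).cexp
  rw [funext h, zero_mul, Complex.exp_zero, one_mul, one_mul] at h1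
  exact h1.unique (hasDerivAt_const _ _)

variable (hG : IsZariskiClosed G) {P : GL (Fin n) ℂ} {A : Subgroup G} (hA : IsClosedIn A)
include hG hA

theorem expDiag_mem {v : Fin n → ℂ} (hv : v ∈ diagLie (trivialChars (diagPart P A))) :
    expDiag v ∈ diagPart P A := by
  rw [mem_diagPart_iff hG P hA]
  intro m hm
  apply Units.ext
  rw [monomialChar_expDiag, hv m hm, Complex.exp_zero, Units.val_one]

theorem mem_diagLie_iff {v : Fin n → ℂ} :
    v ∈ diagLie (trivialChars (diagPart P A)) ↔ ∀ s : ℂ, expDiag (s • v) ∈ diagPart P A := by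
  constructor
  · exact fun hv s => expDiag_mem hG hA (Submodule.smul_mem _ s hv)
  · intro h m hm
    refine eq_zero_of_exp_eq_one fun s => ?_
    have h1 := congrArg Units.val (hm _ (h s))
    rw [monomialChar_expDiag, Units.val_one] at h1
    rw [← h1, Finset.mul_sum]
    congr 1
    exact Finset.sum_congr rfl fun i _ => by simp only [Pi.smul_apply, smul_eq_mul]; ring

omit hG hA in
/-- The identity component of a closed group of diagonal matrices is the image of its Lie algebra
under the exponential map: near the identity the logarithm of an element of the group lies in the
Lie algebra, since finitely many characters cut out the group. -/
theorem exists_eq_expGL (hd : ∀ a ∈ A, (P * (a : GL (Fin n) ℂ) * P⁻¹).val.IsDiag) {a : G}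
    (ha : a ∈ identityComponent A) :
    ∃ v ∈ diagLie (trivialChars (diagPart P A)), (a : GL (Fin n) ℂ) = expGL (diagMat P v) := by
  set Λ := trivialChars (diagPart P A) with hΛ
  set E : Subgroup A :=
    { carrier := {a | ∃ v ∈ diagLie Λ, (a : GL (Fin n) ℂ) = diagGL P (expDiag v)}
      one_mem' := ⟨0, zero_mem _, by rw [expDiag_zero, map_one]; rfl⟩
      mul_mem' := by
        rintro a b ⟨v, hv, hav⟩ ⟨w, hw, hbw⟩
        exact ⟨v + w, add_mem hv hw, by rw [expDiag_add, map_mul, ← hav, ← hbw]; rfl⟩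
      inv_mem' := by
        rintro a ⟨v, hv, hav⟩
        exact ⟨-v, neg_mem hv, by rw [expDiag_neg, map_inv, ← hav]; rfl⟩ } with hE
  -- An open subgroup is closed, so that it suffices to show that the image `E` is open.
  have hEo : IsOpen (E : Set A) := by
    refine Subgroup.isOpen_of_mem_nhds E (g := 1) ?_
    obtain ⟨F, hF⟩ : Λ.toIntSubmodule.FG := IsNoetherian.noetherian _
    set d : A → Fin n → ℂ := fun a i => (P * (a : GL (Fin n) ℂ) * P⁻¹).val i i with hdd
    have hdc : ∀ i, Continuous fun a => d a i := by
      intro i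
      have : Continuous fun a : A => (P * (a : GL (Fin n) ℂ) * P⁻¹).val := by
        refine Units.continuous_val.comp ?_
        exact (continuous_const.mul (continuous_subtype_val.comp continuous_subtype_val)).mul
          continuous_const
      exact (continuous_apply i).comp ((continuous_apply i).comp this)
    have hd1 : ∀ i, d 1 i = 1 := by
      intro i
      have : P * ((1 : A) : GL (Fin n) ℂ) * P⁻¹ = 1 := by simp
      simp only [hdd, this]
      simp
    have hlog : ∀ i, ContinuousAt (fun a => Complex.log (d a i)) 1 := by
      intro i
      refine ContinuousAt.clog (hdc i).continuousAt ?_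
      rw [hd1]
      exact Complex.one_mem_slitPlane
    have hsmall : ∀ m ∈ F, ∀ᶠ a in 𝓝 (1 : A),
        ‖∑ i, (m i : ℂ) * Complex.log (d a i)‖ < 1 := by
      intro m _
      have hc : ContinuousAt (fun a => ‖∑ i, (m i : ℂ) * Complex.log (d a i)‖) 1 :=
        (tendsto_finsetSum _ fun i _ => tendsto_const_nhds.mul (hlog i)).norm
      refine hc.eventually_lt continuousAt_const ?_
      simp [hd1]
    have hall := (Filter.eventually_all_finset F).2 hsmall
    refine Filter.mem_of_superset hall fun a ha => ?_
    obtain ⟨d', hd'⟩ := exists_diagGL_eq (hd a a.2)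
    have hda : ∀ i, d a i = d' i := by
      intro i
      simp only [hdd, hd', val_conj_diagGL, Matrix.diagonal_apply_eq]
    have hexp : expDiag (fun i => Complex.log (d a i)) = d' := by
      funext i
      apply Units.ext
      change Complex.exp (Complex.log (d a i)) = _
      rw [hda, Complex.exp_log (d' i).ne_zero]
    refine ⟨fun i => Complex.log (d a i), ?_, ?_⟩
    · have key : ∀ m ∈ Submodule.span ℤ (F : Set (Fin n → ℤ)),
          ∑ i, (m i : ℂ) * Complex.log (d a i) = 0 := by
        intro m hm
        induction hm using Submodule.span_induction with
        | mem m hm =>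
          have hmΛ : m ∈ Λ := by
            have : m ∈ Λ.toIntSubmodule := hF ▸ Submodule.subset_span hm
            exact this
          have h1 : (monomialChar m d' : ℂ) = 1 := by
            rw [hmΛ d' (mem_diagPart.2 ⟨hd' ▸ a.1.2, ?_⟩), Units.val_one]
            have : (⟨diagGL P d', hd' ▸ a.1.2⟩ : G) = a := Subtype.ext hd'.symm
            rw [this]
            exact a.2
          rw [← hexp, monomialChar_expDiag, Complex.exp_eq_one_iff] at h1
          -- The exponent is in `2πiℤ` and of norm less than one.
          obtain ⟨k, hk⟩ := h1
          have h2 := ha m hm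
          rw [hk] at h2 ⊢
          have h3 : k = 0 := by
            by_contra hk0
            have h4 : (1 : ℝ) ≤ |(k : ℝ)| := by exact_mod_cast Int.one_le_abs hk0
            have h5 : ‖(k : ℂ) * (2 * Real.pi * Complex.I)‖ = |(k : ℝ)| * (2 * Real.pi) := by
              simp [abs_of_pos Real.pi_pos]
            rw [h5] at h2
            nlinarith [Real.pi_gt_three]
          simp [h3]
        | zero => simp
        | add x y _ _ hx hy => simp [add_mul, Finset.sum_add_distrib, hx, hy]
        | smul c x _ hx =>
          simp only [Pi.smul_apply, smul_eq_mul, Int.cast_mul, mul_assoc, ← Finset.mul_sum, hx,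
            mul_zero]
      intro m hm
      exact key m (hF ▸ hm)
    · rw [hexp, ← hd']
  obtain ⟨b, hb, rfl⟩ := ha
  have hcl : IsClopen (E : Set A) := ⟨Subgroup.isClosed_of_isOpen E hEo, hEo⟩
  obtain ⟨v, hv, hbv⟩ := hcl.connectedComponent_subset (one_mem E) hb
  exact ⟨v, hv, by rw [expGL_diagMat, ← hbv]; rfl⟩

end IdentityComponent

/-! ### Subspaces that generate unipotent normal subgroups -/

section NilpotentAction

/-- For a Lie algebra that acts nilpotently on `V`, the products of sufficiently many of the
operators vanish. -/
theorem exists_pow_eq_bot {V Λ : Type*} [AddCommGroup V] [Module ℂ V] [LieRing Λ]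
    [LieAlgebra ℂ Λ] [LieRingModule Λ V] [LieModule ℂ Λ V] [hn : LieModule.IsNilpotent Λ V]
    {N : Submodule ℂ (Module.End ℂ V)}
    (hN : ∀ X ∈ N, ∃ x : Λ, LieModule.toEnd ℂ Λ V x = X) : ∃ k, N ^ k = ⊥ := by
  obtain ⟨k, hk⟩ := (LieModule.isNilpotent_iff ℂ Λ V).1 hn
  refine ⟨k, ?_⟩
  have key : ∀ k, ∀ X ∈ N ^ k, ∀ v, X v ∈ LieModule.lowerCentralSeries ℂ Λ V k := by
    intro k
    induction k with
    | zero =>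
      intro X _ v
      simp
    | succ k ih =>
      intro X hX v
      replace hX : X ∈ N * N ^ k := (pow_succ' N k) ▸ hX
      induction hX using Submodule.mul_induction_on' with
      | mem_mul_mem A hA B hB =>
        obtain ⟨x, rfl⟩ := hN A hA
        rw [LieModule.lowerCentralSeries_succ]
        exact LieSubmodule.lie_mem_lie (LieSubmodule.mem_top x) (ih B hB v)
      | add A _ B _ hA hB => exact add_mem hA hB
  rw [Submodule.eq_bot_iff]
  intro X hX
  apply LinearMap.ext; intro v
  have := key k X hX v
  rw [hk] at this
  exact this

end NilpotentAction

section UnipotentRadical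

variable {n : ℕ} {G : Subgroup (GL (Fin n) ℂ)}

theorem linear_mem_regular (l : Matrix (Fin n) (Fin n) ℂ →ₗ[ℂ] ℂ) :
    (fun g : G => l ((g : GL (Fin n) ℂ).val - 1)) ∈ regularFunctions G := by
  have key : (fun g : G => l ((g : GL (Fin n) ℂ).val - 1)) =
      (∑ i, ∑ j, l (Matrix.single i j 1) • (fun g : G => (g : GL (Fin n) ℂ).val i j)) -
        algebraMap ℂ (G → ℂ) (l 1) := by
    funext g
    rw [map_sub, Pi.sub_apply]
    congr 1
    conv_lhs => rw [Matrix.matrix_eq_sum_single (g : GL (Fin n) ℂ).val]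
    simp only [map_sum, Finset.sum_apply]
    refine Finset.sum_congr rfl fun i _ => Finset.sum_congr rfl fun j _ => ?_
    rw [Pi.smul_apply, smul_eq_mul, mul_comm, ← smul_eq_mul, ← map_smul, Matrix.smul_single,
      smul_eq_mul, mul_one]
  rw [key]
  exact sub_mem (sum_mem fun i _ => sum_mem fun j _ => Subalgebra.smul_mem _ (entry_mem i j) _)
    (Subalgebra.algebraMap_mem _ _)

/-- In a reductive group, a subspace of the Lie algebra that is stable under conjugation and that
consists of strictly triangular matrices for some flag vanishes: it generates an ideal `J` in the
algebra of matrices spanned by `G`, and the elements `g` of `G` with `g - 1 ∈ J` form a unipotent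
normal subgroup. -/
theorem eq_bot_of_pow_eq_bot (hr : IsConnectedReductive G)
    {N : Submodule ℂ (Matrix (Fin n) (Fin n) ℂ)} (hle : N ≤ LinearMap.range (toMat (G := G)))
    (hN : ∀ g : G, ∀ X ∈ N, (g : GL (Fin n) ℂ).val * X * (g⁻¹ : GL (Fin n) ℂ).val ∈ N)
    {k : ℕ} (hk : N ^ k = ⊥) : N = ⊥ := by
  set A : Submodule ℂ (Matrix (Fin n) (Fin n) ℂ) :=
    Submodule.span ℂ (Set.range fun g : G => (g : GL (Fin n) ℂ).val) with hA
  have hgA : ∀ g : G, (g : GL (Fin n) ℂ).val ∈ A := fun g => Submodule.subset_span ⟨g, rfl⟩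
  have h1A : (1 : Matrix (Fin n) (Fin n) ℂ) ∈ A := hgA 1
  have hAA : A * A ≤ A := by
    rw [hA, Submodule.span_mul_span, Submodule.span_le]
    rintro _ ⟨_, ⟨g, rfl⟩, _, ⟨h, rfl⟩, rfl⟩
    exact hgA (g * h)
  have hAN : A * N ≤ N * A := by
    rw [Submodule.mul_le]
    intro a ha X hX
    induction ha using Submodule.span_induction with
    | mem a ha =>
      obtain ⟨g, rfl⟩ := ha
      have : (g : GL (Fin n) ℂ).val * X =
          ((g : GL (Fin n) ℂ).val * X * (g⁻¹ : GL (Fin n) ℂ).val) * (g : GL (Fin n) ℂ).val := by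
        rw [mul_assoc, Units.inv_mul, mul_one]
      rw [this]
      exact Submodule.mul_mem_mul (hN g X hX) (hgA g)
    | zero => rw [zero_mul]; exact zero_mem _
    | add a b _ _ ha hb => rw [add_mul]; exact add_mem ha hb
    | smul c a _ ha => rw [smul_mul_assoc]; exact Submodule.smul_mem _ _ ha
  -- As `A N ≤ N A`, the product `N A` is a two-sided ideal of `A`, with `(N A)ᵏ ≤ Nᵏ A`.
  set J := N * A with hJ
  have hNJ : N ≤ J := fun X hX => by
    simpa using Submodule.mul_mem_mul hX h1A
  have hAJ : A * J ≤ J := by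
    rw [hJ, ← mul_assoc]
    refine (mul_le_mul' hAN le_rfl).trans ?_
    rw [mul_assoc]
    exact mul_le_mul' le_rfl hAA
  have hJA : J * A ≤ J := by
    rw [hJ, mul_assoc]
    exact mul_le_mul' le_rfl hAA
  have hJk : ∀ k, J ^ k ≤ N ^ k * A := by
    intro k
    induction k with
    | zero =>
      rw [pow_zero, pow_zero, one_mul, Submodule.one_le]
      exact h1A
    | succ k ih =>
      rw [pow_succ, pow_succ]
      refine (mul_le_mul' ih le_rfl).trans ?_
      rw [hJ, mul_assoc, ← mul_assoc A, mul_assoc (N ^ k)]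
      refine mul_le_mul' le_rfl ((mul_le_mul' hAN le_rfl).trans ?_)
      rw [mul_assoc]
      exact mul_le_mul' le_rfl hAA
  set U : Subgroup G :=
    { carrier := {g | (g : GL (Fin n) ℂ).val - 1 ∈ J}
      one_mem' := by simp
      mul_mem' := by
        intro g h hg hh
        have : ((g * h : G) : GL (Fin n) ℂ).val - 1 = ((g : GL (Fin n) ℂ).val - 1) *
            (h : GL (Fin n) ℂ).val + ((h : GL (Fin n) ℂ).val - 1) := by
          rw [Subgroup.coe_mul, Units.val_mul]
          noncomm_ring
        change _ ∈ J
        rw [this]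
        exact add_mem (hJA (Submodule.mul_mem_mul hg (hgA h))) hh
      inv_mem' := by
        intro g hg
        have : ((g⁻¹ : G) : GL (Fin n) ℂ).val - 1 =
            -((g⁻¹ : G) : GL (Fin n) ℂ).val * ((g : GL (Fin n) ℂ).val - 1) := by
          rw [mul_sub, neg_mul, Subgroup.coe_inv, Units.inv_mul]
          noncomm_ring
        change _ ∈ J
        rw [this, neg_mul]
        exact neg_mem (hAJ (Submodule.mul_mem_mul (hgA g⁻¹) hg)) } with hU
  have hmem : ∀ g : G, g ∈ U ↔ (g : GL (Fin n) ℂ).val - 1 ∈ J := fun g => Iff.rfl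
  have hnorm : U.Normal := ⟨fun u hu x => by
    rw [hmem] at hu ⊢
    have : ((x * u * x⁻¹ : G) : GL (Fin n) ℂ).val - 1 = (x : GL (Fin n) ℂ).val *
        ((u : GL (Fin n) ℂ).val - 1) * ((x⁻¹ : G) : GL (Fin n) ℂ).val := by
      rw [mul_sub, sub_mul, mul_one, Subgroup.coe_inv, Units.mul_inv]
      rfl
    rw [this]
    exact hJA (Submodule.mul_mem_mul (hAJ (Submodule.mul_mem_mul (hgA x) hu)) (hgA x⁻¹))⟩
  have hclosed : IsClosedIn U := by
    refine ⟨{f | ∃ l : Matrix (Fin n) (Fin n) ℂ →ₗ[ℂ] ℂ, J ≤ LinearMap.ker l ∧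
      f = fun g : G => l ((g : GL (Fin n) ℂ).val - 1)}, ?_, fun g => ?_⟩
    · rintro _ ⟨l, -, rfl⟩
      exact linear_mem_regular l
    · rw [hmem]
      constructor
      · rintro hg _ ⟨l, hl, rfl⟩
        exact hl hg
      · intro h
        by_contra hn
        obtain ⟨l, hl, hlJ⟩ := Submodule.exists_le_ker_of_notMem hn
        exact hl (h _ ⟨l, hlJ, rfl⟩)
  have hunip : ∀ u ∈ U, IsNilpotent ((u : GL (Fin n) ℂ).val - 1) := by
    intro u hu
    refine ⟨k, ?_⟩
    have h1 := hJk k (Submodule.pow_mem_pow J hu k)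
    rw [hk, Submodule.bot_mul] at h1
    exact h1
  have hbot := hr.unipotentRadical U hnorm hclosed hunip
  rw [Submodule.eq_bot_iff]
  intro X hX
  have hXG : ∀ s : ℂ, expGL (s • X) ∈ G := (mem_range_toMat hr.closed).1 (hle hX)
  -- The derivative `exp(s X) X` lies in `J`: linear functions vanishing on `J` are constant.
  have hexp : ∀ s : ℂ, exp (s • X) - 1 ∈ J := by
    intro s
    by_contra hn
    obtain ⟨l, hl, hlJ⟩ := Submodule.exists_le_ker_of_notMem hn
    apply hl
    have hd : ∀ s : ℂ, HasDerivAt (fun s : ℂ => l (exp (s • X) - 1)) 0 s := by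
      intro s
      have h1 : ∀ i j, HasDerivAt (fun s : ℂ => (exp (s • X) - 1) i j) ((exp (s • X) * X) i j) s :=
        fun i j => (hasDerivAt_exp_entry X i j s).sub_const _
      have h2 := hasDerivAt_of_linear h1 l
      have h3 : l (exp (s • X) * X) = 0 :=
        hlJ (hAN (Submodule.mul_mem_mul (hgA ⟨_, hXG s⟩) hX))
      rwa [h3] at h2
    have := is_const_of_deriv_eq_zero (𝕜 := ℂ) (fun s => (hd s).differentiableAt)
      (fun s => (hd s).deriv) s 0
    rw [this, zero_smul, exp_zero, sub_self, map_zero]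
  have h1 : ∀ s : ℂ, expG (s • (⟨X, hle hX⟩ : matLie hr.closed)) = 1 := by
    intro s
    have : expG (s • (⟨X, hle hX⟩ : matLie hr.closed)) ∈ U := hexp s
    rwa [hbot, Subgroup.mem_bot] at this
  have h2 := eq_zero_of_expG_eq_one h1
  exact congrArg Subtype.val h2

end UnipotentRadical

/-! ### The trace form -/

section InvariantForm

variable {L : Type*} [LieRing L] [LieAlgebra ℂ L] {H : Submodule ℂ L}
  {B : LinearMap.BilinForm ℂ L} (hinv : ∀ x y z, B ⁅x, y⁆ z = B x ⁅y, z⁆)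
include hinv

theorem form_eq_zero_of_invariant {χ χ' : Dual ℂ H} (h : χ + χ' ≠ 0) {x y : L}
    (hx : x ∈ weightSpace (L := L) ⊤ χ) (hy : y ∈ weightSpace (L := L) ⊤ χ') : B x y = 0 := by
  obtain ⟨a, ha⟩ : ∃ a, (χ + χ') a ≠ 0 := by
    by_contra! hcon
    exact h (LinearMap.ext hcon)
  have h1 := hinv x a y
  rw [← lie_skew, hx a trivial, hy a trivial, map_neg, map_smul, map_smul, LinearMap.neg_apply,
    LinearMap.smul_apply, smul_eq_mul, smul_eq_mul] at h1
  refine (mul_eq_zero.1 (?_ : (χ + χ') a * B x y = 0)).resolve_left ha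
  rw [LinearMap.add_apply]
  linear_combination -h1

/-- The weight components of an element of the radical of an invariant form are in the radical. -/
theorem exists_radical_decomposition (hsup : ⨆ χ : Dual ℂ H, weightSpace (L := L) ⊤ χ = ⊤) {x : L}
    (hx : ∀ y, B x y = 0) : ∃ f : Dual ℂ H →₀ L, (∀ χ, f χ ∈ weightSpace (L := L) ⊤ χ) ∧
      (f.sum fun _ y => y) = x ∧ ∀ χ y, B (f χ) y = 0 := by
  obtain ⟨f, hf, rfl⟩ := (Submodule.mem_iSup_iff_exists_finsupp _ x).1
    (show x ∈ ⨆ χ : Dual ℂ H, weightSpace (L := L) ⊤ χ by rw [hsup]; trivial)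
  refine ⟨f, hf, rfl, fun χ y => ?_⟩
  have hy : y ∈ ⨆ χ : Dual ℂ H, weightSpace (L := L) ⊤ χ := by rw [hsup]; trivial
  induction hy using Submodule.iSup_induction' with
  | mem ψ y hy =>
    by_cases h : χ + ψ = 0
    · have h1 := hx y
      rw [Finsupp.sum, map_sum, LinearMap.sum_apply] at h1
      by_cases hs : χ ∈ f.support
      · rw [Finset.sum_eq_single_of_mem χ hs] at h1
        · exact h1
        · intro χ' _ hne
          refine form_eq_zero_of_invariant hinv (fun h' => hne ?_) (hf χ') hy
          exact add_right_cancel (h'.trans h.symm)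
      · rw [Finsupp.notMem_support_iff.1 hs, map_zero, LinearMap.zero_apply]
    · exact form_eq_zero_of_invariant hinv h (hf χ) hy
  | zero => exact map_zero _
  | add y z _ _ hy hz => rw [map_add, hy, hz, add_zero]

end InvariantForm

section TraceForm

variable {n : ℕ} {G : Subgroup (GL (Fin n) ℂ)}

/-- The trace form of the standard representation. -/
noncomputable def traceB (hG : IsZariskiClosed G) : LinearMap.BilinForm ℂ (matLie hG) :=
  LinearMap.mk₂ ℂ (fun X Y => ((X : Matrix (Fin n) (Fin n) ℂ) * Y).trace)
    (fun X X' Y => by simp [add_mul]) (fun c X Y => by simp)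
    (fun X Y Y' => by simp [mul_add]) (fun c X Y => by simp)

variable {hG : IsZariskiClosed G}

theorem traceB_apply (X Y : matLie hG) :
    traceB hG X Y = ((X : Matrix (Fin n) (Fin n) ℂ) * Y).trace := rfl

theorem traceB_symm (X Y : matLie hG) : traceB hG X Y = traceB hG Y X := by
  rw [traceB_apply, traceB_apply, Matrix.trace_mul_comm]

theorem coe_lie (X Y : matLie hG) : ((⁅X, Y⁆ : matLie hG) : Matrix (Fin n) (Fin n) ℂ) =
    (X : Matrix (Fin n) (Fin n) ℂ) * Y - Y * X := rfl

theorem traceB_lie (X Y Z : matLie hG) : traceB hG ⁅X, Y⁆ Z = traceB hG X ⁅Y, Z⁆ := by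
  rw [traceB_apply, traceB_apply, coe_lie, coe_lie, sub_mul, mul_sub, Matrix.trace_sub,
    Matrix.trace_sub, mul_assoc, mul_assoc, Matrix.trace_mul_comm (Y : Matrix (Fin n) (Fin n) ℂ),
    mul_assoc]

theorem traceB_adj (x : G) (X Y : matLie hG) :
    traceB hG (adj hG x X) (adj hG x Y) = traceB hG X Y := by
  rw [traceB_apply, traceB_apply, coe_adj, coe_adj]
  have h : (x : GL (Fin n) ℂ).val * (X : Matrix (Fin n) (Fin n) ℂ) * (x⁻¹ : GL (Fin n) ℂ).val *
      ((x : GL (Fin n) ℂ).val * (Y : Matrix (Fin n) (Fin n) ℂ) * (x⁻¹ : GL (Fin n) ℂ).val) =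
      (x : GL (Fin n) ℂ).val * ((X : Matrix (Fin n) (Fin n) ℂ) * Y) *
        (x⁻¹ : GL (Fin n) ℂ).val := by
    simp only [mul_assoc]
    rw [← mul_assoc (x⁻¹ : GL (Fin n) ℂ).val, Units.inv_mul, one_mul]
  rw [h, Matrix.trace_mul_comm, ← mul_assoc, Units.inv_mul, one_mul]

/-- A matrix of nonzero weight is nilpotent. -/
theorem isNilpotent_of_mem_weightSpace {H : Submodule ℂ (matLie hG)} {χ : Dual ℂ H} (hχ : χ ≠ 0)
    {X : matLie hG} (hX : X ∈ weightSpace (L := matLie hG) ⊤ χ) :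
    IsNilpotent (X : Matrix (Fin n) (Fin n) ℂ) := by
  obtain ⟨a, ha⟩ : ∃ a, χ a = 1 := by
    obtain ⟨a, ha⟩ : ∃ a, χ a ≠ 0 := by
      by_contra! hcon
      exact hχ (LinearMap.ext hcon)
    exact ⟨(χ a)⁻¹ • a, by rw [map_smul, smul_eq_mul, inv_mul_cancel₀ ha]⟩
  set M : Matrix (Fin n) (Fin n) ℂ := X.1
  set A : Matrix (Fin n) (Fin n) ℂ := (a : matLie hG).1
  have h1 : A * M - M * A = M := by
    have := congrArg (Subtype.val) (hX a trivial)
    rwa [ha, one_smul] at this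
  -- The powers of `M` are eigenvectors of `ad A` with distinct eigenvalues.
  set D : Module.End ℂ (Matrix (Fin n) (Fin n) ℂ) :=
    LinearMap.mulLeft ℂ A - LinearMap.mulRight ℂ A
  have h2 : ∀ k : ℕ, D (M ^ k) = (k : ℂ) • M ^ k := by
    intro k
    induction k with
    | zero => simp [D]
    | succ k ih =>
      have h3 : A * M ^ k - M ^ k * A = (k : ℂ) • M ^ k := ih
      change A * M ^ (k + 1) - M ^ (k + 1) * A = _
      have h4 : A * M ^ (k + 1) - M ^ (k + 1) * A =
          (A * M ^ k - M ^ k * A) * M + M ^ k * (A * M - M * A) := by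
        rw [pow_succ]; noncomm_ring
      rw [h4, h3, h1, pow_succ, smul_mul_assoc]
      push_cast
      rw [add_smul, one_smul]
  by_contra hn
  have hne : ∀ k : ℕ, M ^ k ≠ 0 := fun k hk => hn ⟨k, hk⟩
  have hev : ∀ k : ℕ, D.HasEigenvalue (k : ℂ) := fun k =>
    Module.End.hasEigenvalue_of_hasEigenvector
      (x := M ^ k) ⟨Module.End.mem_eigenspace_iff.2 (h2 k), hne k⟩
  have hfin := Module.End.finite_hasEigenvalue D
  refine Set.infinite_of_injective_forall_mem (f := fun k : ℕ => (k : ℂ)) Nat.cast_injective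
    (s := D.HasEigenvalue) hev hfin

/-- The span of the brackets of matrices in a Lie algebra on which the trace form vanishes is
nilpotent (a theorem of Cartan). -/
theorem exists_pow_span_lie_eq_bot (K : LieSubalgebra ℂ (Matrix (Fin n) (Fin n) ℂ))
    (hK : ∀ X ∈ K, ∀ Y ∈ K, (X * Y).trace = 0) :
    ∃ k, (Submodule.span ℂ {Z | ∃ X ∈ K, ∃ Y ∈ K, X * Y - Y * X = Z}) ^ k = ⊥ := by
  set K' : LieSubalgebra ℂ (Module.End ℂ (Fin n → ℂ)) :=
    K.map (lieEquivMatrix' (n := Fin n) (R := ℂ)).symm.toLieHom with hK'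
  have hmem : ∀ x : K', ∃ X ∈ K, Matrix.toLin' X = x := fun x => x.2
  have htr : LieModule.traceForm ℂ K' (Fin n → ℂ) = 0 := by
    ext x y
    obtain ⟨X, hX, hX'⟩ := hmem x
    obtain ⟨Y, hY, hY'⟩ := hmem y
    rw [LieModule.traceForm_apply_apply]
    change LinearMap.trace ℂ _ ((x : Module.End ℂ (Fin n → ℂ)) ∘ₗ (y : Module.End ℂ (Fin n → ℂ))) = 0
    rw [← hX', ← hY', ← Matrix.toLin'_mul, Matrix.trace_toLin'_eq, hK X hX Y hY]
  have hnil := LieModule.isNilpotent_derivedSeries_of_traceForm_eq_zero htr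
  set N := Submodule.span ℂ {Z | ∃ X ∈ K, ∃ Y ∈ K, X * Y - Y * X = Z} with hN
  obtain ⟨k, hk⟩ := exists_pow_eq_bot (hn := hnil) (N := N.map
    ((Matrix.toLinAlgEquiv' : Matrix (Fin n) (Fin n) ℂ ≃ₐ[ℂ] _).toLinearMap)) (by
      rintro _ ⟨Z, hZ, rfl⟩
      induction hZ using Submodule.span_induction with
      | mem Z hZ =>
        obtain ⟨X, hX, Y, hY, rfl⟩ := hZ
        have hX' : Matrix.toLin' X ∈ K' := ⟨X, hX, rfl⟩
        have hY' : Matrix.toLin' Y ∈ K' := ⟨Y, hY, rfl⟩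
        refine ⟨⟨⁅(⟨_, hX'⟩ : K'), (⟨_, hY'⟩ : K')⁆, ?_⟩, ?_⟩
        · exact LieSubmodule.lie_mem_lie (LieSubmodule.mem_top _) (LieSubmodule.mem_top _)
        · apply LinearMap.ext; intro v
          change Matrix.toLin' X (Matrix.toLin' Y v) - Matrix.toLin' Y (Matrix.toLin' X v) =
            Matrix.toLin' (X * Y - Y * X) v
          simp
      | zero => exact ⟨0, by simp⟩
      | add X Y _ _ hX hY =>
        obtain ⟨x, hx⟩ := hX
        obtain ⟨y, hy⟩ := hY
        exact ⟨x + y, by rw [map_add, map_add, hx, hy]⟩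
      | smul c X _ hX =>
        obtain ⟨x, hx⟩ := hX
        exact ⟨c • x, by rw [map_smul, map_smul, hx]⟩)
  refine ⟨k, ?_⟩
  have h1 : (N ^ k).map
      ((Matrix.toLinAlgEquiv' : Matrix (Fin n) (Fin n) ℂ ≃ₐ[ℂ] _).toLinearMap) = ⊥ := by
    rw [← hk]
    exact Submodule.map_pow N (Matrix.toLinAlgEquiv' : Matrix (Fin n) (Fin n) ℂ ≃ₐ[ℂ] _).toAlgHom k
  exact (Submodule.map_eq_bot_iff (e := (Matrix.toLinAlgEquiv' :
    Matrix (Fin n) (Fin n) ℂ ≃ₐ[ℂ] _).toLinearEquiv)).1 h1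

/-- Commuting nilpotent matrices have vanishing products (Engel's theorem). -/
theorem exists_pow_eq_bot_of_commute {N : Submodule ℂ (Matrix (Fin n) (Fin n) ℂ)}
    (hc : ∀ X ∈ N, ∀ Y ∈ N, X * Y = Y * X) (hnil : ∀ X ∈ N, IsNilpotent X) :
    ∃ k, N ^ k = ⊥ := by
  set K : LieSubalgebra ℂ (Matrix (Fin n) (Fin n) ℂ) :=
    { N with
      lie_mem' := fun {X Y} hX hY => by
        rw [LieRing.of_associative_ring_bracket, hc X hX Y hY, sub_self]
        exact zero_mem N }
  set K' : LieSubalgebra ℂ (Module.End ℂ (Fin n → ℂ)) :=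
    K.map (lieEquivMatrix' (n := Fin n) (R := ℂ)).symm.toLieHom with hK'
  have hmem : ∀ x : K', ∃ X ∈ N, Matrix.toLin' X = x := fun x => x.2
  have hnil : LieModule.IsNilpotent K' (Fin n → ℂ) := by
    rw [LieModule.isNilpotent_iff_forall' (R := ℂ)]
    intro x
    obtain ⟨X, hX, hX'⟩ := hmem x
    change IsNilpotent (x : Module.End ℂ (Fin n → ℂ))
    rw [← hX']
    exact (hnil X hX).map (Matrix.toLinAlgEquiv' : Matrix (Fin n) (Fin n) ℂ ≃ₐ[ℂ] _)
  obtain ⟨k, hk⟩ := exists_pow_eq_bot (hn := hnil) (N := N.map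
    ((Matrix.toLinAlgEquiv' : Matrix (Fin n) (Fin n) ℂ ≃ₐ[ℂ] _).toLinearMap)) (by
      rintro _ ⟨Z, hZ, rfl⟩
      exact ⟨⟨Matrix.toLin' Z, ⟨Z, hZ, rfl⟩⟩, rfl⟩)
  refine ⟨k, ?_⟩
  have h1 : (N ^ k).map
      ((Matrix.toLinAlgEquiv' : Matrix (Fin n) (Fin n) ℂ ≃ₐ[ℂ] _).toLinearMap) = ⊥ := by
    rw [← hk]
    exact Submodule.map_pow N (Matrix.toLinAlgEquiv' : Matrix (Fin n) (Fin n) ℂ ≃ₐ[ℂ] _).toAlgHom k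
  exact (Submodule.map_eq_bot_iff (e := (Matrix.toLinAlgEquiv' :
    Matrix (Fin n) (Fin n) ℂ ≃ₐ[ℂ] _).toLinearEquiv)).1 h1

end TraceForm

/-! ### The Cartan subalgebra -/

section Cartan

variable {n : ℕ}

/-- Conjugation by `P`. -/
noncomputable def conjP (P : GL (Fin n) ℂ) :
    Matrix (Fin n) (Fin n) ℂ →ₗ[ℂ] Matrix (Fin n) (Fin n) ℂ where
  toFun X := P.val * X * P⁻¹.val
  map_add' X Y := by simp [mul_add, add_mul]
  map_smul' c X := by simp

theorem conjP_apply (P : GL (Fin n) ℂ) (X : Matrix (Fin n) (Fin n) ℂ) :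
    conjP P X = P.val * X * P⁻¹.val := rfl

theorem conjP_mul (P : GL (Fin n) ℂ) (X Y : Matrix (Fin n) (Fin n) ℂ) :
    conjP P (X * Y) = conjP P X * conjP P Y := by
  simp only [conjP_apply, mul_assoc]
  rw [← mul_assoc P⁻¹.val P.val, Units.inv_mul, one_mul]

theorem trace_conjP (P : GL (Fin n) ℂ) (X : Matrix (Fin n) (Fin n) ℂ) :
    (conjP P X).trace = X.trace := by
  rw [conjP_apply, Matrix.trace_mul_comm, ← mul_assoc, Units.inv_mul, one_mul]

theorem conjP_injective (P : GL (Fin n) ℂ) : Function.Injective (conjP P) := by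
  intro X Y h
  have h2 : ∀ X, P⁻¹.val * conjP P X * P.val = X := by
    intro X
    rw [conjP_apply]
    simp only [mul_assoc, Units.inv_mul, mul_one]
    rw [← mul_assoc, Units.inv_mul, one_mul]
  rw [← h2 X, h, h2]

theorem isDiag_iff_exists_diagMat {P : GL (Fin n) ℂ} {X : Matrix (Fin n) (Fin n) ℂ} :
    (conjP P X).IsDiag ↔ X = diagMat P fun i => conjP P X i i := by
  constructor
  · intro h
    apply conjP_injective P
    conv_rhs => rw [conjP_apply, conj_diagMat]
    exact (Matrix.IsDiag.diagonal_diag h).symm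
  · intro h
    have h2 : conjP P X = Matrix.diagonal fun i => conjP P X i i := by
      conv_lhs => rw [h, conjP_apply, conj_diagMat]
    rw [h2]
    exact Matrix.isDiag_diagonal _

variable {G : Subgroup (GL (Fin n) ℂ)}

/-- The elements of `Lie(G)` that become diagonal after conjugation by `P`. -/
noncomputable def cartan (hG : IsZariskiClosed G) (P : GL (Fin n) ℂ) : Submodule ℂ (matLie hG) where
  carrier := {X | (conjP P (X : Matrix (Fin n) (Fin n) ℂ)).IsDiag}
  add_mem' {X Y} hX hY := by
    change (conjP P ((X : Matrix (Fin n) (Fin n) ℂ) + Y)).IsDiag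
    rw [map_add]
    exact Matrix.IsDiag.add hX hY
  zero_mem' := by
    change (conjP P 0).IsDiag
    rw [map_zero]
    exact Matrix.isDiag_zero
  smul_mem' c X hX := by
    change (conjP P (c • (X : Matrix (Fin n) (Fin n) ℂ))).IsDiag
    rw [map_smul]
    exact Matrix.IsDiag.smul c hX

variable {hG : IsZariskiClosed G} {P : GL (Fin n) ℂ}

theorem mem_cartan {X : matLie hG} :
    X ∈ cartan hG P ↔ (conjP P (X : Matrix (Fin n) (Fin n) ℂ)).IsDiag := Iff.rfl

/-- The diagonal entries of an element of the Cartan subalgebra, as functionals. -/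
noncomputable def coord (i : Fin n) : Dual ℂ (cartan hG P) where
  toFun h := conjP P (h : matLie hG) i i
  map_add' h h' := by simp
  map_smul' c h := by simp

theorem coord_apply (i : Fin n) (h : cartan hG P) :
    coord i h = conjP P (h : matLie hG) i i := rfl

theorem conjP_coe (h : cartan hG P) :
    conjP P (h : matLie hG) = Matrix.diagonal fun i => coord i h :=
  (Matrix.IsDiag.diagonal_diag h.2).symm

theorem coe_eq_diagMat (h : cartan hG P) :
    ((h : matLie hG) : Matrix (Fin n) (Fin n) ℂ) = diagMat P fun i => coord i h :=
  isDiag_iff_exists_diagMat.1 h.2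

theorem eq_zero_of_coord {h : cartan hG P} (h0 : ∀ i, coord i h = 0) : h = 0 := by
  apply Subtype.ext; apply Subtype.ext
  rw [coe_eq_diagMat, (funext h0 : (fun i => coord i h) = 0), map_zero]
  rfl

theorem conjP_smul_apply (P : GL (Fin n) ℂ) (c : ℂ) (X : matLie hG) (i j : Fin n) :
    conjP P (c • X : matLie hG) i j = c * conjP P X i j :=
  congrFun (congrFun (map_smul (conjP P) c (X : Matrix (Fin n) (Fin n) ℂ)) i) j

theorem conjP_lie_apply (h : cartan hG P) (X : matLie hG) (i j : Fin n) :
    conjP P (⁅(h : matLie hG), X⁆ : matLie hG) i j =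
      (coord i h - coord j h) * conjP P X i j := by
  rw [coe_lie, map_sub, conjP_mul, conjP_mul, conjP_coe, Matrix.sub_apply, Matrix.diagonal_mul,
    Matrix.mul_diagonal]
  ring

theorem eq_of_conjP_ne_zero {χ : Dual ℂ (cartan hG P)} {X : matLie hG}
    (hX : X ∈ weightSpace (L := matLie hG) ⊤ χ) {i j : Fin n} (hij : conjP P X i j ≠ 0) :
    χ = coord i - coord j := by
  ext h
  have h1 := congrArg (fun Y : matLie hG => conjP P Y i j) (hX h trivial)
  simp only [conjP_lie_apply] at h1
  rw [conjP_smul_apply] at h1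
  exact (mul_right_cancel₀ hij h1).symm

theorem mem_weightSpace_of_conjP {χ : Dual ℂ (cartan hG P)} {X : matLie hG}
    (h : ∀ i j, conjP P X i j ≠ 0 → χ = coord i - coord j) :
    X ∈ weightSpace (L := matLie hG) ⊤ χ := by
  intro a _
  apply Subtype.ext
  apply conjP_injective P
  ext i j
  rw [conjP_lie_apply, conjP_smul_apply]
  by_cases h0 : conjP P X i j = 0
  · rw [h0, mul_zero, mul_zero]
  · rw [h i j h0]; rfl

theorem exists_conjP_ne_zero {X : matLie hG} (hX : X ≠ 0) : ∃ i j, conjP P X i j ≠ 0 := by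
  by_contra! h
  refine hX (Subtype.ext (conjP_injective P ?_))
  ext i j
  rw [h i j]
  simp

theorem lie_cartan (h h' : cartan hG P) : ⁅(h : matLie hG), (h' : matLie hG)⁆ = 0 := by
  apply Subtype.ext
  apply conjP_injective P
  ext i j
  rw [conjP_lie_apply, conjP_coe]
  by_cases hij : i = j
  · subst hij; simp
  · simp [Matrix.diagonal_apply_ne _ hij]

/-- Every element of `Lie(G)` is a sum of weight vectors. -/
theorem iSup_weightSpace_cartan :
    ⨆ χ : Dual ℂ (cartan hG P), weightSpace (L := matLie hG) ⊤ χ = ⊤ := by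
  set f : cartan hG P → Module.End ℂ (matLie hG) := fun h => LieAlgebra.ad ℂ (matLie hG) h
  have hf : ∀ h h', Commute (f h) (f h') := by
    intro h h'
    rw [commute_iff_lie_eq, ← LieHom.map_lie, lie_cartan, map_zero]
  have h1 := Module.End.iSup_iInf_maxGenEigenspace_eq_top_of_iSup_maxGenEigenspace_eq_top_of_commute
    f (fun h h' _ => hf h h') fun h => Module.End.iSup_maxGenEigenspace_eq_top (f h)
  rw [eq_top_iff, ← h1]
  -- The operators `ad h` multiply the entries of `P X P⁻¹` by scalars: a generalized eigenvector is
  -- an eigenvector.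
  refine iSup_le fun χ X hX => ?_
  by_cases h0 : X = 0
  · rw [h0]; exact zero_mem _
  obtain ⟨i, j, hij⟩ := exists_conjP_ne_zero (P := P) h0
  refine Submodule.mem_iSup_of_mem (coord i - coord j) (mem_weightSpace_of_conjP fun k l hkl => ?_)
  have key : ∀ k l, conjP P X k l ≠ 0 → ∀ h : cartan hG P, χ h = coord k h - coord l h := by
    intro k l hkl h
    have h2 : X ∈ (f h).maxGenEigenspace (χ h) := (Submodule.mem_iInf _).1 hX h
    obtain ⟨m, hm⟩ := (Module.End.mem_maxGenEigenspace _ _ _).1 h2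
    have h3 : ∀ m : ℕ, conjP P (((f h - χ h • 1) ^ m) X : matLie hG) k l =
        (coord k h - coord l h - χ h) ^ m * conjP P X k l := by
      intro m
      induction m with
      | zero => simp
      | succ m ih =>
        set Y := ((f h - χ h • 1) ^ m) X
        have h4 : ((f h - χ h • 1) ^ (m + 1)) X = ⁅(h : matLie hG), Y⁆ - χ h • Y := by
          rw [pow_succ', Module.End.mul_apply]
          rfl
        have h5 : conjP P (⁅(h : matLie hG), Y⁆ - χ h • Y : matLie hG) k l =
            conjP P (⁅(h : matLie hG), Y⁆ : matLie hG) k l - conjP P (χ h • Y : matLie hG) k l :=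
          congrFun (congrFun (map_sub (conjP P) _ _) k) l
        rw [h4, h5, conjP_lie_apply, conjP_smul_apply, ih]
        ring
    have h5 := h3 m
    rw [hm] at h5
    have h6 : conjP P ((0 : matLie hG) : Matrix (Fin n) (Fin n) ℂ) k l = 0 := by simp
    rw [h6] at h5
    have h7 := eq_zero_of_pow_eq_zero ((mul_eq_zero.1 h5.symm).resolve_right hkl)
    exact (sub_eq_zero.1 h7).symm
  ext h
  rw [LinearMap.sub_apply, LinearMap.sub_apply, ← key i j hij, ← key k l hkl]

/-! ### The exponential map of the Cartan subalgebra -/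

theorem expG_coe (h : cartan hG P) :
    (expG (h : matLie hG) : GL (Fin n) ℂ) = diagGL P (expDiag fun i => coord i h) := by
  rw [← expGL_diagMat, ← coe_eq_diagMat]
  rfl

theorem conjP_adj_expG (h : cartan hG P) (X : matLie hG) (i j : Fin n) :
    conjP P (adj hG (expG (h : matLie hG)) X : matLie hG) i j =
      Complex.exp (coord i h - coord j h) * conjP P X i j := by
  rw [coe_adj, conjP_mul, conjP_mul]
  have h1 : conjP P (expG (h : matLie hG) : GL (Fin n) ℂ).val =
      Matrix.diagonal fun i => Complex.exp (coord i h) := by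
    rw [expG_coe]
    exact val_conj_diagGL P _
  have h2 : conjP P ((expG (h : matLie hG))⁻¹ : GL (Fin n) ℂ).val =
      Matrix.diagonal fun i => Complex.exp (-coord i h) := by
    rw [expG_coe, ← map_inv, ← expDiag_neg]
    exact val_conj_diagGL P _
  rw [h1, h2, Matrix.mul_diagonal, Matrix.diagonal_mul, Complex.exp_sub, Complex.exp_neg]
  ring

theorem adj_expG_of_mem {χ : Dual ℂ (cartan hG P)} {X : matLie hG}
    (hX : X ∈ weightSpace (L := matLie hG) ⊤ χ) (h : cartan hG P) :
    adj hG (expG (h : matLie hG)) X = Complex.exp (χ h) • X := by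
  apply Subtype.ext
  apply conjP_injective P
  ext i j
  rw [conjP_adj_expG, conjP_smul_apply]
  by_cases h0 : conjP P X i j = 0
  · rw [h0, mul_zero, mul_zero]
  · rw [eq_of_conjP_ne_zero hX h0]; rfl

variable {T : Subgroup G} (hT : IsMaximalTorus T)
  (hP : ∀ t ∈ T, (P * (t : GL (Fin n) ℂ) * P⁻¹).val.IsDiag)
include hT hP

theorem mem_torus_iff {g : G} : g ∈ T ↔ (P * (g : GL (Fin n) ℂ) * P⁻¹).val.IsDiag := by
  refine ⟨hP g, fun h => ?_⟩
  rw [← hT.centralizer, Subgroup.mem_centralizer_iff]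
  intro t ht
  obtain ⟨d, hd⟩ := exists_diagGL_eq h
  obtain ⟨c, hc⟩ := exists_diagGL_eq (hP t ht)
  apply Subtype.ext
  rw [Subgroup.coe_mul, Subgroup.coe_mul, hd, hc, ← map_mul, ← map_mul, mul_comm]

theorem expG_mem_torus (h : cartan hG P) : expG (h : matLie hG) ∈ T := by
  rw [mem_torus_iff hT hP, expG_coe, val_conj_diagGL]
  exact Matrix.isDiag_diagonal _

omit hT in
theorem mem_cartan_of_expG_mem {X : matLie hG} (h : ∀ s : ℂ, expG (s • X) ∈ T) :
    X ∈ cartan hG P := by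
  intro i j hij
  have h1 := hasDerivAt_of_linear
    (fun i j => hasDerivAt_exp_entry (X : Matrix (Fin n) (Fin n) ℂ) i j 0)
    (Matrix.entryLinearMap ℂ ℂ i j ∘ₗ conjP P)
  have h2 : (fun s : ℂ => (Matrix.entryLinearMap ℂ ℂ i j ∘ₗ conjP P)
      (exp (s • (X : Matrix (Fin n) (Fin n) ℂ)))) = fun _ => 0 := by
    funext s
    exact hP _ (h s) hij
  rw [h2, zero_smul, exp_zero, one_mul] at h1
  exact h1.unique (hasDerivAt_const _ _)

theorem coord_mem_diagLie (h : cartan hG P) :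
    (fun i => coord i h) ∈ diagLie (trivialChars (diagPart P T)) := by
  rw [mem_diagLie_iff hG hT.torus.closed]
  intro s
  have h1 : (s • fun i => coord i h) = fun i => coord i (s • h) := by
    funext i; simp
  rw [h1, mem_diagPart]
  refine ⟨expG_coe (s • h) ▸ (expG ((s • h : cartan hG P) : matLie hG)).2, ?_⟩
  have h2 := expG_mem_torus hT hP (s • h)
  have h3 : (⟨diagGL P (expDiag fun i => coord i (s • h)),
      expG_coe (s • h) ▸ (expG ((s • h : cartan hG P) : matLie hG)).2⟩ : G) =
      expG ((s • h : cartan hG P) : matLie hG) := Subtype.ext (expG_coe (s • h)).symm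
  rw [h3]
  exact h2

omit hP in
theorem exists_cartan_of_mem_diagLie {v : Fin n → ℂ}
    (hv : v ∈ diagLie (trivialChars (diagPart P T))) :
    ∃ h : cartan hG P, (h : matLie hG) = diagMat P v ∧ ∀ i, coord i h = v i := by
  have h1 : diagMat P v ∈ matLie hG := by
    change diagMat P v ∈ LinearMap.range (toMat (G := G))
    rw [mem_range_toMat hG]
    intro s
    rw [← map_smul, expGL_diagMat]
    exact (mem_diagPart.1 ((mem_diagLie_iff hG hT.torus.closed).1 hv s)).1
  have h2 : (⟨diagMat P v, h1⟩ : matLie hG) ∈ cartan hG P := by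
    rw [mem_cartan, conjP_apply, conj_diagMat]
    exact Matrix.isDiag_diagonal _
  refine ⟨⟨_, h2⟩, rfl, fun i => ?_⟩
  rw [coord_apply, conjP_apply, conj_diagMat, Matrix.diagonal_apply_eq]

omit hP in
theorem identityComponent_torus : identityComponent T = T := by
  apply le_antisymm PinnedDualGroup.identityComponent_le
  intro t ht
  refine ⟨⟨t, ht⟩, ?_, rfl⟩
  have h1 : IsPreconnected (Set.univ : Set T) :=
    (Subtype.preconnectedSpace hT.torus.connected.isPreconnected).isPreconnected_univ
  exact h1.subset_connectedComponent trivial trivial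

theorem exists_expG_eq (hG : IsZariskiClosed G) {t : G} (ht : t ∈ T) :
    ∃ h : cartan hG P, expG (h : matLie hG) = t := by
  rw [← identityComponent_torus hT] at ht
  obtain ⟨v, hv, htv⟩ := exists_eq_expGL hP ht
  obtain ⟨h, hh, -⟩ := exists_cartan_of_mem_diagLie (hG := hG) hT hv
  refine ⟨h, Subtype.ext ?_⟩
  rw [htv, ← hh]
  rfl

/-- The complex conjugate of an element of the Cartan subalgebra. -/
theorem exists_conj (h : cartan hG P) :
    ∃ h' : cartan hG P, ∀ i, coord i h' = (starRingEnd ℂ) (coord i h) := by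
  have h1 : (fun i => (starRingEnd ℂ) (coord i h)) ∈ diagLie (trivialChars (diagPart P T)) := by
    intro m hm
    have h2 := congrArg (starRingEnd ℂ) (coord_mem_diagLie hT hP h m hm)
    simpa using h2
  obtain ⟨h', -, hh'⟩ := exists_cartan_of_mem_diagLie (hG := hG) hT h1
  exact ⟨h', hh'⟩

theorem weightSpace_zero_cartan : weightSpace (L := matLie hG) (⊤ : Submodule ℂ (cartan hG P)) 0 =
    cartan hG P := by
  apply le_antisymm
  · intro X hX
    refine mem_cartan_of_expG_mem hP fun s => ?_
    rw [← hT.centralizer, Subgroup.mem_centralizer_iff]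
    intro t ht
    obtain ⟨h, rfl⟩ := exists_expG_eq hT hP hG ht
    have h1 := conj_expG hG (expG (h : matLie hG)) (s • X)
    rw [map_smul, adj_expG_of_mem hX, LinearMap.zero_apply, Complex.exp_zero, one_smul] at h1
    exact mul_inv_eq_iff_eq_mul.1 h1
  · intro X hX a _
    rw [LinearMap.zero_apply, zero_smul]
    exact lie_cartan a ⟨X, hX⟩

omit hT hP in
theorem traceB_cartan (h h' : cartan hG P) :
    traceB hG h h' = ∑ i, coord i h * coord i h' := by
  rw [traceB_apply, ← trace_conjP P, conjP_mul, conjP_coe, conjP_coe, Matrix.diagonal_mul_diagonal,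
    Matrix.trace_diagonal]

omit hT hP in
theorem sum_conj_eq_zero {v : Fin n → ℂ} (h : ∑ i, v i * (starRingEnd ℂ) (v i) = 0) (i : Fin n) :
    v i = 0 := by
  have h1 : ∑ i, Complex.normSq (v i) = 0 := by
    have : ((∑ i, Complex.normSq (v i) : ℝ) : ℂ) = 0 := by
      rw [← h]
      push_cast
      exact Finset.sum_congr rfl fun i _ => (Complex.mul_conj _).symm
    exact_mod_cast this
  have h2 := (Finset.sum_eq_zero_iff_of_nonneg fun i _ => Complex.normSq_nonneg (v i)).1 h1 i
    (Finset.mem_univ i)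
  exact Complex.normSq_eq_zero.1 h2

theorem cartan_eq_zero_of_traceB {h : cartan hG P} (h0 : ∀ h' : cartan hG P, traceB hG h h' = 0) :
    h = 0 := by
  obtain ⟨h', hh'⟩ := exists_conj hT hP h
  refine eq_zero_of_coord (sum_conj_eq_zero ?_)
  rw [← h0 h', traceB_cartan]
  simp only [hh']

/-- The radical of the trace form of a reductive group vanishes: it is an abelian ideal of
nilpotent matrices. -/
theorem traceB_nondegenerate (hr : IsConnectedReductive G) {X : matLie hr.closed}
    (hX : ∀ Y, traceB hr.closed X Y = 0) : X = 0 := by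
  set ι : matLie hr.closed →ₗ[ℂ] Matrix (Fin n) (Fin n) ℂ :=
    (matLie hr.closed).toSubmodule.subtype
  set R : Submodule ℂ (matLie hr.closed) := LinearMap.ker (traceB hr.closed)
  have hR : ∀ X : matLie hr.closed, X ∈ R ↔ ∀ Y, traceB hr.closed X Y = 0 := fun X => by
    rw [LinearMap.mem_ker, LinearMap.ext_iff]; rfl
  have hRadj : ∀ (g : G) (X : matLie hr.closed), X ∈ R → adj hr.closed g X ∈ R := by
    intro g X hX
    rw [hR] at hX ⊢
    intro Y
    have h1 : Y = adj hr.closed g (adj hr.closed g⁻¹ Y) := by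
      rw [← adj_mul, mul_inv_cancel, adj_one]
    rw [h1, traceB_adj, hX]
  have hRlie : ∀ X ∈ R, ∀ Y : matLie hr.closed, ⁅X, Y⁆ ∈ R := by
    intro X hX Y
    rw [hR] at hX ⊢
    intro Z
    rw [traceB_lie, hX]
  set K : LieSubalgebra ℂ (Matrix (Fin n) (Fin n) ℂ) :=
    { R.map ι with
      lie_mem' := by
        rintro _ _ ⟨X, hX, rfl⟩ ⟨Y, hY, rfl⟩
        exact ⟨⁅X, Y⁆, hRlie X hX Y, rfl⟩ }
  have hmem : ∀ Z, Z ∈ K ↔ ∃ X ∈ R, (X : Matrix (Fin n) (Fin n) ℂ) = Z := fun Z => Iff.rfl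
  obtain ⟨k, hk⟩ := exists_pow_span_lie_eq_bot K (by
    rintro _ ⟨X, hX, rfl⟩ _ ⟨Y, hY, rfl⟩
    exact (hR X).1 hX Y)
  have hspan : Submodule.span ℂ {Z | ∃ X ∈ K, ∃ Y ∈ K, X * Y - Y * X = Z} ≤
      R.map ι := by
    rw [Submodule.span_le]
    rintro _ ⟨_, ⟨X, hX, rfl⟩, _, ⟨Y, hY, rfl⟩, rfl⟩
    exact ⟨⁅X, Y⁆, hRlie X hX Y, rfl⟩
  have hrange : R.map ι ≤ LinearMap.range (toMat (G := G)) := by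
    rintro _ ⟨X, -, rfl⟩
    exact X.2
  -- The derived algebra of the radical consists of matrices whose products vanish.
  have hab := eq_bot_of_pow_eq_bot hr (hspan.trans hrange) (by
    intro g Z hZ
    induction hZ using Submodule.span_induction with
    | mem Z hZ =>
      obtain ⟨_, ⟨X, hX, rfl⟩, _, ⟨Y, hY, rfl⟩, rfl⟩ := hZ
      refine Submodule.subset_span ⟨_, ⟨adj hr.closed g X, hRadj g X hX, rfl⟩, _,
        ⟨adj hr.closed g Y, hRadj g Y hY, rfl⟩, ?_⟩
      have hmul : ∀ A B : Matrix (Fin n) (Fin n) ℂ,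
          (g : GL (Fin n) ℂ).val * A * (g⁻¹ : GL (Fin n) ℂ).val *
          ((g : GL (Fin n) ℂ).val * B * (g⁻¹ : GL (Fin n) ℂ).val) =
          (g : GL (Fin n) ℂ).val * (A * B) * (g⁻¹ : GL (Fin n) ℂ).val :=
        fun A B => (conjP_mul (g : GL (Fin n) ℂ) A B).symm
      change (g : GL (Fin n) ℂ).val * (X : Matrix (Fin n) (Fin n) ℂ) * (g⁻¹ : GL (Fin n) ℂ).val *
          ((g : GL (Fin n) ℂ).val * (Y : Matrix (Fin n) (Fin n) ℂ) * (g⁻¹ : GL (Fin n) ℂ).val) -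
          (g : GL (Fin n) ℂ).val * (Y : Matrix (Fin n) (Fin n) ℂ) * (g⁻¹ : GL (Fin n) ℂ).val *
          ((g : GL (Fin n) ℂ).val * (X : Matrix (Fin n) (Fin n) ℂ) * (g⁻¹ : GL (Fin n) ℂ).val) =
          (g : GL (Fin n) ℂ).val * ((X : Matrix (Fin n) (Fin n) ℂ) * Y - Y * X) *
            (g⁻¹ : GL (Fin n) ℂ).val
      rw [hmul, hmul, mul_sub, sub_mul]
    | zero => simp
    | add A B _ _ hA hB => rw [mul_add, add_mul]; exact add_mem hA hB
    | smul c A _ hA => rw [mul_smul_comm, smul_mul_assoc]; exact Submodule.smul_mem _ c hA) hk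
  have hcomm : ∀ X ∈ R, ∀ Y ∈ R, (X : Matrix (Fin n) (Fin n) ℂ) * Y = Y * X := by
    intro X hX Y hY
    have h1 : (X : Matrix (Fin n) (Fin n) ℂ) * Y - Y * X ∈
        Submodule.span ℂ {Z | ∃ X ∈ K, ∃ Y ∈ K, X * Y - Y * X = Z} :=
      Submodule.subset_span ⟨_, ⟨X, hX, rfl⟩, _, ⟨Y, hY, rfl⟩, rfl⟩
    rw [hab] at h1
    exact sub_eq_zero.1 h1
  -- The components of nonzero weight are nilpotent; the component of weight zero is an element of
  -- the Cartan subalgebra that is orthogonal to its complex conjugate, hence vanishes.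
  have hnil : ∀ X ∈ R, IsNilpotent (X : Matrix (Fin n) (Fin n) ℂ) := by
    intro X hX
    obtain ⟨f, hf, rfl, hfR⟩ := exists_radical_decomposition (H := cartan hr.closed P) traceB_lie
      iSup_weightSpace_cartan ((hR X).1 hX)
    have h1 : ((f.sum fun _ y => y : matLie hr.closed) : Matrix (Fin n) (Fin n) ℂ) =
        ∑ χ ∈ f.support, (f χ : Matrix (Fin n) (Fin n) ℂ) := by
      rw [Finsupp.sum]
      exact map_sum ι _ _
    rw [h1]
    refine Commute.isNilpotent_sum (fun χ _ => ?_) fun χ χ' _ _ =>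
      hcomm _ ((hR _).2 (hfR χ)) _ ((hR _).2 (hfR χ'))
    by_cases hχ : χ = 0
    · subst hχ
      have h2 : f 0 ∈ cartan hr.closed P := (weightSpace_zero_cartan hT hP).le (hf 0)
      have h3 : (⟨f 0, h2⟩ : cartan hr.closed P) = 0 :=
        cartan_eq_zero_of_traceB hT hP fun h' => hfR 0 _
      have h4 : f 0 = 0 := congrArg Subtype.val h3
      rw [h4]
      exact IsNilpotent.zero
    · exact isNilpotent_of_mem_weightSpace hχ (hf χ)
  obtain ⟨k, hk⟩ := exists_pow_eq_bot_of_commute (N := R.map ι)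
    (by rintro _ ⟨X, hX, rfl⟩ _ ⟨Y, hY, rfl⟩; exact hcomm X hX Y hY)
    (by rintro _ ⟨X, hX, rfl⟩; exact hnil X hX)
  have hbot := eq_bot_of_pow_eq_bot hr hrange (by
    rintro g _ ⟨X, hX, rfl⟩
    exact ⟨adj hr.closed g X, hRadj g X hX, rfl⟩) hk
  have h1 : ι X ∈ R.map ι := ⟨X, (hR X).2 hX, rfl⟩
  rw [hbot] at h1
  exact Subtype.ext h1

/-- The Lie algebra of a connected reductive group is split reductive. -/
theorem isSplitReductive (hr : IsConnectedReductive G) :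
    IsSplitReductive (cartan hr.closed P) (traceB hr.closed) where
  iSup_weightSpace := iSup_weightSpace_cartan
  weightSpace_zero := weightSpace_zero_cartan hT hP
  symm := traceB_symm
  invariant := traceB_lie
  nondegenerate _ hX := traceB_nondegenerate hT hP hr hX
  coroot := by
    intro χ hχ x hx y hy hxy
    have h1 : ⁅x, y⁆ ∈ cartan hr.closed P := by
      rw [← weightSpace_zero_cartan hT hP]
      have := lie_mem_weightSpace hx hy
      rwa [add_neg_cancel] at this
    refine ⟨⟨_, h1⟩, rfl, fun h0 => hχ ?_⟩
    set h : cartan hr.closed P := ⟨_, h1⟩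
    have hx0 : x ≠ 0 := by
      rintro rfl
      exact hxy (by simp)
    obtain ⟨i, j, hij⟩ := exists_conjP_ne_zero (P := P) hx0
    have hχij := eq_of_conjP_ne_zero hx hij
    have hB : ∀ a : cartan hr.closed P, traceB hr.closed a h = χ a * traceB hr.closed x y := by
      intro a
      change traceB hr.closed a ⁅x, y⁆ = _
      rw [← traceB_lie, hx a trivial, map_smul, LinearMap.smul_apply, smul_eq_mul]
    -- The root `χ` takes conjugate values at conjugate elements.
    obtain ⟨h', hh'⟩ := exists_conj hT hP h
    have h2 : χ h' = 0 := by
      have h3 : coord i h - coord j h = 0 := by rw [← h0, hχij]; rfl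
      rw [hχij, LinearMap.sub_apply, hh', hh', ← map_sub, h3, map_zero]
    have h4 := hB h'
    rw [h2, zero_mul, traceB_symm, traceB_cartan] at h4
    simp only [hh'] at h4
    have h5 : h = 0 := eq_zero_of_coord (sum_conj_eq_zero h4)
    ext a
    have h6 := hB a
    rw [h5] at h6
    have h7 : χ a * traceB hr.closed x y = 0 := by rw [← h6]; simp
    exact (mul_eq_zero.1 h7).resolve_right hxy

end Cartan

/-! ### Differentials of characters -/

section Differentials

variable {n : ℕ} {G : Subgroup (GL (Fin n) ℂ)} {hG : IsZariskiClosed G} {P : GL (Fin n) ℂ}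
  {T : Subgroup G}

/-- The functional `χ` on the Cartan subalgebra is the differential of the character `α`. -/
def IsDiffOf (α : T →* ℂˣ) (χ : Dual ℂ (cartan hG P)) : Prop :=
  ∀ (h : cartan hG P) (hh : expG (h : matLie hG) ∈ T), (α ⟨_, hh⟩ : ℂ) = Complex.exp (χ h)

namespace IsDiffOf

theorem one : IsDiffOf (hG := hG) (P := P) (1 : T →* ℂˣ) 0 := fun h hh => by simp

theorem mul {α α' : T →* ℂˣ} {χ χ' : Dual ℂ (cartan hG P)} (h : IsDiffOf α χ)
    (h' : IsDiffOf α' χ') : IsDiffOf (α * α') (χ + χ') := fun a ha => by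
  rw [MonoidHom.mul_apply, Units.val_mul, h a ha, h' a ha, LinearMap.add_apply, Complex.exp_add]

theorem inv {α : T →* ℂˣ} {χ : Dual ℂ (cartan hG P)} (h : IsDiffOf α χ) :
    IsDiffOf α⁻¹ (-χ) := fun a ha => by
  rw [MonoidHom.inv_apply, Units.val_inv_eq_inv_val, h a ha, LinearMap.neg_apply, Complex.exp_neg]

theorem div {α α' : T →* ℂˣ} {χ χ' : Dual ℂ (cartan hG P)} (h : IsDiffOf α χ)
    (h' : IsDiffOf α' χ') : IsDiffOf (α / α') (χ - χ') := fun a ha => by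
  rw [MonoidHom.div_apply, Units.val_div_eq_div_val, h a ha, h' a ha, LinearMap.sub_apply,
    Complex.exp_sub]

theorem zpow {α : T →* ℂˣ} {χ : Dual ℂ (cartan hG P)} (h : IsDiffOf α χ) (k : ℤ) :
    IsDiffOf (α ^ k) (k • χ) := fun a ha => by
  have h1 : (α ^ k) ⟨_, ha⟩ = (α ⟨_, ha⟩) ^ k := rfl
  rw [h1, Units.val_zpow_eq_zpow_val, h a ha, LinearMap.smul_apply, zsmul_eq_mul, Complex.exp_int_mul]

theorem prod {ι : Type*} {s : Finset ι} {α : ι → T →* ℂˣ} {χ : ι → Dual ℂ (cartan hG P)}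
    (h : ∀ i ∈ s, IsDiffOf (α i) (χ i)) : IsDiffOf (∏ i ∈ s, α i) (∑ i ∈ s, χ i) := by
  classical
  induction s using Finset.induction_on with
  | empty => exact one
  | insert i s hi ih =>
    rw [Finset.prod_insert hi, Finset.sum_insert hi]
    exact (h i (Finset.mem_insert_self i s)).mul
      (ih fun j hj => h j (Finset.mem_insert_of_mem hj))

variable (hT : IsMaximalTorus T) (hP : ∀ t ∈ T, (P * (t : GL (Fin n) ℂ) * P⁻¹).val.IsDiag)
include hT hP

theorem unique {α : T →* ℂˣ} {χ χ' : Dual ℂ (cartan hG P)} (h : IsDiffOf α χ)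
    (h' : IsDiffOf α χ') : χ = χ' := by
  ext a
  rw [← sub_eq_zero]
  refine eq_zero_of_exp_eq_one fun s => ?_
  have h1 := h (s • a) (expG_mem_torus hT hP _)
  rw [h' (s • a) (expG_mem_torus hT hP _), map_smul, map_smul, smul_eq_mul, smul_eq_mul] at h1
  rw [mul_sub, Complex.exp_sub, h1, div_self (Complex.exp_ne_zero _)]

theorem injective {α α' : T →* ℂˣ} {χ : Dual ℂ (cartan hG P)} (h : IsDiffOf α χ)
    (h' : IsDiffOf α' χ) : α = α' := by
  ext ⟨t, ht⟩
  obtain ⟨a, rfl⟩ := exists_expG_eq hT hP hG ht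
  rw [h, h']

end IsDiffOf

/-- The diagonal entries, as characters of the torus. -/
noncomputable def coordChar (hP : ∀ t ∈ T, (P * (t : GL (Fin n) ℂ) * P⁻¹).val.IsDiag) (i : Fin n) :
    T →* ℂˣ :=
  MonoidHom.toHomUnits
    { toFun := fun t => conjP P (t : GL (Fin n) ℂ).val i i
      map_one' := by
        simp [conjP_apply]
      map_mul' := fun t t' => by
        have h1 : ((t * t' : T) : GL (Fin n) ℂ).val = (t : GL (Fin n) ℂ).val * (t' : GL (Fin n) ℂ).val :=
          rfl
        have h2 := Matrix.IsDiag.diagonal_diag (hP t t.2)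
        have h3 : conjP P (t : GL (Fin n) ℂ).val =
            Matrix.diagonal (conjP P (t : GL (Fin n) ℂ).val).diag := h2.symm
        rw [h1, conjP_mul, h3, Matrix.diagonal_mul]
        simp }

variable (hT : IsMaximalTorus T) (hP : ∀ t ∈ T, (P * (t : GL (Fin n) ℂ) * P⁻¹).val.IsDiag)

theorem coordChar_apply (i : Fin n) (t : T) :
    (coordChar hP i t : ℂ) = conjP P (t : GL (Fin n) ℂ).val i i := rfl

theorem conjP_torus (t : T) : conjP P (t : GL (Fin n) ℂ).val =
    Matrix.diagonal fun i => (coordChar hP i t : ℂ) :=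
  (Matrix.IsDiag.diagonal_diag (hP t t.2)).symm

theorem conjP_adj_torus (t : T) (X : matLie hG) (i j : Fin n) :
    conjP P (adj hG (t : G) X : matLie hG) i j =
      ((coordChar hP i / coordChar hP j) t : ℂˣ) * conjP P X i j := by
  have h1 : (((t : G)⁻¹ : G) : GL (Fin n) ℂ).val = ((t⁻¹ : T) : GL (Fin n) ℂ).val := rfl
  have h2 : ((t : G) : GL (Fin n) ℂ)⁻¹.val = ((t⁻¹ : T) : GL (Fin n) ℂ).val := rfl
  rw [coe_adj, h2, conjP_mul, conjP_mul, conjP_torus hP, conjP_torus hP, Matrix.mul_diagonal,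
    Matrix.diagonal_mul, MonoidHom.div_apply, map_inv, div_eq_mul_inv, Units.val_mul]
  ring

theorem isDiffOf_coordChar (i : Fin n) :
    IsDiffOf (hG := hG) (P := P) (coordChar hP i) (coord i) := by
  intro h hh
  rw [coordChar_apply]
  change conjP P (expG (h : matLie hG) : GL (Fin n) ℂ).val i i = _
  have h1 : conjP P (expG (h : matLie hG) : GL (Fin n) ℂ).val =
      Matrix.diagonal fun i => Complex.exp (coord i h) := by
    rw [expG_coe]
    exact val_conj_diagGL P _
  rw [h1, Matrix.diagonal_apply_eq]

/-- A regular function on `G` restricts to the character `α` of `T`. -/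
def IsRegularChar (α : T →* ℂˣ) : Prop := ∃ f ∈ regularFunctions G, ∀ t : T, f t = (α t : ℂ)

theorem IsRegularChar.mul {α β : T →* ℂˣ} (hα : IsRegularChar α) (hβ : IsRegularChar β) :
    IsRegularChar (α * β) := by
  obtain ⟨f, hf, hf'⟩ := hα
  obtain ⟨g, hg, hg'⟩ := hβ
  exact ⟨f * g, mul_mem hf hg, fun t => by simp [hf', hg']⟩

theorem IsRegularChar.one : IsRegularChar (1 : T →* ℂˣ) :=
  ⟨1, one_mem _, fun t => by simp⟩

theorem isRegularChar_coord (i j : Fin n) :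
    IsRegularChar (coordChar hP i / coordChar hP j) := by
  have hl : ∀ (i : Fin n) (c : G → Matrix (Fin n) (Fin n) ℂ),
      (∀ k l, (fun g => c g k l) ∈ regularFunctions G) →
      (fun g => conjP P (c g) i i) ∈ regularFunctions G := by
    intro i c hc
    have h1 : (fun g => conjP P (c g) i i) =
        ∑ l, ∑ k, (P.val i k * P⁻¹.val l i) • (fun g => c g k l) := by
      funext g
      rw [conjP_apply]
      simp only [Matrix.mul_apply, Finset.sum_mul, Finset.sum_apply, Pi.smul_apply, smul_eq_mul]
      exact Finset.sum_congr rfl fun _ _ => Finset.sum_congr rfl fun _ _ => by ring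
    rw [h1]
    exact sum_mem fun _ _ => sum_mem fun _ _ => Subalgebra.smul_mem _ (hc _ _) _
  refine ⟨_, mul_mem (hl i (fun g => (g : GL (Fin n) ℂ).val) entry_mem)
    (hl j (fun g => (g⁻¹ : GL (Fin n) ℂ).val) inv_entry_mem), fun t => ?_⟩
  have h2 : ((t : G) : GL (Fin n) ℂ)⁻¹.val = ((t⁻¹ : T) : GL (Fin n) ℂ).val := rfl
  rw [Pi.mul_apply, h2, MonoidHom.div_apply, div_eq_mul_inv, ← map_inv, Units.val_mul]
  rfl

include hT hP

/-- The eigenvectors of the torus are the weight vectors of its Lie algebra. -/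
theorem IsDiffOf.mem_weightSpace_iff {α : T →* ℂˣ} {χ : Dual ℂ (cartan hG P)} (h : IsDiffOf α χ)
    {X : matLie hG} : X ∈ weightSpace (L := matLie hG) ⊤ χ ↔
      ∀ t : T, adj hG (t : G) X = (α t : ℂ) • X := by
  constructor
  · rintro hX ⟨t, ht⟩
    obtain ⟨a, rfl⟩ := exists_expG_eq hT hP hG ht
    rw [adj_expG_of_mem hX, h]
  · intro hX
    refine mem_weightSpace_of_conjP fun i j hij => ?_
    have h1 : α = coordChar hP i / coordChar hP j := by
      ext t
      have h2 := congrArg (fun Y : matLie hG => conjP P Y i j) (hX t)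
      simp only [conjP_adj_torus hP, conjP_smul_apply] at h2
      exact (mul_right_cancel₀ hij h2).symm
    rw [h1] at h
    exact h.unique hT hP ((isDiffOf_coordChar hP i).div (isDiffOf_coordChar hP j))

theorem exists_isDiffOf_of_mem_roots (hG : IsZariskiClosed G) {α : T →* ℂˣ} (hα : α ∈ roots T) :
    ∃ χ ∈ rootSet (L := matLie hG) (cartan hG P), IsDiffOf α χ ∧ IsRegularChar α := by
  obtain ⟨hα1, D, hD, h⟩ := hα
  have hX : toLie hG D ≠ 0 := (LinearEquiv.map_ne_zero_iff _).2 hD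
  have h' : ∀ t : T, adj hG (t : G) (toLie hG D) = (α t : ℂ) • toLie hG D := fun t => by
    rw [← toLie_Ad, h, map_smul]
  obtain ⟨i, j, hij⟩ := exists_conjP_ne_zero (P := P) hX
  have h1 : α = coordChar hP i / coordChar hP j := by
    ext t
    have h2 := congrArg (fun Y : matLie hG => conjP P Y i j) (h' t)
    simp only [conjP_adj_torus hP, conjP_smul_apply] at h2
    exact (mul_right_cancel₀ hij h2).symm
  have h3 : IsDiffOf (hG := hG) α (coord i - coord j) :=
    h1 ▸ (isDiffOf_coordChar hP i).div (isDiffOf_coordChar hP j)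
  refine ⟨coord i - coord j, ⟨fun h0 => hα1 ?_, fun h0 => hX ?_⟩, h3,
    h1 ▸ isRegularChar_coord hP i j⟩
  · rw [h0] at h3
    exact h3.injective hT hP IsDiffOf.one
  · rw [← Submodule.mem_bot ℂ, ← h0]
    exact (h3.mem_weightSpace_iff hT hP).2 h'

theorem exists_isDiffOf_of_mem_rootSet {χ : Dual ℂ (cartan hG P)}
    (hχ : χ ∈ rootSet (L := matLie hG) (cartan hG P)) : ∃ α ∈ roots T, IsDiffOf α χ := by
  obtain ⟨hχ0, hne⟩ := hχ
  obtain ⟨X, hX, hX0⟩ := Submodule.exists_mem_ne_zero_of_ne_bot hne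
  obtain ⟨i, j, hij⟩ := exists_conjP_ne_zero (P := P) hX0
  have h1 := eq_of_conjP_ne_zero hX hij
  have h3 : IsDiffOf (hG := hG) (coordChar hP i / coordChar hP j) χ :=
    h1 ▸ (isDiffOf_coordChar hP i).div (isDiffOf_coordChar hP j)
  refine ⟨_, ⟨fun h0 => hχ0 ?_, (toLie hG).symm X, (LinearEquiv.map_ne_zero_iff _).2 hX0,
    fun t => ?_⟩, h3⟩
  · rw [h0] at h3
    exact h3.unique hT hP IsDiffOf.one
  · apply (toLie hG).injective
    rw [toLie_Ad, map_smul, LinearEquiv.apply_symm_apply]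
    exact (h3.mem_weightSpace_iff hT hP).1 hX t

/-- The functionals `φ ∘ v` on elements with entries `v`, for a `ℚ`-linear function `φ`. -/
theorem exists_map_rat (φ : ℂ →ₗ[ℚ] ℚ) (h : cartan hG P) :
    ∃ h' : cartan hG P, ∀ i, coord i h' = (φ (coord i h) : ℂ) := by
  have h1 : (fun i => ((φ (coord i h) : ℚ) : ℂ)) ∈ diagLie (trivialChars (diagPart P T)) := by
    intro m hm
    have h2 := congrArg φ (coord_mem_diagLie hT hP h m hm)
    rw [map_zero, map_sum] at h2
    have h3 : ∀ i, φ ((m i : ℂ) * coord i h) = m i * φ (coord i h) := by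
      intro i
      rw [← zsmul_eq_mul, map_zsmul, zsmul_eq_mul]
    simp only [h3] at h2
    have h4 := congrArg (fun q : ℚ => (q : ℂ)) h2
    simpa using h4
  obtain ⟨h', -, hh'⟩ := exists_cartan_of_mem_diagLie (hG := hG) hT h1
  exact ⟨h', hh'⟩

omit hT hP in
theorem exists_rat_functional {c : ℂ} (hc : c ≠ 0) : ∃ φ : ℂ →ₗ[ℚ] ℚ, φ c ≠ 0 := by
  by_contra! h
  exact hc ((Module.forall_dual_apply_eq_zero_iff ℚ c).1 h)

/-- Multiplicatively independent roots have linearly independent differentials: a linear relation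
with complex coefficients stays a relation after a `ℚ`-linear map `ℂ → ℚ` is applied to the
coefficients. -/
theorem linearIndependent_of_isDiffOf {ι : Type*} {α : ι → T →* ℂˣ} {χ : ι → Dual ℂ (cartan hG P)}
    (h : ∀ i, IsDiffOf (α i) (χ i)) (hroot : ∀ i, ∃ k l, χ i = coord k - coord l)
    (hind : ∀ c : ι →₀ ℤ, (c.prod fun i k => α i ^ k) = 1 → c = 0) : LinearIndependent ℂ χ := by
  have h1 : LinearIndependent ℤ χ := by
    rw [linearIndependent_iff]
    intro c hc
    refine hind c ?_
    have h2 : IsDiffOf (c.prod fun i k => α i ^ k) (Finsupp.linearCombination ℤ χ c) :=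
      IsDiffOf.prod fun i _ => (h i).zpow (c i)
    rw [hc] at h2
    exact h2.injective hT hP IsDiffOf.one
  rw [LinearIndependent.iff_fractionRing ℤ ℚ, linearIndependent_iff'] at h1
  rw [linearIndependent_iff']
  intro s c hc i hi
  by_contra hne
  obtain ⟨φ, hφ⟩ := exists_rat_functional hne
  refine hφ (h1 s (fun i => φ (c i)) ?_ i hi)
  ext a
  rw [LinearMap.zero_apply]
  by_contra hne'
  -- `φ` is applied to the coefficients, and `φ'` to the values of the characters, which are made
  -- rational by `exists_map_rat`.
  obtain ⟨φ', hφ'⟩ := exists_rat_functional hne'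
  refine hφ' ?_
  obtain ⟨a', ha'⟩ := exists_map_rat hT hP φ' a
  have h2 : ∀ i, χ i a' = (φ' (χ i a) : ℂ) := by
    intro i
    obtain ⟨k, l, hkl⟩ := hroot i
    rw [hkl, LinearMap.sub_apply, LinearMap.sub_apply, ha', ha', map_sub]
    push_cast
    rfl
  have h3 : ∑ i ∈ s, c i * (φ' (χ i a) : ℂ) = 0 := by
    have := DFunLike.congr_fun hc a'
    simpa [LinearMap.sum_apply, h2] using this
  have h4 := congrArg φ h3
  rw [map_sum, map_zero] at h4
  have h5 : ∀ i, φ (c i * (φ' (χ i a) : ℂ)) = φ (c i) * φ' (χ i a) := by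
    intro i
    rw [mul_comm, ← Rat.smul_def, map_smul, smul_eq_mul, mul_comm]
  simp only [h5] at h4
  rw [LinearMap.sum_apply, map_sum, ← h4]
  exact Finset.sum_congr rfl fun i _ => by
    rw [LinearMap.smul_apply, map_smul, smul_eq_mul]

end Differentials

/-! ### The Lie algebra of a pinned group -/

theorem eq_of_expG_eq {n : ℕ} {G : Subgroup (GL (Fin n) ℂ)} {hG : IsZariskiClosed G}
    {X Y : matLie hG} (h : ∀ s : ℂ, expG (s • X) = expG (s • Y)) : X = Y := by
  apply Subtype.ext
  ext i j
  have h1 := hasDerivAt_exp_entry (X : Matrix (Fin n) (Fin n) ℂ) i j 0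
  have h2 := hasDerivAt_exp_entry (Y : Matrix (Fin n) (Fin n) ℂ) i j 0
  have h3 : (fun s : ℂ => exp (s • (X : Matrix (Fin n) (Fin n) ℂ)) i j) =
      fun s : ℂ => exp (s • (Y : Matrix (Fin n) (Fin n) ℂ)) i j := by
    funext s
    exact congrArg (fun g : G => (g : GL (Fin n) ℂ).val i j) (h s)
  rw [h3] at h1
  simpa using h1.unique h2

namespace PinnedDualGroup

variable {n : ℕ} (D : PinnedDualGroup n)

/-- A matrix that diagonalizes the maximal torus. -/
noncomputable def diagonalizer : GL (Fin n) ℂ := D.maximalTorus.torus.diagonalizable.choose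

theorem isDiag_conj : ∀ t ∈ D.T, (D.diagonalizer * (t : GL (Fin n) ℂ) * D.diagonalizer⁻¹).val.IsDiag :=
  D.maximalTorus.torus.diagonalizable.choose_spec

/-- The Lie algebra of `G`, as an algebra of matrices. -/
noncomputable abbrev lie : LieSubalgebra ℂ (Matrix (Fin n) (Fin n) ℂ) := matLie D.reductive.closed

/-- The Lie algebra of `T`. -/
noncomputable abbrev cartanLie : Submodule ℂ D.lie := cartan D.reductive.closed D.diagonalizer

instance : FiniteDimensional ℂ D.lie :=
  FiniteDimensional.finiteDimensional_submodule D.lie.toSubmodule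

theorem split : IsSplitReductive D.cartanLie (traceB D.reductive.closed) :=
  isSplitReductive D.maximalTorus D.isDiag_conj D.reductive

/-- The differential of `θ`. -/
noncomputable def thetaLie : D.lie ≃ₗ⁅ℂ⁆ D.lie := lieDiff D.reductive.closed D.θ_algebraic

theorem theta_expG (X : D.lie) : D.θ (expG X) = expG (D.thetaLie X) :=
  apply_expG D.reductive.closed D.θ_algebraic X

theorem mem_cartanLie_iff {X : D.lie} : X ∈ D.cartanLie ↔ ∀ s : ℂ, expG (s • X) ∈ D.T :=
  ⟨fun h s => expG_mem_torus D.maximalTorus D.isDiag_conj ⟨_, D.cartanLie.smul_mem s h⟩,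
    mem_cartan_of_expG_mem D.isDiag_conj⟩

theorem thetaLie_mem (X : D.lie) : D.thetaLie X ∈ D.cartanLie ↔ X ∈ D.cartanLie := by
  rw [mem_cartanLie_iff, mem_cartanLie_iff]
  refine forall_congr' fun s => ?_
  rw [← map_smul, ← theta_expG, D.θ_torus]

variable {D}

/-- The functional `χ` is the differential of the character `α` of the maximal torus. -/
abbrev IsDiff (α : D.T →* ℂˣ) (χ : Dual ℂ D.cartanLie) : Prop := IsDiffOf α χ

theorem IsDiff.unique {α : D.T →* ℂˣ} {χ χ' : Dual ℂ D.cartanLie} (h : D.IsDiff α χ)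
    (h' : D.IsDiff α χ') : χ = χ' := IsDiffOf.unique D.maximalTorus D.isDiag_conj h h'

theorem IsDiff.injective {α α' : D.T →* ℂˣ} {χ : Dual ℂ D.cartanLie} (h : D.IsDiff α χ)
    (h' : D.IsDiff α' χ) : α = α' := IsDiffOf.injective D.maximalTorus D.isDiag_conj h h'

theorem IsDiff.charComp {α : D.T →* ℂˣ} {χ : Dual ℂ D.cartanLie} (h : D.IsDiff α χ) :
    D.IsDiff (charComp D.θ_torus α) (pullWeight D.thetaLie D.thetaLie_mem χ) := by
  intro a ha
  have h1 : D.θ (expG (a : D.lie)) = expG (restrictAut D.thetaLie D.thetaLie_mem a : D.lie) :=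
    D.theta_expG a
  rw [pullWeight_apply, ← h (restrictAut D.thetaLie D.thetaLie_mem a) (h1 ▸ (D.θ_torus _).2 ha)]
  change (α ⟨D.θ (expG (a : D.lie)), _⟩ : ℂ) = _
  congr 2
  exact Subtype.ext h1

theorem IsDiff.iterate_charComp {α : D.T →* ℂˣ} {χ : Dual ℂ D.cartanLie} (h : D.IsDiff α χ)
    (k : ℕ) : D.IsDiff ((UnramGamma.charComp D.θ_torus)^[k] α)
      ((pullWeight D.thetaLie D.thetaLie_mem)^[k] χ) := by
  induction k with
  | zero => exact h
  | succ k ih =>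
    rw [Function.iterate_succ_apply', Function.iterate_succ_apply']
    exact ih.charComp

theorem IsDiff.mem_weightSpace_iff {α : D.T →* ℂˣ} {χ : Dual ℂ D.cartanLie} (h : D.IsDiff α χ)
    {X : D.lie} : X ∈ weightSpace (L := D.lie) ⊤ χ ↔
      ∀ t : D.T, adj D.reductive.closed (t : D.G) X = (α t : ℂ) • X :=
  IsDiffOf.mem_weightSpace_iff D.maximalTorus D.isDiag_conj h

theorem exists_isDiff {α : D.T →* ℂˣ} (hα : α ∈ roots D.T) :
    ∃ χ ∈ rootSet (L := D.lie) D.cartanLie, D.IsDiff α χ ∧ IsRegularChar α :=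
  exists_isDiffOf_of_mem_roots D.maximalTorus D.isDiag_conj D.reductive.closed hα

theorem exists_root {χ : Dual ℂ D.cartanLie} (hχ : χ ∈ rootSet (L := D.lie) D.cartanLie) :
    ∃ α ∈ roots D.T, D.IsDiff α χ :=
  exists_isDiffOf_of_mem_rootSet D.maximalTorus D.isDiag_conj hχ

theorem IsDiff.mem_roots {α : D.T →* ℂˣ} {χ : Dual ℂ D.cartanLie} (h : D.IsDiff α χ)
    (hχ : χ ∈ rootSet (L := D.lie) D.cartanLie) : α ∈ roots D.T := by
  obtain ⟨β, hβ, hβχ⟩ := exists_root hχ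
  rwa [h.injective hβχ]

theorem IsDiff.mem_rootSet {α : D.T →* ℂˣ} {χ : Dual ℂ D.cartanLie} (h : D.IsDiff α χ)
    (hα : α ∈ roots D.T) : χ ∈ rootSet (L := D.lie) D.cartanLie := by
  obtain ⟨χ', hχ', h', -⟩ := exists_isDiff hα
  rwa [h.unique h']

theorem finite_roots : (roots D.T).Finite := by
  have h1 : ∀ α : roots D.T, ∃ χ ∈ rootSet (L := D.lie) D.cartanLie, D.IsDiff α χ := fun α => by
    obtain ⟨χ, hχ, h, -⟩ := exists_isDiff α.2
    exact ⟨χ, hχ, h⟩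
  choose f hf hf' using h1
  have := D.split.finite_rootSet.to_subtype
  refine Set.finite_coe_iff.1 (Finite.of_injective (fun α => (⟨f α, hf α⟩ : rootSet (L := D.lie) D.cartanLie))
    fun α β h => Subtype.ext ((hf' α).injective (by
      have h2 : f α = f β := congrArg Subtype.val h
      rw [h2]
      exact hf' β)))

variable (D)

/-- The differentials of the simple roots. -/
def simpleSet : Set (Dual ℂ D.cartanLie) := {χ | ∃ α ∈ D.Δ, D.IsDiff α χ}

/-- The chosen root vector of a simple root, extended by `0`. -/
noncomputable def rootVector (χ : Dual ℂ D.cartanLie) : D.lie :=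
  open Classical in
  if h : ∃ α ∈ D.Δ, D.IsDiff α χ then toLie D.reductive.closed (D.X h.choose) else 0

variable {D}

theorem rootVector_eq {α : D.T →* ℂˣ} (hα : α ∈ D.Δ) {χ : Dual ℂ D.cartanLie}
    (h : D.IsDiff α χ) : D.rootVector χ = toLie D.reductive.closed (D.X α) := by
  have h1 : ∃ α ∈ D.Δ, D.IsDiff α χ := ⟨α, hα, h⟩
  rw [rootVector, dif_pos h1, h1.choose_spec.2.injective h]

theorem rootVector_ne_zero {χ : Dual ℂ D.cartanLie} (hχ : χ ∈ D.simpleSet) :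
    D.rootVector χ ≠ 0 := by
  obtain ⟨α, hα, h⟩ := hχ
  rw [rootVector_eq hα h]
  exact (LinearEquiv.map_ne_zero_iff _).2 (D.X_ne_zero α hα)

theorem rootVector_mem {χ : Dual ℂ D.cartanLie} (hχ : χ ∈ D.simpleSet) :
    D.rootVector χ ∈ weightSpace (L := D.lie) ⊤ χ := by
  obtain ⟨α, hα, h⟩ := hχ
  rw [rootVector_eq hα h, h.mem_weightSpace_iff]
  intro t
  rw [← toLie_Ad, D.X_mem α hα, map_smul]

theorem pullWeight_mem_simpleSet {χ : Dual ℂ D.cartanLie} (hχ : χ ∈ D.simpleSet) :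
    pullWeight D.thetaLie D.thetaLie_mem χ ∈ D.simpleSet := by
  obtain ⟨α, hα, h⟩ := hχ
  exact ⟨_, D.θ_basis α hα, h.charComp⟩

theorem thetaLie_rootVector {χ : Dual ℂ D.cartanLie} (hχ : χ ∈ D.simpleSet) :
    D.thetaLie (D.rootVector (pullWeight D.thetaLie D.thetaLie_mem χ)) = D.rootVector χ := by
  obtain ⟨α, hα, h⟩ := hχ
  rw [rootVector_eq hα h, rootVector_eq (D.θ_basis α hα) h.charComp, ← D.θ_pinning α hα]
  exact matDiff_toLie D.reductive.closed D.θ_algebraic _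

theorem simpleSet_subset : D.simpleSet ⊆ rootSet (L := D.lie) D.cartanLie := by
  rintro χ ⟨α, hα, h⟩
  exact h.mem_rootSet (D.basis.subset hα)

theorem exists_iterate_thetaLie : ∃ N : ℕ, 0 < N ∧ ∀ x, D.thetaLie^[N] x = x := by
  obtain ⟨N, hN, h⟩ := isOfFinOrder_iff_pow_eq_one.1 D.θ_finite
  have key : ∀ (k : ℕ) (s : ℂ) (X : D.lie), (D.θ ^ k) (expG (s • X)) =
      expG (s • D.thetaLie^[k] X) := by
    intro k s X
    induction k with
    | zero => rfl
    | succ k ih =>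
      rw [pow_succ', MulAut.mul_apply, ih, theta_expG, Function.iterate_succ_apply', map_smul]
  refine ⟨N, hN, fun X => eq_of_expG_eq fun s => ?_⟩
  rw [← key, h]
  rfl

theorem exists_mem_closure {S : Set (D.T →* ℂˣ)} {S' : Set (Dual ℂ D.cartanLie)}
    (hS : ∀ α ∈ S, ∃ χ ∈ S', D.IsDiff α χ) {α : D.T →* ℂˣ} (hα : α ∈ Submonoid.closure S) :
    ∃ χ ∈ AddSubmonoid.closure S', D.IsDiff α χ := by
  induction hα using Submonoid.closure_induction with
  | mem α hα =>
    obtain ⟨χ, hχ, h⟩ := hS α hα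
    exact ⟨χ, AddSubmonoid.subset_closure hχ, h⟩
  | one => exact ⟨0, zero_mem _, IsDiffOf.one⟩
  | mul α β _ _ hα hβ =>
    obtain ⟨χ, hχ, h⟩ := hα
    obtain ⟨χ', hχ', h'⟩ := hβ
    exact ⟨χ + χ', add_mem hχ hχ', h.mul h'⟩

theorem exists_isDiff_simple {α : D.T →* ℂˣ} (hα : α ∈ D.Δ) : ∃ χ ∈ D.simpleSet, D.IsDiff α χ := by
  obtain ⟨χ, -, h, -⟩ := exists_isDiff (D.basis.subset hα)
  exact ⟨χ, ⟨α, hα, h⟩, h⟩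

theorem linearIndepOn_simpleSet : LinearIndepOn ℂ id D.simpleSet := by
  have h1 : ∀ χ : D.simpleSet, ∃ α ∈ D.Δ, D.IsDiff α χ := fun χ => χ.2
  choose f hf hf' using h1
  have hinj : Function.Injective fun χ => (⟨f χ, hf χ⟩ : D.Δ) := by
    intro χ χ' h
    have h2 : f χ = f χ' := congrArg Subtype.val h
    exact Subtype.ext ((hf' χ).unique (h2 ▸ hf' χ'))
  refine linearIndependent_of_isDiffOf D.maximalTorus D.isDiag_conj hf' (fun χ => ?_) fun c hc => ?_
  · obtain ⟨-, hne⟩ := simpleSet_subset χ.2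
    obtain ⟨X, hX, hX0⟩ := Submodule.exists_mem_ne_zero_of_ne_bot hne
    obtain ⟨i, j, hij⟩ := exists_conjP_ne_zero (P := D.diagonalizer) hX0
    exact ⟨i, j, eq_of_conjP_ne_zero hX hij⟩
  · have h2 := D.basis.independent (c.mapDomain fun χ => (⟨f χ, hf χ⟩ : D.Δ)) (by
      rw [Finsupp.prod_mapDomain_index_inj hinj]
      exact hc)
    exact Finsupp.mapDomain_injective hinj (h2.trans Finsupp.mapDomain_zero.symm)

/-- The differential of a pinned automorphism permutes `sl₂`-triples that extend the pinning. -/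
theorem exists_isPinned : ∃ (h : Dual ℂ D.cartanLie → D.cartanLie)
    (f : Dual ℂ D.cartanLie → D.lie),
    IsPinned D.thetaLie D.thetaLie_mem D.simpleSet h D.rootVector f := by
  have h1 : ∀ χ : Dual ℂ D.cartanLie, ∃ (h : D.cartanLie) (f : D.lie), χ ∈ D.simpleSet →
      f ∈ weightSpace (L := D.lie) ⊤ (-χ) ∧ χ h = 2 ∧
        IsSl2Triple (h : D.lie) (D.rootVector χ) f := by
    intro χ
    by_cases hχ : χ ∈ D.simpleSet
    · obtain ⟨h, f, hf⟩ := D.split.exists_sl2Triple (simpleSet_subset hχ).1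
        (rootVector_ne_zero hχ) (rootVector_mem hχ)
      exact ⟨h, f, fun _ => hf⟩
    · exact ⟨0, 0, fun h => absurd h hχ⟩
  choose h f hf using h1
  have hmap_f : ∀ χ ∈ D.simpleSet,
      D.thetaLie (f (pullWeight D.thetaLie D.thetaLie_mem χ)) = f χ := by
    intro χ hχ
    obtain ⟨h1, h2, h3⟩ := hf χ hχ
    obtain ⟨h1', h2', h3'⟩ := hf _ (pullWeight_mem_simpleSet hχ)
    have h4 : D.thetaLie (f (pullWeight D.thetaLie D.thetaLie_mem χ)) ∈
        weightSpace (L := D.lie) ⊤ (-χ) := by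
      rw [map_mem_weightSpace_top D.thetaLie D.thetaLie_mem, map_neg]
      exact h1'
    -- `θ` maps `f` to `c f`, hence `h` to `c h`; the value `2` of the roots shows that `c = 1`.
    obtain ⟨c, hc⟩ := D.split.exists_smul_eq (neg_ne_zero.2 (simpleSet_subset hχ).1) h3.f_ne_zero
      h1 h4
    have h5 := congrArg D.thetaLie h3'.lie_e_f
    rw [LieEquiv.map_lie, thetaLie_rootVector hχ, hc, lie_smul, h3.lie_e_f] at h5
    have h6 : restrictAut D.thetaLie D.thetaLie_mem (h (pullWeight D.thetaLie D.thetaLie_mem χ)) =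
        c • h χ := Subtype.ext h5.symm
    rw [pullWeight_apply, h6, map_smul, h2, smul_eq_mul] at h2'
    have h7 : c = 1 := by linear_combination h2' / 2
    rw [hc, h7, one_smul]
  refine ⟨h, f, ?_⟩
  exact
    { finite_order := exists_iterate_thetaLie
      indep := linearIndepOn_simpleSet
      subset := simpleSet_subset
      pos_or_neg := by
        intro χ hχ
        obtain ⟨α, hα, hαχ⟩ := exists_root hχ
        rcases D.basis.pos_or_neg α hα with h1 | h1
        · obtain ⟨χ', hχ', h2⟩ := exists_mem_closure (fun _ => exists_isDiff_simple) h1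
          exact Or.inl (hαχ.unique h2 ▸ hχ')
        · obtain ⟨χ', hχ', h2⟩ := exists_mem_closure (fun _ => exists_isDiff_simple) h1
          exact Or.inr ((show D.IsDiff _ _ from hαχ.inv).unique h2 ▸ hχ')
      pull_mem := fun _ => pullWeight_mem_simpleSet
      triple := fun χ hχ => (hf χ hχ).2.2
      e_mem := fun _ => rootVector_mem
      f_mem := fun χ hχ => (hf χ hχ).1
      map_h := by
        intro χ hχ
        have h5 := congrArg D.thetaLie (hf _ (pullWeight_mem_simpleSet hχ)).2.2.lie_e_f
        rw [LieEquiv.map_lie, thetaLie_rootVector hχ, hmap_f χ hχ, (hf χ hχ).2.2.lie_e_f] at h5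
        exact h5.symm
      map_e := fun _ => thetaLie_rootVector
      map_f := hmap_f }

end PinnedDualGroup

/-! ### Determinants of monomial operators -/

section Monomial

/-- The matrix `1 - y C`, where `C` is the companion matrix of `X ^ (m + 1) - c`. -/
theorem det_one_sub_smul_companion (m : ℕ) (c y : ℂ) :
    (1 - y • Matrix.of fun i j : Fin (m + 1) => if (i : ℕ) = j + 1 then 1 else
      if i = 0 ∧ j = Fin.last m then c else 0).det = 1 - y ^ (m + 1) * c := by
  set N : Matrix (Fin (m + 1)) (Fin (m + 1)) ℂ :=
    Matrix.of fun i j => if (i : ℕ) = j + 1 then 1 else 0 with hN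
  set w : Fin (m + 1) → ℂ := fun i => y ^ (i : ℕ) with hw
  set u : Fin (m + 1) → ℂ := Pi.single (Fin.last m) (y * c) with hu
  have h1 : (1 - y • N) *ᵥ w = Pi.single 0 1 := by
    funext i
    rw [Matrix.sub_mulVec, Matrix.one_mulVec, Matrix.smul_mulVec]
    simp only [Pi.sub_apply, Pi.smul_apply, smul_eq_mul, Matrix.mulVec, dotProduct, hN,
      Matrix.of_apply, hw, ite_mul, one_mul, zero_mul]
    refine Fin.cases ?_ (fun i => ?_) i
    · simp
    · rw [Finset.sum_eq_single (Fin.castSucc i)]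
      · simp [pow_succ, mul_comm]
      · intro b _ hb
        rw [if_neg]
        intro h
        exact hb (Fin.ext (by simpa using h.symm))
      · simp
  have h2 : (1 - y • Matrix.of fun i j : Fin (m + 1) => if (i : ℕ) = j + 1 then 1 else
      if i = 0 ∧ j = Fin.last m then c else 0) =
      (1 - y • N) * (1 - Matrix.vecMulVec w u) := by
    rw [mul_sub, mul_one, Matrix.mul_vecMulVec, h1]
    ext i j
    simp only [Matrix.sub_apply, Matrix.smul_apply, Matrix.of_apply, Matrix.vecMulVec_apply, hN, hu,
      smul_eq_mul]
    by_cases hi : i = 0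
    · subst hi
      by_cases hj : j = Fin.last m
      · subst hj; simp
      · simp [hj]
    · simp [hi]
  have h3 : (1 - y • N).det = 1 := by
    rw [Matrix.det_of_isLowerTriangular]
    · simp [hN]
    · intro i j hij
      have hij' : i < j := hij
      rw [Matrix.sub_apply, Matrix.one_apply_ne hij'.ne, Matrix.smul_apply, hN, Matrix.of_apply,
        if_neg (by have := Fin.lt_def.1 hij'; omega)]
      simp
  rw [h2, Matrix.det_mul, h3, one_mul, Matrix.vecMulVec_eq Unit, Matrix.det_one_sub_mul_comm]
  simp [Matrix.mul_apply, hu, hw, pow_succ, Pi.single_apply]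
  ring

theorem det_blockDiagonal' {ι : Type*} [Fintype ι] [DecidableEq ι] {k : ι → ℕ}
    (M : ∀ i, Matrix (Fin (k i)) (Fin (k i)) ℂ) :
    (Matrix.blockDiagonal' M).det = ∏ i, (M i).det := by
  let _ : LinearOrder ι := LinearOrder.lift' (Fintype.equivFin ι) (Fintype.equivFin ι).injective
  have h : (Matrix.blockDiagonal' M).BlockTriangular (Sigma.fst : (Σ i, Fin (k i)) → ι) := by
    rintro ⟨i, a⟩ ⟨j, b⟩ hij
    exact Matrix.blockDiagonal'_apply_ne _ _ _ (ne_of_gt hij)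
  rw [h.det_fintype]
  refine Finset.prod_congr rfl fun i _ => ?_
  let φ : Fin (k i) ≃ {p : Σ i, Fin (k i) // p.1 = i} :=
    Equiv.ofBijective (fun a => ⟨⟨i, a⟩, rfl⟩)
      ⟨fun a b hab => by simpa using hab, fun ⟨⟨j, a⟩, hj⟩ => by
        subst hj
        exact ⟨a, rfl⟩⟩
  rw [← Matrix.det_submatrix_equiv_self φ]
  congr 1
  ext a b
  exact Matrix.blockDiagonal'_apply_eq M i a b

variable {V ι : Type*} [AddCommGroup V] [Module ℂ V] [Fintype ι]

/-- The characteristic determinant of an operator that permutes the lines spanned by the vectors of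
a basis: each cycle, of length `k`, on whose lines the `k`-th power of the operator is `c`,
contributes a factor `1 - yᵏ c`. -/
theorem det_one_sub_smul_eq_prod {k : ι → ℕ} (hk : ∀ i, 0 < k i) {A : V →ₗ[ℂ] V} {e : ι → V}
    {c : ι → ℂ} (hc : ∀ i, (A ^ k i) (e i) = c i • e i) (b : Basis (Σ i, Fin (k i)) ℂ V)
    (hb : ∀ i (j : Fin (k i)), b ⟨i, j⟩ = (A ^ (j : ℕ)) (e i)) (y : ℂ) :
    LinearMap.det (1 - y • A) = ∏ i, (1 - y ^ k i * c i) := by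
  classical
  obtain ⟨m, rfl⟩ : ∃ m : ι → ℕ, k = fun i => m i + 1 :=
    ⟨fun i => k i - 1, funext fun i => (Nat.succ_pred_eq_of_pos (hk i)).symm⟩
  have hA : ∀ i (j : Fin (m i + 1)), A (b ⟨i, j⟩) =
      if h : (j : ℕ) + 1 < m i + 1 then b ⟨i, ⟨j + 1, h⟩⟩ else c i • b ⟨i, 0⟩ := by
    intro i j
    rw [hb, ← Module.End.mul_apply, ← pow_succ']
    split_ifs with h
    · rw [hb]
    · rw [hb, show (j : ℕ) + 1 = m i + 1 by omega, hc]
      simp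
  rw [← LinearMap.det_toMatrix b]
  have h1 : LinearMap.toMatrix b b (1 - y • A) = Matrix.blockDiagonal' fun i =>
      (1 - y • Matrix.of fun a j : Fin (m i + 1) => if (a : ℕ) = j + 1 then 1 else
        if a = 0 ∧ j = Fin.last (m i) then c i else 0 : Matrix _ _ ℂ) := by
    ext ⟨i', a⟩ ⟨i, j⟩
    rw [LinearMap.toMatrix_apply, LinearMap.sub_apply, LinearMap.smul_apply, Module.End.one_apply,
      map_sub, map_smul, Finsupp.sub_apply, Finsupp.smul_apply, hA]
    by_cases hi : i' = i
    · subst hi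
      rw [Matrix.blockDiagonal'_apply_eq, Matrix.sub_apply, Matrix.smul_apply, Matrix.of_apply]
      congr 1
      · rw [Basis.repr_self, Finsupp.single_apply, Matrix.one_apply]
        simp [eq_comm]
      · congr 1
        split_ifs with h h1 h2 h1 h2
        · rw [Basis.repr_self, Finsupp.single_apply, if_pos]
          simp [Fin.ext_iff, h1]
        · exfalso
          have := congrArg Fin.val h2.2
          rw [Fin.val_last] at this
          omega
        · rw [Basis.repr_self, Finsupp.single_apply, if_neg]
          simp [Fin.ext_iff]
          omega
        · exfalso
          omega
        · rw [map_smul, Finsupp.smul_apply, Basis.repr_self, Finsupp.single_apply, if_pos]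
          · simp
          · rw [h2.1]
        · rw [map_smul, Finsupp.smul_apply, Basis.repr_self, Finsupp.single_apply, if_neg]
          · simp
          · intro h3
            have h4 : (0 : Fin (m i' + 1)) = a := by simpa using h3
            exact h2 ⟨h4.symm, Fin.ext (by rw [Fin.val_last]; omega)⟩
    · rw [Matrix.blockDiagonal'_apply_ne _ _ _ hi]
      have hne : ∀ l, (⟨i, l⟩ : Σ i, Fin (m i + 1)) ≠ ⟨i', a⟩ := fun l h =>
        hi (congrArg Sigma.fst h).symm
      split_ifs <;> simp [hne]
  rw [h1, det_blockDiagonal']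
  exact Finset.prod_congr rfl fun i _ => det_one_sub_smul_companion _ _ _

end Monomial

/-! ### Levi subgroups and their centers -/

section ClosedSubgroups

variable {n : ℕ} {G : Subgroup (GL (Fin n) ℂ)} {hG : IsZariskiClosed G}

/-- One-parameter groups lie in the identity component. -/
theorem mem_identityComponent_of_forall {A : Subgroup G} {X : matLie hG}
    (h : ∀ s : ℂ, expG (s • X) ∈ A) : expG X ∈ identityComponent A := by
  set c : ℂ → A := fun s => ⟨expG (s • X), h s⟩ with hc
  have hexp : ∀ X : Matrix (Fin n) (Fin n) ℂ, Continuous fun s : ℂ => exp (s • X) := fun X =>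
    continuous_pi fun i => continuous_pi fun j => continuous_iff_continuousAt.2 fun s =>
      (hasDerivAt_exp_entry X i j s).continuousAt
  have hcont : Continuous c := by
    refine Continuous.subtype_mk (Continuous.subtype_mk ?_ _) _
    rw [Units.continuous_iff]
    refine ⟨hexp X, ?_⟩
    have h1 : (fun s : ℂ => ((expGL ((s • X : matLie hG) : Matrix (Fin n) (Fin n) ℂ))⁻¹).val) =
        fun s : ℂ => exp (s • (-(X : Matrix (Fin n) (Fin n) ℂ))) := by
      funext s
      rw [smul_neg]
      rfl
    rw [h1]
    exact hexp _
  have h0 : c 0 = 1 := by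
    apply Subtype.ext; apply Subtype.ext
    change expGL (((0 : ℂ) • X : matLie hG) : Matrix (Fin n) (Fin n) ℂ) = 1
    rw [zero_smul]
    exact expGL_zero
  have h2 : c 1 ∈ Subgroup.connectedComponentOfOne A :=
    (isPreconnected_range hcont).subset_connectedComponent ⟨0, h0⟩ ⟨1, rfl⟩
  refine ⟨c 1, h2, ?_⟩
  change expG ((1 : ℂ) • X) = _
  rw [one_smul]

theorem IsClosedIn.inf {A B : Subgroup G} (hA : IsClosedIn A) (hB : IsClosedIn B) :
    IsClosedIn (A ⊓ B) := by
  obtain ⟨S, hS, hS'⟩ := hA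
  obtain ⟨R, hR, hR'⟩ := hB
  refine ⟨S ∪ R, Set.union_subset hS hR, fun g => ?_⟩
  rw [Subgroup.mem_inf, hS', hR']
  constructor
  · rintro ⟨h1, h2⟩ f (hf | hf)
    exacts [h1 f hf, h2 f hf]
  · exact fun h => ⟨fun f hf => h f (Or.inl hf), fun f hf => h f (Or.inr hf)⟩

variable {P : GL (Fin n) ℂ} {T : Subgroup G} (hT : IsMaximalTorus T)
  (hP : ∀ t ∈ T, (P * (t : GL (Fin n) ℂ) * P⁻¹).val.IsDiag)
include hT hP

/-- The identity component of a closed subgroup of a torus is the image of its Lie algebra under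
the exponential map. -/
theorem exists_of_mem_identityComponent (hG : IsZariskiClosed G) {A : Subgroup G}
    (hA : IsClosedIn A) (hAT : A ≤ T) {a : G} (ha : a ∈ identityComponent A) :
    ∃ h : cartan hG P, (∀ s : ℂ, expG (s • (h : matLie hG)) ∈ A) ∧ expG (h : matLie hG) = a := by
  obtain ⟨v, hv, hav⟩ := exists_eq_expGL (fun t ht => hP t (hAT ht)) ha
  have hv' := (mem_diagLie_iff hG hA).1 hv
  have hvT : v ∈ diagLie (trivialChars (diagPart P T)) := by
    rw [mem_diagLie_iff hG hT.torus.closed]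
    intro s
    obtain ⟨h1, h2⟩ := mem_diagPart.1 (hv' s)
    exact mem_diagPart.2 ⟨h1, hAT h2⟩
  obtain ⟨h, hh, hc⟩ := exists_cartan_of_mem_diagLie (hG := hG) hT hvT
  refine ⟨h, fun s => ?_, Subtype.ext ?_⟩
  · obtain ⟨h1, h2⟩ := mem_diagPart.1 (hv' s)
    have h3 : expG (s • (h : matLie hG)) = ⟨diagGL P (expDiag (s • v)), h1⟩ := by
      apply Subtype.ext
      change expGL (s • ((h : matLie hG) : Matrix (Fin n) (Fin n) ℂ)) = diagGL P (expDiag (s • v))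
      rw [← expGL_diagMat, map_smul, ← hh]
    rw [h3]
    exact h2
  · rw [hav, ← hh]
    rfl

end ClosedSubgroups

namespace PinnedDualGroup

variable {n : ℕ} {D : PinnedDualGroup n}

theorem isClosedIn_fixed : IsClosedIn D.fixed := by
  refine ⟨{k | ∃ f ∈ regularFunctions D.G, k = fun g => f (D.θ g) - f g}, ?_, fun g => ?_⟩
  · rintro _ ⟨f, hf, rfl⟩
    exact sub_mem ((D.θ_algebraic f).2 hf) hf
  · constructor
    · rintro hg _ ⟨f, -, rfl⟩
      have : D.θ g = g := hg
      simp only [this, sub_self]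
    · intro h
      change D.θ g = g
      apply Subtype.ext; apply Units.ext
      ext i j
      exact sub_eq_zero.1 (h _ ⟨_, entry_mem i j, rfl⟩)

theorem mem_torusFixed_iff {t : D.G} : t ∈ D.torusFixed ↔
    ∃ h ∈ fixedPart D.thetaLie D.cartanLie, expG (h : D.lie) = t := by
  constructor
  · intro ht
    obtain ⟨h, hh, rfl⟩ := exists_of_mem_identityComponent D.maximalTorus D.isDiag_conj
      D.reductive.closed (D.maximalTorus.torus.closed.inf isClosedIn_fixed) inf_le_left ht
    refine ⟨h, eq_of_expG_eq fun s => ?_, rfl⟩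
    rw [← map_smul, ← theta_expG]
    exact (hh s).2
  · rintro ⟨h, hh, rfl⟩
    refine mem_identityComponent_of_forall fun s =>
      ⟨expG_mem_torus D.maximalTorus D.isDiag_conj (s • h), ?_⟩
    change D.θ (expG (s • (h : D.lie))) = _
    rw [theta_expG, map_smul, hh]
    rfl

/-- Equivalence of roots, in terms of their differentials. -/
theorem rootEquiv_iff {α β : D.T →* ℂˣ} {χ χ' : Dual ℂ D.cartanLie} (h : D.IsDiff α χ)
    (h' : D.IsDiff β χ') : D.RootEquiv α β ↔ RestrictEquiv D.thetaLie χ χ' := by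
  refine exists₂_congr fun k l => and_congr_right fun _ => and_congr_right fun _ => ?_
  have key : ∀ (a : D.cartanLie) (ha : expG (a : D.lie) ∈ D.T),
      (α ⟨_, ha⟩ ^ k = β ⟨_, ha⟩ ^ l ↔ Complex.exp (k * χ a) = Complex.exp (l * χ' a)) := by
    intro a ha
    rw [← Units.val_inj, Units.val_pow_eq_pow_val, Units.val_pow_eq_pow_val, h, h',
      Complex.exp_nat_mul, Complex.exp_nat_mul]
  constructor
  · intro hh a ha
    rw [← sub_eq_zero]
    refine eq_zero_of_exp_eq_one fun s => ?_
    have h1 := hh ⟨_, expG_mem_torus D.maximalTorus D.isDiag_conj (s • a)⟩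
      (mem_torusFixed_iff.2 ⟨s • a, Submodule.smul_mem _ s ha, rfl⟩)
    rw [key, map_smul, map_smul, smul_eq_mul, smul_eq_mul] at h1
    rw [mul_sub, Complex.exp_sub, mul_left_comm, h1, mul_left_comm, div_self (Complex.exp_ne_zero _)]
  · rintro hh ⟨t, ht⟩ htf
    obtain ⟨a, ha, rfl⟩ := mem_torusFixed_iff.1 htf
    rw [key, hh a ha]

namespace Levi

variable (L : D.Levi)

/-- The differentials of the simple roots of `M`. -/
def simpleSet : Set (Dual ℂ D.cartanLie) := {χ | ∃ α ∈ L.J, D.IsDiff α χ}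

/-- The Lie algebra of the center of `M`. -/
def centerLie : Submodule ℂ D.cartanLie where
  carrier := {h | ∀ χ ∈ L.simpleSet, χ h = 0}
  add_mem' {h h'} hh hh' χ hχ := by rw [map_add, hh χ hχ, hh' χ hχ, add_zero]
  zero_mem' χ _ := map_zero χ
  smul_mem' c h hh χ hχ := by rw [map_smul, hh χ hχ, smul_zero]

variable {L}

theorem simpleSet_subset : L.simpleSet ⊆ D.simpleSet := by
  rintro χ ⟨α, hα, h⟩
  exact ⟨α, L.subset hα, h⟩

theorem exists_isDiff_of_mem {α : D.T →* ℂˣ} (hα : α ∈ L.J) : ∃ χ ∈ L.simpleSet, D.IsDiff α χ := by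
  obtain ⟨χ, -, h⟩ := exists_isDiff_simple (L.subset hα)
  exact ⟨χ, ⟨α, hα, h⟩, h⟩

variable (L) in
/-- The kernel of the simple roots of `M`. -/
def kernel : Subgroup D.G := (⨅ α ∈ L.J, α.ker).map D.T.subtype

theorem mem_kernel {g : D.G} : g ∈ L.kernel ↔ ∃ h : g ∈ D.T, ∀ α ∈ L.J, α ⟨g, h⟩ = 1 := by
  rw [kernel, Subgroup.mem_map]
  constructor
  · rintro ⟨t, ht, rfl⟩
    refine ⟨t.2, fun α hα => ?_⟩
    rw [Subgroup.mem_iInf] at ht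
    exact Subgroup.mem_iInf.1 (ht α) hα
  · rintro ⟨h, hg⟩
    refine ⟨⟨g, h⟩, ?_, rfl⟩
    rw [Subgroup.mem_iInf]
    exact fun α => Subgroup.mem_iInf.2 (hg α)

theorem isClosedIn_kernel : IsClosedIn L.kernel := by
  obtain ⟨S, hS, hS'⟩ := D.maximalTorus.torus.closed
  refine ⟨S ∪ {k | k ∈ regularFunctions D.G ∧ ∃ α ∈ L.J, ∀ t : D.T, k t = (α t : ℂ) - 1},
    Set.union_subset hS fun k hk => hk.1, fun g => ?_⟩
  rw [mem_kernel]
  constructor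
  · rintro ⟨h, hg⟩ f (hf | ⟨-, α, hα, hf⟩)
    · exact (hS' g).1 h f hf
    · rw [hf ⟨g, h⟩, hg α hα, Units.val_one, sub_self]
  · intro h
    have hgT : g ∈ D.T := (hS' g).2 fun f hf => h f (Or.inl hf)
    refine ⟨hgT, fun α hα => ?_⟩
    obtain ⟨-, -, -, f, hf, hf'⟩ := exists_isDiff (D.basis.subset (L.subset hα))
    have h1 := h (f - 1) (Or.inr ⟨sub_mem hf (one_mem _), α, hα, fun t => by
      rw [Pi.sub_apply, hf', Pi.one_apply]⟩)
    apply Units.ext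
    rw [Pi.sub_apply, hf' ⟨g, hgT⟩, Pi.one_apply] at h1
    exact sub_eq_zero.1 h1

theorem expG_mem_kernel {h : D.cartanLie} (hh : h ∈ L.centerLie) : expG (h : D.lie) ∈ L.kernel := by
  refine mem_kernel.2 ⟨expG_mem_torus D.maximalTorus D.isDiag_conj h, fun α hα => ?_⟩
  obtain ⟨χ, hχ, hαχ⟩ := exists_isDiff_of_mem hα
  apply Units.ext
  rw [hαχ, hh χ hχ, Complex.exp_zero, Units.val_one]

theorem mem_identityComponent_kernel {g : D.G} : g ∈ identityComponent L.kernel ↔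
    ∃ h ∈ L.centerLie, expG (h : D.lie) = g := by
  constructor
  · intro hg
    obtain ⟨h, hh, rfl⟩ := exists_of_mem_identityComponent D.maximalTorus D.isDiag_conj
      D.reductive.closed isClosedIn_kernel (fun g hg => (mem_kernel.1 hg).1) hg
    refine ⟨h, fun χ ⟨α, hα, hαχ⟩ => eq_zero_of_exp_eq_one fun s => ?_, rfl⟩
    obtain ⟨h1, h2⟩ := mem_kernel.1 (hh s)
    have h3 : (α ⟨_, h1⟩ : ℂ) = _ := hαχ (s • h) h1
    rw [← smul_eq_mul, ← map_smul, ← h3, h2 α hα, Units.val_one]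
  · rintro ⟨h, hh, rfl⟩
    exact mem_identityComponent_of_forall fun s =>
      expG_mem_kernel (L.centerLie.smul_mem s hh)

theorem mem_M_iff {m : D.G} : m ∈ L.M ↔
    ∀ h ∈ L.centerLie, expG (h : D.lie) * m = m * expG (h : D.lie) := by
  rw [Levi.M, standardLevi, Subgroup.mem_centralizer_iff]
  constructor
  · intro hm h hh
    exact hm _ (mem_identityComponent_kernel.2 ⟨h, hh, rfl⟩)
  · intro hm s hs
    obtain ⟨h, hh, rfl⟩ := mem_identityComponent_kernel.1 hs
    exact hm h hh

theorem mem_centralizer {h : D.cartanLie} (hh : h ∈ L.centerLie) :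
    expG (h : D.lie) ∈ Subgroup.centralizer (L.M : Set D.G) :=
  Subgroup.mem_centralizer_iff.2 fun _ hm => (mem_M_iff.1 hm h hh).symm

/-- The Lie algebra of `M` is the centralizer of the Lie algebra of the center of `M`. -/
theorem mem_lieSub_iff {E : LieAlg D.G} : E ∈ lieSub L.M ↔
    toLie D.reductive.closed E ∈ weightSpace (L := D.lie) L.centerLie 0 := by
  set X := toLie D.reductive.closed E with hX
  have key : ∀ h : D.cartanLie, ⁅(h : D.lie), X⁆ = 0 ↔ ∀ i j,
      conjP D.diagonalizer X i j ≠ 0 → coord i h - coord j h = 0 := by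
    intro h
    constructor
    · intro h1 i j hij
      have h2 := conjP_lie_apply h X i j
      rw [h1] at h2
      have h3 : conjP D.diagonalizer ((0 : D.lie) : Matrix (Fin n) (Fin n) ℂ) i j = 0 := by simp
      rw [h3] at h2
      exact (mul_eq_zero.1 h2.symm).resolve_right hij
    · intro h1
      apply Subtype.ext
      apply conjP_injective D.diagonalizer
      ext i j
      rw [conjP_lie_apply]
      have h3 : conjP D.diagonalizer ((0 : D.lie) : Matrix (Fin n) (Fin n) ℂ) i j = 0 := by simp
      rw [h3]
      by_cases hij : conjP D.diagonalizer X i j = 0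
      · rw [hij, mul_zero]
      · rw [h1 i j hij, zero_mul]
  have hmem : X ∈ weightSpace (L := D.lie) L.centerLie 0 ↔
      ∀ h ∈ L.centerLie, ⁅(h : D.lie), X⁆ = 0 :=
    forall₂_congr fun h _ => by rw [LinearMap.zero_apply, zero_smul]
  rw [hmem]
  constructor
  · intro hE h hh
    rw [key]
    intro i j hij
    refine eq_zero_of_exp_eq_one fun s => ?_
    set g : D.G := expG ((s • h : D.cartanLie) : D.lie)
    have h1 : adj D.reductive.closed g X = X := by
      rw [hX, ← toLie_Ad]
      apply Subtype.ext
      rw [coe_toLie, coe_toLie]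
      ext i j
      rw [toMat_apply, toMat_apply, ← sub_eq_zero]
      have h2 := hE (pullback (conj_mem_algAut g) (entry D.G i j) - entry D.G i j) (fun m hm => by
        have h3 := mem_M_iff.1 hm (s • h) (L.centerLie.smul_mem s hh)
        have h4 : MulAut.conj g m = m := by
          rw [MulAut.conj_apply, h3, mul_inv_cancel_right]
        change (entry D.G i j).1 (MulAut.conj g m) - (entry D.G i j).1 m = 0
        rw [h4, sub_self])
      rw [map_sub] at h2
      exact h2
    have h2 := conjP_adj_expG (s • h) X i j
    change conjP D.diagonalizer (adj D.reductive.closed g X : D.lie) i j = _ at h2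
    rw [h1, map_smul, map_smul, ← smul_sub, smul_eq_mul] at h2
    exact (mul_right_cancel₀ hij ((one_mul _).trans h2)).symm
  · intro h1 f hf
    have h2 : ∀ s : ℂ, expG (s • X) ∈ L.M := by
      intro s
      rw [mem_M_iff]
      intro h hh
      have h3 : adj D.reductive.closed (expG (h : D.lie)) X = X := by
        apply Subtype.ext
        apply conjP_injective D.diagonalizer
        ext i j
        rw [conjP_adj_expG]
        by_cases hij : conjP D.diagonalizer X i j = 0
        · rw [hij, mul_zero]
        · rw [(key h).1 (h1 h hh) i j hij, Complex.exp_zero, one_mul]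
      have h4 := conj_expG D.reductive.closed (expG (h : D.lie)) (s • X)
      rw [map_smul, h3] at h4
      exact mul_inv_eq_iff_eq_mul.1 h4
    have h5 := hasDerivAt_expG X f
    rw [(funext fun s => hf _ (h2 s) : (fun s : ℂ => f.1 (expG (s • X))) = fun _ => 0)] at h5
    have h6 := h5.unique (hasDerivAt_const _ _)
    rwa [hX, LinearEquiv.symm_apply_apply] at h6

theorem thetaLie_mem_weightSpace {X : D.lie} :
    D.thetaLie X ∈ weightSpace (L := D.lie) L.centerLie 0 ↔
      X ∈ weightSpace (L := D.lie) L.centerLie 0 := by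
  obtain ⟨E, rfl⟩ := (toLie D.reductive.closed).surjective X
  have h1 : D.thetaLie (toLie D.reductive.closed E) =
      toLie D.reductive.closed (differential D.θ_algebraic E) := matDiff_toLie _ _ _
  rw [h1, ← mem_lieSub_iff, ← mem_lieSub_iff]
  constructor
  · intro h
    obtain ⟨E', hE', h2⟩ := (map_lieSub D.θ_algebraic L.stable).ge h
    rwa [← (differentialEquiv D.θ_algebraic).injective h2]
  · exact differential_mem_lieSub D.θ_algebraic fun m hm => (L.stable m).2 hm

theorem mem_weightSpace_zero_iff {χ : Dual ℂ D.cartanLie} {X : D.lie} (hX0 : X ≠ 0)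
    (hX : X ∈ weightSpace (L := D.lie) ⊤ χ) :
    X ∈ weightSpace (L := D.lie) L.centerLie 0 ↔ ∀ h ∈ L.centerLie, χ h = 0 := by
  constructor
  · intro h a ha
    exact eq_of_mem_weightSpace hX0 (weightSpace_top_le _ _ hX) h ha
  · intro h a ha
    rw [hX a trivial, h a ha]
    rfl

theorem pull_vanish_iff {χ : Dual ℂ D.cartanLie} (hχ : χ ∈ rootSet (L := D.lie) D.cartanLie) :
    (∀ h ∈ L.centerLie, pullWeight D.thetaLie D.thetaLie_mem χ h = 0) ↔
      ∀ h ∈ L.centerLie, χ h = 0 := by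
  obtain ⟨X, hX, hX0⟩ := Submodule.exists_mem_ne_zero_of_ne_bot
    ((pullWeight_mem_rootSet D.thetaLie D.thetaLie_mem).2 hχ).2
  have h1 : D.thetaLie X ∈ weightSpace (L := D.lie) ⊤ χ := (map_mem_weightSpace_top _ _).2 hX
  have h2 : D.thetaLie X ≠ 0 := fun h => hX0 (D.thetaLie.injective (h.trans (map_zero _).symm))
  rw [← mem_weightSpace_zero_iff hX0 hX, ← mem_weightSpace_zero_iff h2 h1,
    thetaLie_mem_weightSpace]

open Classical in
/-- An element of the center of `Lie(M)` on which precisely the simple roots of `M` vanish. -/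
theorem exists_indicator : ∃ x : D.cartanLie, ∀ χ ∈ D.simpleSet,
    χ x = if χ ∈ L.simpleSet then 0 else 1 := by
  obtain ⟨h, f, Q⟩ := exists_isPinned (D := D)
  exact Q.exists_eq fun χ => if χ ∈ L.simpleSet then 0 else 1

open Classical in
theorem mem_centerLie_of_indicator {x : D.cartanLie} (hx : ∀ χ ∈ D.simpleSet,
    χ x = if χ ∈ L.simpleSet then 0 else 1) : x ∈ L.centerLie := fun χ hχ => by
  rw [hx χ (simpleSet_subset hχ), if_pos hχ]

open Classical in
theorem mem_simpleSet_iff {χ : Dual ℂ D.cartanLie} (hχ : χ ∈ D.simpleSet) :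
    χ ∈ L.simpleSet ↔ ∀ h ∈ L.centerLie, χ h = 0 := by
  refine ⟨fun h1 h hh => hh χ h1, fun h => ?_⟩
  obtain ⟨x, hx⟩ := exists_indicator (L := L)
  by_contra hn
  have h1 := h x (mem_centerLie_of_indicator hx)
  rw [hx χ hχ, if_neg hn] at h1
  exact one_ne_zero h1

theorem pull_mem_simpleSet_iff {χ : Dual ℂ D.cartanLie} (hχ : χ ∈ D.simpleSet) :
    pullWeight D.thetaLie D.thetaLie_mem χ ∈ L.simpleSet ↔ χ ∈ L.simpleSet := by
  rw [mem_simpleSet_iff hχ, mem_simpleSet_iff (pullWeight_mem_simpleSet hχ),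
    pull_vanish_iff (PinnedDualGroup.simpleSet_subset hχ)]

open Classical in
/-- A `θ`-fixed element of the center of `Lie(M)` on which precisely the simple roots of `M`
vanish. -/
theorem exists_fixed_indicator : ∃ x ∈ fixedPart D.thetaLie D.cartanLie, ∀ χ ∈ D.simpleSet,
    χ x = if χ ∈ L.simpleSet then 0 else 1 := by
  obtain ⟨h, f, Q⟩ := exists_isPinned (D := D)
  exact Q.exists_fixed_eq (w := fun χ => if χ ∈ L.simpleSet then 0 else 1) fun χ hχ =>
    if_congr (pull_mem_simpleSet_iff hχ) rfl rfl

open Classical in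
theorem exists_nat_of_mem_closure {x : D.cartanLie} (hx : ∀ χ ∈ D.simpleSet,
    χ x = if χ ∈ L.simpleSet then 0 else 1) {χ : Dual ℂ D.cartanLie}
    (hχ : χ ∈ AddSubmonoid.closure D.simpleSet) :
    ∃ m : ℕ, χ x = m ∧ (m = 0 → χ ∈ AddSubmonoid.closure L.simpleSet) := by
  induction hχ using AddSubmonoid.closure_induction with
  | mem χ hχ =>
    by_cases h : χ ∈ L.simpleSet
    · exact ⟨0, by rw [hx χ hχ, if_pos h, Nat.cast_zero], fun _ => AddSubmonoid.subset_closure h⟩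
    · exact ⟨1, by rw [hx χ hχ, if_neg h, Nat.cast_one], fun h => absurd h one_ne_zero⟩
  | zero => exact ⟨0, by simp, fun _ => zero_mem _⟩
  | add χ χ' _ _ h h' =>
    obtain ⟨m, hm, hm'⟩ := h
    obtain ⟨k, hk, hk'⟩ := h'
    refine ⟨m + k, by rw [LinearMap.add_apply, hm, hk, Nat.cast_add], fun h0 => ?_⟩
    exact add_mem (hm' (by omega)) (hk' (by omega))

open Classical in
theorem exists_int_of_mem_rootSet {x : D.cartanLie} (hx : ∀ χ ∈ D.simpleSet,
    χ x = if χ ∈ L.simpleSet then 0 else 1) {χ : Dual ℂ D.cartanLie}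
    (hχ : χ ∈ rootSet (L := D.lie) D.cartanLie) :
    ∃ m : ℤ, χ x = m ∧ (m = 0 → χ ∈ AddSubgroup.closure L.simpleSet) := by
  obtain ⟨h, f, Q⟩ := exists_isPinned (D := D)
  have hle : AddSubmonoid.closure L.simpleSet ≤
      (AddSubgroup.closure L.simpleSet).toAddSubmonoid :=
    AddSubmonoid.closure_le.2 AddSubgroup.subset_closure
  rcases Q.pos_or_neg χ hχ with h1 | h1
  · obtain ⟨m, hm, hm'⟩ := exists_nat_of_mem_closure hx h1
    exact ⟨m, by simpa using hm, fun h0 => hle (hm' (by exact_mod_cast h0))⟩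
  · obtain ⟨m, hm, hm'⟩ := exists_nat_of_mem_closure hx h1
    refine ⟨-m, ?_, fun h0 => ?_⟩
    · rw [LinearMap.neg_apply] at hm
      push_cast
      rw [← hm, neg_neg]
    · exact neg_mem_iff.1 (hle (hm' (by exact_mod_cast neg_eq_zero.1 h0)))

open Classical in
theorem apply_eq_zero_iff {x : D.cartanLie} (hx : ∀ χ ∈ D.simpleSet,
    χ x = if χ ∈ L.simpleSet then 0 else 1) {χ : Dual ℂ D.cartanLie}
    (hχ : χ ∈ rootSet (L := D.lie) D.cartanLie) :
    χ x = 0 ↔ ∀ h ∈ L.centerLie, χ h = 0 := by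
  refine ⟨fun h0 => ?_, fun h => h x (mem_centerLie_of_indicator hx)⟩
  obtain ⟨m, hm, hm'⟩ := exists_int_of_mem_rootSet hx hχ
  have h1 := hm' (by rw [hm] at h0; exact_mod_cast h0)
  intro h hh
  clear hm hm' h0 hχ
  induction h1 using AddSubgroup.closure_induction with
  | mem χ hχ => exact hh χ hχ
  | zero => rfl
  | add χ χ' _ _ h1 h2 => rw [LinearMap.add_apply, h1, h2, add_zero]
  | neg χ _ h1 => rw [LinearMap.neg_apply, h1, neg_zero]

open Classical in
/-- The roots of `M` are the roots that vanish on the center of `Lie(M)`. -/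
theorem mem_rootsM_iff {x : D.cartanLie} (hx : ∀ χ ∈ D.simpleSet,
    χ x = if χ ∈ L.simpleSet then 0 else 1) {α : D.T →* ℂˣ} (hα : α ∈ roots D.T)
    {χ : Dual ℂ D.cartanLie} (h : D.IsDiff α χ) : α ∈ L.rootsM ↔ χ x = 0 := by
  constructor
  · rintro ⟨-, h1⟩
    have key : ∃ χ, D.IsDiff α χ ∧ χ x = 0 := by
      clear hα h
      induction h1 using Subgroup.closure_induction with
      | mem α hα =>
        obtain ⟨χ, hχ, h⟩ := exists_isDiff_of_mem hα
        exact ⟨χ, h, mem_centerLie_of_indicator hx χ hχ⟩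
      | one => exact ⟨0, IsDiffOf.one, rfl⟩
      | mul α β _ _ h1 h2 =>
        obtain ⟨χ, h1, h1'⟩ := h1
        obtain ⟨χ', h2, h2'⟩ := h2
        exact ⟨χ + χ', h1.mul h2, by rw [LinearMap.add_apply, h1', h2', add_zero]⟩
      | inv α _ h1 =>
        obtain ⟨χ, h1, h1'⟩ := h1
        exact ⟨-χ, h1.inv, by rw [LinearMap.neg_apply, h1', neg_zero]⟩
    obtain ⟨χ', h2, h2'⟩ := key
    rwa [h.unique h2]
  · intro h0
    obtain ⟨m, hm, hm'⟩ := exists_int_of_mem_rootSet hx (h.mem_rootSet hα)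
    have h1 := hm' (by rw [hm] at h0; exact_mod_cast h0)
    have key : ∃ β ∈ Subgroup.closure L.J, D.IsDiff β χ := by
      clear hm hm' h0 h hα
      induction h1 using AddSubgroup.closure_induction with
      | mem χ hχ =>
        obtain ⟨β, hβ, h⟩ := hχ
        exact ⟨β, Subgroup.subset_closure hβ, h⟩
      | zero => exact ⟨1, one_mem _, IsDiffOf.one⟩
      | add χ χ' _ _ h1 h2 =>
        obtain ⟨β, hβ, h1⟩ := h1
        obtain ⟨β', hβ', h2⟩ := h2
        exact ⟨β * β', mul_mem hβ hβ', h1.mul h2⟩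
      | neg χ _ h1 =>
        obtain ⟨β, hβ, h1⟩ := h1
        exact ⟨β⁻¹, inv_mem hβ, h1.inv⟩
    obtain ⟨β, hβ, h2⟩ := key
    exact ⟨hα, by rwa [h.injective h2]⟩

end Levi

end PinnedDualGroup

/-! ### Classes of roots as unions of orbits -/

namespace PinnedDualGroup

variable {n : ℕ} {D : PinnedDualGroup n}

local notation "cθ" => charComp D.θ_torus
local notation "pθ" => pullWeight D.thetaLie D.thetaLie_mem

variable (D) in
/-- The root `α`, with differential `χ`, has a `θ`-orbit of `k` elements, and `θᵏ` acts on its root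
space as the scalar `ε`. -/
structure IsCycle (α : D.T →* ℂˣ) (χ : Dual ℂ D.cartanLie) (k : ℕ) (ε : ℂ) : Prop where
  diff : D.IsDiff α χ
  mem : χ ∈ rootSet (L := D.lie) D.cartanLie
  pos : 0 < k
  period : Function.minimalPeriod pθ χ = k
  power : ∀ x ∈ weightSpace (L := D.lie) ⊤ χ, D.thetaLie^[k] x = ε • x

theorem iterate_charComp_mul (j : ℕ) (α β : D.T →* ℂˣ) :
    cθ^[j] (α * β) = cθ^[j] α * cθ^[j] β := by
  induction j with
  | zero => rfl
  | succ j ih =>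
    rw [Function.iterate_succ_apply', Function.iterate_succ_apply', Function.iterate_succ_apply', ih]
    rfl

theorem iterate_pull_mem_rootSet {χ : Dual ℂ D.cartanLie}
    (h : χ ∈ rootSet (L := D.lie) D.cartanLie) (j : ℕ) :
    pθ^[j] χ ∈ rootSet (L := D.lie) D.cartanLie := by
  induction j with
  | zero => exact h
  | succ j ih =>
    rw [Function.iterate_succ_apply']
    exact (pullWeight_mem_rootSet _ _).2 ih

namespace IsCycle

variable {α : D.T →* ℂˣ} {χ : Dual ℂ D.cartanLie} {k : ℕ} {ε : ℂ} (h : D.IsCycle α χ k ε)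
include h

theorem iterate_eq : pθ^[k] χ = χ := by
  rw [← h.period]
  exact Function.iterate_minimalPeriod

theorem iterate_charComp_eq : cθ^[k] α = α := by
  have h1 := h.diff.iterate_charComp k
  rw [h.iterate_eq] at h1
  exact h1.injective h.diff

theorem injOn : Set.InjOn (fun j => cθ^[j] α) (Finset.range k : Set ℕ) := by
  intro i hi j hj hij
  have h1 := h.diff.iterate_charComp i
  have h2 : cθ^[i] α = cθ^[j] α := hij
  rw [h2] at h1
  have h3 := h1.unique (h.diff.iterate_charComp j)
  have h4 := Function.iterate_injOn_Iio_minimalPeriod (f := pθ) (x := χ)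
  rw [h.period] at h4
  exact h4 (by simpa using hi) (by simpa using hj) h3

omit h in
variable (D) in
open Classical in
/-- The first `k` elements of the `θ`-orbit of `α`. -/
noncomputable def orbit (α : D.T →* ℂˣ) (k : ℕ) : Finset (D.T →* ℂˣ) :=
  (Finset.range k).image fun j => (charComp D.θ_torus)^[j] α

theorem mem_orbit {β : D.T →* ℂˣ} : β ∈ orbit D α k ↔ ∃ j, cθ^[j] α = β := by
  classical
  rw [orbit, Finset.mem_image]
  constructor
  · rintro ⟨j, -, hj⟩
    exact ⟨j, hj⟩
  · rintro ⟨j, rfl⟩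
    refine ⟨j % k, Finset.mem_range.2 (Nat.mod_lt _ h.pos), ?_⟩
    exact Function.IsPeriodicPt.iterate_mod_apply h.iterate_charComp_eq j

theorem card_orbit : (orbit D α k).card = k := by
  classical
  rw [orbit, Finset.card_image_of_injOn h.injOn, Finset.card_range]

theorem exists_isDiff_of_mem_orbit {β : D.T →* ℂˣ} (hβ : β ∈ orbit D α k) :
    ∃ χ' ∈ rootSet (L := D.lie) D.cartanLie, D.IsDiff β χ' ∧
      ∀ x ∈ fixedPart D.thetaLie D.cartanLie, χ' x = χ x := by
  obtain ⟨j, rfl⟩ := h.mem_orbit.1 hβ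
  exact ⟨_, iterate_pull_mem_rootSet h.mem j, h.diff.iterate_charComp j,
    fun x hx => iterate_apply_of_fixed hx j⟩

theorem prod_orbit : ∏ β ∈ orbit D α k, β = ∏ j ∈ Finset.range k, cθ^[j] α := by
  classical
  rw [orbit, Finset.prod_image h.injOn]

end IsCycle

variable (D) in
/-- The class `a` is a single orbit. -/
def IsClassOne (a : Set (D.T →* ℂˣ)) (α : D.T →* ℂˣ) (χ : Dual ℂ D.cartanLie) (k : ℕ) : Prop :=
  D.IsCycle α χ k 1 ∧ ∀ β, β ∈ a ↔ β ∈ IsCycle.orbit D α k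

variable (D) in
/-- The class `a` consists of the orbit of `α` and of the orbit of `α + θᵏ α`, with `2 k` and with
`k` elements. -/
def IsClassTwo (a : Set (D.T →* ℂˣ)) (α : D.T →* ℂˣ) (χ : Dual ℂ D.cartanLie) (k : ℕ) : Prop :=
  D.IsCycle α χ (2 * k) 1 ∧ D.IsCycle (α * cθ^[k] α) (χ + pθ^[k] χ) k (-1) ∧
    ∀ β, β ∈ a ↔ β ∈ IsCycle.orbit D α (2 * k) ∨ β ∈ IsCycle.orbit D (α * cθ^[k] α) k

theorem exists_isClass {α : D.T →* ℂˣ} (hα : α ∈ roots D.T) :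
    ∃ α₁ χ₁ k, D.IsClassOne (D.rootClass α) α₁ χ₁ k ∨ D.IsClassTwo (D.rootClass α) α₁ χ₁ k := by
  obtain ⟨h, f, Q⟩ := exists_isPinned (D := D)
  obtain ⟨χ, hχ, hαχ, -⟩ := exists_isDiff hα
  obtain ⟨χ₁, hχ₁, hequiv, htype⟩ := Q.exists_isType D.split hχ
  obtain ⟨α₁, hα₁, hαχ₁⟩ := exists_root hχ₁
  obtain ⟨N, hN, -, -, hper⟩ := Q.exists_iterate_eq
  have hpos : ∀ χ, 0 < Function.minimalPeriod pθ χ := fun χ =>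
    Function.IsPeriodicPt.minimalPeriod_pos hN (hper χ)
  have hmem : ∀ {β χ'}, D.IsDiff β χ' → (β ∈ D.rootClass α ↔
      χ' ∈ rootSet (L := D.lie) D.cartanLie ∧ RestrictEquiv D.thetaLie χ₁ χ') := by
    intro β χ' hβ
    constructor
    · rintro ⟨h1, h2⟩
      exact ⟨hβ.mem_rootSet h1, hequiv.symm.trans ((rootEquiv_iff hαχ hβ).1 h2)⟩
    · rintro ⟨h1, h2⟩
      exact ⟨hβ.mem_roots h1, (rootEquiv_iff hαχ hβ).2 (hequiv.trans h2)⟩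
  have horb : ∀ {χ' : Dual ℂ D.cartanLie} (j : ℕ), RestrictEquiv D.thetaLie χ₁ χ' →
      RestrictEquiv D.thetaLie χ₁ (pθ^[j] χ') := fun j h1 =>
    h1.trans ⟨1, 1, one_pos, one_pos, fun x hx => by rw [iterate_apply_of_fixed hx]⟩
  have hrefl : RestrictEquiv D.thetaLie χ₁ χ₁ := ⟨1, 1, one_pos, one_pos, fun _ _ => rfl⟩
  rcases htype with ⟨h1, h2⟩ | ⟨k, hk, hp1, hp2, hsum, h1, h2, h3⟩
  · refine ⟨α₁, χ₁, Function.minimalPeriod pθ χ₁, Or.inl ?_⟩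
    have hc : D.IsCycle α₁ χ₁ (Function.minimalPeriod pθ χ₁) 1 :=
      ⟨hαχ₁, hχ₁, hpos _, rfl, fun x hx => by rw [h2 x hx, one_smul]⟩
    refine ⟨hc, fun β => ?_⟩
    rw [hc.mem_orbit]
    constructor
    · intro hβ
      obtain ⟨χ', hχ', hβχ', -⟩ := exists_isDiff hβ.1
      obtain ⟨j, rfl⟩ := h1 χ' hχ' ((hmem hβχ').1 hβ).2
      exact ⟨j, (hαχ₁.iterate_charComp j).injective hβχ'⟩
    · rintro ⟨j, rfl⟩
      exact (hmem (hαχ₁.iterate_charComp j)).2 ⟨iterate_pull_mem_rootSet hχ₁ j, horb j hrefl⟩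
  · refine ⟨α₁, χ₁, k, Or.inr ?_⟩
    have hd2 : D.IsDiff (α₁ * cθ^[k] α₁) (χ₁ + pθ^[k] χ₁) := hαχ₁.mul (hαχ₁.iterate_charComp k)
    have hc : D.IsCycle α₁ χ₁ (2 * k) 1 :=
      ⟨hαχ₁, hχ₁, by omega, hp1, fun x hx => by rw [h2 x hx, one_smul]⟩
    have hc2 : D.IsCycle (α₁ * cθ^[k] α₁) (χ₁ + pθ^[k] χ₁) k (-1) :=
      ⟨hd2, hsum, hk, hp2, fun x hx => by rw [h3 x hx, neg_one_smul]⟩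
    refine ⟨hc, hc2, fun β => ?_⟩
    rw [hc.mem_orbit, hc2.mem_orbit]
    constructor
    · intro hβ
      obtain ⟨χ', hχ', hβχ', -⟩ := exists_isDiff hβ.1
      rcases h1 χ' hχ' ((hmem hβχ').1 hβ).2 with ⟨j, rfl⟩ | ⟨j, rfl⟩
      · exact Or.inl ⟨j, (hαχ₁.iterate_charComp j).injective hβχ'⟩
      · exact Or.inr ⟨j, (hd2.iterate_charComp j).injective hβχ'⟩
    · rintro (⟨j, rfl⟩ | ⟨j, rfl⟩)
      · exact (hmem (hαχ₁.iterate_charComp j)).2 ⟨iterate_pull_mem_rootSet hχ₁ j, horb j hrefl⟩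
      · refine (hmem (hd2.iterate_charComp j)).2 ⟨iterate_pull_mem_rootSet hsum j,
          horb j ⟨2, 1, two_pos, one_pos, fun x hx => ?_⟩⟩
        rw [LinearMap.add_apply, iterate_apply_of_fixed hx]
        push_cast
        ring

/-- There is a `θ`-fixed element at which no root vanishes. -/
theorem exists_height : ∃ ρ ∈ fixedPart D.thetaLie D.cartanLie,
    ∀ χ ∈ rootSet (L := D.lie) D.cartanLie, χ ρ ≠ 0 := by
  obtain ⟨h, f, Q⟩ := exists_isPinned (D := D)
  obtain ⟨ρ, hρ, -, hρ2⟩ := Q.exists_height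
  exact ⟨ρ, hρ, fun χ hχ => Q.root_height_ne_zero hρ2 hχ⟩

section ClassInvariants

variable {a : Set (D.T →* ℂˣ)} {α : D.T →* ℂˣ} {χ : Dual ℂ D.cartanLie} {k : ℕ}

namespace IsClassOne

variable (h : D.IsClassOne a α χ k)
include h

theorem mul_notMem {β β' : D.T →* ℂˣ} (hβ : β ∈ a) (hβ' : β' ∈ a) : β * β' ∉ a := by
  intro hm
  obtain ⟨ρ, hρ, hne⟩ := exists_height (D := D)
  obtain ⟨χ₁, -, h1, h1'⟩ := h.1.exists_isDiff_of_mem_orbit ((h.2 _).1 hβ)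
  obtain ⟨χ₂, -, h2, h2'⟩ := h.1.exists_isDiff_of_mem_orbit ((h.2 _).1 hβ')
  obtain ⟨χ₃, -, h3, h3'⟩ := h.1.exists_isDiff_of_mem_orbit ((h.2 _).1 hm)
  have h4 := h3.unique (IsDiffOf.mul h1 h2)
  have h5 := h3' ρ hρ
  rw [h4, LinearMap.add_apply, h1' ρ hρ, h2' ρ hρ] at h5
  exact hne χ h.1.mem (by linear_combination h5)

theorem not_isTypeII : ¬ D.IsTypeII a := by
  rintro ⟨β, hβ, β', hβ', hm, -⟩
  exact h.mul_notMem hβ hβ' hm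

theorem eq_orbit : a = IsCycle.orbit D α k := Set.ext h.2

theorem ncard_eq : a.ncard = k := by
  rw [h.eq_orbit, Set.ncard_coe_finset, h.1.card_orbit]

theorem mPlus_eq : D.mPlus a = k := by
  rw [mPlus, if_neg h.not_isTypeII, h.ncard_eq]

theorem mMinus_eq : D.mMinus a = 0 := by
  rw [mMinus, if_neg h.not_isTypeII]

theorem gammaRoot_eq : D.gammaRoot a = ∏ j ∈ Finset.range k, cθ^[j] α := by
  have h1 : {β ∈ a | ¬ ∃ β₁ ∈ a, ∃ β₂ ∈ a, β = β₁ * β₂} = (IsCycle.orbit D α k : Set _) := by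
    ext β
    constructor
    · exact fun hβ => (h.2 β).1 hβ.1
    · intro hβ
      refine ⟨(h.2 β).2 hβ, ?_⟩
      rintro ⟨β₁, h1, β₂, h2, rfl⟩
      exact h.mul_notMem h1 h2 ((h.2 _).2 hβ)
  rw [gammaRoot, h1, finprod_mem_coe_finset, h.1.prod_orbit]

end IsClassOne

namespace IsClassTwo

variable (h : D.IsClassTwo a α χ k)
include h

theorem exists_isDiff_of_mem_orbit {β : D.T →* ℂˣ} (hβ : β ∈ IsCycle.orbit D (α * cθ^[k] α) k) :
    ∃ χ' : Dual ℂ D.cartanLie, D.IsDiff β χ' ∧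
      ∀ x ∈ fixedPart D.thetaLie D.cartanLie, χ' x = 2 * χ x := by
  obtain ⟨χ', -, h1, h2⟩ := h.2.1.exists_isDiff_of_mem_orbit hβ
  refine ⟨χ', h1, fun x hx => ?_⟩
  rw [h2 x hx, LinearMap.add_apply, iterate_apply_of_fixed hx, two_mul]

theorem disjoint : Disjoint (IsCycle.orbit D α (2 * k)) (IsCycle.orbit D (α * cθ^[k] α) k) := by
  rw [Finset.disjoint_left]
  intro β h1 h2
  obtain ⟨ρ, hρ, hne⟩ := exists_height (D := D)
  obtain ⟨χ₁, -, h3, h3'⟩ := h.1.exists_isDiff_of_mem_orbit h1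
  obtain ⟨χ₂, h4, h4'⟩ := h.exists_isDiff_of_mem_orbit h2
  have h5 := h3' ρ hρ
  rw [h3.unique h4, h4' ρ hρ] at h5
  exact hne χ h.1.mem (by linear_combination h5)

theorem isTypeII : D.IsTypeII a := by
  refine ⟨α, (h.2.2 _).2 (Or.inl (h.1.mem_orbit.2 ⟨0, rfl⟩)), cθ^[k] α,
    (h.2.2 _).2 (Or.inl (h.1.mem_orbit.2 ⟨k, rfl⟩)),
    (h.2.2 _).2 (Or.inr (h.2.1.mem_orbit.2 ⟨0, rfl⟩)), k, rfl⟩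

theorem ncard_eq : a.ncard = 3 * k := by
  classical
  have h1 : a = (IsCycle.orbit D α (2 * k) ∪ IsCycle.orbit D (α * cθ^[k] α) k : Finset _) := by
    ext β
    rw [h.2.2, Finset.coe_union]
    rfl
  rw [h1, Set.ncard_coe_finset, Finset.card_union_of_disjoint h.disjoint, h.1.card_orbit,
    h.2.1.card_orbit]
  ring

theorem mPlus_eq : D.mPlus a = 2 * k := by
  rw [mPlus, if_pos h.isTypeII, h.ncard_eq]
  omega

theorem mMinus_eq : D.mMinus a = k := by
  rw [mMinus, if_pos h.isTypeII, h.ncard_eq]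
  omega

theorem gammaRoot_eq : D.gammaRoot a = ∏ j ∈ Finset.range (2 * k), cθ^[j] α := by
  have h1 : {β ∈ a | ¬ ∃ β₁ ∈ a, ∃ β₂ ∈ a, β = β₁ * β₂} =
      (IsCycle.orbit D α (2 * k) : Set _) := by
    obtain ⟨ρ, hρ, hne⟩ := exists_height (D := D)
    -- The differentials take the values `χ ρ` and `2 * χ ρ` at `ρ`.
    have hval : ∀ β ∈ a, ∃ χ' : Dual ℂ D.cartanLie, D.IsDiff β χ' ∧
        ∃ m : ℕ, 0 < m ∧ χ' ρ = m * χ ρ := by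
      intro β hβ
      rcases (h.2.2 β).1 hβ with hβ | hβ
      · obtain ⟨χ', -, h1, h2⟩ := h.1.exists_isDiff_of_mem_orbit hβ
        exact ⟨χ', h1, 1, one_pos, by rw [h2 ρ hρ]; simp⟩
      · obtain ⟨χ', h1, h2⟩ := h.exists_isDiff_of_mem_orbit hβ
        exact ⟨χ', h1, 2, two_pos, by rw [h2 ρ hρ]; simp⟩
    ext β
    constructor
    · rintro ⟨hβ, hn⟩
      refine ((h.2.2 β).1 hβ).resolve_right fun h2 => hn ?_
      obtain ⟨j, rfl⟩ := h.2.1.mem_orbit.1 h2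
      refine ⟨_, (h.2.2 _).2 (Or.inl (h.1.mem_orbit.2 ⟨j, rfl⟩)), _,
        (h.2.2 _).2 (Or.inl (h.1.mem_orbit.2 ⟨j + k, rfl⟩)), ?_⟩
      rw [iterate_charComp_mul, Function.iterate_add_apply]
    · intro hβ
      refine ⟨(h.2.2 β).2 (Or.inl hβ), ?_⟩
      rintro ⟨β₁, h1, β₂, h2, rfl⟩
      obtain ⟨χ', -, h3, h3'⟩ := h.1.exists_isDiff_of_mem_orbit hβ
      obtain ⟨χ₁, h4, m₁, hm₁, h4'⟩ := hval β₁ h1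
      obtain ⟨χ₂, h5, m₂, hm₂, h5'⟩ := hval β₂ h2
      have h6 := h3' ρ hρ
      rw [h3.unique (IsDiffOf.mul h4 h5), LinearMap.add_apply, h4', h5', ← add_mul] at h6
      have h7 : ((m₁ + m₂ : ℕ) : ℂ) = (1 : ℕ) := by
        push_cast
        exact mul_right_cancel₀ (hne χ h.1.mem) (h6.trans (one_mul _).symm)
      have h8 : m₁ + m₂ = 1 := by exact_mod_cast h7
      omega
  rw [gammaRoot, h1, finprod_mem_coe_finset, h.1.prod_orbit]

theorem prod_short : ∏ j ∈ Finset.range k, cθ^[j] (α * cθ^[k] α) = D.gammaRoot a := by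
  rw [h.gammaRoot_eq, two_mul, Finset.prod_range_add, ← Finset.prod_mul_distrib]
  refine Finset.prod_congr rfl fun j _ => ?_
  rw [iterate_charComp_mul, add_comm k j, Function.iterate_add_apply]

end IsClassTwo

end ClassInvariants

section Frobenius

/-- The inverse of the automorphism `Ad(g) ∘ dθ` of `Lie(G)`. -/
noncomputable def frobInv (g : D.T) : D.lie →ₗ[ℂ] D.lie :=
  (D.thetaLie.symm : D.lie →ₗ[ℂ] D.lie) ∘ₗ adj D.reductive.closed (g : D.G)⁻¹

theorem frobInv_apply (g : D.T) (x : D.lie) :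
    frobInv g x = D.thetaLie.symm (adj D.reductive.closed (g : D.G)⁻¹ x) := rfl

theorem adj_inv_torus {α : D.T →* ℂˣ} {χ : Dual ℂ D.cartanLie} (h : D.IsDiff α χ) (g : D.T)
    {x : D.lie} (hx : x ∈ weightSpace (L := D.lie) ⊤ χ) :
    adj D.reductive.closed (g : D.G)⁻¹ x = ((α g)⁻¹ : ℂ) • x := by
  have h1 := h.mem_weightSpace_iff.1 hx g⁻¹
  rw [map_inv, Units.val_inv_eq_inv_val] at h1
  exact h1

theorem thetaLie_symm_mem {χ : Dual ℂ D.cartanLie} {x : D.lie} :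
    D.thetaLie.symm x ∈ weightSpace (L := D.lie) ⊤ (pθ χ) ↔
      x ∈ weightSpace (L := D.lie) ⊤ χ := by
  rw [← map_mem_weightSpace_top, LieEquiv.apply_symm_apply]

theorem frobInv_pow {α : D.T →* ℂˣ} {χ : Dual ℂ D.cartanLie} (h : D.IsDiff α χ) (g : D.T)
    {x : D.lie} (hx : x ∈ weightSpace (L := D.lie) ⊤ χ) (j : ℕ) :
    D.thetaLie.symm^[j] x ∈ weightSpace (L := D.lie) ⊤ (pθ^[j] χ) ∧
      (frobInv g ^ j) x = (((∏ i ∈ Finset.range j, cθ^[i] α) g : ℂˣ) : ℂ)⁻¹ •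
        D.thetaLie.symm^[j] x := by
  induction j with
  | zero => exact ⟨hx, by simp⟩
  | succ j ih =>
    obtain ⟨h1, h2⟩ := ih
    rw [Function.iterate_succ_apply', Function.iterate_succ_apply', thetaLie_symm_mem]
    refine ⟨h1, ?_⟩
    rw [pow_succ', Module.End.mul_apply, h2, map_smul, frobInv_apply,
      adj_inv_torus (h.iterate_charComp j) g h1, map_smul, smul_smul, Finset.prod_range_succ,
      MonoidHom.mul_apply, Units.val_mul, mul_inv]

theorem frobInv_pow_mem {α : D.T →* ℂˣ} {χ : Dual ℂ D.cartanLie} (h : D.IsDiff α χ) (g : D.T)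
    {x : D.lie} (hx : x ∈ weightSpace (L := D.lie) ⊤ χ) (j : ℕ) :
    (frobInv g ^ j) x ∈ weightSpace (L := D.lie) ⊤ (pθ^[j] χ) := by
  obtain ⟨h1, h2⟩ := frobInv_pow h g hx j
  rw [h2]
  exact Submodule.smul_mem _ _ h1

theorem IsCycle.frobInv_pow_eq {α : D.T →* ℂˣ} {χ : Dual ℂ D.cartanLie} {k : ℕ} {ε : ℂ}
    (h : D.IsCycle α χ k ε) (hε : ε * ε = 1) (g : D.T) {x : D.lie}
    (hx : x ∈ weightSpace (L := D.lie) ⊤ χ) :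
    (frobInv g ^ k) x = (ε * (((∏ i ∈ Finset.range k, cθ^[i] α) g : ℂˣ) : ℂ)⁻¹) • x := by
  obtain ⟨h1, h2⟩ := frobInv_pow h.diff g hx k
  rw [h.iterate_eq] at h1
  have h3 := h.power _ h1
  have h4 : Function.LeftInverse D.thetaLie D.thetaLie.symm := fun y =>
    D.thetaLie.apply_symm_apply y
  rw [h4.iterate k x] at h3
  rw [h2, mul_comm, mul_smul]
  congr 1
  conv_rhs => rw [h3, smul_smul, hε, one_smul]

theorem frobInv_injective (g : D.T) : Function.Injective (frobInv g) := by
  intro x y hxy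
  have h1 := D.thetaLie.symm.injective hxy
  have h2 : ∀ x, adj D.reductive.closed (g : D.G) (adj D.reductive.closed (g : D.G)⁻¹ x) = x :=
    fun x => by rw [← adj_mul, mul_inv_cancel, adj_one]
  rw [← h2 x, ← h2 y]
  exact congrArg _ h1

theorem frobInv_pow_ne_zero (g : D.T) {x : D.lie} (hx : x ≠ 0) (j : ℕ) :
    (frobInv g ^ j) x ≠ 0 := by
  induction j with
  | zero => exact hx
  | succ j ih =>
    rw [pow_succ', Module.End.mul_apply]
    exact fun h0 => ih (frobInv_injective g (h0.trans (map_zero _).symm))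

end Frobenius

end PinnedDualGroup

/-! ### The determinant of Frobenius on `Lie(G) / Lie(M)` -/

namespace PinnedDualGroup

variable {n : ℕ} {D : PinnedDualGroup n}

theorem RootEquiv.symm {α β : D.T →* ℂˣ} (h : D.RootEquiv α β) : D.RootEquiv β α := by
  obtain ⟨k, l, hk, hl, h⟩ := h
  exact ⟨l, k, hl, hk, fun t ht => (h t ht).symm⟩

theorem RootEquiv.trans {α β γ : D.T →* ℂˣ} (h : D.RootEquiv α β) (h' : D.RootEquiv β γ) :
    D.RootEquiv α γ := by
  obtain ⟨k, l, hk, hl, h⟩ := h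
  obtain ⟨k', l', hk', hl', h'⟩ := h'
  refine ⟨k * k', l' * l, by positivity, by positivity, fun t ht => ?_⟩
  rw [pow_mul, h t ht, pow_right_comm, h' t ht, pow_mul]

theorem RootEquiv.refl (α : D.T →* ℂˣ) : D.RootEquiv α α := ⟨1, 1, one_pos, one_pos, fun _ _ => rfl⟩

theorem rootClass_eq {α β : D.T →* ℂˣ} (h : β ∈ D.rootClass α) :
    D.rootClass β = D.rootClass α := by
  ext γ
  exact and_congr_right fun _ => ⟨fun h1 => h.2.trans h1, fun h1 => h.2.symm.trans h1⟩

/-- The factor of `det(1 - y (Ad(t) ∘ dθ)⁻¹)` for the cycle of length `k` of the root `α`. -/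
noncomputable def cycleFactor (α : D.T →* ℂˣ) (k : ℕ) (ε : ℂ) (t : D.T) (y : ℂ) : ℂ :=
  1 - y ^ k * (ε * (((∏ i ∈ Finset.range k, (charComp D.θ_torus)^[i] α) t : ℂˣ) : ℂ)⁻¹)

variable (D) in
/-- A decomposition of the class `a` of roots into the `θ`-orbits of `m` roots `α b`, with
differentials `χ b`, lengths `k b` and signs `ε b`. The character `γ_a` is the product over the orbit
of `α b₀`, and `factor` identifies the quotient of the values at `y = 1` and `y = q⁻¹` of the factor
of `det(1 - y (Ad(t) ∘ dθ)⁻¹)` with the factor of the `μ`-function. -/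
structure ClassData (a : Set (D.T →* ℂˣ)) where
  m : ℕ
  α : Fin m → D.T →* ℂˣ
  χ : Fin m → Dual ℂ D.cartanLie
  k : Fin m → ℕ
  ε : Fin m → ℂ
  cycle : ∀ b, D.IsCycle (α b) (χ b) (k b) (ε b)
  sq : ∀ b, ε b * ε b = 1
  mem_iff : ∀ β, β ∈ a ↔ ∃ b, β ∈ IsCycle.orbit D (α b) (k b)
  disjoint : ∀ b b' β, β ∈ IsCycle.orbit D (α b) (k b) → β ∈ IsCycle.orbit D (α b') (k b') → b = b'
  b₀ : Fin m
  gamma : D.gammaRoot a = ∏ j ∈ Finset.range (k b₀), (charComp D.θ_torus)^[j] (α b₀)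
  factor : ∀ (q : ℕ) (t : D.T), D.muDenominator q a t ≠ 0 →
    ∏ b, cycleFactor (α b) (k b) (ε b) t (q : ℂ)⁻¹ ≠ 0 ∧
      (∏ b, cycleFactor (α b) (k b) (ε b) t 1) / ∏ b, cycleFactor (α b) (k b) (ε b) t (q : ℂ)⁻¹ =
        (1 - ((D.gammaRoot a t : ℂ) ^ 2)⁻¹) / D.muDenominator q a t

theorem nonempty_classData {α : D.T →* ℂˣ} (hα : α ∈ roots D.T) :
    Nonempty (D.ClassData (D.rootClass α)) := by
  obtain ⟨α₁, χ₁, k, h | h⟩ := exists_isClass hα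
  · exact ⟨{
      m := 1
      α := fun _ => α₁
      χ := fun _ => χ₁
      k := fun _ => k
      ε := fun _ => 1
      cycle := fun _ => h.1
      sq := fun _ => one_mul 1
      mem_iff := fun β => by rw [h.2]; exact ⟨fun h1 => ⟨0, h1⟩, fun ⟨_, h1⟩ => h1⟩
      disjoint := fun b b' _ _ _ => Subsingleton.elim b b'
      b₀ := 0
      gamma := h.gammaRoot_eq
      factor := by
        intro q t ht
        rw [muDenominator, h.mPlus_eq, h.mMinus_eq, pow_zero, inv_one, one_mul] at ht ⊢
        simp only [Fin.prod_univ_one, cycleFactor, ← h.gammaRoot_eq, one_mul, one_pow, inv_pow]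
        obtain ⟨h1, h2⟩ := mul_ne_zero_iff.1 ht
        refine ⟨h2, ?_⟩
        rw [div_eq_div_iff h2 ht, ← inv_pow]
        ring }⟩
  · exact ⟨{
      m := 2
      α := ![α₁, α₁ * (charComp D.θ_torus)^[k] α₁]
      χ := ![χ₁, χ₁ + (pullWeight D.thetaLie D.thetaLie_mem)^[k] χ₁]
      k := ![2 * k, k]
      ε := ![1, -1]
      cycle := Fin.forall_fin_two.2 ⟨h.1, h.2.1⟩
      sq := Fin.forall_fin_two.2 ⟨one_mul 1, by simp⟩
      mem_iff := fun β => by rw [h.2.2]; exact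
        (Fin.exists_fin_two (p := fun b => β ∈ IsCycle.orbit D
          ((![α₁, α₁ * (charComp D.θ_torus)^[k] α₁] : Fin 2 → _) b)
          ((![2 * k, k] : Fin 2 → ℕ) b))).symm
      disjoint := by
        have hd := Finset.disjoint_left.1 h.disjoint
        refine Fin.forall_fin_two.2 ⟨Fin.forall_fin_two.2 ⟨fun _ _ _ => rfl, fun β h1 h2 => ?_⟩,
          Fin.forall_fin_two.2 ⟨fun β h1 h2 => ?_, fun _ _ _ => rfl⟩⟩
        · exact absurd h2 (hd h1)
        · exact absurd h1 (hd h2)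
      b₀ := 0
      gamma := h.gammaRoot_eq
      -- With `γ = γ_a(t)`, the two orbits contribute `1 - y²ᵏ γ⁻¹` and `1 + yᵏ γ⁻¹`.
      factor := by
        intro q t ht
        rw [muDenominator, h.mPlus_eq, h.mMinus_eq] at ht ⊢
        have e : ∀ y : ℂ, ∏ b, cycleFactor (![α₁, α₁ * (charComp D.θ_torus)^[k] α₁] b)
            ((![2 * k, k] : Fin 2 → ℕ) b) ((![1, -1] : Fin 2 → ℂ) b) t y =
            (1 + y ^ k * (D.gammaRoot (D.rootClass α) t : ℂ)⁻¹) *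
              (1 - y ^ (2 * k) * (D.gammaRoot (D.rootClass α) t : ℂ)⁻¹) := by
          intro y
          rw [Fin.prod_univ_two]
          simp only [Matrix.cons_val_zero, Matrix.cons_val_one, cycleFactor, ← h.gammaRoot_eq,
            h.prod_short]
          ring
        rw [e, e, inv_pow, inv_pow]
        refine ⟨ht, ?_⟩
        congr 1
        rw [one_pow, one_pow, ← inv_pow]
        ring }⟩

namespace Levi

variable {L : D.Levi}

theorem finite_classes : L.classes.Finite := by
  refine ((finite_roots (D := D)).image D.rootClass).subset ?_
  rintro _ ⟨α, hα, rfl⟩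
  exact ⟨α, hα.1, rfl⟩

theorem eq_of_mem_classes {a a' : Set (D.T →* ℂˣ)} (ha : a ∈ L.classes) (ha' : a' ∈ L.classes)
    {β : D.T →* ℂˣ} (h : β ∈ a) (h' : β ∈ a') : a = a' := by
  obtain ⟨α, -, rfl⟩ := ha
  obtain ⟨α', -, rfl⟩ := ha'
  exact (rootClass_eq h).symm.trans (rootClass_eq h')

section Quotient

variable {V : Type*} [AddCommGroup V] [Module ℂ V] {pr : D.lie →ₗ[ℂ] V}
  (hpr : Function.Surjective pr)
  (hpr0 : ∀ X, pr X = 0 ↔ X ∈ weightSpace (L := D.lie) L.centerLie 0)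

include hpr hpr0 in
/-- Root vectors for the roots outside `Φ_M` form a basis of a quotient of `Lie(G)` by `Lie(M)`. -/
theorem exists_basis {κ : Type*} {v : κ → D.lie} {w : κ → Dual ℂ D.cartanLie}
    (hv : ∀ s, v s ∈ weightSpace (L := D.lie) ⊤ (w s)) (hv0 : ∀ s, v s ≠ 0)
    (hw : Function.Injective w)
    (hrange : ∀ χ, χ ∈ Set.range w ↔ χ ∈ rootSet (L := D.lie) D.cartanLie ∧
      ¬ ∀ h ∈ L.centerLie, χ h = 0) :
    ∃ b : Basis κ ℂ V, ∀ s, b s = pr (v s) := by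
  classical
  obtain ⟨x, hx⟩ := exists_indicator (L := L)
  have hind : LinearIndependent ℂ v :=
    (D.split.iSupIndep_weightSpace.comp hw).linearIndependent _ hv hv0
  have hind' : LinearIndependent ℂ fun s => pr (v s) := by
    rw [linearIndependent_iff'] at hind ⊢
    intro S c hc s hs
    have h1 : pr (∑ s ∈ S, c s • v s) = 0 := by
      rw [map_sum, ← hc]
      exact Finset.sum_congr rfl fun s _ => map_smul _ _ _
    -- The sum is annihilated by the element `x` of the center of `Lie(M)`.
    have h2 := (hpr0 _).1 h1 x (mem_centerLie_of_indicator hx)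
    rw [LinearMap.zero_apply, zero_smul, lie_sum] at h2
    have h3 : ∑ s ∈ S, (c s * w s x) • v s = 0 := by
      rw [← h2]
      refine Finset.sum_congr rfl fun s _ => ?_
      rw [lie_smul, hv s x trivial, smul_smul]
    obtain ⟨h4, h5⟩ := (hrange (w s)).1 ⟨s, rfl⟩
    exact (mul_eq_zero.1 (hind S _ h3 s hs)).resolve_right fun h0 =>
      h5 ((apply_eq_zero_iff hx h4).1 h0)
  have hspan : ⊤ ≤ Submodule.span ℂ (Set.range fun s => pr (v s)) := by
    rintro y -
    obtain ⟨X, rfl⟩ := hpr y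
    have hX : X ∈ ⨆ χ : Dual ℂ D.cartanLie, weightSpace (L := D.lie) ⊤ χ := by
      rw [D.split.iSup_weightSpace]; trivial
    induction hX using Submodule.iSup_induction' with
    | mem χ X hX =>
      by_cases hX0 : X = 0
      · rw [hX0, map_zero]; exact zero_mem _
      by_cases hχ : ∀ h ∈ L.centerLie, χ h = 0
      · rw [(hpr0 _).2 ((mem_weightSpace_zero_iff hX0 hX).2 hχ)]
        exact zero_mem _
      · have hχ0 : χ ≠ 0 := by
          rintro rfl
          exact hχ fun _ _ => rfl
        have hroot : χ ∈ rootSet (L := D.lie) D.cartanLie :=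
          ⟨hχ0, fun h0 => hX0 (by rw [← Submodule.mem_bot ℂ, ← h0]; exact hX)⟩
        obtain ⟨s, rfl⟩ := (hrange χ).2 ⟨hroot, hχ⟩
        obtain ⟨c, rfl⟩ := D.split.exists_smul_eq hχ0 (hv0 s) (hv s) hX
        rw [map_smul]
        exact Submodule.smul_mem _ _ (Submodule.subset_span ⟨s, rfl⟩)
    | zero => rw [map_zero]; exact zero_mem _
    | add X Y _ _ hX hY => rw [map_add]; exact add_mem hX hY
  exact ⟨Basis.mk hind' hspan, fun s => Basis.mk_apply hind' hspan s⟩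

theorem not_vanish_of_mem {a : Set (D.T →* ℂˣ)} (ha : a ∈ L.classes) {β : D.T →* ℂˣ} (hβ : β ∈ a)
    {χ : Dual ℂ D.cartanLie} (h : D.IsDiff β χ) {x : D.cartanLie}
    (hxf : x ∈ fixedPart D.thetaLie D.cartanLie)
    (hx : ∀ α χ, α ∈ roots D.T → D.IsDiff α χ → (α ∈ L.rootsM ↔ χ x = 0)) : χ x ≠ 0 := by
  obtain ⟨α, ⟨hα, hαM⟩, rfl⟩ := ha
  obtain ⟨χ', hχ', hαχ, -⟩ := exists_isDiff hα
  obtain ⟨k, l, hk, hl, hkl⟩ := (rootEquiv_iff hαχ h).1 hβ.2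
  intro h0
  have h1 := hkl x hxf
  rw [h0, mul_zero] at h1
  have hk' : (k : ℂ) ≠ 0 := by exact_mod_cast hk.ne'
  exact hαM ((hx α χ' hα hαχ).2 ((mul_eq_zero.1 h1).resolve_left hk'))

include hpr hpr0 in
/-- The characteristic determinant of `(Ad(t) ∘ dθ)⁻¹` on `Lie(G) / Lie(M)`: for every orbit, a root
vector and its images under the powers of the operator span the sum of the root spaces. -/
theorem det_eq_prod [Fintype L.classes] (C : ∀ a : L.classes, D.ClassData a) (t : D.T)
    {A : V →ₗ[ℂ] V}
    (hA : ∀ X, A (pr X) = pr (frobInv t X)) (y : ℂ) :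
    LinearMap.det (1 - y • A) =
      ∏ a, ∏ b, cycleFactor ((C a).α b) ((C a).k b) ((C a).ε b) t y := by
  classical
  obtain ⟨x, hxf, hx⟩ := exists_fixed_indicator (L := L)
  have hx' : ∀ α χ, α ∈ roots D.T → D.IsDiff α χ → (α ∈ L.rootsM ↔ χ x = 0) :=
    fun α χ hα h => mem_rootsM_iff hx hα h
  have hv : ∀ i : (Σ a : L.classes, Fin (C a).m), ∃ e : D.lie,
      e ∈ weightSpace (L := D.lie) ⊤ ((C i.1).χ i.2) ∧ e ≠ 0 := fun i =>
    Submodule.exists_mem_ne_zero_of_ne_bot ((C i.1).cycle i.2).mem.2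
  choose e he he0 using hv
  set k : (Σ a : L.classes, Fin (C a).m) → ℕ := fun i => (C i.1).k i.2 with hk
  have hAj : ∀ (j : ℕ) X, (A ^ j) (pr X) = pr ((frobInv t ^ j) X) := by
    intro j X
    induction j with
    | zero => rfl
    | succ j ih => rw [pow_succ', pow_succ', Module.End.mul_apply, Module.End.mul_apply, ih, hA]
  have horb : ∀ (i : Σ a : L.classes, Fin (C a).m) (j : ℕ),
      (charComp D.θ_torus)^[j] ((C i.1).α i.2) ∈
        IsCycle.orbit D ((C i.1).α i.2) ((C i.1).k i.2) := fun i j =>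
    ((C i.1).cycle i.2).mem_orbit.2 ⟨j, rfl⟩
  have hmem : ∀ (i : Σ a : L.classes, Fin (C a).m) (j : ℕ),
      (charComp D.θ_torus)^[j] ((C i.1).α i.2) ∈ (i.1 : Set (D.T →* ℂˣ)) := fun i j =>
    ((C i.1).mem_iff _).2 ⟨i.2, horb i j⟩
  have hdiff : ∀ (i : Σ a : L.classes, Fin (C a).m) (j : ℕ),
      D.IsDiff ((charComp D.θ_torus)^[j] ((C i.1).α i.2))
        ((pullWeight D.thetaLie D.thetaLie_mem)^[j] ((C i.1).χ i.2)) := fun i j =>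
    ((C i.1).cycle i.2).diff.iterate_charComp j
  obtain ⟨b, hb⟩ := exists_basis hpr hpr0 (κ := Σ i, Fin (k i))
    (v := fun s => (frobInv t ^ (s.2 : ℕ)) (e s.1))
    (w := fun s => (pullWeight D.thetaLie D.thetaLie_mem)^[(s.2 : ℕ)] ((C s.1.1).χ s.1.2))
    (fun s => frobInv_pow_mem ((C s.1.1).cycle s.1.2).diff t (he s.1) _)
    (fun s => frobInv_pow_ne_zero t (he0 s.1) _)
    (by
      rintro ⟨⟨a, b⟩, j⟩ ⟨⟨a', b'⟩, j'⟩ hw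
      have h1 : (charComp D.θ_torus)^[(j : ℕ)] ((C a).α b) =
          (charComp D.θ_torus)^[(j' : ℕ)] ((C a').α b') := by
        have h2 := hdiff ⟨a', b'⟩ j'
        have hw' : (pullWeight D.thetaLie D.thetaLie_mem)^[(j : ℕ)] ((C a).χ b) =
          (pullWeight D.thetaLie D.thetaLie_mem)^[(j' : ℕ)] ((C a').χ b') := hw
        have h3 := hdiff ⟨a, b⟩ j
        rw [show (pullWeight D.thetaLie D.thetaLie_mem)^[(j : ℕ)] ((C (⟨a, b⟩ : Σ a : L.classes,
          Fin (C a).m).1).χ b) = _ from hw'] at h3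
        exact h3.injective h2
      have haa : a = a' := by
        have h2 := hmem ⟨a, b⟩ j
        have h3 := hmem ⟨a', b'⟩ j'
        rw [← h1] at h3
        exact Subtype.ext (eq_of_mem_classes a.2 a'.2 h2 h3)
      subst haa
      have hbb : b = b' := by
        have h3 := horb ⟨a, b'⟩ j'
        rw [← h1] at h3
        exact (C a).disjoint b b' _ (horb ⟨a, b⟩ j) h3
      subst hbb
      have hjj : (j : ℕ) = j' :=
        ((C a).cycle b).injOn (Finset.mem_coe.2 (Finset.mem_range.2 j.2))
          (Finset.mem_coe.2 (Finset.mem_range.2 j'.2)) h1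
      rw [Fin.ext hjj])
    (by
      intro χ
      constructor
      · rintro ⟨⟨i, j⟩, rfl⟩
        refine ⟨iterate_pull_mem_rootSet ((C i.1).cycle i.2).mem _, fun h0 => ?_⟩
        exact not_vanish_of_mem i.1.2 (hmem i j) (hdiff i j) hxf hx'
          (h0 x (mem_centerLie_of_indicator hx))
      · rintro ⟨hχ, hχ0⟩
        obtain ⟨α, hα, hαχ⟩ := exists_root hχ
        have hαM : α ∉ L.rootsM := fun hM =>
          hχ0 ((apply_eq_zero_iff hx hχ).1 ((hx' α χ hα hαχ).1 hM))
        let a : L.classes := ⟨D.rootClass α, α, ⟨hα, hαM⟩, rfl⟩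
        obtain ⟨b, hb⟩ := ((C a).mem_iff α).1 ⟨hα, RootEquiv.refl α⟩
        rw [IsCycle.orbit, Finset.mem_image] at hb
        obtain ⟨j, hj, hjα⟩ := hb
        refine ⟨⟨⟨a, b⟩, ⟨j, Finset.mem_range.1 hj⟩⟩, ?_⟩
        have h1 := hdiff ⟨a, b⟩ j
        rw [show (charComp D.θ_torus)^[j] ((C a).α b) = α from hjα] at h1
        exact h1.unique hαχ)
  rw [det_one_sub_smul_eq_prod (k := k) (fun i => ((C i.1).cycle i.2).pos) (A := A)
    (e := fun i => pr (e i)) (c := fun i => (C i.1).ε i.2 *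
      (((∏ j ∈ Finset.range (k i), (charComp D.θ_torus)^[j] ((C i.1).α i.2)) t : ℂˣ) : ℂ)⁻¹)
    (fun i => ?_) b (fun i j => ?_) y, Fintype.prod_sigma]
  · rfl
  · rw [hAj, ((C i.1).cycle i.2).frobInv_pow_eq ((C i.1).sq i.2) t (he i), map_smul]
  · rw [hb, hAj]

end Quotient

variable (L) in
/-- The projection of `Lie(G)` onto `Lie(G) / Lie(M)`. -/
noncomputable def proj : D.lie →ₗ[ℂ] LieAlg D.G ⧸ lieSub L.M :=
  (lieSub L.M).mkQ ∘ₗ ((toLie D.reductive.closed).symm : D.lie →ₗ[ℂ] LieAlg D.G)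

theorem proj_eq_zero_iff {X : D.lie} :
    L.proj X = 0 ↔ X ∈ weightSpace (L := D.lie) L.centerLie 0 := by
  change (lieSub L.M).mkQ ((toLie D.reductive.closed).symm X) = 0 ↔ _
  rw [Submodule.mkQ_apply, Submodule.Quotient.mk_eq_zero, mem_lieSub_iff,
    LinearEquiv.apply_symm_apply]

theorem proj_surjective : Function.Surjective L.proj :=
  (Submodule.mkQ_surjective _).comp (toLie D.reductive.closed).symm.surjective

end Levi

end PinnedDualGroup

/-! ### Nonvanishing of the denominators, and the action of Frobenius -/

namespace PinnedDualGroup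

variable {n : ℕ} {D : PinnedDualGroup n}

theorem isRegularChar_prod {ι : Type*} (s : Finset ι) {α : ι → D.T →* ℂˣ}
    (h : ∀ i ∈ s, IsRegularChar (α i)) : IsRegularChar (∏ i ∈ s, α i) := by
  classical
  induction s using Finset.induction_on with
  | empty => exact IsRegularChar.one
  | insert i s hi ih =>
    rw [Finset.prod_insert hi]
    exact (h i (Finset.mem_insert_self i s)).mul
      (ih fun j hj => h j (Finset.mem_insert_of_mem hj))

namespace ClassData

variable {a : Set (D.T →* ℂˣ)} (C : D.ClassData a)
include C

theorem isRegularChar_inv : IsRegularChar (D.gammaRoot a)⁻¹ := by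
  have h0 : (D.gammaRoot a)⁻¹ =
      ∏ j ∈ Finset.range (C.k C.b₀), ((charComp D.θ_torus)^[j] (C.α C.b₀))⁻¹ := by
    rw [C.gamma]
    ext t
    simp only [MonoidHom.inv_apply, MonoidHom.finsetProd_apply, Finset.prod_inv_distrib]
  rw [h0]
  refine isRegularChar_prod _ fun j _ => ?_
  have h : D.IsDiff ((charComp D.θ_torus)^[j] (C.α C.b₀))⁻¹ _ :=
    ((C.cycle C.b₀).diff.iterate_charComp j).inv
  obtain ⟨-, -, -, h1⟩ := exists_isDiff (h.mem_roots
    (D.split.neg_mem_rootSet (iterate_pull_mem_rootSet (C.cycle C.b₀).mem j)))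
  exact h1

/-- On the `θ`-fixed part of the Cartan subalgebra, the differential of `γ_a` is a multiple of that
of a root in `a`. -/
theorem gammaRoot_expG {x : D.cartanLie} (hx : x ∈ fixedPart D.thetaLie D.cartanLie)
    (h : expG (x : D.lie) ∈ D.T) :
    (D.gammaRoot a ⟨_, h⟩ : ℂ) = Complex.exp (C.k C.b₀ * C.χ C.b₀ x) := by
  have h1 : D.IsDiff (D.gammaRoot a) (∑ j ∈ Finset.range (C.k C.b₀),
      (pullWeight D.thetaLie D.thetaLie_mem)^[j] (C.χ C.b₀)) := by
    rw [C.gamma]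
    exact IsDiffOf.prod fun j _ => (C.cycle C.b₀).diff.iterate_charComp j
  rw [h1 x h, LinearMap.sum_apply, Finset.sum_congr rfl fun j _ => iterate_apply_of_fixed hx j,
    Finset.sum_const, Finset.card_range, nsmul_eq_mul]

end ClassData

theorem subsingleton_setOf_mul_exp_eq {m : ℤ} (hm : m ≠ 0) (u : ℂ) {v : ℂ} (hv : v ≠ 0) :
    {s : ℝ | u * Complex.exp (m * s) = v}.Subsingleton := by
  intro s hs s' hs'
  have hs : u * Complex.exp (m * s) = v := hs
  have hs' : u * Complex.exp (m * s') = v := hs'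
  have hu : u ≠ 0 := by
    rintro rfl
    exact hv (by rw [← hs, zero_mul])
  have h1 := congrArg norm (mul_left_cancel₀ hu (hs.trans hs'.symm))
  rw [Complex.norm_exp, Complex.norm_exp, Real.exp_eq_exp] at h1
  have h2 : (m : ℝ) * s = m * s' := by simpa using h1
  exact mul_left_cancel₀ (Int.cast_ne_zero.2 hm) h2

namespace Levi

variable {L : D.Levi}

/-- The product of the denominators of the `μ`-function, at the translates by an element of `T`, is
a regular function. -/
theorem exists_regular_eq_prod [Fintype L.classes] (q : ℕ) (r : D.T) :
    ∃ f ∈ regularFunctions D.G, ∀ z : D.T, f z = ∏ a : L.classes, D.muDenominator q a (z * r) := by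
  have h : ∀ a : L.classes, ∃ f ∈ regularFunctions D.G, ∀ z : D.T,
      f z = D.muDenominator q a (z * r) := by
    rintro ⟨_, α, hα, rfl⟩
    obtain ⟨C⟩ := nonempty_classData hα.1
    obtain ⟨F, hF, hF'⟩ := C.isRegularChar_inv
    set γ := D.gammaRoot (D.rootClass α)
    refine ⟨(1 + (((q : ℂ) ^ D.mMinus (D.rootClass α))⁻¹ * (γ r : ℂ)⁻¹) • F) *
      (1 - (((q : ℂ) ^ D.mPlus (D.rootClass α))⁻¹ * (γ r : ℂ)⁻¹) • F),
      mul_mem (add_mem (one_mem _) (Subalgebra.smul_mem _ hF _))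
        (sub_mem (one_mem _) (Subalgebra.smul_mem _ hF _)), fun z => ?_⟩
    have h1 : (γ (z * r) : ℂ)⁻¹ = (γ r : ℂ)⁻¹ * F z := by
      rw [hF', MonoidHom.inv_apply, map_mul, Units.val_mul, mul_inv, Units.val_inv_eq_inv_val,
        mul_comm]
    rw [muDenominator, h1]
    simp only [Pi.mul_apply, Pi.add_apply, Pi.sub_apply, Pi.one_apply, Pi.smul_apply, smul_eq_mul,
      mul_assoc]
  choose f hf hf' using h
  refine ⟨∏ a, f a, prod_mem fun a _ => hf a, fun z => ?_⟩
  rw [Finset.prod_apply]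
  exact Finset.prod_congr rfl fun a _ => hf' a z

theorem expG_mem_centerFixed {x : D.cartanLie} (hx : x ∈ L.centerLie)
    (hxf : x ∈ fixedPart D.thetaLie D.cartanLie) : expG (x : D.lie) ∈ L.centerFixed := by
  refine mem_identityComponent_of_forall fun s => ?_
  have h1 : expG ((s • x : D.cartanLie) : D.lie) ∈ D.T :=
    expG_mem_torus D.maximalTorus D.isDiag_conj (s • x)
  have h2 : expG ((s • x : D.cartanLie) : D.lie) ∈ Subgroup.centralizer (L.M : Set D.G) :=
    mem_centralizer (L.centerLie.smul_mem s hx)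
  refine Subgroup.mem_inf.2 ⟨Subgroup.mem_inf.2 ⟨L.torus_le h1, h2⟩, ?_⟩
  change D.θ (expG (s • (x : D.lie))) = _
  rw [theta_expG, map_smul, hxf]
  rfl

/-- The denominators of the `μ`-function do not vanish identically on a translate of
`Z(M)^{θ,∘}`. -/
theorem exists_muDenominator_ne_zero (q : ℕ) (r : D.T) : ∃ (z : D.G) (hz : z ∈ L.centerFixed),
    ∀ a ∈ L.classes, D.muDenominator q a (⟨z, L.centerFixed_le_torus hz⟩ * r) ≠ 0 := by
  classical
  obtain ⟨x, hxf, hx⟩ := exists_fixed_indicator (L := L)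
  have hx' : ∀ α χ, α ∈ roots D.T → D.IsDiff α χ → (α ∈ L.rootsM ↔ χ x = 0) :=
    fun α χ hα h => mem_rootsM_iff hx hα h
  have hz : ∀ s : ℂ, expG ((s • x : D.cartanLie) : D.lie) ∈ L.centerFixed := fun s =>
    expG_mem_centerFixed (L.centerLie.smul_mem s (mem_centerLie_of_indicator hx))
      (Submodule.smul_mem _ s hxf)
  -- On the one-parameter group `exp (s x)` the character `γ_a` is `exp (m s)` with `m ≠ 0`.
  have hγ : ∀ a ∈ L.classes, ∃ m : ℤ, m ≠ 0 ∧ ∀ s : ℂ,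
      (D.gammaRoot a ⟨_, L.centerFixed_le_torus (hz s)⟩ : ℂ)⁻¹ = Complex.exp (m * s) := by
    intro a ha
    obtain ⟨α, hα, rfl⟩ := id ha
    obtain ⟨C⟩ := nonempty_classData hα.1
    have hc := C.cycle C.b₀
    have hne := not_vanish_of_mem ha
      ((C.mem_iff _).2 ⟨C.b₀, hc.mem_orbit.2 ⟨0, rfl⟩⟩) hc.diff hxf hx'
    obtain ⟨m, hm, -⟩ := exists_int_of_mem_rootSet hx hc.mem
    rw [hm] at hne
    refine ⟨-(C.k C.b₀ * m), neg_ne_zero.2 (mul_ne_zero (by exact_mod_cast hc.pos.ne')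
      (by exact_mod_cast hne)), fun s => ?_⟩
    rw [C.gammaRoot_expG (Submodule.smul_mem _ s hxf), ← Complex.exp_neg, map_smul, hm, smul_eq_mul]
    congr 1
    push_cast
    ring
  choose! m hm0 hm using hγ
  set u : Set (D.T →* ℂˣ) → ℂ := fun a => (D.gammaRoot a r : ℂ)⁻¹
  have hfin : (⋃ a ∈ L.classes,
      ({s : ℝ | ((q : ℂ) ^ D.mMinus a)⁻¹ * u a * Complex.exp (m a * s) = -1} ∪
        {s : ℝ | ((q : ℂ) ^ D.mPlus a)⁻¹ * u a * Complex.exp (m a * s) = 1})).Finite :=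
    finite_classes.biUnion fun a ha =>
      (subsingleton_setOf_mul_exp_eq (hm0 a ha) _ (neg_ne_zero.2 one_ne_zero)).finite.union
        (subsingleton_setOf_mul_exp_eq (hm0 a ha) _ one_ne_zero).finite
  obtain ⟨s, hs⟩ := hfin.exists_notMem
  simp only [Set.mem_iUnion, Set.mem_union, Set.mem_ofPred_eq, not_exists, not_or] at hs
  refine ⟨_, hz s, fun a ha => ?_⟩
  obtain ⟨h1, h2⟩ := hs a ha
  have h3 : (D.gammaRoot a (⟨_, L.centerFixed_le_torus (hz s)⟩ * r) : ℂ)⁻¹ =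
      u a * Complex.exp (m a * s) := by
    rw [map_mul, Units.val_mul, mul_inv, hm a ha, mul_comm]
  rw [muDenominator, h3, ← mul_assoc, ← mul_assoc]
  refine mul_ne_zero (fun h0 => h1 ?_) (fun h0 => h2 ?_)
  · linear_combination h0
  · linear_combination -h0

end Levi

theorem toLie_differential {σ : MulAut D.G} (hσ : σ ∈ AlgAut D.G) {g : D.T}
    (h : σ = MulAut.conj (g : D.G) * D.θ) (E : LieAlg D.G) :
    toLie D.reductive.closed (differential hσ E) =
      adj D.reductive.closed (g : D.G) (D.thetaLie (toLie D.reductive.closed E)) := by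
  subst h
  have h1 : differential hσ E = Ad (g : D.G) (differential D.θ_algebraic E) := by
    apply Subtype.ext; apply LinearMap.ext; intro f
    rfl
  rw [h1, toLie_Ad]
  congr 1
  exact (matDiff_toLie D.reductive.closed D.θ_algebraic E).symm

theorem toLie_differential_frobInv {σ : MulAut D.G} (hσ : σ ∈ AlgAut D.G) {g : D.T}
    (h : σ = MulAut.conj (g : D.G) * D.θ) (X : D.lie) :
    differential hσ ((toLie D.reductive.closed).symm (frobInv g X)) =
      (toLie D.reductive.closed).symm X := by
  rw [LinearEquiv.eq_symm_apply, toLie_differential hσ h, LinearEquiv.apply_symm_apply,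
    frobInv_apply, LieEquiv.apply_symm_apply, ← adj_mul, mul_inv_cancel, adj_one]

end PinnedDualGroup

section LParameter

variable {n : ℕ} {D : PinnedDualGroup n} {L : D.Levi} {K : Type*} [Field K] [ValuativeRel K]
  [TopologicalSpace K] [IsNonarchimedeanLocalField K]

open PinnedDualGroup

instance : FiniteDimensional ℂ (LieAlg D.G) :=
  (toLie D.reductive.closed).symm.finiteDimensional

theorem UnramifiedLParameter.adWD_twist_frob_symm (φ : UnramifiedLParameter K L) (Fr : FrobeniusElement K)
    {z : D.G} (hz : z ∈ L.centerFixed) {g : D.T} (hg : (g : D.G) = z * φ.r Fr) (X : D.lie) :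
    ((φ.twist hz).adWD Fr).frob.symm (L.proj X) = L.proj (frobInv g X) := by
  rw [LinearEquiv.symm_apply_eq]
  have hσ : innerAut ((φ.twist hz).infChar Fr) = MulAut.conj (g : D.G) * D.θ := by
    have h1 : ((φ.twist hz).infChar Fr).left =
      z ^ (WeilGroup.deg K Fr.1).toAdd * φ.r Fr := rfl
    have h2 : ((φ.twist hz).infChar Fr).right = Fr.1 := rfl
    have h3 : (WeilGroup.deg K Fr.1).toAdd = 1 := by
      rw [Fr.2]
      rfl
    rw [innerAut, h1, h2, weilAction_apply, h3, zpow_one, zpow_one, hg]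
  exact (congrArg (Submodule.Quotient.mk (p := lieSub L.M)) (toLie_differential_frobInv
    (innerAut_mem ((φ.twist hz).infChar Fr)) hσ X)).symm

end LParameter

/-! ### The γ-factor and the μ-function -/

section LParameter

variable {n : ℕ} {D : PinnedDualGroup n} {L : D.Levi} {K : Type*} [Field K] [ValuativeRel K]
  [MeasurableSpace K]

open PinnedDualGroup Levi

/-- The value at `s = 0` of the `γ`-factor of a Weil--Deligne representation on
`V = Lie(G) / Lie(M)` on which Frobenius acts by `Ad(g) ∘ dθ`. -/
theorem tendsto_gammaFactor_eq_relativeMu {V : Type*} [AddCommGroup V] [Module ℂ V]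
    [FiniteDimensional ℂ V] {pr : D.lie →ₗ[ℂ] V} (hpr : Function.Surjective pr)
    (hpr0 : ∀ X, pr X = 0 ↔ X ∈ weightSpace (L := D.lie) L.centerLie 0) {q : ℕ} (hq : q ≠ 0)
    (ρ : UnramifiedWD q V) {g : D.T} (hρ : ∀ X, ρ.frob.symm (pr X) = pr (frobInv g X))
    {ψ : AddChar K ℂ} (hψ : charOrder ψ = -1) {μ : MeasureTheory.Measure K}
    (hμ : μ.real (𝒪[K] : Set K) ^ 2 = q) (hden : ∀ a ∈ L.classes, D.muDenominator q a g ≠ 0) :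
    Filter.Tendsto (fun s : ℂ => ρ.gammaFactor ψ μ s) (𝓝[≠] 0)
      (𝓝 ((-1) ^ finrank ℂ V * ((((q : ℝ) ^ (-(finrank ℂ V : ℝ) / 2) : ℝ) : ℂ) *
        ∏ᶠ a ∈ L.classes, (1 - ((D.gammaRoot a g : ℂ) ^ 2)⁻¹) / D.muDenominator q a g))) := by
  have := (finite_classes (L := L)).fintype
  have hC : ∀ a : L.classes, Nonempty (D.ClassData a) := by
    rintro ⟨_, α, hα, rfl⟩
    exact nonempty_classData hα.1
  have C := fun a => (hC a).some
  have hdet := det_eq_prod hpr hpr0 C g (A := (ρ.frob.symm : V →ₗ[ℂ] V)) hρ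
  have hdet1 := hdet 1
  rw [one_smul] at hdet1
  have hmu := ρ.tendsto_gammaFactor hq hψ hμ (by
    rw [hdet]
    exact Finset.prod_ne_zero_iff.2 fun a _ => ((C a).factor _ g (hden a a.2)).1)
  rw [hdet, hdet1, ← Finset.prod_div_distrib,
    Finset.prod_congr rfl fun a _ => ((C a).factor _ g (hden a a.2)).2] at hmu
  rwa [← finprod_set_coe_eq_finprod_mem, finprod_eq_prod_of_fintype]

end LParameter

end UnramGamma

theorem lemmaA3 {K : Type*} [Field K] [ValuativeRel K] [TopologicalSpace K]
    [IsNonarchimedeanLocalField K] [MeasurableSpace K] [BorelSpace K]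
    (ψ : AddChar K ℂ) (hψ : ∀ x : 𝒪[K], x ∈ 𝓂[K] → ψ (x : K) = 1)
    (hψ' : ∃ x : 𝒪[K], ψ (x : K) ≠ 1)
    (μ : MeasureTheory.Measure K) [μ.IsAddHaarMeasure] (hμ : IsSelfDual ψ μ)
    (Fr : FrobeniusElement K)
    {n : ℕ} (P : PinnedDualGroup n) (L : P.Levi)
    (φ : UnramifiedLParameter K L) (hφ : φ.IsFrobeniusSemisimple)
    (hr : φ.r Fr ∈ P.torusFixed) :
    ∃ ε : ℂ, (ε = 1 ∨ ε = -1) ∧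
      ∃ f : regularFunctions P.G, (∃ z ∈ L.centerFixed, f.1 z ≠ 0) ∧
        ∀ (z : P.G) (hz : z ∈ L.centerFixed), f.1 z ≠ 0 →
          (∀ a ∈ L.classes, P.muDenominator (residueCard K) a
            ⟨z * φ.r Fr, mul_mem (L.centerFixed_le_torus hz)
              (PinnedDualGroup.torusFixed_le_torus hr)⟩ ≠ 0) ∧
          Filter.Tendsto (fun s : ℂ => ((φ.twist hz).adWD Fr).gammaFactor ψ μ s) (𝓝[≠] 0)
            (𝓝 (ε * L.relativeMu (residueCard K)
              ⟨z * φ.r Fr, mul_mem (L.centerFixed_le_torus hz)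
                (PinnedDualGroup.torusFixed_le_torus hr)⟩)) := by
  have := (PinnedDualGroup.Levi.finite_classes (L := L)).fintype
  have hrT : φ.r Fr ∈ P.T := PinnedDualGroup.torusFixed_le_torus hr
  obtain ⟨f, hf, hf'⟩ := PinnedDualGroup.Levi.exists_regular_eq_prod (L := L) (residueCard K)
    ⟨φ.r Fr, hrT⟩
  refine ⟨(-1) ^ Module.finrank ℂ (LieAlg P.G ⧸ lieSub L.M), neg_one_pow_eq_or ℂ _, ⟨f, hf⟩, ?_, ?_⟩
  · obtain ⟨z, hz, h⟩ := PinnedDualGroup.Levi.exists_muDenominator_ne_zero (L := L)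
      (residueCard K) ⟨φ.r Fr, hrT⟩
    refine ⟨z, hz, ?_⟩
    change f ((⟨z, L.centerFixed_le_torus hz⟩ : P.T) : P.G) ≠ 0
    rw [hf']
    exact Finset.prod_ne_zero_iff.2 fun a _ => h a a.2
  · intro z hz hfz
    set g : P.T := ⟨z * φ.r Fr, mul_mem (L.centerFixed_le_torus hz) hrT⟩
    have hfz' : f ((⟨z, L.centerFixed_le_torus hz⟩ : P.T) : P.G) ≠ 0 := hfz
    rw [hf'] at hfz'
    have hden : ∀ a ∈ L.classes, P.muDenominator (residueCard K) a g ≠ 0 := fun a ha =>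
      Finset.prod_ne_zero_iff.1 hfz' ⟨a, ha⟩ (Finset.mem_univ _)
    refine ⟨hden, ?_⟩
    exact tendsto_gammaFactor_eq_relativeMu PinnedDualGroup.Levi.proj_surjective
      (fun _ => PinnedDualGroup.Levi.proj_eq_zero_iff) (residueCard_pos K).ne'
      ((φ.twist hz).adWD Fr) (φ.adWD_twist_frob_symm Fr hz rfl) (charOrder_eq_neg_one hψ hψ')
      (measure_integers_sq μ hψ hψ' hμ) hden
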